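/- **Setting.** All strings are over $\{0,1\}$, $\oplus$ is bitwise exclusive or (the shorter string padded by zeros), $\|$ is concatenation, $\kappa$ is the security parameter; PPT means (uniform) probabilistic polynomial time, with exact uniform sampling from $\{0,\dots,N\}$. *BF-IBE.* Setup chooses (the description of) groups $\mathbb G,\mathbb G_T$ of prime order $p$ with a non-degenerate bilinear map $e$, a length $n$, hash functions $\mathsf H_1:\{0,1\}^*\to\mathbb G\setminus\{1\}$, $\mathsf H_2:\mathbb G_T\to\{0,1\}^n$, $\mathsf H_3:\{0,1\}^*\times\{0,1\}^*\to\{1,\dots,p-1\}$, $\mathsf H_4:\{0,1\}^*\to\{0,1\}^n$, a random generator $g$ and a random master key $s\in\mathbb Z_p$; $G_{pub}=g^s$ is public. The private key of $\mathsf{ID}$ is $\mathsf H_1(\mathsf{ID})^s$. With $g_{\mathsf{ID}}=e(\mathsf H_1(\mathsf{ID}),G_{pub})$, the basic version encrypts $M\in\{0,1\}^n$ as $(g^r,\,M\oplus\mathsf H_2(g_{\mathsf{ID}}^r))$ with random $r\in\mathbb Z_p$; the full version encrypts it as $(g^r,\,\sigma\oplus\mathsf H_2(g_{\mathsf{ID}}^r),\,M\oplus\mathsf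 H_4(\sigma))$ with random $\sigma\in\{0,1\}^n$ and $r=\mathsf H_3(\sigma,M)$, and decryption rejects if $g^{\mathsf H_3(\sigma,M)}$ is not the first component. IND-CCA security is the usual notion for identity-based encryption (adaptive private-key and decryption queries; the private key of the challenge identity and the decryption of the challenge ciphertext under the challenge identity are refused). *CN-GD2C.* Further primitives are a hash function $\mathsf H:\{0,1\}^*\to\{0,1\}^l$ and a symmetric cipher $\mathsf E_S(K,\cdot)$ that permutes the strings of each length. Every $\mathrm{UE}_i$ has independent uniform $n$-bit strings $\mathsf{ID}_i,\mathsf{AID}_i,K_i$, known also to HSS/AuC, and belongs to a group whose identity $\mathsf{GID}_i$ is a uniform $n$-bit string known to the ProSe function only. The ProSe function has a uniform $n$-bit secret $K_P$ and issues $AK_i=\mathsf{AID}_i\oplus\mathsf{GID}_i\oplus K_P$ to $\mathrm{UE}_i$. A session between $\mathrm{UE}_i$ and $\mathrm{UE}_j$ runs as follows. 1. $\mathrm{UE}_i$ chooses $sid,x_i\in\mathbb Z_p$ and sends $sid,\ \delta_i=\mathsf H(AK_i\oplus sid),\ \mathcal E_i,\ \mathcal X=g^{x_i}$ to $\mathrm{UE}_j$,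 where $\mathcal E_i$ is the BF-IBE encryption of $\mathsf{ID}_i$ under the identity $\delta_i\|\mathcal X\|sid$. 2. $\mathrm{UE}_j$ chooses $y_j\in\mathbb Z_p$, forms $\mathcal Y=g^{y_j}$, $\delta_j=\mathsf H(AK_j\oplus sid)$ and $\mathcal E_j$ (the encryption of $\mathsf{ID}_j$ under $\delta_j\|\mathcal Y\|sid$), and sends $sid,\delta_i,\delta_j,\mathcal E_i,\mathcal E_j,\mathcal X,\mathcal Y$ to HSS/AuC. 3. HSS/AuC decrypts both identities and sends $sid,\delta_i,\delta_j,\mathsf{AID}_i,\mathsf{AID}_j$ to the ProSe function, which, if the groups coincide, returns $ack_i=\mathsf H(AK_i\oplus sid\oplus\mathsf{true})$ and $ack_j=\mathsf H(AK_j\oplus sid\oplus\mathsf{true})$. HSS/AuC chooses a random string $R$ as long as $sid$ and sends $\mathcal E'_i=\mathsf E_S(K_i,ack_i\|(sid\oplus R))$ and $\mathcal E'_j=\mathsf E_S(K_j,ack_j\|(sid\oplus R))$ to $\mathrm{UE}_j$. 4. $\mathrm{UE}_j$ decrypts $\mathcal E'_j$, checks $ack_j$, extracts $R$, and sends $\mathcal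 Y,\mathcal E'_i$ to $\mathrm{UE}_i$, which decrypts $\mathcal E'_i$, checks $ack_i$, extracts $R$, and sends $RES_i=\mathsf E_S(K_i,R)$ to $\mathrm{UE}_j$, which sends $RES_j=\mathsf E_S(K_j,RES_i\oplus R)$ to HSS/AuC. 5. HSS/AuC recovers $RES_i$ and checks that it decrypts to $R$. If so it sends $XRES_i=\mathsf H(K_i\|sid)$, $XRES_j=\mathsf H(K_j\|sid)$ to $\mathrm{UE}_j$. $\mathrm{UE}_j$ checks $XRES_j$ and forwards $XRES_i$ to $\mathrm{UE}_i$, which checks it. Each device accepts after its check, with the session key $g^{x_iy_j}$. *Anonymity.* A PPT attacker creates groups and registers devices of its choice in them. It adaptively runs undisturbed sessions between any two devices and sees their transcripts (**Execute**), and sends arbitrary messages to any protocol instances and to HSS/AuC (**Send**), over any number of concurrent sessions. Finally it may choose an instance of a device $U$ with partner $V$ such that this instance and an instance of $V$ with partner $U$, in the other role and with the same $sid$, have both accepted. According to a random bit $b$ it then receives a fresh uniform $n$-bit string, or the identity of $U$ (**TestID**) respectively the group identity of $U$ (**TestGroup**). It makes no further query of the system and outputs a guess $b'$; its advantage is $|\Pr[b=b']-\tfrac12|$.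 The protocol has identity (group) anonymity if this advantage is negligible in the game with **TestID** (**TestGroup**) for every such attacker. An *outsider* knows the public parameters only. The attacker *HSS/AuC* moreover knows the master key $s$ and all $\mathsf{ID}_i,\mathsf{AID}_i,K_i$, and may send arbitrary requests to the ProSe function. **Theorem (identity and group anonymity of CN-GD2C).** Let BF-IBE be used in the basic or in the full version. Assume that the group operations, pairing, hash functions and cipher can be evaluated in polynomial time on objects of polynomial size, and that $n\ge\nu(\kappa)$ for some function $\nu$ with $2^{-\nu(\kappa)}$ negligible. Then: 1. (Reduction.) For every PPT outsider $\mathcal A$ against identity anonymity there are a PPT adversary $\mathcal B$ against the IND-CCA security of BF-IBE and a polynomial $q$ such that for all $\kappa$ $$\mathbf{Adv}^{\mathrm{anon\_id}}_{\mathcal A}(\kappa)\le q(\kappa)\left(\mathbf{Adv}^{\mathrm{IND\text{-}CCA}}_{\mathcal B}(\kappa)+2^{-\nu(\kappa)}\right).$$ 2. If BF-IBE is IND-CCA secure, then CN-GD2C has identity anonymity against outsiders. 3. CN-GD2C has group anonymity against outsiders. 4. CN-GD2C has group anonymity against HSS/AuC. In particular all these anonymity properties hold if mutual authentication is guaranteed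 and BF-IBE is IND-CCA secure. -/

import Mathlib

open Filter

noncomputable section

namespace GD2C

/-! ### Bit strings -/

/-- Bit strings, `{0,1}*`. Numbers are written with the least significant bit first. -/
abbrev Str := List Bool

/-- Bitwise exclusive or; the shorter string is padded with zeros at its end. -/
def xorStr : Str → Str → Str
  | [], v => v
  | u, [] => u
  | a :: u, b :: v => (a ^^ b) :: xorStr u v

/-- The number with a given binary expansion. -/
def toNat (w : Str) : ℕ := w.foldr Nat.bit 0

/-- The `L` low-order binary digits of `x`. -/
def fixedBits (L x : ℕ) : Str := List.ofFn fun i : Fin L => x.testBit i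

/-- Encoding of a finite sequence of strings as one string: a bit `b` is written `1b`, and every
string of the sequence is followed by `0`. -/
def encodeList (ws : List Str) : Str :=
  ws.flatMap fun w => (w.flatMap fun b => [true, b]) ++ [false]

/-- Decoder for `encodeList`; `acc` holds the string being read, reversed, and an incomplete
last string is dropped. -/
def decodeAux : Str → Str → List Str
  | _, [] => []
  | acc, false :: w => acc.reverse :: decodeAux [] w
  | _, [true] => []
  | acc, true :: b :: w => decodeAux (b :: acc) w

/-- Decoder for `encodeList`. -/
def decodeList (w : Str) : List Str := decodeAux [] w

theorem decodeAux_append (w acc rest : Str) :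
    decodeAux acc ((w.flatMap fun b => [true, b]) ++ false :: rest) =
      (acc.reverse ++ w) :: decodeAux [] rest := by
  induction w generalizing acc with
  | nil => simp [decodeAux]
  | cons b w ih => simp [decodeAux, ih]

theorem decodeList_encodeList (ws : List Str) : decodeList (encodeList ws) = ws := by
  induction ws with
  | nil => rfl
  | cons w ws ih =>
    have h := decodeAux_append w [] (encodeList ws)
    simp only [decodeList, encodeList, List.flatMap_cons, List.append_assoc,
      List.singleton_append] at h ih ⊢
    rw [h, ih]
    simp

/-- The uniform distribution on `{0,1}^n`. -/
def uniformStr (n : ℕ) : PMF Str := (PMF.uniformOfFintype (Fin n → Bool)).map List.ofFn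

/-- The uniform distribution on `{0, …, N}`. -/
def uniformUpTo (N : ℕ) : PMF ℕ := (PMF.uniformOfFintype (Fin (N + 1))).map Fin.val

/-! ### Polynomial time

Structured programs for a machine with countably many stacks of bits, of which each program uses
finitely many. Every elementary operation costs one step. -/

/-- Programs. `branch r P Q R` runs `P`, `Q` or `R` according as stack `r` is empty, has `0` on top,
or has `1` on top; `loop r P` repeats `P` while stack `r` is non-empty. -/
inductive Prog : Type
  | skip : Prog
  | push (r : ℕ) (b : Bool) : Prog
  | pop (r : ℕ) : Prog
  | seq (P Q : Prog) : Prog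
  | branch (r : ℕ) (P Q R : Prog) : Prog
  | loop (r : ℕ) (P : Prog) : Prog

/-- The contents of all stacks. -/
abbrev Store := ℕ → Str

/-- `Exec P s s' t`: program `P`, started with contents `s`, halts with contents `s'` after exactly
`t` steps. -/
inductive Exec : Prog → Store → Store → ℕ → Prop
  | skip (s : Store) : Exec .skip s s 1
  | push (r : ℕ) (b : Bool) (s : Store) :
      Exec (.push r b) s (Function.update s r (b :: s r)) 1
  | pop (r : ℕ) (s : Store) : Exec (.pop r) s (Function.update s r (s r).tail) 1
  | seq {P Q : Prog} {s s' s'' : Store} {t t' : ℕ} :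
      Exec P s s' t → Exec Q s' s'' t' → Exec (.seq P Q) s s'' (t + t' + 1)
  | branch_nil {r : ℕ} {P Q R : Prog} {s s' : Store} {t : ℕ} :
      s r = [] → Exec P s s' t → Exec (.branch r P Q R) s s' (t + 1)
  | branch_zero {r : ℕ} {P Q R : Prog} {s s' : Store} {t : ℕ} {w : Str} :
      s r = false :: w → Exec Q s s' t → Exec (.branch r P Q R) s s' (t + 1)
  | branch_one {r : ℕ} {P Q R : Prog} {s s' : Store} {t : ℕ} {w : Str} :
      s r = true :: w → Exec R s s' t → Exec (.branch r P Q R) s s' (t + 1)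
  | loop_done {r : ℕ} {P : Prog} {s : Store} : s r = [] → Exec (.loop r P) s s 1
  | loop_again {r : ℕ} {P : Prog} {s s' s'' : Store} {t t' : ℕ} :
      s r ≠ [] → Exec P s s' t → Exec (.loop r P) s' s'' t' →
      Exec (.loop r P) s s'' (t + t' + 1)

/-- A function of `k` bit strings is computable in polynomial time: some program that starts with
the arguments on stacks `0, …, k - 1` and all other stacks empty halts with the value on
stack `0`, after a number of steps that is polynomial in the total length of the arguments. -/
def PolyTime {k : ℕ} (f : (Fin k → Str) → Str) : Prop :=
  ∃ (P : Prog) (q : Polynomial ℕ), ∀ x : Fin k → Str, ∃ (s : Store) (t : ℕ),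
    Exec P (fun r => if h : r < k then x ⟨r, h⟩ else []) s t ∧
      s 0 = f x ∧ t ≤ q.eval (∑ i, (x i).length)

/-! ### Games and probabilistic polynomial-time adversaries -/

/-- A security game: a challenger with a state, drawn at random for each security parameter, that
publishes `greet`, answers the queries of an adversary, and hides a bit. -/
structure Game where
  State : Type
  init : ℕ → PMF State
  greet : State → List Str
  oracle : List Str → State → PMF (List Str × State)
  bit : State → Bool

/-- A probabilistic polynomial-time adversary. In every round a polynomial-time function is applied
to `1^κ`, the current state and the last reply; its value encodes the new state and the next
query. The number of rounds, the length of the state and the part of a reply that is read are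
bounded by a polynomial in `κ`. Randomness is obtained by the queries `[[], N]`, which are
answered by a uniform number in `{0, …, N}`. -/
structure Adversary where
  step : (Fin 3 → Str) → Str
  bound : Polynomial ℕ
  polyTime : PolyTime step

/-- Answer to a query: either a random number, or the answer of the challenger. -/
def Game.answer (𝒢 : Game) (q : List Str) (c : 𝒢.State) : PMF (List Str × 𝒢.State) :=
  match q with
  | [[], N] => (uniformUpTo (toNat N)).map fun x => ([x.bits], c)
  | q => 𝒢.oracle q c

/-- One round: from (state of the adversary, last reply, state of the challenger) to the next. -/
def Adversary.round (A : Adversary) (𝒢 : Game) (κ : ℕ) (x : Str × Str × 𝒢.State) :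
    PMF (Str × Str × 𝒢.State) :=
  match decodeList (A.step ![List.replicate κ true, x.1, x.2.1]) with
  | [] => PMF.pure (x.1, [], x.2.2)
  | st :: q => (𝒢.answer q x.2.2).map fun y =>
      (st.take (A.bound.eval κ), (encodeList y.1).take (A.bound.eval κ), y.2)

/-- `k` rounds. -/
def Adversary.rounds (A : Adversary) (𝒢 : Game) (κ : ℕ) :
    ℕ → Str × Str × 𝒢.State → PMF (Str × Str × 𝒢.State)
  | 0, x => PMF.pure x
  | k + 1, x => (A.round 𝒢 κ x).bind (A.rounds 𝒢 κ k)

/-- The whole interaction. The guess of the adversary is the first bit of its final state; the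
outcome says whether it is the bit of the challenger. -/
def Adversary.play (A : Adversary) (𝒢 : Game) (κ : ℕ) : PMF Bool :=
  (𝒢.init κ).bind fun c =>
    (A.rounds 𝒢 κ (A.bound.eval κ)
      ([], (encodeList (𝒢.greet c)).take (A.bound.eval κ), c)).map fun x =>
        (x.1.headD false) == 𝒢.bit x.2.2

/-- `|Pr[b = b'] - 1/2|`. -/
def Adversary.advantage (A : Adversary) (𝒢 : Game) (κ : ℕ) : ℝ :=
  |(A.play 𝒢 κ true).toReal - 1 / 2|

/-- Negligible functions of the security parameter: `o(κ^(-c))` for every `c`. -/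
def Negligible (f : ℕ → ℝ) : Prop :=
  Asymptotics.SuperpolynomialDecay atTop (fun κ : ℕ => (κ : ℝ)) f

/-- Every probabilistic polynomial-time adversary has negligible advantage. -/
def Game.Secure (𝒢 : Game) : Prop := ∀ A : Adversary, Negligible (A.advantage 𝒢)

/-! ### Boneh–Franklin identity-based encryption -/

/-- The public choices of **Setup**: `gen κ` generates a description `d` of a prime `p`, two groups
`G`, `G_T` of order `p`, a bilinear map `e`, a length `n` and hash functions. Group elements are
written as bit strings by `encG` and `encGT`. The functions `H3`, `H4` are used by the full
version of the scheme only. -/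
structure BFFamily where
  gen : ℕ → PMF Str
  p : Str → ℕ
  prime_p : ∀ d, (p d).Prime
  G : Str → Type
  GT : Str → Type
  groupG : ∀ d, CommGroup (G d)
  groupGT : ∀ d, CommGroup (GT d)
  fintypeG : ∀ d, Fintype (G d)
  fintypeGT : ∀ d, Fintype (GT d)
  card_G : ∀ d, Fintype.card (G d) = p d
  card_GT : ∀ d, Fintype.card (GT d) = p d
  e : ∀ d, G d → G d → GT d
  e_pow : ∀ d (u v : G d) (a b : ℕ), e d (u ^ a) (v ^ b) = e d u v ^ (a * b)
  e_ne_one : ∀ d (g : G d), g ≠ 1 → e d g g ≠ 1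
  encG : ∀ d, G d → Str
  encGT : ∀ d, GT d → Str
  encG_injective : ∀ d, Function.Injective (encG d)
  encGT_injective : ∀ d, Function.Injective (encGT d)
  n : Str → ℕ
  H1 : ∀ d, Str → G d
  H1_ne_one : ∀ d w, H1 d w ≠ 1
  H2 : ∀ d, GT d → Str
  length_H2 : ∀ d z, (H2 d z).length = n d
  H3 : Str → Str → Str → ℕ
  H3_pos : ∀ d σ m, 0 < H3 d σ m
  H3_lt : ∀ d σ m, H3 d σ m < p d
  H4 : Str → Str → Str
  length_H4 : ∀ d σ, (H4 d σ).length = n d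

attribute [instance] BFFamily.groupG BFFamily.groupGT BFFamily.fintypeG BFFamily.fintypeGT

/-- The two published versions of the scheme: the basic one, with ciphertexts
`(g^r, M ⊕ H2(g_ID^r))`, and the full one, its strengthening against chosen ciphertexts, with
ciphertexts `(g^r, σ ⊕ H2(g_ID^r), M ⊕ H4(σ))` where `r = H3(σ, M)`. -/
inductive BFVersion : Type
  | basic : BFVersion
  | full : BFVersion

/-- Ciphertexts; the third component is empty in the basic version. -/
abbrev Ctxt := Str × Str × Str

namespace BFFamily

variable (𝓑 : BFFamily)

instance (d : Str) : Nonempty {g : 𝓑.G d // g ≠ 1} := by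
  have h : 1 < Fintype.card (𝓑.G d) := by
    rw [𝓑.card_G d]; exact (𝓑.prime_p d).one_lt
  have := Fintype.one_lt_card_iff_nontrivial.mp h
  obtain ⟨g, hg⟩ := exists_ne (1 : 𝓑.G d)
  exact ⟨⟨g, hg⟩⟩

instance (d : Str) : Fintype {g : 𝓑.G d // g ≠ 1} := Fintype.ofFinite _

/-- A uniformly random generator of `G`. -/
def randGen (d : Str) : PMF (𝓑.G d) :=
  (PMF.uniformOfFintype {g : 𝓑.G d // g ≠ 1}).map Subtype.val

/-- A uniformly random exponent in `Z_p`. -/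
def randExp (d : Str) : PMF ℕ := uniformUpTo (𝓑.p d - 1)

/-- The group element written as a given string, if there is one. -/
def decG (d : Str) (w : Str) : Option (𝓑.G d) := by
  classical exact if h : ∃ x, 𝓑.encG d x = w then some h.choose else none

/-- **Extract**. -/
def extract (d : Str) (msk : ℕ) (ident : Str) : 𝓑.G d := 𝓑.H1 d ident ^ msk

/-- The mask `H2(e(Q_ID, G_pub)^r)`. -/
def mask (d : Str) (gpub : 𝓑.G d) (ident : Str) (r : ℕ) : Str :=
  𝓑.H2 d (𝓑.e d (𝓑.H1 d ident) gpub ^ r)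

/-- **Encrypt**. -/
def encrypt (v : BFVersion) (d : Str) (g gpub : 𝓑.G d) (ident m : Str) : PMF Ctxt :=
  match v with
  | .basic => (𝓑.randExp d).map fun r =>
      (𝓑.encG d (g ^ r), xorStr m (𝓑.mask d gpub ident r), [])
  | .full => (uniformStr (𝓑.n d)).map fun σ =>
      (𝓑.encG d (g ^ 𝓑.H3 d σ m), xorStr σ (𝓑.mask d gpub ident (𝓑.H3 d σ m)),
        xorStr m (𝓑.H4 d σ))

/-- **Decrypt**, with the private key `dk`; `none` means rejection. -/
def decrypt (v : BFVersion) (d : Str) (g dk : 𝓑.G d) (c : Ctxt) : Option Str :=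
  match 𝓑.decG d c.1 with
  | none => none
  | some U =>
    let x := xorStr c.2.1 (𝓑.H2 d (𝓑.e d dk U))
    match v with
    | .basic => if c.2.1.length = 𝓑.n d ∧ c.2.2 = [] then some x else none
    | .full =>
      let m := xorStr c.2.2 (𝓑.H4 d x)
      if c.2.1.length = 𝓑.n d ∧ c.2.2.length = 𝓑.n d ∧ 𝓑.encG d (g ^ 𝓑.H3 d x m) = c.1
      then some m else none

/-- All public operations can be carried out in polynomial time, and all objects have polynomial
size. -/
structure Efficient : Prop where
  size_gen : ∃ q : Polynomial ℕ, ∀ κ, ∀ d ∈ (𝓑.gen κ).support, d.length ≤ q.eval κ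
  size_encG : ∃ q : Polynomial ℕ, ∀ d x, (𝓑.encG d x).length ≤ q.eval d.length
  size_encGT : ∃ q : Polynomial ℕ, ∀ d x, (𝓑.encGT d x).length ≤ q.eval d.length
  prime : ∃ f, PolyTime (k := 1) f ∧ ∀ d, f ![d] = (𝓑.p d).bits
  memG : ∃ f, PolyTime (k := 2) f ∧
    ∀ d w, f ![d, w] = if (𝓑.decG d w).isSome then [true] else []
  powG : ∃ f, PolyTime (k := 3) f ∧ ∀ d x (a : ℕ), f ![d, 𝓑.encG d x, a.bits] = 𝓑.encG d (x ^ a)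
  powGT : ∃ f, PolyTime (k := 3) f ∧
    ∀ d x (a : ℕ), f ![d, 𝓑.encGT d x, a.bits] = 𝓑.encGT d (x ^ a)
  pairing : ∃ f, PolyTime (k := 3) f ∧
    ∀ d x y, f ![d, 𝓑.encG d x, 𝓑.encG d y] = 𝓑.encGT d (𝓑.e d x y)
  hash1 : ∃ f, PolyTime (k := 2) f ∧ ∀ d w, f ![d, w] = 𝓑.encG d (𝓑.H1 d w)
  hash2 : ∃ f, PolyTime (k := 2) f ∧ ∀ d z, f ![d, 𝓑.encGT d z] = 𝓑.H2 d z
  hash3 : ∃ f, PolyTime (k := 3) f ∧ ∀ d σ m, f ![d, σ, m] = (𝓑.H3 d σ m).bits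
  hash4 : ∃ f, PolyTime (k := 2) f ∧ ∀ d σ, f ![d, σ] = 𝓑.H4 d σ

end BFFamily

/-! ### The chosen-ciphertext game for identity-based encryption -/

/-- State of the challenger: parameters, master key, hidden bit, challenge (if made), and the
identities whose private keys were given out. -/
structure CCAState (𝓑 : BFFamily) where
  d : Str
  g : 𝓑.G d
  msk : ℕ
  b : Bool
  target : Option (Str × Ctxt)
  extracted : List Str

/-- Queries: private key of an identity; decryption of a ciphertext under an identity; challenge on
an identity and two messages. -/
inductive CCAQuery : Type
  | extract (ident : Str) : CCAQuery
  | decrypt (ident : Str) (c : Ctxt) : CCAQuery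
  | challenge (ident m₀ m₁ : Str) : CCAQuery

/-- The first string of a query is a number that gives its kind. -/
def CCAQuery.parse : List Str → Option CCAQuery
  | [] => none
  | tag :: args =>
    match toNat tag, args with
    | 1, [ident] => some (.extract ident)
    | 2, [ident, c₁, c₂, c₃] => some (.decrypt ident (c₁, c₂, c₃))
    | 3, [ident, m₀, m₁] => some (.challenge ident m₀ m₁)
    | _, _ => none

/-- Answers to the queries; the empty answer means refusal or rejection. The private key of the
challenge identity and the decryption of the challenge ciphertext under the challenge identity are
refused, and only one challenge is granted. -/
def ccaOracle (𝓑 : BFFamily) (v : BFVersion) (q : List Str) (S : CCAState 𝓑) :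
    PMF (List Str × CCAState 𝓑) :=
  match CCAQuery.parse q with
  | none => PMF.pure ([], S)
  | some (.extract ident) =>
    if S.target.map Prod.fst = some ident then PMF.pure ([], S)
    else PMF.pure ([𝓑.encG S.d (𝓑.extract S.d S.msk ident)],
      { S with extracted := ident :: S.extracted })
  | some (.decrypt ident c) =>
    if S.target = some (ident, c) then PMF.pure ([], S)
    else PMF.pure ((𝓑.decrypt v S.d S.g (𝓑.extract S.d S.msk ident) c).toList, S)
  | some (.challenge ident m₀ m₁) =>
    if S.target = none ∧ ident ∉ S.extracted ∧
        m₀.length = 𝓑.n S.d ∧ m₁.length = 𝓑.n S.d then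
      (𝓑.encrypt v S.d S.g (S.g ^ S.msk) ident (if S.b then m₁ else m₀)).map fun c =>
        ([c.1, c.2.1, c.2.2], { S with target := some (ident, c) })
    else PMF.pure ([], S)

/-- The IND-CCA game of BF-IBE. -/
def ccaGame (𝓑 : BFFamily) (v : BFVersion) : Game where
  State := CCAState 𝓑
  init κ :=
    (𝓑.gen κ).bind fun d =>
    (𝓑.randGen d).bind fun g =>
    (𝓑.randExp d).bind fun s =>
    (PMF.uniformOfFintype Bool).map fun b =>
      { d := d, g := g, msk := s, b := b, target := none, extracted := [] }
  greet S := [S.d, 𝓑.encG S.d S.g, 𝓑.encG S.d (S.g ^ S.msk)]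
  oracle := ccaOracle 𝓑 v
  bit S := S.b

/-! ### The protocol CN-GD2C -/

/-- The remaining primitives: a hash function `H` with values in `{0,1}^l`, and a symmetric
cipher `ES` with inverse `DS` that permutes the strings of each length. -/
structure Family extends BFFamily where
  l : Str → ℕ
  H : Str → Str → Str
  length_H : ∀ d w, (H d w).length = l d
  ES : Str → Str → Str
  DS : Str → Str → Str
  DS_ES : ∀ k m, DS k (ES k m) = m
  length_ES : ∀ k m, (ES k m).length = m.length

/-- The primitives can be evaluated in polynomial time. -/
structure Family.Efficient (𝓕 : Family) : Prop where
  ibe : 𝓕.toBFFamily.Efficient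
  hash : ∃ f, PolyTime (k := 2) f ∧ ∀ d w, f ![d, w] = 𝓕.H d w
  encS : PolyTime (k := 2) fun x => 𝓕.ES (x 0) (x 1)
  decS : PolyTime (k := 2) fun x => 𝓕.DS (x 0) (x 1)

/-- A registered device: `ID`, `AID`, the key `K` shared with HSS/AuC, the authorization key `AK`
issued by the ProSe function, and the number of its group. -/
structure UE where
  ident : Str
  aid : Str
  key : Str
  ak : Str
  group : ℕ

/-- An instance of the protocol at the device `owner` with intended partner `peer`. `stage` counts
the messages awaited so far (`0` after an abort), `own` and `other` are the two Diffie–Hellman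
values as strings, `nonce` is the recovered number `R`, and `key` is the session key, present exactly
when the instance has accepted. -/
structure Inst where
  owner : ℕ
  peer : ℕ
  initiator : Bool
  stage : ℕ
  sid : Str
  exp : ℕ
  own : Str
  other : Str
  nonce : Str
  key : Option Str

/-- A session at HSS/AuC: the two devices it has identified, the session identity and `R`. -/
structure HSession where
  ui : UE
  uj : UE
  sid : Str
  nonce : Str
  isOpen : Bool

/-- The state of the whole system during the anonymity games: BF-IBE parameters and master key, the
secret `kp` of the ProSe function, the group identities, the devices, the protocol instances, the
sessions at HSS/AuC, the hidden bit, and whether the test query was answered. -/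
structure World (𝓕 : Family) where
  d : Str
  g : 𝓕.G d
  msk : ℕ
  kp : Str
  gids : List Str
  ues : List UE
  insts : List Inst
  hss : List HSession
  b : Bool
  tested : Bool

namespace World

variable {𝓕 : Family}

/-- Number of bits of an element of `Z_p`. -/
def width (W : World 𝓕) : ℕ := (𝓕.p W.d).size

/-- `δ = H(AK ⊕ sid)`. -/
def delta (W : World 𝓕) (ak sid : Str) : Str := 𝓕.H W.d (xorStr ak sid)

/-- `ack = H(AK ⊕ sid ⊕ true)`. -/
def ack (W : World 𝓕) (ak sid : Str) : Str := 𝓕.H W.d (xorStr (xorStr ak sid) [true])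

/-- `XRES = H(K, sid)`. -/
def xres (W : World 𝓕) (key sid : Str) : Str := 𝓕.H W.d (key ++ sid)

/-- The group identity of a device. -/
def gid (W : World 𝓕) (u : UE) : Str := W.gids.getD u.group []

/-- The BF-IBE ciphertext of the identity of `u` under `TID = δ‖X‖sid`. -/
def sealId (v : BFVersion) (W : World 𝓕) (u : UE) (x sid : Str) : PMF Ctxt :=
  𝓕.encrypt v W.d W.g (W.g ^ W.msk) (W.delta u.ak sid ++ x ++ sid) u.ident

/-- Decryption by HSS/AuC of such a ciphertext, and search for the device with this identity. -/
def openId (v : BFVersion) (W : World 𝓕) (δ x sid : Str) (c : Ctxt) : Option UE :=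
  match 𝓕.decrypt v W.d W.g (𝓕.extract W.d W.msk (δ ++ x ++ sid)) c with
  | none => none
  | some m => W.ues.find? fun u => u.ident == m

/-- The ProSe function: if both application identities belong to the same group, it returns
`ack_i` and `ack_j`, computed from `AK = AID ⊕ GID ⊕ K_P`. -/
def prose (W : World 𝓕) (sid aidi aidj : Str) : Option (Str × Str) :=
  match W.ues.find? (fun u => u.aid == aidi), W.ues.find? (fun u => u.aid == aidj) with
  | some ui, some uj =>
    if W.gid ui = W.gid uj then
      some (W.ack (xorStr (xorStr ui.aid (W.gid ui)) W.kp) sid,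
        W.ack (xorStr (xorStr uj.aid (W.gid uj)) W.kp) sid)
    else none
  | _, _ => none

/-- Creation of a new group. -/
def newGroup (W : World 𝓕) : PMF (List Str × World 𝓕) :=
  (uniformStr (𝓕.n W.d)).map fun gid =>
    ([W.gids.length.bits], { W with gids := W.gids ++ [gid] })

/-- Registration of a new device in an existing group. The reply holds, if `toHSS`, what HSS/AuC
stores on the device: `ID`, `AID` and `K`. -/
def register (toHSS : Bool) (grp : ℕ) (W : World 𝓕) : PMF (List Str × World 𝓕) :=
  match W.gids[grp]? with
  | none => PMF.pure ([], W)
  | some gid =>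
    (uniformStr (𝓕.n W.d)).bind fun ident =>
    (uniformStr (𝓕.n W.d)).bind fun aid =>
    (uniformStr (𝓕.n W.d)).map fun key =>
      (W.ues.length.bits :: (if toHSS then [ident, aid, key] else []),
        { W with ues := W.ues ++
          [{ ident := ident, aid := aid, key := key, ak := xorStr (xorStr aid gid) W.kp,
             group := grp }] })

/-- Device `i` starts a session with device `j`: it chooses `sid`, `x_i` and sends
`sid, δ_i, E_i, X`. -/
def start (v : BFVersion) (i j : ℕ) (W : World 𝓕) : PMF (List Str × World 𝓕) :=
  match W.ues[i]?, W.ues[j]? with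
  | some u, some _ =>
    if i = j then PMF.pure ([], W) else
    (𝓕.randExp W.d).bind fun sidNum =>
    (𝓕.randExp W.d).bind fun x =>
    let sid := fixedBits W.width sidNum
    let X := 𝓕.encG W.d (W.g ^ x)
    (W.sealId v u X sid).map fun c =>
      ([sid, W.delta u.ak sid, c.1, c.2.1, c.2.2, X],
        { W with insts := W.insts ++
          [{ owner := i, peer := j, initiator := true, stage := 1, sid := sid, exp := x,
             own := X, other := [], nonce := [], key := none }] })
  | _, _ => PMF.pure ([], W)

/-- Device `j` receives the first message of a session with device `i`. It chooses `y_j` and sends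
`sid, δ_i, δ_j, E_i, E_j, X, Y` to HSS/AuC. -/
def respond (v : BFVersion) (j i : ℕ) (msg : List Str) (W : World 𝓕) :
    PMF (List Str × World 𝓕) :=
  match W.ues[j]?, W.ues[i]?, msg with
  | some u, some _, [sid, δi, c₁, c₂, c₃, X] =>
    if i = j ∨ 𝓕.decG W.d X = none then PMF.pure ([], W) else
    (𝓕.randExp W.d).bind fun y =>
    let Y := 𝓕.encG W.d (W.g ^ y)
    (W.sealId v u Y sid).map fun c =>
      ([sid, δi, W.delta u.ak sid, c₁, c₂, c₃, c.1, c.2.1, c.2.2, X, Y],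
        { W with insts := W.insts ++
          [{ owner := j, peer := i, initiator := false, stage := 1, sid := sid, exp := y,
             own := Y, other := X, nonce := [], key := none }] })
  | _, _, _ => PMF.pure ([], W)

/-- HSS/AuC receives a request: it decrypts the two identities, lets the ProSe function compare the
groups, chooses `R`, and sends `E'_i, E'_j`. -/
def hssRequest (v : BFVersion) (msg : List Str) (W : World 𝓕) : PMF (List Str × World 𝓕) :=
  match msg with
  | [sid, δi, δj, a₁, a₂, a₃, b₁, b₂, b₃, X, Y] =>
    match W.openId v δi X sid (a₁, a₂, a₃), W.openId v δj Y sid (b₁, b₂, b₃) with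
    | some ui, some uj =>
      match W.prose sid ui.aid uj.aid with
      | some (acki, ackj) =>
        (uniformStr W.width).map fun R =>
          ([𝓕.ES ui.key (acki ++ xorStr sid R), 𝓕.ES uj.key (ackj ++ xorStr sid R)],
            { W with hss := W.hss ++
              [{ ui := ui, uj := uj, sid := sid, nonce := R, isOpen := true }] })
      | none => PMF.pure ([], W)
    | _, _ => PMF.pure ([], W)
  | _ => PMF.pure ([], W)

/-- HSS/AuC receives `RES_j` in its session number `k`, checks it, and sends `XRES_i, XRES_j`. -/
def hssConfirm (k : ℕ) (msg : List Str) (W : World 𝓕) : List Str × World 𝓕 :=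
  match W.hss[k]?, msg with
  | some s, [resj] =>
    let W' : World 𝓕 := { W with hss := W.hss.set k { s with isOpen := false } }
    let resi := xorStr (𝓕.DS s.uj.key resj) s.nonce
    if s.isOpen = true ∧ 𝓕.DS s.ui.key resi = s.nonce then
      ([W.xres s.ui.key s.sid, W.xres s.uj.key s.sid], W')
    else ([], W')
  | _, _ => ([], W)

/-- Check of `E' = ES(K, ack‖(sid ⊕ R))` by the device `u`; the result is `R`. -/
def checkToken (W : World 𝓕) (u : UE) (sid tok : Str) : Option Str :=
  let m := 𝓕.DS u.key tok
  if m.take (𝓕.l W.d) = W.ack u.ak sid then some (xorStr (m.drop (𝓕.l W.d)) sid) else none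

/-- The session key `other ^ exp`. -/
def sessionKey (W : World 𝓕) (I : Inst) : Option Str :=
  (𝓕.decG W.d I.other).map fun z => 𝓕.encG W.d (z ^ I.exp)

/-- Reaction of an instance to its next message: the reply, and the new state of the instance. It
aborts on every message that fails a check.

* The initiator receives `Y, E'_i`, then sends `RES_i`; it receives `XRES_i`, then accepts.
* The responder receives `E'_i, E'_j`, then sends `Y, E'_i` to the initiator; it receives `RES_i`,
  then sends `RES_j` to HSS/AuC; it receives `XRES_i, XRES_j`, then accepts and sends `XRES_i`. -/
def react (W : World 𝓕) (u : UE) (I : Inst) (msg : List Str) : List Str × Inst :=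
  match I.initiator, I.stage, msg with
  | true, 1, [Y, tok] =>
    match 𝓕.decG W.d Y, W.checkToken u I.sid tok with
    | some _, some R => ([𝓕.ES u.key R], { I with stage := 2, other := Y, nonce := R })
    | _, _ => ([], { I with stage := 0 })
  | true, 2, [x] =>
    if x = W.xres u.key I.sid then ([], { I with stage := 3, key := W.sessionKey I })
    else ([], { I with stage := 0 })
  | false, 1, [toki, tokj] =>
    match W.checkToken u I.sid tokj with
    | some R => ([I.own, toki], { I with stage := 2, nonce := R })
    | none => ([], { I with stage := 0 })
  | false, 2, [resi] =>
    ([𝓕.ES u.key (xorStr resi I.nonce)], { I with stage := 3 })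
  | false, 3, [xi, xj] =>
    if xj = W.xres u.key I.sid then ([xi], { I with stage := 4, key := W.sessionKey I })
    else ([], { I with stage := 0 })
  | true, 3, _ => ([], I)
  | false, 4, _ => ([], I)
  | _, _, _ => ([], { I with stage := 0 })

/-- Delivery of a message to the instance number `k`. -/
def send (k : ℕ) (msg : List Str) (W : World 𝓕) : List Str × World 𝓕 :=
  match W.insts[k]? with
  | none => ([], W)
  | some I =>
    match W.ues[I.owner]? with
    | none => ([], W)
    | some u =>
      ((W.react u I msg).1, { W with insts := W.insts.set k (W.react u I msg).2 })

/-- The rest of an undisturbed session between the instances number `ki` and `kj` and the session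
number `h` at HSS/AuC, after the message `m` of HSS/AuC: all further messages. -/
def relay (ki kj h : ℕ) (m : List Str) (W : World 𝓕) : List Str × World 𝓕 :=
  let s₁ := W.send kj m
  let s₂ := s₁.2.send ki s₁.1
  let s₃ := s₂.2.send kj s₂.1
  let s₄ := s₃.2.hssConfirm h s₃.1
  let s₅ := s₄.2.send kj s₄.1
  let s₆ := s₅.2.send ki s₅.1
  ([encodeList s₁.1, encodeList s₂.1, encodeList s₃.1, encodeList s₄.1, encodeList s₅.1], s₆.2)

/-- An undisturbed session between devices `i` and `j`, with its complete transcript. -/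
def execute (v : BFVersion) (i j : ℕ) (W : World 𝓕) : PMF (List Str × World 𝓕) :=
  (W.start v i j).bind fun s₁ =>
  (s₁.2.respond v j i s₁.1).bind fun s₂ =>
  (s₂.2.hssRequest v s₂.1).map fun s₃ =>
    let s := s₃.2.relay W.insts.length (W.insts.length + 1) W.hss.length s₃.1
    (encodeList s₁.1 :: encodeList s₂.1 :: encodeList s₃.1 :: s.1, s.2)

/-- The instance `I` and some instance of its partner, in the same session and in the other role,
have accepted with a session key. -/
def Completed (W : World 𝓕) (I : Inst) : Prop :=
  I.key.isSome ∧ ∃ J ∈ W.insts, J.key.isSome ∧ J.owner = I.peer ∧ J.peer = I.owner ∧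
    J.initiator = !I.initiator ∧ J.sid = I.sid

end World

/-- The two attackers. -/
inductive Attacker : Type
  | outsider : Attacker
  | hss : Attacker
  deriving DecidableEq

/-- What is tested: the identity or the group identity. -/
inductive Goal : Type
  | identity : Goal
  | group : Goal

/-- The test query on the instance number `k` (**TestID** or **TestGroup**): the real value for the
owner of the instance, or a random string of the same length, according to the hidden bit. It fails
unless the session is completed. -/
def World.test {𝓕 : Family} (goal : Goal) (k : ℕ) (W : World 𝓕) : PMF (List Str × World 𝓕) := by
  classical exact
  match W.insts[k]? with
  | none => PMF.pure ([], W)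
  | some I =>
    match W.ues[I.owner]? with
    | none => PMF.pure ([], W)
    | some u =>
      if W.Completed I then
        let real : Str := match goal with
          | .identity => u.ident
          | .group => W.gid u
        (uniformStr (𝓕.n W.d)).map fun fake =>
          ([if W.b then fake else real], { W with tested := true })
      else PMF.pure ([], W)

/-- Queries of the anonymity games. `start`, `respond` and `send` are **Send** to an instance for
its first and its later messages; `hssRequest` and `hssConfirm` send messages to HSS/AuC; `prose`
sends a message of HSS/AuC to the ProSe function. -/
inductive Query : Type
  | newGroup : Query
  | register (grp : ℕ) : Query
  | execute (i j : ℕ) : Query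
  | start (i j : ℕ) : Query
  | respond (j i : ℕ) (msg : List Str) : Query
  | send (k : ℕ) (msg : List Str) : Query
  | hssRequest (msg : List Str) : Query
  | hssConfirm (k : ℕ) (msg : List Str) : Query
  | prose (sid δi δj aidi aidj : Str) : Query
  | test (k : ℕ) : Query

/-- The first string of a query is a number that gives its kind. -/
def Query.parse : List Str → Option Query
  | [] => none
  | tag :: args =>
    match toNat tag, args with
    | 1, [] => some .newGroup
    | 2, [grp] => some (.register (toNat grp))
    | 3, [i, j] => some (.execute (toNat i) (toNat j))
    | 4, [i, j] => some (.start (toNat i) (toNat j))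
    | 5, j :: i :: msg => some (.respond (toNat j) (toNat i) msg)
    | 6, k :: msg => some (.send (toNat k) msg)
    | 7, msg => some (.hssRequest msg)
    | 8, k :: msg => some (.hssConfirm (toNat k) msg)
    | 9, [sid, δi, δj, aidi, aidj] => some (.prose sid δi δj aidi aidj)
    | 10, [k] => some (.test (toNat k))
    | _, _ => none

/-- Answers to the queries. Every query after the test query is refused. Only the attacker
HSS/AuC can address the ProSe function. -/
def anonOracle (𝓕 : Family) (v : BFVersion) (att : Attacker) (goal : Goal) (q : List Str)
    (W : World 𝓕) : PMF (List Str × World 𝓕) :=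
  if W.tested then PMF.pure ([], W) else
  match Query.parse q with
  | none => PMF.pure ([], W)
  | some .newGroup => W.newGroup
  | some (.register grp) => W.register (att = .hss) grp
  | some (.execute i j) => W.execute v i j
  | some (.start i j) => W.start v i j
  | some (.respond j i msg) => W.respond v j i msg
  | some (.send k msg) => PMF.pure (W.send k msg)
  | some (.hssRequest msg) => W.hssRequest v msg
  | some (.hssConfirm k msg) => PMF.pure (W.hssConfirm k msg)
  | some (.prose sid _ _ aidi aidj) =>
    if att = .hss then PMF.pure (((W.prose sid aidi aidj).map fun a => [a.1, a.2]).getD [], W)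
    else PMF.pure ([], W)
  | some (.test k) => W.test goal k

/-- The anonymity games for CN-GD2C. Both attackers are given the public parameters, and the
attacker HSS/AuC also the master key. -/
def anonGame (𝓕 : Family) (v : BFVersion) (att : Attacker) (goal : Goal) : Game where
  State := World 𝓕
  init κ :=
    (𝓕.gen κ).bind fun d =>
    (𝓕.randGen d).bind fun g =>
    (𝓕.randExp d).bind fun s =>
    (uniformStr (𝓕.n d)).bind fun kp =>
    (PMF.uniformOfFintype Bool).map fun b =>
      { d := d, g := g, msk := s, kp := kp, gids := [], ues := [], insts := [], hss := [],
        b := b, tested := false }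
  greet W := [W.d, 𝓕.encG W.d W.g, 𝓕.encG W.d (W.g ^ W.msk)] ++
    (if att = .hss then [W.msk.bits] else [])
  oracle := anonOracle 𝓕 v att goal
  bit W := W.b

end GD2C

end

noncomputable section

/-! Group anonymity is perfect, against both attackers. The secret K_P and the group identities
influence the answers in two ways only: through the authorization keys AK = AID ⊕ GID ⊕ K_P, and
through the comparison of two group identities by the ProSe function. Replacing K_P by K_P ⊕ Δ and
every GID by GID ⊕ Δ preserves both. For uniform Δ the view before the test is therefore unchanged,
while the group identity revealed by the test becomes uniform, exactly like the fake answer. Since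
nothing is answered after the test, the secrets may be erased at that moment, and then the two
values of the hidden bit lead to the same distribution (`World.wiped_step`, `guess_group_eq`). The
advantage is 0 (`advantage_group`).

Identity anonymity is computational. Apart from the test, an identity is used in two places: as
plaintext of a BF-IBE encryption, and when HSS/AuC looks for the device that belongs to a decrypted
plaintext. In `hybridGame` every device carries two independent uniform candidates for its identity;
HSS/AuC recognizes both, the test reveals the first, and a sequence of bits selects the candidate
for each encryption. If the first candidate is always encrypted, the test reveals the identity in
use, as for hidden bit 0; if the second is always encrypted, the test reveals an independent string,
as for hidden bit 1. A deviation from the real game is noticed only if HSS/AuC decrypts something to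
a candidate that is never encrypted, or if candidates of different devices collide. With T the bound
of the attacker, union bounds give a distance of at most 4T·2^(-n) per round (`World.near_step`),
hence 4T²·2^(-n) in all (`guess_near_hybrid`). The passage from one step to the whole interaction is
`Adversary.run_near`.

Every query contains at most two encryptions, so 2T slots lead from the first candidates to the
second ones. The reduction draws j in {0, …, 2T}, encrypts second candidates before slot j, first
candidates after it, and makes slot j its challenge on the two candidates. It chooses all secrets
itself except the master key, for which it uses decryption queries. The one decryption it is refused
is that of the challenge ciphertext under the challenge identity. But both challenge messages are
candidates of the same device, so the reaction of HSS/AuC is known without knowing which of them was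
encrypted (`RState.answer_decQuery`). Averaging over j telescopes, with the factor 2T + 1
(`advantage_le_of_hybrids`).

The reduction must be an adversary in the sense of the stack machine. For this, a class `PT` of
functions computable in polynomial time on encodings is shown to be closed under composition,
pairing, case distinction and iteration with bounded growth, and the whole protocol is shown to lie
in it. The encoding of the system contains g^s but neither s nor the hidden bit, so membership in
`PT` also certifies that the reduction uses only what it knows. `exists_adversary` turns transition
functions in `PT` into an adversary; a block of 14 queries simulates one round
(`RState.exists_round`), and `RState.Bounded` guarantees that no truncation ever takes effect.

The asymptotic statement follows because a negligible function times a polynomial is negligible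
(`Negligible.of_le`). -/

namespace GD2C

/-! ### A calculus of polynomial-time functions over the stack machine. -/

/-! ### Executions with a bound on the number of steps -/

/-- `P` leads from `s` to `s'` in at most `b` steps. -/
def Runs (P : Prog) (s s' : Store) (b : ℕ) : Prop := ∃ t ≤ b, Exec P s s' t

theorem Runs.mono {P : Prog} {s s' : Store} {b b' : ℕ} (h : Runs P s s' b) (hb : b ≤ b') :
    Runs P s s' b' := by
  obtain ⟨t, ht, h⟩ := h
  exact ⟨t, ht.trans hb, h⟩

theorem Runs.cast {P : Prog} {s s' s'' : Store} {b b' : ℕ} (h : Runs P s s' b) (hs : s' = s'')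
    (hb : b ≤ b') : Runs P s s'' b' := hs ▸ h.mono hb

theorem Runs.seq {P Q : Prog} {s s' s'' : Store} {b b' : ℕ} (h : Runs P s s' b)
    (h' : Runs Q s' s'' b') : Runs (.seq P Q) s s'' (b + b' + 1) := by
  obtain ⟨t, ht, h⟩ := h
  obtain ⟨t', ht', h'⟩ := h'
  exact ⟨_, by omega, .seq h h'⟩

theorem Runs.skip (s : Store) : Runs .skip s s 1 := ⟨1, le_rfl, .skip s⟩

theorem Runs.push (r : ℕ) (b : Bool) (s : Store) :
    Runs (.push r b) s (Function.update s r (b :: s r)) 1 := ⟨1, le_rfl, .push r b s⟩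

theorem Runs.pop (r : ℕ) (s : Store) :
    Runs (.pop r) s (Function.update s r (s r).tail) 1 := ⟨1, le_rfl, .pop r s⟩

theorem Runs.branch_nil {r : ℕ} {P Q R : Prog} {s s' : Store} {b : ℕ} (hr : s r = [])
    (h : Runs P s s' b) : Runs (.branch r P Q R) s s' (b + 1) := by
  obtain ⟨t, ht, h⟩ := h
  exact ⟨_, by omega, .branch_nil hr h⟩

theorem Runs.branch_zero {r : ℕ} {P Q R : Prog} {s s' : Store} {b : ℕ} {w : Str}
    (hr : s r = false :: w) (h : Runs Q s s' b) : Runs (.branch r P Q R) s s' (b + 1) := by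
  obtain ⟨t, ht, h⟩ := h
  exact ⟨_, by omega, .branch_zero hr h⟩

theorem Runs.branch_one {r : ℕ} {P Q R : Prog} {s s' : Store} {b : ℕ} {w : Str}
    (hr : s r = true :: w) (h : Runs R s s' b) : Runs (.branch r P Q R) s s' (b + 1) := by
  obtain ⟨t, ht, h⟩ := h
  exact ⟨_, by omega, .branch_one hr h⟩

theorem Runs.loop_done {r : ℕ} {P : Prog} {s : Store} (hr : s r = []) :
    Runs (.loop r P) s s 1 := ⟨1, le_rfl, .loop_done hr⟩

theorem Runs.loop_again {r : ℕ} {P : Prog} {s s' s'' : Store} {b b' : ℕ} (hr : s r ≠ []) (h : Runs P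
    s s' b) (h' : Runs (.loop r P) s' s'' b') : Runs (.loop r P) s s'' (b + b' + 1) := by
  obtain ⟨t, ht, h⟩ := h
  obtain ⟨t', ht', h'⟩ := h'
  exact ⟨_, by omega, .loop_again hr h h'⟩

/-- Only `push` lengthens a stack, by one bit at the cost of one step. Hence running time bounds
output length, which is what makes polynomial time stable under composition. -/
theorem Exec.length_le {P : Prog} {s s' : Store} {t : ℕ} (h : Exec P s s' t) (r : ℕ) :
    (s' r).length ≤ (s r).length + t := by
  induction h with
  | skip s => omega
  | push r' b s => by_cases hr : r = r' <;> simp [hr]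
  | pop r' s => by_cases hr : r = r' <;> simp [hr]; omega
  | seq _ _ ih ih' => omega
  | branch_nil _ _ ih => omega
  | branch_zero _ _ ih => omega
  | branch_one _ _ ih => omega
  | loop_done _ => omega
  | loop_again _ _ _ ih ih' => omega

/-- A strict upper bound for the stacks that a program uses. -/
def Prog.width : Prog → ℕ
  | .skip => 0
  | .push r _ => r + 1
  | .pop r => r + 1
  | .seq P Q => max P.width Q.width
  | .branch r P Q R => max (r + 1) (max P.width (max Q.width R.width))
  | .loop r P => max (r + 1) P.width

theorem Exec.eq_of_width_le {P : Prog} {s s' : Store} {t : ℕ} (h : Exec P s s' t) {r : ℕ}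
    (hr : P.width ≤ r) : s' r = s r := by
  induction h with
  | skip s => rfl
  | push r' b s => exact Function.update_of_ne (by simp only [Prog.width] at hr; omega) _ _
  | pop r' s => exact Function.update_of_ne (by simp only [Prog.width] at hr; omega) _ _
  | seq _ _ ih ih' =>
    simp only [Prog.width, max_le_iff] at hr
    rw [ih' hr.2, ih hr.1]
  | branch_nil _ _ ih =>
    simp only [Prog.width, max_le_iff] at hr
    exact ih hr.2.1
  | branch_zero _ _ ih =>
    simp only [Prog.width, max_le_iff] at hr
    exact ih hr.2.2.1
  | branch_one _ _ ih =>
    simp only [Prog.width, max_le_iff] at hr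
    exact ih hr.2.2.2
  | loop_done _ => rfl
  | loop_again _ _ _ ih ih' =>
    rw [ih' hr, ih (le_trans (le_max_right _ _) hr)]

/-- The stacks below `R` are taken from `s`, the others from `u`. -/
def merge (R : ℕ) (s u : Store) : Store := fun r => if r < R then s r else u r

theorem merge_update {R r : ℕ} (h : r < R) (s u : Store) (w : Str) :
    merge R (Function.update s r w) u = Function.update (merge R s u) r w := by
  funext i
  by_cases hi : i = r
  · subst hi; simp [merge, h]
  · simp [merge, hi]

/-- A program neither reads nor writes stacks beyond its width, so data kept there survive and do
not disturb it. This is how several programs are combined: intermediate results are parked above the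
width of all of them. -/
theorem Exec.frame {P : Prog} {s s' : Store} {t : ℕ} (h : Exec P s s' t) {R : ℕ}
    (hR : P.width ≤ R) (u : Store) : Exec P (merge R s u) (merge R s' u) t := by
  induction h with
  | skip s => exact .skip _
  | push r b s =>
    have hr : r < R := hR
    have := Exec.push r b (merge R s u)
    rw [merge_update hr]; simpa [merge, hr] using this
  | pop r s =>
    have hr : r < R := hR
    have := Exec.pop r (merge R s u)
    rw [merge_update hr]; simpa [merge, hr] using this
  | seq _ _ ih ih' =>
    simp only [Prog.width, max_le_iff] at hR
    exact .seq (ih hR.1) (ih' hR.2)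
  | branch_nil hs _ ih =>
    simp only [Prog.width, max_le_iff] at hR
    exact .branch_nil (by simp [merge, show _ < R from hR.1, hs]) (ih hR.2.1)
  | branch_zero hs _ ih =>
    simp only [Prog.width, max_le_iff] at hR
    exact .branch_zero (by simp [merge, show _ < R from hR.1, hs]; rfl) (ih hR.2.2.1)
  | branch_one hs _ ih =>
    simp only [Prog.width, max_le_iff] at hR
    exact .branch_one (by simp [merge, show _ < R from hR.1, hs]; rfl) (ih hR.2.2.2)
  | loop_done hs =>
    simp only [Prog.width, max_le_iff] at hR
    exact .loop_done (by simp [merge, show _ < R from hR.1, hs])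
  | loop_again hs _ _ ih ih' =>
    have hR' := hR
    simp only [Prog.width, max_le_iff] at hR
    exact .loop_again (by simpa [merge, show _ < R from hR.1] using hs) (ih hR.2) (ih' hR')

/-! ### Elementary programs -/

/-- Take the bits off stack `a`, and treat each of them by `P`. -/
def Prog.scan (a : ℕ) (P : Bool → Prog) : Prog :=
  .loop a (.branch a .skip (.seq (.pop a) (P false)) (.seq (.pop a) (P true)))

/-- The family `S` is a loop invariant: `S u w` is the store when the bits `u` have been read, the
latest first, and `w` is still to come. Each bit costs the `k` steps of its treatment and one step
each for the loop, the branch, the sequencing and the `pop`. -/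
theorem runs_scan {a k : ℕ} {P : Bool → Prog} {S : Str → Str → Store} (hS : ∀ u w, S u w a = w)
    (hP : ∀ x u w, Runs (P x) (Function.update (S u (x :: w)) a w) (S (x :: u) w) k) (u w : Str) :
    Runs (.scan a P) (S u w) (S (w.reverse ++ u) []) ((k + 4) * w.length + 1) := by
  induction w generalizing u with
  | nil => exact Runs.loop_done (hS u [])
  | cons x w ih =>
    have h := Runs.pop a (S u (x :: w))
    rw [hS] at h
    have step : Runs (.branch a .skip (.seq (.pop a) (P false)) (.seq (.pop a) (P true)))
        (S u (x :: w)) (S (x :: u) w) (1 + k + 1 + 1) := by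
      cases x
      · exact Runs.branch_zero (hS _ _) (h.seq (hP ..))
      · exact Runs.branch_one (hS _ _) (h.seq (hP ..))
    refine (Runs.loop_again (by simp [hS]) step (ih (x :: u))).cast (by simp) ?_
    rw [List.length_cons, Nat.mul_add]; omega

/-- Move stack `a` onto stack `b`, reversing it. -/
def Prog.move (a b : ℕ) : Prog := .scan a fun x => .push b x

/-- Move stack `a` onto both stacks `b` and `c`, reversing it. -/
def Prog.move₂ (a b c : ℕ) : Prog := .scan a fun x => .seq (.push b x) (.push c x)

/-- Move stack `a` onto stack `b`, reversing it and marking every bit by a `1` on top of it. -/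
def Prog.double (a b : ℕ) : Prog := .scan a fun x => .seq (.push b x) (.push b true)

/-- Empty stack `a`. -/
def Prog.clear (a : ℕ) : Prog := .scan a fun _ => .skip

theorem runs_clear (a : ℕ) (s : Store) :
    Runs (.clear a) s (Function.update s a []) (5 * (s a).length + 1) := by
  simpa [Prog.clear] using runs_scan (P := fun _ => .skip) (S := fun _ w => Function.update s a w) (by simp)
    (fun x u w => (Runs.skip _).cast (by simp) le_rfl) [] (s a)

theorem runs_move (a b : ℕ) (s : Store) (h : a ≠ b := by omega) : Runs (.move a b) s
    (Function.update (Function.update s a []) b ((s a).reverse ++ s b)) (5 * (s a).length + 1) := by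
  simpa [Prog.move] using runs_scan (P := fun x => .push b x)
    (S := fun u w => Function.update (Function.update s a w) b (u ++ s b)) (by simp [h])
    (fun x u w => (Runs.push b x _).cast (by funext i; grind) le_rfl) [] (s a)

theorem runs_move₂ (a b c : ℕ) (s : Store) (hab : a ≠ b := by omega) (hac : a ≠ c := by omega)
    (hbc : b ≠ c := by omega) :
    Runs (.move₂ a b c) s
      (Function.update (Function.update (Function.update s a []) b ((s a).reverse ++ s b)) c
        ((s a).reverse ++ s c)) (7 * (s a).length + 1) := by
  simpa [Prog.move₂] using runs_scan (P := fun x => .seq (.push b x) (.push c x)) (S := fun u w =>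
    Function.update (Function.update (Function.update s a w) b (u ++ s b)) c (u ++ s c))
    (by simp [hab, hac]) (fun x u w => ((Runs.push b x _).seq (Runs.push c x _)).cast
      (by funext i; grind) le_rfl) [] (s a)

theorem runs_double (a b : ℕ) (s : Store) (h : a ≠ b := by omega) : Runs (.double a b) s
    (Function.update (Function.update s a []) b
      (((s a).reverse.flatMap fun x => [true, x]) ++ s b)) (7 * (s a).length + 1) := by
  simpa [Prog.double] using runs_scan (P := fun x => .seq (.push b x) (.push b true)) (S := fun u w =>
    Function.update (Function.update s a w) b ((u.flatMap fun x => [true, x]) ++ s b))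
    (by simp [h]) (fun x u w => ((Runs.push b x _).seq (Runs.push b true _)).cast
      (by funext i; grind) le_rfl) [] (s a)

/-! ### Configurations -/

/-- The store with `x` on stack `0` and the strings of `l` on the stacks `R + 1`, `R + 2`, …. -/
def conf (R : ℕ) (x : Str) (l : List Str) : Store := fun r =>
  if r = 0 then x else if R < r then l.getD (r - (R + 1)) [] else []

/-- The store with `x` on stack `0`. -/
def single (x : Str) : Store := fun r => if r = 0 then x else []

theorem conf_nil {R : ℕ} {x : Str} {l : List Str} (h : ∀ w ∈ l, w = []) :
    conf R x l = single x := by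
  funext r
  have : l.getD (r - (R + 1)) [] = [] := by
    rw [List.getD_eq_getElem?_getD]
    cases e : l[r - (R + 1)]? with
    | none => rfl
    | some w => exact h w (List.mem_of_getElem? e)
  simp only [conf, single, this, ite_self]

@[simp] theorem conf_zero (R : ℕ) (x : Str) (l : List Str) : conf R x l 0 = x := by simp [conf]

theorem conf_high (R i : ℕ) (x : Str) (l : List Str) : conf R x l (R + (i + 1)) = l.getD i [] := by
  have : R + (i + 1) - (R + 1) = i := by omega
  simp [conf, this]

@[simp] theorem conf_one (R : ℕ) (x : Str) (l : List Str) :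
    conf R x l (R + 1) = l.getD 0 [] := conf_high R 0 x l
@[simp] theorem conf_two (R : ℕ) (x : Str) (l : List Str) :
    conf R x l (R + 2) = l.getD 1 [] := conf_high R 1 x l
@[simp] theorem conf_three (R : ℕ) (x : Str) (l : List Str) :
    conf R x l (R + 3) = l.getD 2 [] := conf_high R 2 x l
@[simp] theorem conf_four (R : ℕ) (x : Str) (l : List Str) :
    conf R x l (R + 4) = l.getD 3 [] := conf_high R 3 x l

@[simp] theorem update_conf_zero (R : ℕ) (x y : Str) (l : List Str) :
    Function.update (conf R x l) 0 y = conf R y l := by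
  funext r
  by_cases h : r = 0 <;> simp [conf, h]

theorem update_conf_high (R i : ℕ) (x y : Str) (l : List Str) (hi : i < l.length) :
    Function.update (conf R x l) (R + (i + 1)) y = conf R x (l.set i y) := by
  funext r
  by_cases h : r = R + (i + 1)
  · subst h
    rw [Function.update_self, conf_high]
    simp [List.getD_eq_getElem?_getD, hi]
  · simp only [Function.update_apply, h, if_false, conf]
    split_ifs with h1 h2
    · rfl
    · have : i ≠ r - (R + 1) := by omega
      simp [List.getD_eq_getElem?_getD, List.getElem?_set_ne this]
    · rfl

@[simp] theorem update_conf_one (R : ℕ) (x y a : Str) (l : List Str) :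
    Function.update (conf R x (a :: l)) (R + 1) y = conf R x (y :: l) :=
  update_conf_high R 0 x y _ (by simp)
@[simp] theorem update_conf_two (R : ℕ) (x y a b : Str) (l : List Str) :
    Function.update (conf R x (a :: b :: l)) (R + 2) y = conf R x (a :: y :: l) :=
  update_conf_high R 1 x y _ (by simp)
@[simp] theorem update_conf_three (R : ℕ) (x y a b c : Str) (l : List Str) :
    Function.update (conf R x (a :: b :: c :: l)) (R + 3) y = conf R x (a :: b :: y :: l) :=
  update_conf_high R 2 x y _ (by simp)
@[simp] theorem update_conf_four (R : ℕ) (x y a b c d : Str) (l : List Str) :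
    Function.update (conf R x (a :: b :: c :: d :: l)) (R + 4) y =
      conf R x (a :: b :: c :: y :: l) :=
  update_conf_high R 3 x y _ (by simp)

/-- A program that maps `single x` to `single y` can be run with data on higher stacks. -/
theorem Runs.conf {P : Prog} {x y : Str} {b R : ℕ} (h : Runs P (single x) (single y) b)
    (hR : P.width ≤ R + 1) (l : List Str) : Runs P (conf R x l) (conf R y l) b := by
  obtain ⟨t, ht, h⟩ := h
  have key : ∀ z, merge (R + 1) (single z) (GD2C.conf R z l) = GD2C.conf R z l := by
    intro z
    funext r
    simp only [merge, single, GD2C.conf]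
    split_ifs <;> first | rfl | omega
  have key' : merge (R + 1) (single y) (GD2C.conf R x l) = GD2C.conf R y l := by
    funext r
    simp only [merge, single, GD2C.conf]
    split_ifs <;> first | rfl | omega
  have := h.frame hR (GD2C.conf R x l)
  rw [key, key'] at this
  exact ⟨t, ht, this⟩

/-! ### Polynomial bounds -/

/-- `b` is bounded by a polynomial in the length of the argument. -/
def PolyBdd (b : Str → ℕ) : Prop := ∃ q : Polynomial ℕ, ∀ x, b x ≤ q.eval x.length

theorem eval_le_eval (q : Polynomial ℕ) {m n : ℕ} (h : m ≤ n) : q.eval m ≤ q.eval n := by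
  induction q using Polynomial.induction_on' with
  | add p q hp hq => simpa using add_le_add hp hq
  | monomial k a => simpa using Nat.mul_le_mul_left a (Nat.pow_le_pow_left h k)

@[simp] theorem PolyBdd.const (c : ℕ) : PolyBdd fun _ => c := ⟨Polynomial.C c, by simp⟩

@[simp] theorem PolyBdd.length : PolyBdd fun x => x.length := ⟨Polynomial.X, by simp⟩

@[simp] theorem PolyBdd.add {b c : Str → ℕ} (hb : PolyBdd b) (hc : PolyBdd c) :
    PolyBdd fun x => b x + c x := by
  obtain ⟨p, hp⟩ := hb
  obtain ⟨q, hq⟩ := hc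
  exact ⟨p + q, fun x => by simpa using add_le_add (hp x) (hq x)⟩

@[simp] theorem PolyBdd.mul {b c : Str → ℕ} (hb : PolyBdd b) (hc : PolyBdd c) :
    PolyBdd fun x => b x * c x := by
  obtain ⟨p, hp⟩ := hb
  obtain ⟨q, hq⟩ := hc
  exact ⟨p * q, fun x => by simpa using Nat.mul_le_mul (hp x) (hq x)⟩

@[simp] theorem PolyBdd.eval {b : Str → ℕ} (hb : PolyBdd b) (q : Polynomial ℕ) :
    PolyBdd fun x => q.eval (b x) := by
  obtain ⟨p, hp⟩ := hb
  exact ⟨q.comp p, fun x => by simpa using eval_le_eval q (hp x)⟩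

theorem PolyBdd.mono {b c : Str → ℕ} (hc : PolyBdd c) (h : ∀ x, b x ≤ c x) : PolyBdd b := by
  obtain ⟨p, hp⟩ := hc
  exact ⟨p, fun x => (h x).trans (hp x)⟩

/-! ### Polynomial-time functions of one string -/

/-- `f` is computed in polynomial time by a program that leaves all stacks but stack `0` empty. -/
def FP (f : Str → Str) : Prop :=
  ∃ (P : Prog) (b : Str → ℕ), PolyBdd b ∧ ∀ x, Runs P (single x) (single (f x)) (b x)

theorem FP.of_runs {f : Str → Str} {P : Prog} {b : Str → ℕ}
    (h : ∀ x, Runs P (single x) (single (f x)) (b x)) (hb : PolyBdd b) : FP f := ⟨P, b, hb, h⟩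

theorem FP.of_conf {f : Str → Str} {P : Prog} {b : Str → ℕ} {R : ℕ} (l : List Str)
    (h : ∀ x, Runs P (conf R x l) (conf R (f x) l) (b x)) (hl : ∀ w ∈ l, w = [] := by simp)
    (hb : PolyBdd b := by simp (maxDischargeDepth := 20) [*]) : FP f :=
  .of_runs (fun x => by simpa only [conf_nil hl] using h x) hb

/-- At most one bit is added per step, so a value is at most as long as the argument plus the
running time. -/
theorem FP.polyBdd_length {f : Str → Str} (hf : FP f) : PolyBdd fun x => (f x).length := by
  obtain ⟨P, b, hb, h⟩ := hf
  refine (PolyBdd.length.add hb).mono fun x => ?_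
  obtain ⟨t, ht, hx⟩ := h x
  have := hx.length_le 0
  simp only [single, if_true] at this
  omega

theorem FP.id : FP fun x => x := .of_runs (fun _ => Runs.skip _) (PolyBdd.const 1)

theorem FP.comp {f g : Str → Str} (hg : FP g) (hf : FP f) : FP fun x => g (f x) := by
  have hl := hf.polyBdd_length
  obtain ⟨P, b, hb, h⟩ := hf
  obtain ⟨Q, c, ⟨q, hq⟩, h'⟩ := hg
  refine .of_runs (fun x => ((h x).seq (h' (f x))).mono (Nat.add_le_add_right
    (Nat.add_le_add_left (hq (f x)) _) 1)) ?_
  exact (hb.add (hl.eval q)).add (PolyBdd.const 1)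

theorem single_eq (x : Str) : single x = conf 0 x [] := (conf_nil (by simp)).symm

theorem FP.cons (b : Bool) : FP fun x => b :: x := by
  refine .of_runs (P := .push 0 b) (fun x => ?_) (PolyBdd.const 1)
  simpa [single_eq] using Runs.push 0 b (single x)

theorem FP.tail : FP fun x => x.tail := by
  refine .of_runs (P := .pop 0) (fun x => ?_) (PolyBdd.const 1)
  simpa [single_eq] using Runs.pop 0 (single x)

theorem FP.nil : FP fun _ => [] := by
  refine .of_runs (P := .clear 0) (b := fun x => 5 * x.length + 1) (fun x => ?_) (by simp)
  simpa [single_eq] using runs_clear 0 (single x)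

theorem FP.const (w : Str) : FP fun _ => w := by
  induction w with
  | nil => exact FP.nil
  | cons b w ih => exact (FP.cons b).comp ih

/-- The pair of two strings; a list of strings is encoded as a nested pair. -/
def strPair (x y : Str) : Str := (x.flatMap fun b => [true, b]) ++ false :: y

theorem encodeList_cons (w : Str) (ws : List Str) :
    encodeList (w :: ws) = strPair w (encodeList ws) := by
  simp [encodeList, strPair]

@[simp] theorem length_strPair (x y : Str) :
    (strPair x y).length = 2 * x.length + 1 + y.length := by
  simp [strPair, List.length_flatMap]; ring

/-- Copy stack `0` onto the empty stack `R + 1`, with the help of stack `R + 2`. -/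
def Prog.save (R : ℕ) : Prog := .seq (.move 0 (R + 2)) (.move₂ (R + 2) 0 (R + 1))

theorem runs_save (R : ℕ) (x : Str) (l : List Str) :
    Runs (.save R) (conf R x ([] :: [] :: l)) (conf R x (x :: [] :: l)) (12 * x.length + 3) := by
  have h := (runs_move 0 (R + 2) (conf R x ([] :: [] :: l))).seq
    (runs_move₂ (R + 2) 0 (R + 1) _)
  simp at h
  exact h.mono (by omega)

/-- Move stack `a` onto stack `b` without reversing it, with the help of stack `c`. -/
def Prog.shift (a b c : ℕ) : Prog := .seq (.move a c) (.move c b)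

/-- The argument is saved above the stacks of both programs. The second component is computed first
and parked, because a stack is filled from its far end: the pair is assembled by pushing the
separator onto the second component and then the marked bits of the first. -/
theorem FP.pair {f g : Str → Str} (hf : FP f) (hg : FP g) : FP fun x => strPair (f x) (g x) := by
  have hlf := hf.polyBdd_length
  have hlg := hg.polyBdd_length
  obtain ⟨P, b, hb, h⟩ := hf
  obtain ⟨Q, c, hc, h'⟩ := hg
  set R := max P.width Q.width with hR
  refine .of_conf (R := R)
    (P := .seq (.save R) <| .seq Q <| .seq (.seq (.move 0 (R + 2)) <|
      .shift (R + 1) 0 (R + 3)) <| .seq P <| .seq (.move (R + 2) (R + 1)) <|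
      .seq (.push (R + 1) false) <| .seq (.move 0 (R + 2)) <| .seq (.double (R + 2) (R + 1)) <|
      .shift (R + 1) 0 (R + 2))
    (b := fun x => 40 * (x.length + (f x).length + (g x).length + b x + c x + 1)) [[], [], []]
    fun x => ?_
  have e₁ := (runs_move 0 (R + 2) (conf R (g x) [x, [], []])).seq
    ((runs_move (R + 1) (R + 3) _).seq
      (runs_move (R + 3) 0 _))
  have e₂ := (runs_move (R + 2) (R + 1)
    (conf R (f x) [[], (g x).reverse, []])).seq ((Runs.push (R + 1) false _).seq
    ((runs_move 0 (R + 2) _).seq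
    ((runs_double (R + 2) (R + 1) _).seq
    ((runs_move (R + 1) (R + 2) _).seq
      (runs_move (R + 2) 0 _)))))
  simp at e₁ e₂
  have e := (runs_save R x [[]]).seq (((h' x).conf (by omega) _).seq (e₁.seq
    (((h x).conf (by omega) _).seq e₂)))
  refine e.cast (by simp [strPair]) ?_
  omega

/-- Reads a pair; `acc` holds the part of the first component that was read, reversed. -/
def unpairAux : Str → Str → Str × Str
  | acc, [] => (acc, [])
  | acc, false :: w => (acc, w)
  | acc, [true] => (acc, [])
  | acc, true :: b :: w => unpairAux (b :: acc) w

/-- The first component of a pair. -/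
def strFst (w : Str) : Str := (unpairAux [] w).1.reverse

/-- The second component of a pair. -/
def strSnd (w : Str) : Str := (unpairAux [] w).2

theorem unpairAux_strPair (acc x y : Str) :
    unpairAux acc (strPair x y) = (x.reverse ++ acc, y) := by
  induction x generalizing acc with
  | nil => simp [strPair, unpairAux]
  | cons b x ih =>
    have := ih (b :: acc)
    simpa [strPair, unpairAux] using this

@[simp] theorem strFst_strPair (x y : Str) : strFst (strPair x y) = x := by
  simp [strFst, unpairAux_strPair]

@[simp] theorem strSnd_strPair (x y : Str) : strSnd (strPair x y) = y := by
  simp [strSnd, unpairAux_strPair]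

theorem length_unpairAux (acc w : Str) :
    (unpairAux acc w).1.length + (unpairAux acc w).2.length ≤ acc.length + w.length := by
  induction acc, w using unpairAux.induct with
  | case1 acc => simp [unpairAux]
  | case2 acc w => simp [unpairAux]
  | case3 acc => simp [unpairAux]
  | case4 acc b w ih => simp [unpairAux] at ih ⊢; omega

/-- One step of the following program. -/
def Prog.splitStep (a c : ℕ) : Prog :=
  .branch 0 .skip (.seq (.pop 0) (.move 0 c))
    (.seq (.pop 0) (.branch 0 .skip (.seq (.pop 0) (.push a false)) (.seq (.pop 0) (.push a true))))

/-- Split the pair on stack `0`: its first component goes reversed onto stack `a`, its second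
component stays on stack `0`; stack `c` is auxiliary. -/
def Prog.split (a c : ℕ) : Prog := .seq (.loop 0 (.splitStep a c)) (.move c 0)

theorem runs_split (R : ℕ) (x : Str) (l : List Str) :
    Runs (.split (R + 1) (R + 2)) (conf R x ([] :: [] :: l))
      (conf R (strSnd x) ((strFst x).reverse :: [] :: l)) (20 * x.length + 20) := by
  have main : ∀ acc w, Runs (.loop 0 (.splitStep (R + 1) (R + 2))) (conf R w (acc :: [] :: l))
      (conf R [] ((unpairAux acc w).1 :: (unpairAux acc w).2.reverse :: l))
      (10 * w.length + 10) := by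
    intro acc w
    induction acc, w using unpairAux.induct with
    | case1 acc => exact (Runs.loop_done (by simp)).mono (by omega)
    | case2 acc w =>
      -- At the separator the rest of stack `0` is moved away to stack `R + 2`, which makes the loop
      -- condition fail.
      have e := Runs.loop_again (r := 0) (by simp) (Runs.branch_zero (r := 0) (P := .skip)
        (R := .seq (.pop 0) (.branch 0 .skip (.seq (.pop 0) (.push (R + 1) false))
          (.seq (.pop 0) (.push (R + 1) true)))) (conf_zero ..) ((Runs.pop 0 (conf R (false :: w)
        (acc :: [] :: l))).seq (runs_move 0 (R + 2) _))) (Runs.loop_done (by simp))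
      simp at e
      refine e.mono ?_
      simp; omega
    | case3 acc =>
      have e := Runs.loop_again (r := 0) (by simp) (Runs.branch_one (r := 0) (P := .skip)
        (Q := .seq (.pop 0) (.move 0 (R + 2))) (conf_zero ..)
        ((Runs.pop 0 (conf R [true] (acc :: [] :: l))).seq (Runs.branch_nil (r := 0)
          (Q := .seq (.pop 0) (.push (R + 1) false)) (R := .seq (.pop 0) (.push (R + 1) true))
          (by simp) (Runs.skip _)))) (Runs.loop_done (by simp))
      simp at e
      exact e.mono (by simp)
    | case4 acc b w ih =>
      have o := Runs.pop 0 (conf R (true :: b :: w) (acc :: [] :: l))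
      have p := (Runs.pop 0 (conf R (b :: w) (acc :: [] :: l))).seq (Runs.push (R + 1) b _)
      simp at o p
      have q : Runs (.branch 0 .skip (.seq (.pop 0) (.push (R + 1) false)) (.seq (.pop 0)
          (.push (R + 1) true))) (conf R (b :: w) (acc :: [] :: l))
          (conf R w ((b :: acc) :: [] :: l)) 4 := by
        cases b
        · exact Runs.branch_zero (conf_zero ..) p
        · exact Runs.branch_one (conf_zero ..) p
      refine (Runs.loop_again (by simp) (Runs.branch_one (P := .skip) (Q := .seq (.pop 0)
        (.move 0 (R + 2))) (conf_zero ..) (o.seq q)) ih).mono ?_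
      simp; omega
  have e := (main [] x).seq (runs_move (R + 2) 0 _)
  have := length_unpairAux [] x
  simp at e this
  refine e.cast (by simp [strFst, strSnd]) ?_
  omega

theorem length_strFst_add (x : Str) : (strFst x).length + (strSnd x).length ≤ x.length := by
  simpa [strFst, strSnd] using length_unpairAux [] x

theorem FP.strFst : FP strFst := by
  refine .of_conf (R := 0) (P := .seq (.split 1 2) (.seq (.clear 0) (.move 1 0)))
    (b := fun x => 40 * x.length + 40) [[], []] fun x => ?_
  have e := (runs_split 0 x []).seq ((runs_clear 0 _).seq (runs_move 1 0 _))
  have := length_strFst_add x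
  simp at e
  refine e.mono ?_
  omega

theorem FP.strSnd : FP strSnd := by
  refine .of_conf (R := 0) (P := .seq (.split 1 2) (.clear 1))
    (b := fun x => 40 * x.length + 40) [[], []] fun x => ?_
  have e := (runs_split 0 x []).seq (runs_clear 1 _)
  have := length_strFst_add x
  simp at e
  refine e.mono ?_
  omega

theorem FP.append : FP fun x => GD2C.strFst x ++ GD2C.strSnd x := by
  refine .of_conf (R := 0) (P := .seq (.split 1 2) (.move 1 0))
    (b := fun x => 40 * x.length + 40) [[], []] fun x => ?_
  have e := (runs_split 0 x []).seq (runs_move 1 0 _)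
  have := length_strFst_add x
  simp at e
  refine e.mono ?_
  omega

/-- Case distinction on a string: empty, or first bit `0`, or first bit `1`. -/
def strCases {α : Sort*} (w : Str) (a b c : α) : α :=
  match w with
  | [] => a
  | false :: _ => b
  | true :: _ => c

/-- The argument is saved before the condition is evaluated; every branch starts with `D`, which
discards the value of the condition and restores the argument. -/
theorem FP.cases {c f g h : Str → Str} (hc : FP c) (hf : FP f) (hg : FP g) (hh : FP h) :
    FP fun x => strCases (c x) (f x) (g x) (h x) := by
  have lc := hc.polyBdd_length
  obtain ⟨C, tc, htc, hC⟩ := hc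
  obtain ⟨P, tf, htf, hP⟩ := hf
  obtain ⟨Q, tg, htg, hQ⟩ := hg
  obtain ⟨S, th, hth, hS⟩ := hh
  set R := max (max C.width P.width) (max Q.width S.width) with hR
  set D : Prog := .seq (.clear 0) (.shift (R + 1) 0 (R + 2)) with hD
  refine .of_conf (R := R) (P := .seq (.save R) <| .seq C <|
      .branch 0 (.seq D P) (.seq D Q) (.seq D S))
    (b := fun x => 60 * (x.length + (c x).length + tc x + tf x + tg x + th x + 1)) [[], []]
    fun x => ?_
  have d := (runs_clear 0 (conf R (c x) [x, []])).seq
    ((runs_move (R + 1) (R + 2) _).seq (runs_move (R + 2) 0 _))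
  simp at d
  have p := d.seq ((hP x).conf (by omega) [[], []])
  have q := d.seq ((hQ x).conf (by omega) [[], []])
  have s := d.seq ((hS x).conf (by omega) [[], []])
  refine ((runs_save R x []).seq (((hC x).conf (by omega) [x, []]).seq (b' := 30 * (x.length +
    (c x).length + tf x + tg x + th x + 1)) ?_)).mono (by omega)
  match hcx : c x with
  | [] =>
    rw [hcx] at p
    exact (Runs.branch_nil (conf_zero ..) p).mono (by simp; omega)
  | false :: w =>
    rw [hcx] at q
    exact (Runs.branch_zero (conf_zero ..) q).mono (by simp; omega)
  | true :: w =>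
    rw [hcx] at s
    exact (Runs.branch_one (conf_zero ..) s).mono (by simp; omega)

/-- One step of the following program. -/
def Prog.truncateStep (R : ℕ) : Prog :=
  .seq (.seq (.pop (R + 2)) (.push (R + 3) true))
    (.branch 0 .skip (.seq (.pop 0) (.push (R + 4) false)) (.seq (.pop 0) (.push (R + 4) true)))

/-- Truncate stack `0` to the length of stack `R + 2`. -/
def Prog.truncate (R : ℕ) : Prog := .seq (.loop (R + 2) (.truncateStep R))
  (.seq (.clear 0) (.seq (.move (R + 4) 0) (.move (R + 3) (R + 2))))

/-- The loop is driven by the unary counter and not by the data, so it makes exactly `k` turns even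
if the string is shorter. The counter is rebuilt on stack `R + 3` for the next use. -/
theorem runs_truncate (R k : ℕ) (x y : Str) :
    Runs (.truncate R) (conf R x [y, List.replicate k true, [], []])
      (conf R (x.take k) [y, List.replicate k true, [], []]) (5 * x.length + 40 * k + 40) := by
  have main : ∀ k m x z, Runs (.loop (R + 2) (.truncateStep R))
      (conf R x [y, List.replicate k true, List.replicate m true, z])
      (conf R (x.drop k) [y, [], List.replicate (k + m) true, (x.take k).reverse ++ z])
      (20 * k + 1) := by
    intro k
    induction k with
    | zero =>
      intro m x z
      rw [Nat.zero_add]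
      exact Runs.loop_done (conf_two ..)
    | succ k ih =>
      intro m x z
      have o := (Runs.pop (R + 2) (conf R x [y, List.replicate (k + 1) true,
        List.replicate m true, z])).seq (Runs.push (R + 3) true _)
      have p := fun b => (Runs.pop 0 (conf R x [y, List.replicate k true,
        List.replicate (m + 1) true, z])).seq (Runs.push (R + 4) b _)
      have i := ih (m + 1) x.tail ((x.take 1).reverse ++ z)
      simp [List.replicate_succ] at o p
      have q : Runs (.branch 0 .skip (.seq (.pop 0) (.push (R + 4) false)) (.seq (.pop 0)
          (.push (R + 4) true))) (conf R x [y, List.replicate k true,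
          List.replicate (m + 1) true, z]) (conf R x.tail [y, List.replicate k true,
          List.replicate (m + 1) true, (x.take 1).reverse ++ z]) 4 := by
        match x with
        | [] => exact (Runs.branch_nil (conf_zero ..) (Runs.skip _)).mono (by omega)
        | false :: x => exact Runs.branch_zero (conf_zero ..) p.1
        | true :: x => exact Runs.branch_one (conf_zero ..) p.2
      refine (Runs.loop_again (by simp) (o.seq q) i).cast ?_ (by omega)
      rw [show k + (m + 1) = k + 1 + m by omega]
      cases x <;> simp
  have e := (main k 0 x []).seq ((runs_clear 0 _).seq ((runs_move (R + 4) 0 _).seq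
    (runs_move (R + 3) (R + 2) _)))
  simp at e
  refine e.mono ?_
  omega

/-- Iterating a polynomial-time function can make lengths explode. Cutting every intermediate value
down to `k x` bits keeps all arguments of `g` below a fixed polynomial size, so each turn has the
same polynomial bound. The number of turns is given in unary by the length of `c x`. -/
theorem FP.iterate {c u s g : Str → Str} (hc : FP c) (hu : FP u) (hs : FP s) (hg : FP g)
    {k : Str → ℕ} (huk : ∀ x, u x = List.replicate (k x) true) :
    FP fun x => (fun w => (g w).take (k x))^[(c x).length] (s x) := by
  have lc := hc.polyBdd_length
  have ls := hs.polyBdd_length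
  have lu : PolyBdd k := hu.polyBdd_length.mono fun x => by simp [huk]
  obtain ⟨ql, hql⟩ := hg.polyBdd_length
  obtain ⟨Z, tz, htz, hZ⟩ := hc.pair (hu.pair hs)
  obtain ⟨P, tg, ⟨qg, hqg⟩, hP⟩ := hg
  set R := max Z.width P.width with hR
  have run : ∀ x n (y w : Str), w.length ≤ n → k x ≤ n →
      Runs (.loop (R + 1) (.seq (.pop (R + 1)) (.seq P (.truncate R))))
        (conf R w [y, u x, [], []])
        (conf R ((fun w => (g w).take (k x))^[y.length] w) [[], u x, [], []])
        (y.length * (qg.eval n + 5 * ql.eval n + 40 * n + 50) + 1) := by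
    intro x n y
    induction y with
    | nil => exact fun w _ _ => (Runs.loop_done (conf_one ..)).mono (by simp)
    | cons b y ih =>
      intro w hw hk
      have e₁ := Runs.pop (R + 1) (conf R w [b :: y, u x, [], []])
      have e₂ := (hP w).conf (R := R) (by omega) [y, u x, [], []]
      have e₃ := runs_truncate R (k x) (g w) y
      rw [← huk] at e₃
      simp at e₁
      have h₁ := (hqg w).trans (eval_le_eval qg hw)
      have h₂ := (hql w).trans (eval_le_eval ql hw)
      rw [List.length_cons, Function.iterate_succ_apply]
      refine (Runs.loop_again (by simp) (e₁.seq (e₂.seq e₃))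
        (ih ((g w).take (k x)) (by simp; omega) hk)).mono ?_
      simp only at h₂
      rw [add_mul y.length 1, one_mul]
      omega
  refine .of_conf (R := R) (P := .seq Z <| .seq (.seq (.split (R + 1) (R + 2)) <|
      .move (R + 1) (R + 3)) <| .seq (.seq (.split (R + 1) (R + 2)) <|
      .seq (.move (R + 1) (R + 2)) <| .move (R + 3) (R + 1)) <|
      .seq (.loop (R + 1) (.seq (.pop (R + 1)) (.seq P (.truncate R)))) (.clear (R + 2)))
    (b := fun x => 200 * (tz x + (c x).length + k x + (s x).length + (c x).length *
      (qg.eval ((s x).length + k x) + 5 * ql.eval ((s x).length + k x) +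
        40 * ((s x).length + k x) + 50) + 1)) [[], [], [], []] fun x => ?_
  have lux : (u x).length = k x := by simp [huk]
  have ux : (u x).reverse = u x := by simp [huk]
  have e₁ := (runs_split R (strPair (c x) (strPair (u x) (s x))) [[], []]).seq
    (runs_move (R + 1) (R + 3) _)
  have e₂ := (runs_split R (strPair (u x) (s x)) [c x, []]).seq
    ((runs_move (R + 1) (R + 2) _).seq (runs_move (R + 3) (R + 1) _))
  have e₃ := (run x ((s x).length + k x) (c x).reverse (s x) (by omega) (by omega)).seq
    (runs_clear (R + 2) _)
  simp [ux, lux] at e₁ e₂ e₃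
  refine (((hZ x).conf (by omega) _).seq (e₁.seq (e₂.seq e₃))).mono ?_
  omega

/-! ### Functions of several strings -/

/-- Empty the stacks `1, …, n`. -/
def Prog.clearAll : ℕ → Prog
  | 0 => .skip
  | n + 1 => .seq (.clear (n + 1)) (Prog.clearAll n)

theorem runs_clearAll (n : ℕ) (s : Store) :
    Runs (.clearAll n) s (fun r => if 0 < r ∧ r ≤ n then [] else s r)
      (∑ i ∈ Finset.range n, (5 * (s (i + 1)).length + 2) + 1) := by
  induction n generalizing s with
  | zero =>
    have : (fun r => if 0 < r ∧ r ≤ 0 then [] else s r) = s := by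
      funext r; rw [if_neg]; omega
    rw [this]; exact Runs.skip s
  | succ n ih =>
    have e1 := runs_clear (n + 1) s
    have e2 := ih (Function.update s (n + 1) [])
    have hs : (fun r => if 0 < r ∧ r ≤ n then [] else Function.update s (n + 1) [] r) =
        fun r => if 0 < r ∧ r ≤ n + 1 then [] else s r := by
      funext r
      by_cases hr : r = n + 1
      · subst hr; simp
      · simp only [ne_eq, hr, not_false_eq_true, Function.update_of_ne]
        congr 1; simp; omega
    rw [hs] at e2
    refine (e1.seq e2).mono ?_
    rw [Finset.sum_range_succ]
    have : ∀ i ∈ Finset.range n, 5 * (Function.update s (n + 1) [] (i + 1)).length + 2 =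
        5 * (s (i + 1)).length + 2 := by
      intro i hi
      rw [Function.update_of_ne]
      have := Finset.mem_range.mp hi
      omega
    rw [Finset.sum_congr rfl this]
    omega

theorem conf_args (x y z : Str) : conf 0 x [y, z, [], []] =
    fun r => if r = 0 then x else if r = 1 then y else if r = 2 then z else [] := by
  funext r
  match r with
  | 0 | 1 | 2 | 3 | 4 | r + 5 => simp [conf]

/-- A function that is computed on stacks `0`, `1`, `2` is a polynomial-time function of the
triple of its arguments. -/
theorem FP.of_three {f : Str → Str → Str → Str} {P : Prog} {q : Polynomial ℕ}
    (h : ∀ x y z : Str, ∃ (s : Store) (t : ℕ),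
      Exec P (fun r => if r = 0 then x else if r = 1 then y else if r = 2 then z else []) s t ∧ s 0 = f x y z ∧ t ≤ q.eval (x.length + y.length + z.length)) :
    FP fun w => f (GD2C.strFst w) (GD2C.strFst (GD2C.strSnd w)) (GD2C.strSnd (GD2C.strSnd w)) := by
  refine .of_conf (R := 0) (P := .seq (.seq (.split 1 2) (.move 1 3)) <| .seq (.split 1 2) <|
      .seq (.seq (.move 0 4) <| .seq (.move 4 2) <| .seq (.move 1 0) <| .seq (.move 0 4) <|
      .seq (.move 4 1) <| .seq (.move 3 4) (.move 4 0)) <| .seq P (.clearAll (P.width + 2)))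
    (b := fun w => 200 * (w.length + q.eval w.length + (P.width + 2) *
      (5 * (w.length + q.eval w.length) + 2) + 1)) [[], [], [], []] fun w => ?_
  have l₁ := length_strFst_add w
  have l₂ := length_strFst_add (GD2C.strSnd w)
  set x := GD2C.strFst w with hx
  set y := GD2C.strFst (GD2C.strSnd w) with hy
  set z := GD2C.strSnd (GD2C.strSnd w) with hz
  obtain ⟨s, t, hs, hs0, ht⟩ := h x y z
  have ht' : t ≤ q.eval w.length := ht.trans (eval_le_eval q (by omega))
  have e₁ := (runs_split 0 w [[], []]).seq ((runs_move 1 3 _))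
  have e₂ := runs_split 0 (GD2C.strSnd w) [x, []]
  have e₃ := (runs_move 0 4 (conf 0 z [y.reverse, [], x, []])).seq ((runs_move 4 2 _).seq
    ((runs_move 1 0 _).seq ((runs_move 0 4 _).seq ((runs_move 4 1 _).seq ((runs_move 3 4 _).seq
      (runs_move 4 0 _))))))
  simp at e₁ e₃
  have e₄ := runs_clearAll (P.width + 2) s
  -- Stacks up to `P.width + 2` are emptied explicitly (the arguments occupy stacks 1 and 2 even if
  -- the program ignores them); all higher ones were empty at the start and are out of reach.
  have hfin : (fun r => if 0 < r ∧ r ≤ P.width + 2 then [] else s r) = single (f x y z) := by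
    funext r
    by_cases h0 : r = 0
    · subst h0; simp [single, hs0]
    · by_cases h1 : r ≤ P.width + 2
      · simp [single, h0, h1, Nat.pos_of_ne_zero h0]
      · have := hs.eq_of_width_le (r := r) (by omega)
        rw [if_neg (by omega), this]
        simp [single, h0, show r ≠ 1 by omega, show r ≠ 2 by omega]
  rw [hfin] at e₄
  have hsum : ∑ i ∈ Finset.range (P.width + 2), (5 * (s (i + 1)).length + 2) ≤
      (P.width + 2) * (5 * (w.length + q.eval w.length) + 2) := by
    refine (Finset.sum_le_card_nsmul _ _ (5 * (w.length + q.eval w.length) + 2)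
      fun i _ => ?_).trans_eq (by simp)
    have := hs.length_le (i + 1)
    split_ifs at this <;> (try simp only [List.length_nil] at this) <;> omega
  rw [← conf_args] at hs
  refine (e₁.seq (e₂.seq (e₃.seq (Runs.seq ⟨t, ht', hs⟩ e₄)))).cast
    (conf_nil (R := 0) (l := [[], [], [], []]) (by simp)).symm ?_
  rw [← hx]
  omega

/-- A polynomial-time function of a triple, computed from its components on stacks `0`, `1`, `2`. -/
theorem FP.polyTime {f : Str → Str} (hf : FP f) :
    PolyTime (k := 3) fun v => f (strPair (v 0) (strPair (v 1) (v 2))) := by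
  obtain ⟨P, tb, ⟨q, hq⟩, h⟩ := hf
  refine ⟨.seq (.seq (.move 0 4) <| .seq (.move 2 3) <| .seq (.move 3 0) <|
    .seq (.move 1 3) <| .seq (.push 0 false) <| .seq (.double 3 0) <| .seq (.push 0 false)
      (.double 4 0)) P,
    q.comp (2 * Polynomial.X + 2) + 100 * Polynomial.X + 100, fun v => ?_⟩
  have h0 : (fun r => if h : r < 3 then v ⟨r, h⟩ else []) = conf 0 (v 0) [v 1, v 2, [], []] := by
    rw [conf_args]
    funext r
    match r with
    | 0 | 1 | 2 | r + 3 => simp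
  have e := (runs_move 0 4 (conf 0 (v 0) [v 1, v 2, [], []])).seq ((runs_move 2 3 _).seq
    ((runs_move 3 0 _).seq ((runs_move 1 3 _).seq ((Runs.push 0 false _).seq
    ((runs_double 3 0 _).seq ((Runs.push 0 false _).seq (runs_double 4 0 _)))))))
  simp at e
  have e' := h (strPair (v 0) (strPair (v 1) (v 2)))
  rw [← conf_nil (R := 0) (l := [[], [], [], []]) (by simp)] at e'
  obtain ⟨t, ht, he⟩ := e.seq e'
  rw [h0]
  refine ⟨_, t, he, rfl, ht.trans ?_⟩
  have := (hq (strPair (v 0) (strPair (v 1) (v 2)))).trans (eval_le_eval q (show _ ≤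
    2 * ((v 0).length + (v 1).length + (v 2).length) + 2 by simp; omega))
  simp only [Fin.sum_univ_three, Polynomial.eval_add, Polynomial.eval_comp, Polynomial.eval_mul,
    Polynomial.eval_X, Polynomial.eval_ofNat]
  omega

/-! ### Polynomials in unary -/

theorem FP.ones : FP fun x => List.replicate x.length true := by
  refine .of_conf (R := 0) (P := .seq (.scan 0 fun _ => .push 1 true) (.move 1 0))
    (b := fun x => 20 * x.length + 20) [[]] fun x => ?_
  have e := (runs_scan (a := 0) (P := fun _ => .push 1 true)
    (S := fun u w => conf 0 w [List.replicate u.length true]) (fun _ _ => rfl)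
    (fun x u w => (Runs.push 1 true _).cast (by simp [List.replicate_succ]) le_rfl) [] x).seq
    (runs_move 1 0 _)
  simp at e
  refine e.mono ?_
  omega

theorem FP.repeat : FP fun w =>
    (List.replicate (GD2C.strFst w).length (GD2C.strSnd w)).flatten := by
  refine .of_conf (R := 0) (P := .seq (.seq (.split 1 2) (.move 0 2)) <| .seq
      (.scan 1 fun _ => .seq (.move₂ 2 0 3) (.move 3 2)) (.clear 2))
    (b := fun w => 100 * (w.length * w.length + w.length + 1)) [[], [], []] fun w => ?_
  have l := length_strFst_add w
  have e := (runs_split 0 w [[]]).seq (runs_move 0 2 _)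
  have e' := (runs_scan (a := 1) (k := 12 * (GD2C.strSnd w).length + 3)
    (P := fun _ => .seq (.move₂ 2 0 3) (.move 3 2)) (S := fun u x =>
      conf 0 (List.replicate u.length (GD2C.strSnd w)).flatten [x, (GD2C.strSnd w).reverse, []])
    (fun _ _ => rfl) (fun x u y => by
      have e := (runs_move₂ 2 0 3 (conf 0 (List.replicate u.length (GD2C.strSnd w)).flatten
        [y, (GD2C.strSnd w).reverse, []])).seq (runs_move 3 2 _)
      simp at e
      change Runs _ (Function.update (conf 0 _ _) (0 + 1) y) _ _
      rw [update_conf_one]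
      refine e.cast ?_ ?_
      · simp [List.replicate_succ]
      · omega) [] (GD2C.strFst w).reverse).seq (runs_clear 2 _)
  have h := Nat.mul_le_mul (show 12 * (GD2C.strSnd w).length + 3 + 4 ≤ 12 * w.length + 7 by omega)
    (show (GD2C.strFst w).length ≤ w.length by omega)
  rw [Nat.add_mul (12 * w.length), Nat.mul_assoc 12 w.length] at h
  simp at e e'
  refine (e.seq e').mono ?_
  omega

theorem FP.append₂ {f g : Str → Str} (hf : FP f) (hg : FP g) : FP fun x => f x ++ g x := by
  simpa using FP.append.comp (hf.pair hg)

/-- In unary, addition is concatenation and multiplication is repetition, so induction over the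
monomials suffices. -/
theorem FP.polynomial (q : Polynomial ℕ) {f : Str → Str} (hf : FP f) :
    FP fun x => List.replicate (q.eval (f x).length) true := by
  have hX : FP fun x => List.replicate (f x).length true := FP.ones.comp hf
  have hmul : ∀ {a b : Str → ℕ}, FP (fun x => List.replicate (a x) true) →
      FP (fun x => List.replicate (b x) true) →
      FP fun x => List.replicate (a x * b x) true := by
    intro a b ha hb
    simpa [List.flatten_replicate_replicate] using FP.repeat.comp (ha.pair hb)
  have hpow : ∀ n, FP fun x => List.replicate ((f x).length ^ n) true := by
    intro n
    induction n with
    | zero => exact FP.const _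
    | succ n ih => simpa [pow_succ] using hmul ih hX
  induction q using Polynomial.induction_on' with
  | add p q hp hq => simpa only [Polynomial.eval_add, List.replicate_add] using hp.append₂ hq
  | monomial n a => simpa using hmul (FP.const (List.replicate a true)) (hpow n)

/-! ### Polynomial-time functions between encoded types -/

/-- Types whose elements are written as strings. The encoding need not be injective. -/
class Code (α : Type) where
  enc : α → Str

open Code

instance : Code Bool := ⟨fun b => if b then [true] else []⟩
instance : Code ℕ := ⟨Nat.bits⟩
instance {α β : Type} [Code α] [Code β] : Code (α × β) := ⟨fun p => strPair (enc p.1) (enc p.2)⟩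
instance {α : Type} [Code α] : Code (List α) := ⟨fun l => encodeList (l.map enc)⟩
instance {α : Type} [Code α] : Code (Option α) := ⟨fun o => o.elim [] fun a => true :: enc a⟩
instance : Code Str := ⟨fun w => w⟩

variable {α β γ σ τ : Type} [Code α] [Code β] [Code γ] [Code σ] [Code τ]

theorem enc_str (w : Str) : enc w = w := rfl
theorem enc_true : enc true = [true] := rfl
theorem enc_false : enc false = [] := rfl
theorem enc_nat (n : ℕ) : enc n = n.bits := rfl
theorem enc_pair (a : α) (b : β) : enc (a, b) = strPair (enc a) (enc b) := rfl
theorem enc_none : enc (none : Option α) = [] := rfl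
theorem enc_some (a : α) : enc (some a) = true :: enc a := rfl
theorem enc_nil : enc ([] : List α) = [] := rfl
theorem enc_cons (a : α) (l : List α) : enc (a :: l) = strPair (enc a) (enc l) :=
  encodeList_cons _ _
theorem enc_append (l l' : List α) : enc (l ++ l') = enc l ++ enc l' := by
  simp [enc, encodeList]
theorem enc_strs (l : List Str) : enc l = encodeList l := by
  change encodeList (l.map fun w => w) = _
  simp

/-- Functions that are computed in polynomial time on encodings. -/
@[fun_prop]
def PT (f : α → β) : Prop := ∃ F : Str → Str, FP F ∧ ∀ a, F (enc a) = enc (f a)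

theorem FP.pt {F : Str → Str} (h : FP F) : PT F := ⟨F, h, fun _ => rfl⟩

theorem PT.length_le {f : α → β} (h : PT f) :
    ∃ q : Polynomial ℕ, ∀ a, (enc (f a)).length ≤ q.eval (enc a).length := by
  obtain ⟨F, h, e⟩ := h
  obtain ⟨q, hq⟩ := h.polyBdd_length
  exact ⟨q, fun a => e a ▸ hq (enc a)⟩

@[fun_prop] theorem PT.id : PT fun a : α => a := ⟨_, FP.id, fun _ => rfl⟩

@[fun_prop] theorem PT.const (b : β) : PT fun _ : α => b := ⟨_, FP.const _, fun _ => rfl⟩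

@[fun_prop] theorem PT.comp {g : β → γ} {f : α → β} (hg : PT g) (hf : PT f) :
    PT fun a => g (f a) := by
  obtain ⟨F, hF, eF⟩ := hf
  obtain ⟨G, hG, eG⟩ := hg
  exact ⟨_, hG.comp hF, fun a => by rw [eF, eG]⟩

@[fun_prop] theorem PT.prodMk {f : α → β} {g : α → γ} (hf : PT f) (hg : PT g) :
    PT fun a => (f a, g a) := by
  obtain ⟨F, hF, eF⟩ := hf
  obtain ⟨G, hG, eG⟩ := hg
  exact ⟨_, hF.pair hG, fun a => by rw [eF, eG]; rfl⟩

@[fun_prop] theorem PT.fst {f : α → β × γ} (hf : PT f) : PT fun a => (f a).1 := by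
  obtain ⟨F, hF, eF⟩ := hf
  exact ⟨_, FP.strFst.comp hF, fun a => by rw [eF]; exact strFst_strPair _ _⟩

@[fun_prop] theorem PT.snd {f : α → β × γ} (hf : PT f) : PT fun a => (f a).2 := by
  obtain ⟨F, hF, eF⟩ := hf
  exact ⟨_, FP.strSnd.comp hF, fun a => by rw [eF]; exact strSnd_strPair _ _⟩

/-- The encoding itself is computed in polynomial time. -/
theorem PT.enc {f : α → β} (hf : PT f) : PT fun a => enc (f a) := by
  obtain ⟨F, hF, eF⟩ := hf
  exact ⟨F, hF, eF⟩

/-- A function is computed in polynomial time if its encoding is. -/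
theorem PT.of_enc {f : α → β} (hf : PT fun a => Code.enc (f a)) : PT f := by
  obtain ⟨F, hF, eF⟩ := hf
  exact ⟨F, hF, eF⟩

/-! ### Case distinctions -/

theorem PT.strCases {w : α → Str} {f g h : α → β} (hw : PT w) (hf : PT f) (hg : PT g)
    (hh : PT h) : PT fun a => strCases (w a) (f a) (g a) (h a) := by
  obtain ⟨W, hW, eW⟩ := hw
  obtain ⟨F, hF, eF⟩ := hf
  obtain ⟨G, hG, eG⟩ := hg
  obtain ⟨H, hH, eH⟩ := hh
  refine ⟨_, hW.cases hF hG hH, fun a => ?_⟩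
  rw [eW, eF, eG, eH, enc_str]
  dsimp only
  rcases w a with - | ⟨- | -, -⟩ <;> rfl

@[fun_prop] theorem PT.boolCond {c : α → Bool} {f g : α → β} (hc : PT c) (hf : PT f) (hg : PT g) :
    PT fun a => bif c a then f a else g a := by
  refine (PT.strCases (PT.enc hc) hg hf hf).comp PT.id |> fun h => ?_
  convert h using 2 with a
  cases c a <;> rfl

@[fun_prop] theorem PT.iteProp {p : α → Prop} [∀ a, Decidable (p a)] {f g : α → β} (hc : PT fun a =>
    decide (p a)) (hf : PT f) (hg : PT g) : PT fun a => if p a then f a else g a := by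
  convert hc.boolCond hf hg using 2 with a
  by_cases h : p a <;> simp [h]

@[fun_prop] theorem PT.boolNot {f : α → Bool} (hf : PT f) : PT fun a => !f a := by
  convert hf.boolCond (PT.const false) (PT.const true) using 2 with a
  cases f a <;> rfl

@[fun_prop] theorem PT.boolAnd {f g : α → Bool} (hf : PT f) (hg : PT g) :
    PT fun a => (f a && g a) := by
  convert hf.boolCond hg (PT.const false) using 2 with a
  cases f a <;> rfl

@[fun_prop] theorem PT.boolOr {f g : α → Bool} (hf : PT f) (hg : PT g) :
    PT fun a => (f a || g a) := by
  convert hf.boolCond (PT.const true) hg using 2 with a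
  cases f a <;> rfl

@[fun_prop] theorem PT.decide_not {p : α → Prop} [∀ a, Decidable (p a)]
    (hp : PT fun a => decide (p a)) : PT fun a => decide (¬ p a) := by
  simpa using hp.boolNot

@[fun_prop] theorem PT.decide_and {p q : α → Prop} [∀ a, Decidable (p a)] [∀ a, Decidable (q a)]
    (hp : PT fun a => decide (p a)) (hq : PT fun a => decide (q a)) :
    PT fun a => decide (p a ∧ q a) := by
  simpa using hp.boolAnd hq

@[fun_prop] theorem PT.decide_or {p q : α → Prop} [∀ a, Decidable (p a)] [∀ a, Decidable (q a)]
    (hp : PT fun a => decide (p a)) (hq : PT fun a => decide (q a)) :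
    PT fun a => decide (p a ∨ q a) := by
  simpa using hp.boolOr hq

@[fun_prop] theorem PT.decide_eq_true {f : α → Bool} (hf : PT f) :
    PT fun a => decide (f a = true) := by
  simpa using hf

@[fun_prop] theorem PT.optionSome {f : α → β} (hf : PT f) : PT fun a => some (f a) := by
  obtain ⟨F, hF, eF⟩ := hf
  exact ⟨_, (FP.cons true).comp hF, fun a => by rw [eF]; rfl⟩

theorem PT.optionCases {o : α → Option β} {f : α → γ} {g : α → β → γ} (ho : PT o) (hf : PT f)
    (hg : PT fun p : α × β => g p.1 p.2) : PT fun a => (o a).elim (f a) (g a) := by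
  obtain ⟨O, hO, eO⟩ := ho
  obtain ⟨F, hF, eF⟩ := hf
  obtain ⟨G, hG, eG⟩ := hg
  have h := hG.comp (FP.id.pair (FP.tail.comp hO))
  refine ⟨_, hO.cases hF h h, fun a => ?_⟩
  rw [eO, eF]
  dsimp only
  rcases o a with - | b
  · rfl
  · exact eG (a, b)

/-- The code of a non-empty list is literally the pair of the codes of head and tail, so no
decomposition is needed. It starts with either bit, depending on whether the code of the head is
empty; both branches therefore run the same program. -/
theorem PT.listCases {l : α → List β} {f : α → γ} {g : α → β → List β → γ} (hl : PT l)
    (hf : PT f) (hg : PT fun p : α × β × List β => g p.1 p.2.1 p.2.2) :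
    PT fun a => match l a with
      | [] => f a
      | b :: r => g a b r := by
  obtain ⟨L, hL, eL⟩ := hl
  obtain ⟨F, hF, eF⟩ := hf
  obtain ⟨G, hG, eG⟩ := hg
  have h := hG.comp (FP.id.pair hL)
  refine ⟨_, hL.cases hF h h, fun a => ?_⟩
  rw [eL, eF]
  dsimp only
  rcases l a with - | ⟨b, r⟩
  · rfl
  · have e := eG (a, b, r)
    rw [enc_cons]
    have : ∀ (x y : Str) (c : Str), GD2C.strCases (strPair x y) c
        (G (strPair (Code.enc a) (strPair x y))) (G (strPair (Code.enc a) (strPair x y))) =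
        G (strPair (Code.enc a) (strPair x y)) := by
      intro x y c
      cases x <;> rfl
    rw [this]
    exact e

@[fun_prop] theorem PT.isSome {o : α → Option β} (ho : PT o) : PT fun a => (o a).isSome := by
  convert PT.optionCases ho (PT.const false) (g := fun _ _ => true) (by fun_prop) using 2 with a
  cases o a <;> rfl

@[fun_prop] theorem PT.getD {o : α → Option β} {f : α → β} (ho : PT o) (hf : PT f) :
    PT fun a => (o a).getD (f a) := by
  convert PT.optionCases ho hf (g := fun _ b => b) (by fun_prop) using 2 with a
  cases o a <;> rfl

theorem PT.optionMap {o : α → Option β} {g : α → β → γ} (ho : PT o)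
    (hg : PT fun p : α × β => g p.1 p.2) : PT fun a => (o a).map (g a) := by
  convert PT.optionCases ho (PT.const none) (g := fun a b => some (g a b)) (by fun_prop)
    using 2 with a
  cases o a <;> rfl

theorem PT.optionBind {o : α → Option β} {g : α → β → Option γ} (ho : PT o)
    (hg : PT fun p : α × β => g p.1 p.2) : PT fun a => (o a).bind (g a) := by
  convert PT.optionCases ho (PT.const none) hg using 2 with a
  cases o a <;> rfl

/-! ### Iteration -/

/-- The iterated state is carried together with the parameter `a`. The truncation in `FP.iterate` is
set to 2|a| + 1 + q(|a|), the maximal length of that pair under the assumed size bound, so it never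
takes effect. -/
theorem PT.iterate {n : α → Str} {s : α → σ} {g : α → σ → σ} (hn : PT n) (hs : PT s)
    (hg : PT fun p : α × σ => g p.1 p.2) (q : Polynomial ℕ)
    (hq : ∀ a i, i ≤ (n a).length → (Code.enc ((g a)^[i] (s a))).length ≤
      q.eval (Code.enc a).length) :
    PT fun a => (g a)^[(n a).length] (s a) := by
  obtain ⟨N, hN, eN⟩ := hn
  obtain ⟨S, hS, eS⟩ := hs
  obtain ⟨G, hG, eG⟩ := hg
  have h := FP.iterate hN (FP.polynomial (2 * Polynomial.X + 1 + q) FP.id)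
    (FP.id.pair hS) (FP.strFst.pair hG) (fun x => rfl)
  refine ⟨_, FP.strSnd.comp h, fun a => ?_⟩
  set k := (2 * Polynomial.X + 1 + q).eval (Code.enc a).length with hk
  have key : ∀ i ≤ (n a).length,
      (fun w => (strPair (GD2C.strFst w) (G w)).take k)^[i]
        (strPair (Code.enc a) (S (Code.enc a))) =
        strPair (Code.enc a) (Code.enc ((g a)^[i] (s a))) := by
    intro i
    induction i with
    | zero => intro _; simp [eS]
    | succ i ih =>
      intro hi
      have hb := hq a (i + 1) hi
      rw [Function.iterate_succ_apply'] at hb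
      rw [Function.iterate_succ_apply', ih (by omega), Function.iterate_succ_apply',
        strFst_strPair]
      have := eG (a, (g a)^[i] (s a))
      rw [enc_pair] at this
      simp_all
  rw [eN, enc_str, key _ le_rfl, strSnd_strPair]

@[fun_prop] theorem PT.tail {f : α → Str} (hf : PT f) : PT fun a => (f a).tail :=
  FP.tail.pt.comp hf

@[fun_prop] theorem PT.consBit {f : α → Str} {b : α → Bool} (hb : PT b) (hf : PT f) :
    PT fun a => b a :: f a := by
  convert hb.boolCond ((FP.cons true).pt.comp hf) ((FP.cons false).pt.comp hf) using 2 with a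
  cases b a <;> rfl

@[fun_prop] theorem PT.isEmptyStr {f : α → Str} (hf : PT f) : PT fun a => (f a).isEmpty := by
  convert PT.strCases hf (PT.const true) (PT.const false) (PT.const false) using 2 with a
  rcases f a with - | ⟨- | -, -⟩ <;> rfl

@[fun_prop] theorem PT.headDStr {f : α → Str} (hf : PT f) : PT fun a => (f a).headD false := by
  convert PT.strCases hf (PT.const false) (PT.const false) (PT.const true) using 2 with a
  rcases f a with - | ⟨- | -, -⟩ <;> rfl

theorem foldl_iterate {β σ : Type} (F : σ → β → σ) (g : List β × σ → List β × σ)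
    (h0 : ∀ x, g ([], x) = ([], x)) (hc : ∀ b l x, g (b :: l, x) = (l, F x b)) (l : List β) (x : σ)
    (i : ℕ) : g^[i] (l, x) = (l.drop i, (l.take i).foldl F x) := by
  induction i generalizing l x with
  | zero => rfl
  | succ i ih => cases l <;> simp [h0, hc, ih]

/-- A fold is the iteration of the step that consumes the first item of the remaining list. The
number of turns is the length of the code of the list, which is at least its number of items;
surplus turns do nothing on the empty list. The growth of the accumulator is additive, at most
q(|a|) per item, hence polynomial in total. Folds over bits and over encoded lists are both
instances. -/
theorem pt_foldl_aux {ι : Type} [Code (List ι)] {l : α → List ι} {s : α → σ} {F : α → σ → ι → σ}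
    (hl : PT l) (hs : PT s) {g : α → List ι × σ → List ι × σ}
    (hg : PT fun p : α × (List ι × σ) => g p.1 p.2) (h0 : ∀ a x, g a ([], x) = ([], x))
    (hc : ∀ a b l x, g a (b :: l, x) = (l, F a x b))
    (hlen : ∀ l : List ι, l.length ≤ (enc l).length)
    (hdrop : ∀ (l : List ι) i, (enc (l.drop i)).length ≤ (enc l).length) (q : Polynomial ℕ)
    (hq : ∀ a x, ∀ b ∈ l a, (enc (F a x b)).length ≤ (enc x).length + q.eval (enc a).length) :
    PT fun a => (l a).foldl (F a) (s a) := by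
  obtain ⟨ql, hql⟩ := hl.length_le
  obtain ⟨qs, hqs⟩ := hs.length_le
  have hbd : ∀ a (l' : List ι), l' ⊆ l a → (enc (l'.foldl (F a) (s a))).length ≤
      (enc (s a)).length + l'.length * q.eval (enc a).length := by
    intro a l' h
    induction l' using List.reverseRecOn with
    | nil => simp
    | append_singleton l' b ih =>
      have := hq a (l'.foldl (F a) (s a)) b (h (by simp))
      have := ih fun x hx => h (by simp [hx])
      simp [add_mul] at this ⊢
      omega
  have h := PT.iterate (PT.enc hl) (hl.prodMk hs) hg (2 * ql + 1 + (qs + ql * q)) (by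
    intro a i _
    rw [foldl_iterate _ _ (h0 a) (hc a), enc_pair, length_strPair]
    have h1 := hbd a _ ((l a).take_subset i)
    have h2 := Nat.mul_le_mul_right (q.eval (enc a).length)
      (((l a).length_take_le' i).trans ((hlen _).trans (hql a)))
    have h3 := (hdrop (l a) i).trans (hql a)
    have h4 := hqs a
    simp
    omega)
  convert h.snd using 2 with a
  rw [foldl_iterate _ _ (h0 a) (hc a), List.take_of_length_le (hlen _)]

/-- Iteration over the bits of a string. -/
theorem PT.foldlBits {l : α → Str} {s : α → σ} {F : α → σ → Bool → σ} (hl : PT l) (hs : PT s) (hF :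
    PT fun p : α × σ × Bool => F p.1 p.2.1 p.2.2) (q : Polynomial ℕ) (hq : ∀ a x b, (Code.enc (F a x
    b)).length ≤ (Code.enc x).length + q.eval (Code.enc a).length) : PT fun a => (l a).foldl (F a)
    (s a) := by
  have : PT fun p : α × (Str × σ) => F p.1 p.2.2 (p.2.1.headD false) :=
    hF.comp (f := fun p : α × (Str × σ) => (p.1, p.2.2, p.2.1.headD false)) (by fun_prop)
  exact pt_foldl_aux (ι := Bool) hl hs (g := fun a p => if p.1.isEmpty then p else
    (p.1.tail, F a p.2 (p.1.headD false))) (by fun_prop) (by simp) (by simp) (fun _ => le_rfl)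
    (by simp [enc_str]) q fun a x b _ => hq a x b

theorem length_enc_le (l : List β) : l.length ≤ (enc l).length ∧
    (∀ b ∈ l, (enc b).length ≤ (enc l).length) ∧ ∀ i, (enc (l.drop i)).length ≤ (enc l).length := by
  induction l with
  | nil => simp
  | cons c l ih =>
    simp only [enc_cons, length_strPair, List.length_cons, List.forall_mem_cons]
    refine ⟨by omega, ⟨by omega, fun b hb => ?_⟩, fun i => ?_⟩
    · have := ih.2.1 b hb
      omega
    · cases i with
      | zero => simp [enc_cons]
      | succ i =>
        have := ih.2.2 i
        rw [List.drop_succ_cons]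
        omega

/-- Iteration over a list. -/
theorem PT.foldl {l : α → List β} {s : α → σ} {F : α → σ → β → σ} (hl : PT l) (hs : PT s) (hF : PT
    fun p : α × σ × β => F p.1 p.2.1 p.2.2) (q : Polynomial ℕ) (hq : ∀ a x b, (Code.enc (F a x
    b)).length ≤ (Code.enc x).length + q.eval ((Code.enc a).length + (Code.enc b).length)) : PT fun
    a => (l a).foldl (F a) (s a) := by
  obtain ⟨ql, hql⟩ := hl.length_le
  have : PT fun p : (α × (List β × σ)) × β × List β => F p.1.1 p.1.2.2 p.2.1 :=
    hF.comp (f := fun p : (α × (List β × σ)) × β × List β => (p.1.1, p.1.2.2, p.2.1)) (by fun_prop)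
  refine pt_foldl_aux hl hs (g := fun a p => match p.1 with
    | [] => p
    | b :: r => (r, F a p.2 b)) (PT.listCases (l := fun p : α × (List β × σ) => p.2.1)
    (f := fun p => p.2) (g := fun p b r => (r, F p.1 p.2.2 b)) (by fun_prop) (by fun_prop)
    (by fun_prop)) (fun _ _ => rfl) (fun _ _ _ _ => rfl) (fun l => (length_enc_le l).1)
    (fun l => (length_enc_le l).2.2) (q.comp (Polynomial.X + ql)) fun a x b hb => ?_
  have := eval_le_eval q (Nat.add_le_add_left (((length_enc_le _).2.1 b hb).trans (hql a))
    (Code.enc a).length)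
  have := hq a x b
  simp
  omega

end GD2C

/-! ### Polynomial-time arithmetic of strings, binary numbers and lists. -/

namespace GD2C

open Code

variable {α β γ σ τ : Type} [Code α] [Code β] [Code γ] [Code σ] [Code τ]

/-! ### Operations on strings -/

@[fun_prop] theorem PT.reverseStr {f : α → Str} (hf : PT f) : PT fun a => (f a).reverse := by
  have h := PT.foldlBits hf (PT.const ([] : Str)) (F := fun _ (s : Str) b => b :: s)
    (by fun_prop) 1 (by simp [enc_str])
  convert h using 2 with a
  simp

@[fun_prop] theorem PT.appendStr {f g : α → Str} (hf : PT f) (hg : PT g) :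
    PT fun a => f a ++ g a := by
  obtain ⟨F, hF, eF⟩ := hf
  obtain ⟨G, hG, eG⟩ := hg
  exact ⟨_, hF.append₂ hG, fun a => by rw [eF, eG]; rfl⟩

@[fun_prop] theorem PT.ones {f : α → Str} (hf : PT f) :
    PT fun a => List.replicate (f a).length true := FP.ones.pt.comp hf

theorem PT.polynomial (q : Polynomial ℕ) {f : α → Str} (hf : PT f) :
    PT fun a => List.replicate (q.eval (f a).length) true := (FP.polynomial q FP.id).pt.comp hf

@[fun_prop] theorem PT.dropStr {f g : α → Str} (hf : PT f) (hg : PT g) :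
    PT fun a => (g a).drop (f a).length := by
  obtain ⟨q, hq⟩ := hg.length_le
  have key : ∀ (i : ℕ) (w : Str), (fun w : Str => w.tail)^[i] w = w.drop i := by
    intro i
    induction i with
    | zero => simp
    | succ i ih => intro w; rw [Function.iterate_succ_apply, ih]; cases w <;> simp
  have h := PT.iterate hf hg (g := fun _ w => w.tail) (by fun_prop) q (by
    intro a i _
    rw [key]
    have := hq a
    simp [enc_str] at this ⊢
    omega)
  convert h using 2 with a
  rw [key]

@[fun_prop] theorem PT.takeStr {f g : α → Str} (hf : PT f) (hg : PT g) :
    PT fun a => (g a).take (f a).length := by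
  have key : ∀ u v acc : Str, (u.foldl (fun (s : Str × Str) _ => (s.1.tail,
      bif s.1.isEmpty then s.2 else s.1.headD false :: s.2)) (v, acc)).2.reverse =
      acc.reverse ++ v.take u.length := by
    intro u
    induction u with
    | nil => simp
    | cons b u ih =>
      intro v acc
      rw [List.foldl_cons, ih]
      cases v <;> simp
  have h := PT.foldlBits hf (hg.prodMk (PT.const ([] : Str))) (F := fun _ (s : Str × Str) _ =>
    (s.1.tail, bif s.1.isEmpty then s.2 else s.1.headD false :: s.2)) (by fun_prop) 1 (by
      intro a s b
      rcases s with ⟨- | ⟨c, x⟩, y⟩ <;> simp [enc_pair, enc_str]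
      omega)
  convert h.snd.reverseStr using 2 with a
  rw [key]; rfl

theorem xorStr_nil (u : Str) : xorStr u [] = u := by cases u <;> rfl

theorem nil_xorStr (u : Str) : xorStr [] u = u := by cases u <;> rfl

-- The scan runs over the first string; an exhausted second string delivers zeros, and an unread
-- rest of the second string is appended at the end. This is the padding convention of `xorStr` in
-- both directions.
@[fun_prop] theorem PT.xorStr {f g : α → Str} (hf : PT f) (hg : PT g) :
    PT fun a => xorStr (f a) (g a) := by
  have key : ∀ u v acc : Str,
      (fun s : Str × Str => s.2.reverse ++ s.1) (u.foldl (fun (s : Str × Str) b => (s.1.tail,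
        (bif b then !s.1.headD false else s.1.headD false) :: s.2)) (v, acc)) =
      acc.reverse ++ GD2C.xorStr u v := by
    intro u
    induction u with
    | nil => intro v acc; simp [nil_xorStr]
    | cons b u ih =>
      intro v acc
      rw [List.foldl_cons, ih]
      cases v <;> cases b <;> simp [GD2C.xorStr, xorStr_nil]
  have h := PT.foldlBits hf (hg.prodMk (PT.const ([] : Str))) (F := fun _ (s : Str × Str) b =>
    (s.1.tail, (bif b then !s.1.headD false else s.1.headD false) :: s.2)) (by fun_prop) 1 (by
      intro a s b
      rcases s with ⟨- | ⟨c, x⟩, y⟩ <;> simp [enc_pair, enc_str] <;> omega)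
  convert h.snd.reverseStr.appendStr h.fst using 2 with a
  exact (key (f a) (g a) []).symm

-- The accumulator holds the unread part of the second string, or `none` after a mismatch or a
-- premature end. Equality means that the empty string is left over.
@[fun_prop] theorem PT.decide_eqStr {f g : α → Str} [∀ a, Decidable (f a = g a)] (hf : PT f)
    (hg : PT g) : PT fun a => decide (f a = g a) := by
  set F : Option Str → Bool → Option Str := fun s b => s.elim none fun v =>
    bif v.isEmpty || (bif b then !v.headD false else v.headD false) then none else some v.tail
    with hF
  have keyn : ∀ u : Str, u.foldl F none = none := by
    intro u
    induction u with
    | nil => rfl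
    | cons b u ih => simpa [hF] using ih
  have key : ∀ u v : Str, (u.foldl F (some v)).elim false List.isEmpty = decide (u = v) := by
    intro u
    induction u with
    | nil => intro v; cases v <;> rfl
    | cons b u ih =>
      intro v
      rw [List.foldl_cons]
      rcases v with - | ⟨c, v⟩
      · rw [show F (some []) b = none from rfl, keyn]; rfl
      · have : F (some (c :: v)) b = if b = c then some v else none := by
          cases b <;> cases c <;> rfl
        rw [this]
        by_cases h : b = c
        · rw [if_pos h, ih]; simp [h]
        · rw [if_neg h, keyn]; simp [h]
  have key' : ∀ u v : Str, (u.foldl F (some v)).elim false List.isEmpty = true ↔ u = v :=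
    fun u v => by rw [key u v, decide_eq_true_iff]
  have hFPT : PT fun p : α × Option Str × Bool => F p.2.1 p.2.2 := by
    refine PT.optionCases (o := fun p : α × Option Str × Bool => p.2.1) (g := fun p v =>
      bif v.isEmpty || (bif p.2.2 then !v.headD false else v.headD false) then none
      else some v.tail) (by fun_prop) (by fun_prop) (by fun_prop)
  have h := PT.foldlBits hf hg.optionSome (F := fun _ => F) hFPT 1 (by
      intro a s b
      rcases s with - | ⟨- | ⟨c, x⟩⟩
      · simp [hF, enc_none]
      · simp [hF, enc_none, enc_some]
      · cases b <;> cases c <;> simp [hF, enc_none, enc_some, enc_str] <;> omega)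
  convert PT.optionCases h (PT.const false) (g := fun _ v => v.isEmpty) (by fun_prop) using 2
    with a
  rw [Bool.eq_iff_iff, decide_eq_true_iff]
  exact (key' (f a) (g a)).symm

@[fun_prop] theorem PT.beqStr {f g : α → Str} (hf : PT f) (hg : PT g) : PT fun a => f a == g a := by
  convert hf.decide_eqStr hg using 2 with a
  rw [Bool.eq_iff_iff]; simp

/-! ### Natural numbers -/

theorem toNat_cons (b : Bool) (w : Str) : toNat (b :: w) = Nat.bit b (toNat w) := rfl

@[simp] theorem toNat_bits (n : ℕ) : toNat n.bits = n := by
  induction n using Nat.binaryRec' with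
  | zero => rfl
  | bit b n h ih => rw [Nat.bits_append_bit n b h, toNat_cons, ih]

/-- Reading a binary number. -/
@[fun_prop] theorem PT.toNat {f : α → Str} (hf : PT f) : PT fun a => toNat (f a) := by
  refine PT.of_enc ?_
  -- Canonical binary notation has no zeros at the most significant end. The scan starts at that end
  -- and drops a zero as long as nothing has been kept.
  have h := PT.foldlBits hf.reverseStr (PT.const ([] : Str)) (F := fun _ (s : Str) b =>
    bif b || !s.isEmpty then b :: s else []) (by fun_prop) 1 (by
      intro a s b
      cases b <;> cases s <;> simp [enc_str])
  convert h using 2 with a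
  rw [List.foldl_reverse]
  induction f a with
  | nil => rfl
  | cons b w ih =>
    rw [List.foldr_cons, ← ih, toNat_cons, enc_nat, enc_nat]
    by_cases h0 : GD2C.toNat w = 0
    · cases b <;> simp [h0]
    · have : (GD2C.toNat w).bits.isEmpty = false := by
        rcases h1 : (GD2C.toNat w).bits with - | ⟨c, x⟩
        · have := toNat_bits (GD2C.toNat w)
          rw [h1] at this
          exact absurd this.symm h0
        · rfl
      rw [Nat.bits_append_bit _ _ fun h => absurd h h0, this]
      simp

theorem PT.bits {f : α → ℕ} (hf : PT f) : PT fun a => (f a).bits := PT.enc hf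

@[fun_prop] theorem PT.bits' {f : α → ℕ} (hf : PT f) : PT fun a => Nat.bits (f a) := PT.enc hf

theorem bits_injective : Function.Injective Nat.bits := fun m n h => by
  rw [← toNat_bits m, h, toNat_bits]

@[fun_prop] theorem PT.decide_eqNat {f g : α → ℕ} [∀ a, Decidable (f a = g a)] (hf : PT f)
    (hg : PT g) : PT fun a => decide (f a = g a) := by
  convert hf.bits.decide_eqStr hg.bits using 2 with a
  simp [bits_injective.eq_iff]

-- Addition with carry, starting at the least significant bit; the accumulator is the carry and the
-- digits produced so far. The final `toNat` restores canonical notation.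
@[fun_prop] theorem PT.succ {f : α → ℕ} (hf : PT f) : PT fun a => f a + 1 := by
  have key : ∀ (w acc : Str) (c : Bool),
      GD2C.toNat ((fun s : Bool × Str => s.2.reverse ++ bif s.1 then [true] else [])
        (w.foldl (fun (s : Bool × Str) b => (s.1 && b, (bif s.1 then !b else b) :: s.2))
          (c, acc))) =
      GD2C.toNat (acc.reverse ++ (GD2C.toNat w + c.toNat).bits) := by
    intro w
    induction w with
    | nil => intro acc c; cases c <;> simp [GD2C.toNat]
    | cons b w ih =>
      intro acc c
      rw [List.foldl_cons, ih]
      have : ∀ x y : Str, GD2C.toNat x = GD2C.toNat y → ∀ z : Str,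
          GD2C.toNat (z ++ x) = GD2C.toNat (z ++ y) := by
        intro x y h z
        induction z with
        | nil => simpa using h
        | cons d z ih => rw [List.cons_append, List.cons_append, toNat_cons, toNat_cons, ih]
      rw [List.reverse_cons, List.append_assoc]
      apply this
      rw [List.singleton_append, toNat_cons, toNat_bits, toNat_bits, toNat_cons]
      cases b <;> cases c <;> simp [Nat.bit] <;> omega
  have h := PT.foldlBits hf.bits (PT.const ((true, []) : Bool × Str)) (F := fun _ s b =>
    (s.1 && b, (bif s.1 then !b else b) :: s.2)) (by fun_prop) 2 (by
      intro a s b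
      rcases s with ⟨- | -, s⟩ <;> cases b <;> simp [enc_pair, enc_str, enc_true, enc_false]
        <;> omega)
  have h' := (h.snd.reverseStr.appendStr (h.fst.boolCond (PT.const [true]) (PT.const []))).toNat
  convert h' using 2 with a
  have := key (f a).bits [] true
  simp only [toNat_bits, List.reverse_nil, List.nil_append, Bool.toNat_true] at this
  exact this.symm

@[fun_prop] theorem PT.double {f : α → ℕ} (hf : PT f) : PT fun a => 2 * f a := by
  convert ((PT.const false).consBit hf.bits).toNat using 2 with a
  rw [toNat_cons, toNat_bits]; rfl

theorem length_bits_succ (n : ℕ) : (n + 1).bits.length ≤ n.bits.length + 1 := by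
  rw [Nat.size_eq_bits_len, Nat.size_eq_bits_len, Nat.size_le, pow_succ]
  have := Nat.lt_size_self n
  omega

@[fun_prop] theorem PT.lengthStr {f : α → Str} (hf : PT f) : PT fun a => (f a).length := by
  have h := PT.foldlBits hf (PT.const 0) (F := fun _ n _ => n + 1) (by fun_prop) 1 (by
    intro a n b
    simpa [enc_nat] using length_bits_succ n)
  convert h using 2 with a
  rw [List.foldl_eq_foldr_reverse]
  simp

/-! ### Operations on lists -/

@[fun_prop] theorem PT.cons {f : α → β} {l : α → List β} (hf : PT f) (hl : PT l) :
    PT fun a => f a :: l a := by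
  obtain ⟨F, hF, eF⟩ := hf
  obtain ⟨L, hL, eL⟩ := hl
  exact ⟨_, hF.pair hL, fun a => by rw [eF, eL]; exact (enc_cons _ _).symm⟩

@[fun_prop] theorem PT.append {f g : α → List β} (hf : PT f) (hg : PT g) :
    PT fun a => f a ++ g a := by
  obtain ⟨F, hF, eF⟩ := hf
  obtain ⟨G, hG, eG⟩ := hg
  exact ⟨_, hF.append₂ hG, fun a => by rw [eF, eG]; exact (enc_append _ _).symm⟩

@[fun_prop] theorem PT.length {l : α → List β} (hl : PT l) : PT fun a => (l a).length := by
  have h := PT.foldl hl (PT.const 0) (F := fun _ n _ => n + 1) (by fun_prop) 1 (by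
    intro a n b
    simpa [enc_nat] using length_bits_succ n)
  convert h using 2 with a
  rw [List.foldl_eq_foldr_reverse]
  simp

@[fun_prop] theorem PT.headD {l : α → List β} {f : α → β} (hl : PT l) (hf : PT f) :
    PT fun a => (l a).headD (f a) := by
  convert PT.listCases hl hf (g := fun _ b _ => b) (by fun_prop) using 2 with a
  cases l a <;> rfl

@[fun_prop] theorem PT.listTail {l : α → List β} (hl : PT l) : PT fun a => (l a).tail := by
  convert PT.listCases hl (PT.const []) (g := fun _ _ r => r) (by fun_prop) using 2 with a
  cases l a <;> rfl

@[fun_prop] theorem PT.getElem? {l : α → List β} {i : α → ℕ} (hl : PT l) (hi : PT i) :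
    PT fun a => (l a)[i a]? := by
  have key : ∀ (l : List β) (i k : ℕ) (r : Option β), (l.foldl (fun (s : ℕ × Option β) b =>
      (s.1 + 1, if s.1 = i then some b else s.2)) (k, r)).2 =
      if k ≤ i then l[i - k]?.or r else r := by
    intro l i
    induction l with
    | nil => simp
    | cons b l ih =>
      intro k r
      rw [List.foldl_cons, ih]
      rcases lt_trichotomy k i with h | h | h
      · have h1 : i - k = i - (k + 1) + 1 := by omega
        simp [h1, h.ne, h.le, show k + 1 ≤ i by omega]
      · subst h; simp
      · simp [h.ne', show ¬ k ≤ i by omega, show ¬ k + 1 ≤ i by omega]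
  have hF : PT fun p : α × (ℕ × Option β) × β =>
      (p.2.1.1 + 1, if p.2.1.1 = i p.1 then some p.2.2 else p.2.1.2) := by
    have := hi.comp (f := fun p : α × (ℕ × Option β) × β => p.1) (by fun_prop)
    fun_prop
  have h := PT.foldl hl (PT.const ((0, none) : ℕ × Option β)) (F := fun a s b =>
    (s.1 + 1, if s.1 = i a then some b else s.2)) hF (Polynomial.X + 3) (by
      intro a s b
      obtain ⟨k, s⟩ := s
      have := length_bits_succ k
      simp only [enc_pair, length_strPair, enc_nat, Polynomial.eval_add, Polynomial.eval_X,
        Polynomial.eval_ofNat]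
      split_ifs <;> (try simp only [enc_some, List.length_cons]) <;> omega)
  convert h.snd using 2 with a
  rw [key]; simp

@[fun_prop] theorem PT.listGetD {l : α → List β} {i : α → ℕ} {f : α → β} (hl : PT l) (hi : PT i)
    (hf : PT f) : PT fun a => (l a).getD (i a) (f a) := by
  simpa [List.getD_eq_getElem?_getD] using (hl.getElem? hi).getD hf

@[fun_prop] theorem PT.set {l : α → List β} {i : α → ℕ} {f : α → β} (hl : PT l) (hi : PT i)
    (hf : PT f) : PT fun a => (l a).set (i a) (f a) := by
  have key : ∀ (l : List β) (i k : ℕ) (f : β) (r : List β), (l.foldl (fun (s : ℕ × List β) b =>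
      (s.1 + 1, s.2 ++ [if s.1 = i then f else b])) (k, r)).2 =
      if k ≤ i then r ++ l.set (i - k) f else r ++ l := by
    intro l i
    induction l with
    | nil => simp
    | cons b l ih =>
      intro k f r
      rw [List.foldl_cons, ih]
      rcases lt_trichotomy k i with h | h | h
      · have h1 : i - k = i - (k + 1) + 1 := by omega
        simp [h1, h.ne, h.le, show k + 1 ≤ i by omega]
      · subst h; simp
      · simp [h.ne', show ¬ k ≤ i by omega, show ¬ k + 1 ≤ i by omega]
  have hF : PT fun p : α × (ℕ × List β) × β =>
      (p.2.1.1 + 1, p.2.1.2 ++ [if p.2.1.1 = i p.1 then f p.1 else p.2.2]) := by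
    have := hi.comp (f := fun p : α × (ℕ × List β) × β => p.1) (by fun_prop)
    have := hf.comp (f := fun p : α × (ℕ × List β) × β => p.1) (by fun_prop)
    fun_prop
  obtain ⟨q, hq⟩ := hf.length_le
  have h := PT.foldl hl (PT.const ((0, []) : ℕ × List β)) (F := fun a s b =>
    (s.1 + 1, s.2 ++ [if s.1 = i a then f a else b])) hF (2 * Polynomial.X + 2 * q + 3) (by
      intro a s b
      obtain ⟨k, s⟩ := s
      have h1 := length_bits_succ k
      have h2 := (hq a).trans (eval_le_eval q (Nat.le_add_right _ (Code.enc b).length))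
      simp only [enc_pair, length_strPair, enc_nat, Polynomial.eval_add, Polynomial.eval_X,
        Polynomial.eval_ofNat, Polynomial.eval_mul, enc_append, enc_cons, enc_nil,
        List.length_append, List.length_nil]
      split_ifs <;> omega)
  convert h.snd using 2 with a
  rw [key]; simp

theorem PT.find? {l : α → List β} {p : α → β → Bool} (hl : PT l)
    (hp : PT fun x : α × β => p x.1 x.2) : PT fun a => (l a).find? (p a) := by
  have key : ∀ (l : List β) (p : β → Bool) (r : Option β), l.foldl (fun (s : Option β) b =>
      bif !s.isSome && p b then some b else s) r = r.or (l.find? p) := by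
    intro l p
    induction l with
    | nil => simp
    | cons b l ih =>
      intro r
      rw [List.foldl_cons, ih]
      cases r <;> cases h : p b <;> simp [h]
  have hF : PT fun x : α × Option β × β =>
      bif !x.2.1.isSome && p x.1 x.2.2 then some x.2.2 else x.2.1 := by
    have := hp.comp (f := fun x : α × Option β × β => (x.1, x.2.2)) (by fun_prop)
    fun_prop
  have h := PT.foldl hl (PT.const (none : Option β)) (F := fun a s b =>
      bif !s.isSome && p a b then some b else s) hF (Polynomial.X + 3) (by
      intro a s b
      simp
      cases s <;> cases p a b <;> simp [enc_some, enc_none] <;> omega)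
  convert h using 2 with a
  rw [key]; simp

theorem PT.any {l : α → List β} {p : α → β → Bool} (hl : PT l)
    (hp : PT fun x : α × β => p x.1 x.2) : PT fun a => (l a).any (p a) := by
  convert (PT.find? hl hp).isSome using 2 with a
  grind

@[fun_prop] theorem PT.encodeList {f : α → List Str} (hf : PT f) :
    PT fun a => encodeList (f a) := by
  convert PT.enc hf using 2 with a
  exact (enc_strs _).symm

-- A finite automaton with memory: a flag that the next bit is data, the string being read in
-- reverse, and the finished strings.
@[fun_prop] theorem PT.decodeList {f : α → Str} (hf : PT f) : PT fun a => decodeList (f a) := by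
  have key : ∀ (w cur : Str) (acc : List Str),
      (w.foldl (fun (s : Bool × Str × List Str) b => bif s.1 then (false, b :: s.2.1, s.2.2)
        else bif b then (true, s.2.1, s.2.2) else (false, [], s.2.2 ++ [s.2.1.reverse]))
        (false, cur, acc)).2.2 = acc ++ decodeAux cur w := by
    intro w cur
    induction cur, w using decodeAux.induct with
    | case1 cur => intro acc; simp [decodeAux]
    | case2 cur w ih => intro acc; simpa [decodeAux] using ih (acc ++ [cur.reverse])
    | case3 cur => intro acc; simp [decodeAux]
    | case4 cur b w ih => intro acc; simpa [decodeAux] using ih acc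
  have h := PT.foldlBits hf (PT.const ((false, [], []) : Bool × Str × List Str)) (F := fun _ s b =>
    bif s.1 then (false, b :: s.2.1, s.2.2)
        else bif b then (true, s.2.1, s.2.2) else (false, [], s.2.2 ++ [s.2.1.reverse]))
    (by fun_prop) 10 (by
      intro a s b
      rcases s with ⟨- | -, s, l⟩ <;> cases b <;>
        simp [enc_pair, enc_str, enc_true, enc_false, enc_append, enc_cons, enc_nil] <;> omega)
  convert h.snd.snd using 2 with a
  rw [key]; rfl

end GD2C

/-! ### Distance of distributions, simulation of games, group anonymity, and the hybrid argument. -/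

namespace GD2C

open scoped ENNReal

/-! ### Distributions that are close to each other -/

/-- Distributions with total variation distance at most `ε`. -/
def Near {X : Type} (ε : ℝ≥0∞) (p q : PMF X) : Prop :=
  ∀ f : X → ℝ≥0∞, (∀ x, f x ≤ 1) →
    ∑' x, p x * f x ≤ ∑' x, q x * f x + ε ∧ ∑' x, q x * f x ≤ ∑' x, p x * f x + ε

section Near

variable {X Y : Type} {ε δ : ℝ≥0∞} {p q r : PMF X}

theorem Near.of_eq (h : p = q) : Near ε p q := fun f _ => by simp [h]

theorem Near.symm (h : Near ε p q) : Near ε q p := fun f hf => (h f hf).symm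

theorem Near.trans (h : Near ε p q) (h' : Near δ q r) : Near (ε + δ) p r := fun f hf =>
  ⟨(h f hf).1.trans ((add_le_add_left (h' f hf).1 ε).trans_eq (by ring)),
    (h' f hf).2.trans ((add_le_add_left (h f hf).2 δ).trans_eq (by ring))⟩

theorem Near.mono (h : Near ε p q) (hε : ε ≤ δ) : Near δ p q := fun f hf =>
  ⟨(h f hf).1.trans (by gcongr), (h f hf).2.trans (by gcongr)⟩

theorem tsum_bind_mul (p : PMF X) (F : X → PMF Y) (f : Y → ℝ≥0∞) :
    ∑' y, (p.bind F) y * f y = ∑' x, p x * ∑' y, F x y * f y := by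
  simp_rw [PMF.bind_apply, ← ENNReal.tsum_mul_right, ← ENNReal.tsum_mul_left]
  rw [ENNReal.tsum_comm]
  simp_rw [mul_assoc]

theorem tsum_mul_le_one (p : PMF X) {f : X → ℝ≥0∞} (hf : ∀ x, f x ≤ 1) : ∑' x, p x * f x ≤ 1 := by
  calc ∑' x, p x * f x ≤ ∑' x, p x * 1 := ENNReal.tsum_le_tsum fun x => by gcongr; exact hf x
    _ = 1 := by simp [p.tsum_coe]

theorem Near.bind_left (h : Near ε p q) (F : X → PMF Y) : Near ε (p.bind F) (q.bind F) :=
  fun f hf => by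
    rw [tsum_bind_mul, tsum_bind_mul]
    exact h _ fun x => tsum_mul_le_one _ hf

/-- Two continuations of the same experiment are close if they are close unless a bad event
occurs. -/
theorem Near.bind_of_bad {F G : X → PMF Y} (bad : Set X) [DecidablePred (· ∈ bad)]
    (h : ∀ x ∈ p.support, x ∉ bad → Near ε (F x) (G x))
    (hb : ∑' x, p x * (if x ∈ bad then 1 else 0) ≤ δ) :
    Near (ε + δ) (p.bind F) (p.bind G) := by
  have key : ∀ F G : X → PMF Y, (∀ x ∈ p.support, x ∉ bad → Near ε (F x) (G x)) →
      ∀ f : Y → ℝ≥0∞, (∀ y, f y ≤ 1) →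
      ∑' y, (p.bind F) y * f y ≤ ∑' y, (p.bind G) y * f y + (ε + δ) := by
    intro F G h f hf
    rw [tsum_bind_mul, tsum_bind_mul]
    calc ∑' x, p x * ∑' y, F x y * f y
        ≤ ∑' x, (p x * ∑' y, G x y * f y + p x * ε + p x * (if x ∈ bad then 1 else 0)) := by
          refine ENNReal.tsum_le_tsum fun x => ?_
          rw [← mul_add, ← mul_add]
          by_cases hx : x ∈ p.support
          · gcongr
            -- On the bad event the trivial bound 1 for the expectation is paid by the indicator;
            -- elsewhere the distance ε is paid.
            by_cases hxb : x ∈ bad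
            · simp only [hxb, if_true]
              exact (tsum_mul_le_one _ hf).trans le_add_self
            · simpa [hxb] using (h x hx hxb f hf).1
          · simp [(p.apply_eq_zero_iff x).mpr hx]
      _ = ∑' x, p x * ∑' y, G x y * f y + (ε + ∑' x, p x * (if x ∈ bad then 1 else 0)) := by
          rw [ENNReal.tsum_add, ENNReal.tsum_add, ENNReal.tsum_mul_right (a := ε), p.tsum_coe,
            one_mul, add_assoc]
      _ ≤ _ := by gcongr
  exact fun f hf => ⟨key F G h f hf, key G F (fun x hx hxb => (h x hx hxb).symm) f hf⟩

theorem Near.bind {F G : X → PMF Y} (h : ∀ x ∈ p.support, Near ε (F x) (G x)) :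
    Near ε (p.bind F) (p.bind G) := by
  simpa using Near.bind_of_bad (∅ : Set X) (δ := 0) (fun x hx _ => h x hx) (by simp)

theorem Near.apply_le (h : Near ε p q) (x : X) : p x ≤ q x + ε := by
  classical
  have := (h (fun y => if y = x then 1 else 0) fun y => by split_ifs <;> simp).1
  simpa using this

theorem Near.eq (h : Near 0 p q) : p = q :=
  PMF.ext fun x => le_antisymm (by simpa using h.apply_le x) (by simpa using h.symm.apply_le x)

theorem bind_congr {F G : X → PMF Y} (h : ∀ x ∈ p.support, F x = G x) : p.bind F = p.bind G :=
  (Near.bind fun x hx => Near.of_eq (h x hx)).eq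

theorem Near.abs_sub_le {p q : PMF Bool} {ε : ℝ} (hε : 0 ≤ ε) (h : Near (ENNReal.ofReal ε) p q)
    (b : Bool) : |(p b).toReal - (q b).toReal| ≤ ε := by
  have key : ∀ {p q : PMF Bool}, Near (ENNReal.ofReal ε) p q →
      (p b).toReal ≤ (q b).toReal + ε := by
    intro p q h
    have := ENNReal.toReal_mono (by simp [q.apply_ne_top]) (h.apply_le b)
    rwa [ENNReal.toReal_add (q.apply_ne_top b) (by simp), ENNReal.toReal_ofReal hε] at this
  rw [abs_le]
  have h1 := key h
  have h2 := key h.symm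
  constructor <;> linarith

end Near

/-! ### Simulation of one game by another -/

/-- The guess of the adversary after `k` more rounds. -/
def Adversary.run (A : Adversary) (Γ : Game) (κ k : ℕ) (x : Str × Str × Γ.State) : PMF Bool :=
  (A.rounds Γ κ k x).map fun y => y.1.headD false

theorem Adversary.run_zero (A : Adversary) (Γ : Game) (κ : ℕ) (x : Str × Str × Γ.State) :
    A.run Γ κ 0 x = PMF.pure (x.1.headD false) := PMF.pure_map _ _

theorem Adversary.run_succ (A : Adversary) (Γ : Game) (κ k : ℕ) (x : Str × Str × Γ.State) :
    A.run Γ κ (k + 1) x = (A.round Γ κ x).bind (A.run Γ κ k) := by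
  simp only [run, rounds, PMF.map_bind]; rfl

theorem Game.answer_coin (Γ : Game) (N : Str) (c : Γ.State) :
    Γ.answer [[], N] c = (uniformUpTo (toNat N)).map fun x => ([x.bits], c) := rfl

theorem Game.answer_of_ne (Γ : Game) {q : List Str} (h : ∀ N, q ≠ [[], N]) (c : Γ.State) :
    Γ.answer q c = Γ.oracle q c := by
  unfold Game.answer
  split
  · exact absurd rfl (h _)
  · rfl

/-- The state and the reply that remain after truncation. -/
def Adversary.next (A : Adversary) (κ : ℕ) {S : Type} (st : Str) (y : List Str × S) :
    Str × Str × S :=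
  (st.take (A.bound.eval κ), (encodeList y.1).take (A.bound.eval κ), y.2)

theorem Adversary.round_nil {A : Adversary} {Γ : Game} {κ : ℕ} {x : Str × Str × Γ.State}
    (h : decodeList (A.step ![List.replicate κ true, x.1, x.2.1]) = []) :
    A.round Γ κ x = PMF.pure (x.1, [], x.2.2) := by
  unfold Adversary.round; rw [h]

theorem Adversary.round_cons {A : Adversary} {Γ : Game} {κ : ℕ} {x : Str × Str × Γ.State} {st : Str}
    {q : List Str} (h : decodeList (A.step ![List.replicate κ true, x.1, x.2.1]) = st :: q) :
    A.round Γ κ x = (Γ.answer q x.2.2).map (A.next κ st) := by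
  unfold Adversary.round; rw [h]; rfl

/-- If a random state of the first game behaves, up to a distance `ε` in every step, like a state of
the second game, then the guesses of the adversary in the two games are close. -/
theorem Adversary.run_near (A : Adversary) {Γ₁ Γ₂ : Game} (κ : ℕ)
    (R : Γ₂.State → PMF Γ₁.State) (Inv : ℕ → Γ₂.State → Prop) (ε : ℝ≥0∞)
    (hmono : ∀ k s, Inv (k + 1) s → Inv k s)
    (hinv : ∀ k s q, Inv (k + 1) s → ∀ y ∈ (Γ₂.oracle q s).support, Inv k y.2)
    (hstep : ∀ k s q, Inv (k + 1) s → Near ε ((R s).bind (Γ₁.oracle q))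
      ((Γ₂.oracle q s).bind fun y => (R y.2).map fun s' => (y.1, s'))) :
    ∀ k s st rep, Inv k s → Near (k * ε) ((R s).bind fun s' => A.run Γ₁ κ k (st, rep, s'))
      (A.run Γ₂ κ k (st, rep, s)) := by
  intro k
  induction k with
  | zero =>
    intro s st rep _
    refine Near.of_eq ?_
    simp [run_zero]
  | succ k ih =>
    intro s st rep hs
    simp only [run_succ]
    have hle : (k : ℝ≥0∞) * ε ≤ ((k + 1 : ℕ) : ℝ≥0∞) * ε := by
      gcongr; exact_mod_cast Nat.le_succ k
    rcases hd : decodeList (A.step ![List.replicate κ true, st, rep]) with - | ⟨st', q⟩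
    · have h1 : ∀ s', A.round Γ₁ κ (st, rep, s') = PMF.pure (st, [], s') := fun s' =>
        round_nil hd
      have h2 : A.round Γ₂ κ (st, rep, s) = PMF.pure (st, [], s) := round_nil hd
      simp only [h1, h2, PMF.pure_bind]
      exact (ih s st [] (hmono k s hs)).mono hle
    · have h1 : ∀ s', A.round Γ₁ κ (st, rep, s') = (Γ₁.answer q s').map (A.next κ st') :=
        fun s' => round_cons hd
      have h2 : A.round Γ₂ κ (st, rep, s) = (Γ₂.answer q s).map (A.next κ st') := round_cons hd
      simp only [h1, h2, PMF.bind_map, Function.comp_def]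
      by_cases hq : ∃ N, q = [[], N]
      · obtain ⟨N, rfl⟩ := hq
        simp only [Game.answer_coin, PMF.bind_map, Function.comp_def]
        -- Random numbers are supplied independently of the challenger, so the coin may be drawn
        -- before the random state; such a round costs nothing.
        rw [PMF.bind_comm]
        refine Near.mono (Near.bind (ε := k * ε) fun x _ => ?_) hle
        exact ih s (st'.take (A.bound.eval κ)) ((encodeList [x.bits]).take (A.bound.eval κ))
          (hmono k s hs)
      · push Not at hq
        simp only [Game.answer_of_ne _ hq]
        set K := fun y : List Str × Γ₁.State => A.run Γ₁ κ k (A.next κ st' y) with hK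
        have e0 := PMF.bind_bind (R s) (Γ₁.oracle q) K
        -- The query itself costs ε, whatever follows it; the remaining `k` rounds cost `k * ε` by
        -- induction.
        have e1 := (hstep k s q hs).bind_left K
        rw [e0, PMF.bind_bind] at e1
        simp only [PMF.bind_map] at e1
        have e2 : Near (k * ε)
            ((Γ₂.oracle q s).bind fun y => (R y.2).bind (K ∘ fun s' => (y.1, s')))
            ((Γ₂.oracle q s).bind fun y => A.run Γ₂ κ k (A.next κ st' y)) :=
          Near.bind fun y hy => ih y.2 (st'.take (A.bound.eval κ))
            ((encodeList y.1).take (A.bound.eval κ)) (hinv k s q hs y hy)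
        refine (e1.trans e2).mono ?_
        push_cast; rw [add_mul, one_mul, add_comm]

/-- The case ε = 0: a perfect simulation, in which the state of the first game is a random function
of the state of the second. All of group anonymity rests on it. -/
theorem Adversary.run_eq (A : Adversary) {Γ₁ Γ₂ : Game} (κ : ℕ) (R : Γ₂.State → PMF Γ₁.State) (Inv :
    Γ₂.State → Prop) (hinv : ∀ s q, Inv s → ∀ y ∈ (Γ₂.oracle q s).support, Inv y.2) (hstep : ∀ s q,
    Inv s → (R s).bind (Γ₁.oracle q) = (Γ₂.oracle q s).bind fun y => (R y.2).map fun s' => (y.1,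
    s')) (k : ℕ) (s : Γ₂.State) (st rep : Str) (hs : Inv s) : ((R s).bind fun s' => A.run Γ₁ κ k
    (st, rep, s')) = A.run Γ₂ κ k (st, rep, s) := by
  have := A.run_near κ R (fun _ => Inv) 0 (fun _ _ h => h) (fun _ s q h => hinv s q h)
    (fun _ s q h => Near.of_eq (hstep s q h)) k s st rep hs
  rw [mul_zero] at this
  exact this.eq

/-! ### The advantage in terms of the guess -/

/-- The guess of the adversary when it starts against the challenger `c`. -/
def Adversary.guess (A : Adversary) (Γ : Game) (κ : ℕ) (c : Γ.State) : PMF Bool :=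
  A.run Γ κ (A.bound.eval κ) ([], (encodeList (Γ.greet c)).take (A.bound.eval κ), c)

theorem Adversary.rounds_bit (A : Adversary) (Γ : Game)
    (hbit : ∀ q c, ∀ y ∈ (Γ.oracle q c).support, Γ.bit y.2 = Γ.bit c) (κ k : ℕ) :
    ∀ x, ∀ y ∈ (A.rounds Γ κ k x).support, Γ.bit y.2.2 = Γ.bit x.2.2 := by
  induction k with
  | zero =>
    intro x y hy
    simp only [rounds, PMF.support_pure, Set.mem_singleton_iff] at hy
    rw [hy]
  | succ k ih =>
    intro x y hy
    simp only [rounds, PMF.mem_support_bind_iff] at hy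
    obtain ⟨z, hz, hy⟩ := hy
    rw [ih z y hy]
    rcases hd : decodeList (A.step ![List.replicate κ true, x.1, x.2.1]) with - | ⟨st', q⟩
    · rw [round_nil hd] at hz
      simp only [PMF.support_pure, Set.mem_singleton_iff] at hz
      rw [hz]
    · rw [round_cons hd] at hz
      simp only [PMF.mem_support_map_iff] at hz
      obtain ⟨w, hw, rfl⟩ := hz
      by_cases hq : ∃ N, q = [[], N]
      · obtain ⟨N, rfl⟩ := hq
        rw [Game.answer_coin, PMF.mem_support_map_iff] at hw
        obtain ⟨n, -, rfl⟩ := hw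
        rfl
      · push Not at hq
        rw [Game.answer_of_ne _ hq] at hw
        exact hbit q _ w hw

/-- If the hidden bit is uniform and independent of the rest of the initial state, then the advantage
is half the difference of the probabilities of the guess `1` for the two values of the bit. -/
theorem Adversary.advantage_eq (A : Adversary) (Γ : Game) (κ : ℕ)
    (hbit : ∀ q c, ∀ y ∈ (Γ.oracle q c).support, Γ.bit y.2 = Γ.bit c)
    (I : PMF (Bool → Γ.State))
    (hI : Γ.init κ = I.bind fun m => (PMF.uniformOfFintype Bool).map m)
    (hm : ∀ m ∈ I.support, ∀ b, Γ.bit (m b) = b) :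
    A.advantage Γ κ = |((I.bind fun m => A.guess Γ κ (m true)) true).toReal -
      ((I.bind fun m => A.guess Γ κ (m false)) true).toReal| / 2 := by
  have hplay : A.play Γ κ = (PMF.uniformOfFintype Bool).bind fun b =>
      (I.bind fun m => A.guess Γ κ (m b)).map fun x => x == b := by
    unfold Adversary.play
    rw [hI, PMF.bind_bind]
    simp only [PMF.bind_map, Function.comp_def, PMF.map_bind]
    rw [PMF.bind_comm]
    congr 1
    funext b
    refine bind_congr fun m hm' => ?_
    rw [Adversary.guess, Adversary.run, PMF.map_comp]
    refine bind_congr fun x hx => ?_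
    have := A.rounds_bit Γ hbit κ _ _ x hx
    simp only [this, hm m hm' b, Function.comp_def]
  have hP : ∀ p : PMF Bool, (p false).toReal = 1 - (p true).toReal := by
    intro p
    have h := p.tsum_coe
    rw [tsum_bool] at h
    have := congrArg ENNReal.toReal h
    rw [ENNReal.toReal_add (p.apply_ne_top _) (p.apply_ne_top _), ENNReal.toReal_one] at this
    linarith
  have hmap : ∀ (p : PMF Bool) (b : Bool), (p.map fun x => x == b) true = p b := by
    intro p b
    rw [PMF.map_apply, tsum_bool]
    cases b <;> simp
  unfold Adversary.advantage
  rw [hplay, PMF.bind_apply, tsum_bool, hmap, hmap]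
  simp only [PMF.uniformOfFintype_apply, Fintype.card_bool]
  rw [ENNReal.toReal_add (ENNReal.mul_ne_top (by simp) (PMF.apply_ne_top _ _))
    (ENNReal.mul_ne_top (by simp) (PMF.apply_ne_top _ _)), ENNReal.toReal_mul, ENNReal.toReal_mul,
    hP]
  have h2 : (((2 : ℕ) : ℝ≥0∞)⁻¹).toReal = 1 / 2 := by simp
  rw [h2]
  generalize ((I.bind fun m => A.guess Γ κ (m true)) true).toReal = x
  generalize ((I.bind fun m => A.guess Γ κ (m false)) true).toReal = y
  rw [show 1 / 2 * (1 - y) + 1 / 2 * x - 1 / 2 = (x - y) / 2 by ring, abs_div]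
  norm_num

/-! ### The oracle of the anonymity games as a function of prepared random choices -/

/-- Random choices, enough for the answer to any query. -/
structure Tape where
  sid : ℕ
  x : ℕ
  ri : ℕ
  si : Str
  y : ℕ
  rj : ℕ
  sj : Str
  s₃ : Str
  s₄ : Str
  R : Str

/-- The distribution of the random choices. -/
def BFFamily.tape (Ψ : BFFamily) (d : Str) : PMF Tape :=
  (Ψ.randExp d).bind fun sid =>
  (Ψ.randExp d).bind fun x =>
  (Ψ.randExp d).bind fun ri =>
  (uniformStr (Ψ.n d)).bind fun si =>
  (Ψ.randExp d).bind fun y =>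
  (Ψ.randExp d).bind fun rj =>
  (uniformStr (Ψ.n d)).bind fun sj =>
  (uniformStr (Ψ.n d)).bind fun s₃ =>
  (uniformStr (Ψ.n d)).bind fun s₄ =>
  (uniformStr (Ψ.p d).size).map fun R => ⟨sid, x, ri, si, y, rj, sj, s₃, s₄, R⟩

/-- **Encrypt** with given random choices. -/
def BFFamily.encryptWith (Ψ : BFFamily) (v : BFVersion) (d : Str) (g gpub : Ψ.G d)
    (ident m : Str) (r : ℕ) (σ : Str) : Ctxt :=
  match v with
  | .basic => (Ψ.encG d (g ^ r), xorStr m (Ψ.mask d gpub ident r), [])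
  | .full => (Ψ.encG d (g ^ Ψ.H3 d σ m), xorStr σ (Ψ.mask d gpub ident (Ψ.H3 d σ m)),
        xorStr m (Ψ.H4 d σ))

theorem map_eq_bind {X Y : Type} (p : PMF X) (f : X → Y) :
    p.map f = p.bind fun x => PMF.pure (f x) := rfl

/-- The basic version uses only the exponent and the full version only σ. Drawing both gives a
common form of the randomness for the two versions; the superfluous draw integrates out. -/
theorem BFFamily.encrypt_eq (Ψ : BFFamily) (v : BFVersion) (d : Str) (g gpub : Ψ.G d) (ident m :
    Str) : Ψ.encrypt v d g gpub ident m = (Ψ.randExp d).bind fun r => (uniformStr (Ψ.n d)).map fun σ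
    => Ψ.encryptWith v d g gpub ident m r σ := by
  cases v with
  | basic => simp [encrypt, encryptWith, map_eq_bind]
  | full => simp [encrypt, encryptWith]

namespace World

variable {Φ : Family}

/-- The group element `g ^ x`, as a string. -/
def dh (W : World Φ) (x : ℕ) : Str := Φ.encG W.d (W.g ^ x)

/-- The session identity for a random number. -/
def newSid (W : World Φ) (k : ℕ) : Str := fixedBits W.width k

/-- The authorization key of a device. -/
def akOf (W : World Φ) (i : ℕ) : Str := ((W.ues[i]?).map UE.ak).getD []

/-- The identity of a device. -/
def identOf (W : World Φ) (i : ℕ) : Str :=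
  ((W.ues[i]?).map UE.ident).getD (List.replicate (Φ.n W.d) false)

/-- The BF-IBE identity `δ‖X‖sid` under which a device encrypts. -/
def tid (W : World Φ) (i : ℕ) (X sid : Str) : Str := W.delta (W.akOf i) sid ++ X ++ sid

/-- The ciphertext of `m` under such an identity, with given random choices. -/
def sealWith (v : BFVersion) (W : World Φ) (i : ℕ) (X sid m : Str) (r : ℕ) (σ : Str) : Ctxt :=
  Φ.encryptWith v W.d W.g (W.g ^ W.msk) (W.tid i X sid) m r σ

/-- Decryption by HSS/AuC and search for the device. -/
def openT (v : BFVersion) (W : World Φ) (t : Str × Ctxt) : Option UE :=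
  (Φ.decrypt v W.d W.g (Φ.extract W.d W.msk t.1) t.2).bind fun m =>
    W.ues.find? fun u => u.ident == m

/-- The first encrypted identity in a request to HSS/AuC. -/
def reqI (msg : List Str) : Str × Ctxt :=
  (msg.getD 1 [] ++ msg.getD 9 [] ++ msg.getD 0 [], msg.getD 3 [], msg.getD 4 [], msg.getD 5 [])

/-- The second encrypted identity in a request to HSS/AuC. -/
def reqJ (msg : List Str) : Str × Ctxt :=
  (msg.getD 2 [] ++ msg.getD 10 [] ++ msg.getD 0 [], msg.getD 6 [], msg.getD 7 [], msg.getD 8 [])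

/-- Adds instances. -/
def addInsts (W : World Φ) (l : List Inst) : World Φ := { W with insts := W.insts ++ l }

/-- Whether a device can start a session with another one. -/
def StartOk (W : World Φ) (i j : ℕ) : Prop := i < W.ues.length ∧ j < W.ues.length ∧ i ≠ j

instance (W : World Φ) (i j : ℕ) : Decidable (W.StartOk i j) :=
  inferInstanceAs (Decidable (_ ∧ _))

/-- The first message of a session. -/
def startMsg (W : World Φ) (i j k x : ℕ) (c : Ctxt) : List Str :=
  if W.StartOk i j then
    [W.newSid k, W.delta (W.akOf i) (W.newSid k), c.1, c.2.1, c.2.2, W.dh x] else []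

/-- The new instance of the initiator. -/
def startInst (W : World Φ) (i j k x : ℕ) : List Inst :=
  if W.StartOk i j then
    [{ owner := i, peer := j, initiator := true, stage := 1, sid := W.newSid k, exp := x,
       own := W.dh x, other := [], nonce := [], key := none }] else []

/-- Whether a device responds to a first message. -/
def RespondOk (W : World Φ) (j i : ℕ) (msg : List Str) : Prop :=
  W.StartOk i j ∧ msg.length = 6 ∧ (Φ.decG W.d (msg.getD 5 [])).isSome = true

instance (W : World Φ) (j i : ℕ) (msg : List Str) : Decidable (W.RespondOk j i msg) :=
  inferInstanceAs (Decidable (_ ∧ _))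

/-- The request that the responder sends to HSS/AuC. -/
def respondMsg (W : World Φ) (j i : ℕ) (msg : List Str) (y : ℕ) (c : Ctxt) : List Str :=
  if W.RespondOk j i msg then
    [msg.getD 0 [], msg.getD 1 [], W.delta (W.akOf j) (msg.getD 0 []), msg.getD 2 [],
      msg.getD 3 [], msg.getD 4 [], c.1, c.2.1, c.2.2, msg.getD 5 [], W.dh y] else []

/-- The new instance of the responder. -/
def respondInst (W : World Φ) (j i : ℕ) (msg : List Str) (y : ℕ) : List Inst :=
  if W.RespondOk j i msg then
    [{ owner := j, peer := i, initiator := false, stage := 1, sid := msg.getD 0 [], exp := y,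
       own := W.dh y, other := msg.getD 5 [], nonce := [], key := none }] else []

/-- The answer of HSS/AuC to a request in which it has identified the two devices. -/
def hssWith (msg : List Str) (oi oj : Option UE) (R : Str) (W : World Φ) :
    List Str × World Φ :=
  if msg.length = 11 then
    (oi.bind fun ui => oj.bind fun uj => (W.prose (msg.getD 0 []) ui.aid uj.aid).map fun a =>
      ([Φ.ES ui.key (a.1 ++ xorStr (msg.getD 0 []) R),
        Φ.ES uj.key (a.2 ++ xorStr (msg.getD 0 []) R)],
        { W with hss := W.hss ++
          [{ ui := ui, uj := uj, sid := msg.getD 0 [], nonce := R, isOpen := true }] })).getD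
      ([], W)
  else ([], W)

end World

/-- The initiating device of a query. -/
def Query.initiator : Query → ℕ
  | .execute i _ => i
  | .start i _ => i
  | _ => 0

/-- The responding device of a query. -/
def Query.responder : Query → ℕ
  | .execute _ j => j
  | .respond j _ _ => j
  | _ => 0

/-- The session identity used by the responder. -/
def Query.respSid (Q : Query) (sid : Str) : Str :=
  match Q with
  | .respond _ _ msg => msg.getD 0 []
  | _ => sid

namespace World

variable {Φ : Family}

/-- The BF-IBE identity for the ciphertext of the initiator. -/
def tidI (Q : Query) (τ : Tape) (W : World Φ) : Str :=
  W.tid Q.initiator (W.dh τ.x) (W.newSid τ.sid)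

/-- The BF-IBE identity for the ciphertext of the responder. -/
def tidJ (Q : Query) (τ : Tape) (W : World Φ) : Str :=
  W.tid Q.responder (W.dh τ.y) (Q.respSid (W.newSid τ.sid))

/-- The ciphertext of the initiator, for the plaintext `m`. -/
def ctI (v : BFVersion) (Q : Query) (τ : Tape) (m : Str) (W : World Φ) : Ctxt :=
  Φ.encryptWith v W.d W.g (W.g ^ W.msk) (W.tidI Q τ) m τ.ri τ.si

/-- The ciphertext of the responder, for the plaintext `m`. -/
def ctJ (v : BFVersion) (Q : Query) (τ : Tape) (m : Str) (W : World Φ) : Ctxt :=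
  Φ.encryptWith v W.d W.g (W.g ^ W.msk) (W.tidJ Q τ) m τ.rj τ.sj

/-- The request to HSS/AuC that belongs to a query. -/
def request (Q : Query) (τ : Tape) (ci cj : Ctxt) (W : World Φ) : List Str :=
  match Q with
  | .hssRequest msg => msg
  | .execute i j => W.respondMsg j i (W.startMsg i j τ.sid τ.x ci) τ.y cj
  | _ => []

/-- The answer to a query (registration, tests, and messages to the ProSe function excepted), for
given random choices, ciphertexts and devices identified by HSS/AuC. -/
def core (Q : Query) (τ : Tape) (ci cj : Ctxt) (oi oj : Option UE) (W : World Φ) :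
    List Str × World Φ :=
  match Q with
  | .newGroup => ([W.gids.length.bits], { W with gids := W.gids ++ [τ.si] })
  | .execute i j =>
    let m₁ := W.startMsg i j τ.sid τ.x ci
    let m₂ := W.respondMsg j i m₁ τ.y cj
    let s := ((W.addInsts (W.startInst i j τ.sid τ.x)).addInsts
      (W.respondInst j i m₁ τ.y)).hssWith m₂ oi oj τ.R
    let r := s.2.relay W.insts.length (W.insts.length + 1) W.hss.length s.1
    (encodeList m₁ :: encodeList m₂ :: encodeList s.1 :: r.1, r.2)
  | .start i j => (W.startMsg i j τ.sid τ.x ci, W.addInsts (W.startInst i j τ.sid τ.x))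
  | .respond j i msg => (W.respondMsg j i msg τ.y cj, W.addInsts (W.respondInst j i msg τ.y))
  | .send k msg => W.send k msg
  | .hssRequest msg => W.hssWith msg oi oj τ.R
  | .hssConfirm k msg => W.hssConfirm k msg
  | _ => ([], W)

theorem addInsts_nil (W : World Φ) : W.addInsts [] = W := by simp [addInsts]

theorem openId_eq (v : BFVersion) (W : World Φ) (δ x sid : Str) (c : Ctxt) :
    W.openId v δ x sid c = W.openT v (δ ++ x ++ sid, c) := by
  unfold openId openT
  grind

/-- The randomness is drawn even if the query is refused, so that every query becomes a
deterministic function of a tape of fixed shape. In the refused case the draws integrate out. -/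
theorem start_eq (v : BFVersion) (i j : ℕ) (W : World Φ) :
    W.start v i j =
      (Φ.randExp W.d).bind fun k => (Φ.randExp W.d).bind fun x =>
      (Φ.randExp W.d).bind fun r => (uniformStr (Φ.n W.d)).map fun σ =>
        (W.startMsg i j k x (W.sealWith v i (W.dh x) (W.newSid k) (W.identOf i) r σ),
          W.addInsts (W.startInst i j k x)) := by
  by_cases h : W.StartOk i j
  · have h' := h
    obtain ⟨hi, hj, hij⟩ := h'
    have hui := List.getElem?_eq_getElem hi
    have huj := List.getElem?_eq_getElem hj
    unfold start
    rw [hui, huj]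
    simp only [if_neg hij, sealId, Φ.encrypt_eq, PMF.map_bind, PMF.map_comp, startMsg,
      startInst, if_pos h, sealWith, tid, akOf, identOf, hui, Option.map_some, Option.getD_some]
    rfl
  · have e : W.start v i j = PMF.pure ([], W) := by
      unfold start
      split
      · rename_i u u' hu hu'
        rw [if_pos]
        by_contra hij
        exact h ⟨(List.getElem?_eq_some_iff.mp hu).1, (List.getElem?_eq_some_iff.mp hu').1, hij⟩
      · rfl
    rw [e]
    simp only [startMsg, startInst, if_neg h, addInsts_nil, map_eq_bind, PMF.bind_const]

theorem respond_eq (v : BFVersion) (j i : ℕ) (msg : List Str) (W : World Φ) :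
    W.respond v j i msg =
      (Φ.randExp W.d).bind fun y =>
      (Φ.randExp W.d).bind fun r => (uniformStr (Φ.n W.d)).map fun σ =>
        (W.respondMsg j i msg y (W.sealWith v j (W.dh y) (msg.getD 0 []) (W.identOf j) r σ),
          W.addInsts (W.respondInst j i msg y)) := by
  by_cases h : W.RespondOk j i msg
  · have h' := h
    obtain ⟨⟨hi, hj, hij⟩, hl, hd⟩ := h'
    have hui := List.getElem?_eq_getElem hi
    have huj := List.getElem?_eq_getElem hj
    match msg, hl with
    | [sid, δi, c₁, c₂, c₃, X], _ =>
      unfold respond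
      rw [hui, huj]
      have hc : ¬ (i = j ∨ Φ.decG W.d X = none) := by
        rintro (h1 | h1)
        · exact hij h1
        · simp [h1] at hd
      simp only [if_neg hc, sealId, Φ.encrypt_eq, PMF.map_bind, PMF.map_comp, respondMsg,
        respondInst, if_pos h, sealWith, tid, akOf, identOf, huj, Option.map_some,
        Option.getD_some]
      rfl
  · have e : W.respond v j i msg = PMF.pure ([], W) := by
      unfold respond
      split
      · rename_i u u' sid δi c₁ c₂ c₃ X hu hu'
        rw [if_pos]
        by_contra hij
        push Not at hij
        exact h ⟨⟨(List.getElem?_eq_some_iff.mp hu').1, (List.getElem?_eq_some_iff.mp hu).1,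
          hij.1⟩, rfl, Option.isSome_iff_ne_none.mpr hij.2⟩
      · rfl
    rw [e]
    simp only [respondMsg, respondInst, if_neg h, addInsts_nil, map_eq_bind, PMF.bind_const]

theorem hssRequest_eq (v : BFVersion) (msg : List Str) (W : World Φ) :
    W.hssRequest v msg = (uniformStr W.width).map fun R =>
      W.hssWith msg (W.openT v (reqI msg)) (W.openT v (reqJ msg)) R := by
  unfold hssRequest
  split
  · rename_i sid δi δj a₁ a₂ a₃ b₁ b₂ b₃ X Y
    rw [openId_eq, openId_eq]
    simp only [hssWith, reqI, reqJ, List.length_cons, List.length_nil, if_true,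
      List.getD_cons_zero, List.getD_cons_succ]
    cases W.openT v (δi ++ X ++ sid, a₁, a₂, a₃) with
    | none => simp [map_eq_bind]
    | some ui =>
      cases W.openT v (δj ++ Y ++ sid, b₁, b₂, b₃) with
      | none => simp [map_eq_bind]
      | some uj =>
        simp only [Option.bind_some]
        cases W.prose sid ui.aid uj.aid with
        | none => simp [map_eq_bind]
        | some a => rfl
  · rename_i h
    have hl : msg.length ≠ 11 := by
      intro hl
      match msg, hl with
      | [sid, δi, δj, a₁, a₂, a₃, b₁, b₂, b₃, X, Y], _ => exact h _ _ _ _ _ _ _ _ _ _ _ rfl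
    simp [hssWith, hl, map_eq_bind]

/-- The answer to a query as a function of the random choices. -/
def answerWith (v : BFVersion) (Q : Query) (W : World Φ) (τ : Tape) : List Str × World Φ :=
  let ci := W.ctI v Q τ (W.identOf Q.initiator)
  let cj := W.ctJ v Q τ (W.identOf Q.responder)
  let m := W.request Q τ ci cj
  W.core Q τ ci cj (W.openT v (reqI m)) (W.openT v (reqJ m))

/-- The responder encrypts under the session identity it finds in the first message, which in an
undisturbed session is the one chosen by the initiator; this is why `Query.respSid` distinguishes
`respond` from `execute`. If the session cannot be started, all messages are empty and every later
party refuses. -/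
theorem execute_eq (v : BFVersion) (i j : ℕ) (W : World Φ) :
    W.execute v i j = (Φ.tape W.d).map (W.answerWith v (.execute i j)) := by
  unfold execute BFFamily.tape
  rw [start_eq]
  simp only [PMF.bind_bind, PMF.bind_map, PMF.map_bind, Function.comp_def, respond_eq,
    hssRequest_eq, PMF.map_comp]
  refine bind_congr fun k _ => bind_congr fun x _ => bind_congr fun r _ => bind_congr fun σ _ =>
    bind_congr fun y _ => bind_congr fun r' _ => bind_congr fun σ' _ => ?_
  by_cases h : W.StartOk i j
  · have hs : ∀ c, (W.startMsg i j k x c).getD 0 [] = W.newSid k := fun c => by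
      simp [startMsg, h]
    rw [hs]
    -- Two strings of the tape, `s₃` and `s₄`, serve registrations only. They do not enter here, so
    -- they may be replaced by empty strings and their draws disappear.
    change _ = (uniformStr (Φ.n W.d)).bind fun _ => (uniformStr (Φ.n W.d)).bind fun _ =>
      (uniformStr W.width).map fun R =>
        W.answerWith v (.execute i j) ⟨k, x, r, σ, y, r', σ', [], [], R⟩
    rw [PMF.bind_const, PMF.bind_const]
    rfl
  · simp only [answerWith, core, request, startMsg, if_neg h]
    have h1 : ∀ (W' : World Φ) y c, W'.respondMsg j i [] y c = [] := fun W' y c => by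
      simp [respondMsg, RespondOk]
    have h2 : ∀ (W' : World Φ) y, W'.respondInst j i [] y = [] := fun W' y => by
      simp [respondInst, RespondOk]
    have h3 : ∀ (W' : World Φ) oi oj R, W'.hssWith [] oi oj R = ([], W') := fun W' oi oj R => by
      simp [hssWith]
    simp only [h1, h2, h3, map_eq_bind, PMF.bind_const]

/-- The answers of the system to most queries. -/
theorem anonOracle_eq {v : BFVersion} {att : Attacker} {goal : Goal} {q : List Str} {W : World Φ}
    (hW : W.tested = false) {Q : Query} (hQ : Query.parse q = some Q) (h₁ : ∀ k, Q ≠ .register k)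
    (h₂ : ∀ k, Q ≠ .test k) (h₃ : ∀ a b c d e, Q ≠ .prose a b c d e) : anonOracle Φ v att goal q W =
    (Φ.tape W.d).map (W.answerWith v Q) := by
  unfold anonOracle
  rw [hW, hQ]
  cases Q with
  | newGroup =>
    simp [newGroup, BFFamily.tape, map_eq_bind, answerWith, core]
  | register k => exact absurd rfl (h₁ k)
  | execute i j => exact execute_eq v i j W
  | start i j =>
    change W.start v i j = _
    rw [start_eq]
    simp only [BFFamily.tape, map_eq_bind, PMF.bind_bind, PMF.pure_bind,
      answerWith, core, ctI, tidI, Query.initiator,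
      PMF.bind_const]
    rfl
  | respond j i msg =>
    change W.respond v j i msg = _
    rw [respond_eq]
    simp only [BFFamily.tape, map_eq_bind, PMF.bind_bind, PMF.pure_bind,
      answerWith, core, ctJ, tidJ, Query.responder, Query.respSid,
      PMF.bind_const]
    rfl
  | send k msg => simp [BFFamily.tape, map_eq_bind, answerWith, core]
  | hssRequest msg =>
    change W.hssRequest v msg = _
    rw [hssRequest_eq]
    simp [BFFamily.tape, map_eq_bind, answerWith, core, request, width]
  | hssConfirm k msg => simp [BFFamily.tape, map_eq_bind, answerWith, core]
  | prose a b c d e => exact absurd rfl (h₃ a b c d e)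
  | test k => exact absurd rfl (h₂ k)

end World

/-! ### Changes of the system that most answers do not reveal -/

/-- A change of the identities of the devices, of the secret of the ProSe function, of the group
identities, and of the hidden bit. -/
structure Remap where
  ue : UE → UE
  kp : Str → Str
  gids : List Str → List Str
  bit : Bool → Bool
  aid_ue : ∀ u, (ue u).aid = u.aid
  key_ue : ∀ u, (ue u).key = u.key
  ak_ue : ∀ u, (ue u).ak = u.ak

attribute [simp] Remap.aid_ue Remap.key_ue Remap.ak_ue

namespace World

variable {Φ : Family}

/-- The changed session at HSS/AuC. -/
def _root_.GD2C.Remap.session (ρ : Remap) (s : HSession) : HSession :=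
  { s with ui := ρ.ue s.ui, uj := ρ.ue s.uj }

/-- The changed system. -/
def remap (ρ : Remap) (W : World Φ) : World Φ :=
  { W with kp := ρ.kp W.kp, gids := ρ.gids W.gids, ues := W.ues.map ρ.ue,
           hss := W.hss.map ρ.session, b := ρ.bit W.b }

/-- The answers of the ProSe function are not changed. -/
def KeepsProse (ρ : Remap) (W : World Φ) : Prop :=
  ∀ sid a b, (W.remap ρ).prose sid a b = W.prose sid a b

/-- `react` in terms of the results of the checks. -/
def reactWith (ok : Str → Bool) (tok : Str → Option Str) (ES : Str → Str) (xres : Str)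
    (sk : Option Str) (I : Inst) (msg : List Str) : List Str × Inst :=
  bif I.initiator then
    if I.stage = 1 ∧ msg.length = 2 ∧ ok (msg.getD 0 []) = true then
      (tok (msg.getD 1 [])).elim ([], { I with stage := 0 }) fun R =>
        ([ES R], { I with stage := 2, other := msg.getD 0 [], nonce := R })
    else if I.stage = 2 ∧ msg.length = 1 ∧ msg.getD 0 [] = xres then
      ([], { I with stage := 3, key := sk })
    else if I.stage = 3 then ([], I)
    else ([], { I with stage := 0 })
  else
    if I.stage = 1 ∧ msg.length = 2 then
      (tok (msg.getD 1 [])).elim ([], { I with stage := 0 }) fun R =>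
        ([I.own, msg.getD 0 []], { I with stage := 2, nonce := R })
    else if I.stage = 2 ∧ msg.length = 1 then
      ([ES (xorStr (msg.getD 0 []) I.nonce)], { I with stage := 3 })
    else if I.stage = 3 ∧ msg.length = 2 ∧ msg.getD 1 [] = xres then
      ([msg.getD 0 []], { I with stage := 4, key := sk })
    else if I.stage = 4 then ([], I)
    else ([], { I with stage := 0 })

/-- The pattern match is replaced by conditionals, in which the system and the device occur only
through five functions and values. Invariance under changes of the system, computability and the
size bounds are then read off from `reactWith`. -/
theorem react_eq (W : World Φ) (u : UE) (I : Inst) (msg : List Str) : W.react u I msg = reactWith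
    (fun Y => (Φ.decG W.d Y).isSome) (W.checkToken u I.sid) (Φ.ES u.key) (W.xres u.key I.sid)
    (W.sessionKey I) I msg := by
  rcases I with ⟨owner, peer, ini, stage, sid, exp, own, other, nonce, key⟩
  unfold react reactWith
  generalize W.xres u.key sid = xr
  generalize W.sessionKey _ = sk
  rcases ini with - | -
  · rcases stage with - | - | - | - | - | n
    all_goals rcases msg with - | ⟨a, - | ⟨b, - | ⟨c, l⟩⟩⟩
    all_goals simp
    · cases W.checkToken u sid b <;> rfl
  · rcases stage with - | - | - | - | n
    all_goals rcases msg with - | ⟨a, - | ⟨b, - | ⟨c, l⟩⟩⟩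
    all_goals simp
    · cases Φ.decG W.d a <;> cases W.checkToken u sid b <;> rfl

variable (ρ : Remap)

/-- A device reacts on the basis of its key and its authorization key alone, and a `Remap` preserves
both. -/
theorem react_remap (W : World Φ) (u : UE) (I : Inst) (msg : List Str) :
    (W.remap ρ).react (ρ.ue u) I msg = W.react u I msg := by
  have h1 : ∀ sid, (W.remap ρ).checkToken (ρ.ue u) sid = W.checkToken u sid := by
    intro sid
    funext tok
    simp only [checkToken, Remap.key_ue, Remap.ak_ue]; rfl
  simp only [react_eq, h1, Remap.key_ue]
  rfl

theorem send_remap (W : World Φ) (k : ℕ) (msg : List Str) :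
    (W.remap ρ).send k msg = ((W.send k msg).1, (W.send k msg).2.remap ρ) := by
  unfold send
  change (match W.insts[k]? with
    | none => _
    | some I => _) = _
  cases W.insts[k]? with
  | none => rfl
  | some I =>
    have h : (W.remap ρ).ues[I.owner]? = (W.ues[I.owner]?).map ρ.ue := List.getElem?_map
    simp only [h]
    cases W.ues[I.owner]? with
    | none => rfl
    | some u => simp only [Option.map_some, react_remap]; rfl

theorem hssConfirm_remap (W : World Φ) (k : ℕ) (msg : List Str) :
    (W.remap ρ).hssConfirm k msg = ((W.hssConfirm k msg).1, (W.hssConfirm k msg).2.remap ρ) := by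
  unfold hssConfirm
  have h : (W.remap ρ).hss[k]? = (W.hss[k]?).map ρ.session := List.getElem?_map
  rw [h]
  cases W.hss[k]? with
  | none => rfl
  | some s =>
    simp only [Option.map_some]
    match msg with
    | [] => rfl
    | [resj] =>
      simp only [Remap.session, Remap.key_ue]
      have hset : ∀ c, (W.remap ρ).hss.set k
          { ui := ρ.ue s.ui, uj := ρ.ue s.uj, sid := s.sid, nonce := s.nonce, isOpen := c } =
          (W.hss.set k { s with isOpen := c }).map ρ.session := fun c => by
        rw [List.map_set]; rfl
      rw [hset]
      split <;> rfl
    | _ :: _ :: _ => rfl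

theorem relay_remap (W : World Φ) (ki kj h : ℕ) (m : List Str) :
    (W.remap ρ).relay ki kj h m = ((W.relay ki kj h m).1, (W.relay ki kj h m).2.remap ρ) := by
  unfold relay
  simp only [send_remap, hssConfirm_remap]

theorem StartOk_remap (W : World Φ) (i j : ℕ) : (W.remap ρ).StartOk i j ↔ W.StartOk i j := by
  simp [StartOk, remap]

theorem akOf_remap (W : World Φ) (i : ℕ) : (W.remap ρ).akOf i = W.akOf i := by
  simp [akOf, remap, Function.comp_def]

theorem RespondOk_remap (W : World Φ) (j i : ℕ) (msg : List Str) :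
    (W.remap ρ).RespondOk j i msg ↔ W.RespondOk j i msg := by
  unfold RespondOk
  rw [StartOk_remap]; rfl

theorem startMsg_remap (W : World Φ) (i j k x : ℕ) (c : Ctxt) :
    (W.remap ρ).startMsg i j k x c = W.startMsg i j k x c := by
  unfold startMsg
  simp only [StartOk_remap, akOf_remap]; rfl

theorem startInst_remap (W : World Φ) (i j k x : ℕ) :
    (W.remap ρ).startInst i j k x = W.startInst i j k x := by
  unfold startInst
  simp only [StartOk_remap]; rfl

theorem respondMsg_remap (W : World Φ) (j i : ℕ) (msg : List Str) (y : ℕ) (c : Ctxt) :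
    (W.remap ρ).respondMsg j i msg y c = W.respondMsg j i msg y c := by
  unfold respondMsg
  simp only [RespondOk_remap, akOf_remap]; rfl

theorem respondInst_remap (W : World Φ) (j i : ℕ) (msg : List Str) (y : ℕ) :
    (W.remap ρ).respondInst j i msg y = W.respondInst j i msg y := by
  unfold respondInst
  simp only [RespondOk_remap]; rfl

theorem request_remap (W : World Φ) (Q : Query) (τ : Tape) (ci cj : Ctxt) :
    (W.remap ρ).request Q τ ci cj = W.request Q τ ci cj := by
  unfold request
  cases Q <;> simp only [startMsg_remap, respondMsg_remap]

theorem tid_remap (W : World Φ) (i : ℕ) (X sid : Str) :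
    (W.remap ρ).tid i X sid = W.tid i X sid := by
  unfold tid
  rw [akOf_remap]; rfl

theorem tidI_remap (W : World Φ) (Q : Query) (τ : Tape) :
    (W.remap ρ).tidI Q τ = W.tidI Q τ := tid_remap ρ W _ _ _

theorem tidJ_remap (W : World Φ) (Q : Query) (τ : Tape) :
    (W.remap ρ).tidJ Q τ = W.tidJ Q τ := tid_remap ρ W _ _ _

theorem ctI_remap (v : BFVersion) (W : World Φ) (Q : Query) (τ : Tape) (m : Str) :
    (W.remap ρ).ctI v Q τ m = W.ctI v Q τ m := by
  unfold ctI
  rw [tidI_remap]; rfl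

theorem ctJ_remap (v : BFVersion) (W : World Φ) (Q : Query) (τ : Tape) (m : Str) :
    (W.remap ρ).ctJ v Q τ m = W.ctJ v Q τ m := by
  unfold ctJ
  rw [tidJ_remap]; rfl

theorem hssWith_remap {W : World Φ} (h : W.KeepsProse ρ) (msg : List Str) (oi oj : Option UE) (R :
    Str) : (W.remap ρ).hssWith msg (oi.map ρ.ue) (oj.map ρ.ue) R = ((W.hssWith msg oi oj R).1,
    (W.hssWith msg oi oj R).2.remap ρ) := by
  unfold hssWith
  split
  · cases oi with
    | none => rfl
    | some ui =>
      cases oj with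
      | none => rfl
      | some uj =>
        simp only [Option.map_some, Option.bind_some, Remap.aid_ue, Remap.key_ue]
        rw [h]
        cases W.prose (msg.getD 0 []) ui.aid uj.aid with
        | none => rfl
        | some a =>
          simp only [Option.map_some, Option.getD_some, Prod.mk.injEq, true_and]
          simp [remap, Remap.session]
  · rfl

/-- The queries answered by `core` that do not change the list of groups. -/
theorem core_remap {W : World Φ} (h : W.KeepsProse ρ) {Q : Query} (hQ : Q ≠ .newGroup) (τ : Tape)
    (ci cj : Ctxt) (oi oj : Option UE) : (W.remap ρ).core Q τ ci cj (oi.map ρ.ue) (oj.map ρ.ue) =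
    ((W.core Q τ ci cj oi oj).1, (W.core Q τ ci cj oi oj).2.remap ρ) := by
  have hadd : ∀ (W' : World Φ) l, (W'.remap ρ).addInsts l = (W'.addInsts l).remap ρ :=
    fun _ _ => rfl
  cases Q with
  | newGroup => exact absurd rfl hQ
  | execute i j =>
    simp only [core, startMsg_remap, startInst_remap, respondMsg_remap, respondInst_remap]
    rw [hadd, hadd, hssWith_remap ρ (W := (W.addInsts _).addInsts _) (by exact h)]
    simp only [relay_remap]
    rw [show (W.remap ρ).hss.length = W.hss.length by simp [remap]]
    rfl
  | start i j => simp only [core, startMsg_remap, startInst_remap, hadd]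
  | respond j i msg => simp only [core, respondMsg_remap, respondInst_remap, hadd]
  | send k msg => simp only [core, send_remap]
  | hssRequest msg => simp only [core, hssWith_remap ρ h]
  | hssConfirm k msg => simp only [core, hssConfirm_remap]
  | register => rfl
  | prose => rfl
  | test => rfl

/-! ### What the answers do not change -/

/-- Two states of the system that differ in the instances and sessions only. -/
def SameUsers (W W' : World Φ) : Prop := W' = { W with insts := W'.insts, hss := W'.hss }

theorem SameUsers.refl (W : World Φ) : W.SameUsers W := rfl

theorem SameUsers.trans {W W' W'' : World Φ} (h : W.SameUsers W') (h' : W'.SameUsers W'') :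
    W.SameUsers W'' := by
  unfold SameUsers at *
  rw [h', h]

theorem sameUsers_send (W : World Φ) (k : ℕ) (msg : List Str) : W.SameUsers (W.send k msg).2 := by
  unfold send
  cases W.insts[k]? with
  | none => rfl
  | some I =>
    simp only []
    cases W.ues[I.owner]? <;> rfl

theorem sameUsers_hssConfirm (W : World Φ) (k : ℕ) (msg : List Str) :
    W.SameUsers (W.hssConfirm k msg).2 := by
  unfold hssConfirm
  split
  · dsimp only
    split_ifs <;> rfl
  · rfl

theorem sameUsers_relay (W : World Φ) (ki kj h : ℕ) (m : List Str) :
    W.SameUsers (W.relay ki kj h m).2 :=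
  ((((((sameUsers_send _ _ _).trans (sameUsers_send _ _ _)).trans
    (sameUsers_send _ _ _)).trans (sameUsers_hssConfirm _ _ _)).trans
    (sameUsers_send _ _ _)).trans (sameUsers_send _ _ _))

theorem sameUsers_hssWith (W : World Φ) (msg : List Str) (oi oj : Option UE) (R : Str) :
    W.SameUsers (W.hssWith msg oi oj R).2 := by
  unfold hssWith
  split
  · cases oi with
    | none => rfl
    | some ui =>
      cases oj with
      | none => rfl
      | some uj =>
        simp only [Option.bind_some]
        cases W.prose (msg.getD 0 []) ui.aid uj.aid <;> rfl
  · rfl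

theorem sameUsers_core (W : World Φ) {Q : Query} (hQ : Q ≠ .newGroup) (τ : Tape)
    (ci cj : Ctxt) (oi oj : Option UE) : W.SameUsers (W.core Q τ ci cj oi oj).2 := by
  cases Q with
  | newGroup => exact absurd rfl hQ
  | execute i j =>
    simp only [core]
    refine SameUsers.trans ?_ (sameUsers_relay _ _ _ _ _)
    refine SameUsers.trans ?_ (sameUsers_hssWith _ _ _ _ _)
    rfl
  | start i j => rfl
  | respond j i msg => rfl
  | send k msg => exact sameUsers_send _ _ _
  | hssRequest msg => exact sameUsers_hssWith _ _ _ _ _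
  | hssConfirm k msg => exact sameUsers_hssConfirm _ _ _
  | register => rfl
  | prose => rfl
  | test => rfl

end World

/-! ### Exclusive or of uniform strings -/

theorem xorStr_comm (u v : Str) : xorStr u v = xorStr v u := by
  induction u generalizing v with
  | nil => cases v <;> simp [xorStr]
  | cons a u ih =>
    cases v with
    | nil => simp [xorStr]
    | cons b v => simp [xorStr, ih v, Bool.xor_comm]

attribute [simp] xorStr_nil nil_xorStr

theorem xorStr_assoc (u v w : Str) : xorStr (xorStr u v) w = xorStr u (xorStr v w) := by
  induction u generalizing v w with
  | nil => simp
  | cons a u ih =>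
    cases v with
    | nil => simp
    | cons b v =>
      cases w with
      | nil => simp
      | cons c w => simp [xorStr, ih v w]

theorem length_xorStr (u v : Str) : (xorStr u v).length = max u.length v.length := by
  induction u generalizing v with
  | nil => simp
  | cons a u ih =>
    cases v with
    | nil => simp
    | cons b v => simp [xorStr, ih v]

theorem xorStr_xorStr_self {u v : Str} (h : v.length ≤ u.length) : xorStr (xorStr u v) v = u := by
  induction u generalizing v with
  | nil =>
    cases v with
    | nil => rfl
    | cons b v => simp at h
  | cons a u ih =>
    cases v with
    | nil => simp
    | cons b v => simp [xorStr, ih (Nat.le_of_succ_le_succ h)]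

/-- The invariance of AK = AID ⊕ GID ⊕ K_P under a common shift of GID and K_P. The length condition
is needed because w ⊕ w is a string of zeros, which is absorbed only by a string at least as long.
-/
theorem xorStr_cancel_pair {a b c w : Str} (h : w.length ≤ c.length) :
    xorStr (xorStr a (xorStr b w)) (xorStr c w) = xorStr (xorStr a b) c := by
  rw [← xorStr_assoc a b w, xorStr_assoc _ w, ← xorStr_assoc w c w, xorStr_comm w c,
    xorStr_xorStr_self h]

theorem xorStr_ofFn {n : ℕ} (f g : Fin n → Bool) :
    xorStr (List.ofFn f) (List.ofFn g) = List.ofFn fun i => f i ^^ g i := by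
  induction n with
  | zero => rfl
  | succ n ih => simp [List.ofFn_succ, xorStr, ih]

theorem uniformOfFintype_map_equiv {α β : Type} [Fintype α] [Nonempty α] [Fintype β] [Nonempty β]
    (e : α ≃ β) : (PMF.uniformOfFintype α).map e = PMF.uniformOfFintype β := by
  classical
  ext b
  rw [PMF.map_apply, tsum_eq_single (e.symm b)]
  · simp [Fintype.card_congr e]
  · intro a ha
    rw [if_neg]
    rintro rfl
    simp at ha

theorem length_of_mem_uniformStr {n : ℕ} {w : Str} (h : w ∈ (uniformStr n).support) :
    w.length = n := by
  rw [uniformStr, PMF.mem_support_map_iff] at h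
  obtain ⟨f, -, rfl⟩ := h
  simp

/-- The one-time pad: exclusive or with a fixed string of length `n` is an involution of `{0,1}^n`,
and a permutation preserves the uniform distribution. -/
theorem uniformStr_map_xorStr {n : ℕ} {w : Str} (h : w.length = n) :
    ((uniformStr n).map fun u => xorStr u w) = uniformStr n := by
  obtain ⟨g, rfl⟩ : ∃ g : Fin n → Bool, w = List.ofFn g := by
    subst h
    exact ⟨w.get, (List.ofFn_get w).symm⟩
  have h1 : Function.Involutive fun (f : Fin n → Bool) i => f i ^^ g i := by
    intro f; funext i; simp
  unfold uniformStr
  rw [PMF.map_comp]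
  conv_rhs => rw [← uniformOfFintype_map_equiv (Function.Involutive.toPerm _ h1), PMF.map_comp]
  congr 1
  funext f
  exact xorStr_ofFn f g

namespace World

variable {Φ : Family}

/-! ### The test query -/

/-- Decides whether a session is completed. -/
def completed (I : Inst) (l : List Inst) : Bool :=
  I.key.isSome && l.any fun J => J.key.isSome && (J.owner == I.peer && (J.peer == I.owner &&
    (J.initiator == !I.initiator && J.sid == I.sid)))

theorem completed_iff (W : World Φ) (I : Inst) : completed I W.insts = true ↔ W.Completed I := by
  simp [completed, Completed]

/-- The owner of an instance that may be tested. -/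
def testOwner (W : World Φ) (k : ℕ) : Option ℕ :=
  (W.insts[k]?).bind fun I =>
    if completed I W.insts = true ∧ I.owner < W.ues.length then some I.owner else none

/-- The group identity of a device, given by its number. -/
def gidOf (W : World Φ) (i : ℕ) : Str := ((W.ues[i]?).map W.gid).getD []

/-- The answer to an admissible test on a device. -/
def testAnswer (goal : Goal) (W : World Φ) (i : ℕ) (fake : Str) : Str :=
  if W.b then fake else match goal with
    | .identity => W.identOf i
    | .group => W.gidOf i

theorem test_eq (goal : Goal) (k : ℕ) (W : World Φ) :
    W.test goal k = (W.testOwner k).elim (PMF.pure ([], W)) fun i =>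
      (uniformStr (Φ.n W.d)).map fun fake =>
        ([W.testAnswer goal i fake], { W with tested := true }) := by
  unfold test testOwner
  cases hI : W.insts[k]? with
  | none => rfl
  | some I =>
    simp only [Option.bind_some]
    cases hu : W.ues[I.owner]? with
    | none =>
      have : ¬ I.owner < W.ues.length := by simpa using hu
      simp [this]
    | some u =>
      have : I.owner < W.ues.length := (List.getElem?_eq_some_iff.mp hu).1
      have hc : (completed I W.insts = true ∧ I.owner < W.ues.length) ↔ W.Completed I := by
        rw [completed_iff]; exact and_iff_left this
      by_cases h : W.Completed I
      · rw [if_pos (hc.mpr h), Option.elim_some]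
        dsimp only
        rw [if_pos h]
        congr 1
        funext fake
        cases goal <;> simp [testAnswer, identOf, gidOf, hu]
      · rw [if_neg (mt hc.mp h), Option.elim_none]
        dsimp only
        rw [if_neg h]

/-! ### Possible changes of the state -/

/-- The possible effects of a query on the system. -/
inductive Step (W : World Φ) : World Φ → Prop
  | same {W' : World Φ} (h : W.SameUsers W') : Step W W'
  | newGroup (gid : Str) (h : gid.length = Φ.n W.d) : Step W { W with gids := W.gids ++ [gid] }
  | register (grp : ℕ) (gid ident aid key : Str) (h : W.gids[grp]? = some gid)
      (h₁ : ident.length = Φ.n W.d) (h₂ : aid.length = Φ.n W.d) (h₃ : key.length = Φ.n W.d) :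
      Step W { W with ues := W.ues ++
          [{ ident := ident, aid := aid, key := key, ak := xorStr (xorStr aid gid) W.kp,
             group := grp }] }
  | test : Step W { W with tested := true }

/-- Invariants need to be checked only against the few kinds of change listed in `Step`, instead of
query by query. -/
theorem step_anonOracle {v : BFVersion} {att : Attacker} {goal : Goal} {q : List Str}
    {W : World Φ} {y : List Str × World Φ}
    (hy : y ∈ (anonOracle Φ v att goal q W).support) :
    (W.tested = true ∧ y.2 = W) ∨ (W.tested = false ∧ Step W y.2) := by
  by_cases ht : W.tested = true
  · unfold anonOracle at hy
    rw [if_pos ht, PMF.support_pure, Set.mem_singleton_iff] at hy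
    exact Or.inl ⟨ht, by rw [hy]⟩
  refine Or.inr ⟨by simpa using ht, ?_⟩
  have hpure : ∀ y' : List Str × World Φ, y'.2 = W → y = y' → Step W y.2 := by
    rintro y' h rfl
    rw [h]
    exact .same (.refl W)
  cases hQ : Query.parse q with
  | none =>
    unfold anonOracle at hy
    rw [if_neg ht, hQ] at hy
    simp only [PMF.support_pure, Set.mem_singleton_iff] at hy
    exact hpure _ rfl hy
  | some Q =>
    have key : (∀ k, Q ≠ .register k) → (∀ k, Q ≠ .test k) →
        (∀ a b c d e, Q ≠ .prose a b c d e) → Q ≠ .newGroup → Step W y.2 := by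
      intro h1 h2 h3 h4
      rw [anonOracle_eq (by simpa using ht) hQ h1 h2 h3, PMF.mem_support_map_iff] at hy
      obtain ⟨τ, -, rfl⟩ := hy
      exact .same (sameUsers_core W h4 _ _ _ _ _)
    unfold anonOracle at hy
    rw [if_neg ht, hQ] at hy
    cases Q with
    | newGroup =>
      simp only [newGroup, PMF.mem_support_map_iff] at hy
      obtain ⟨gid, hg, rfl⟩ := hy
      exact .newGroup gid (length_of_mem_uniformStr hg)
    | register grp =>
      simp only [register] at hy
      cases hg : W.gids[grp]? with
      | none =>
        rw [hg] at hy
        simp only [PMF.support_pure, Set.mem_singleton_iff] at hy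
        exact hpure _ rfl hy
      | some gid =>
        rw [hg] at hy
        simp only [PMF.mem_support_map_iff, PMF.mem_support_bind_iff] at hy
        obtain ⟨ident, h1, aid, h2, k, h3, rfl⟩ := hy
        exact .register grp gid ident aid k hg (length_of_mem_uniformStr h1)
          (length_of_mem_uniformStr h2) (length_of_mem_uniformStr h3)
    | test k =>
      simp only [test_eq] at hy
      cases hi : W.testOwner k with
      | none =>
        simp only [hi, Option.elim_none, PMF.support_pure, Set.mem_singleton_iff] at hy
        exact hpure _ rfl hy
      | some i =>
        simp only [hi, Option.elim_some, PMF.mem_support_map_iff] at hy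
        obtain ⟨f, -, rfl⟩ := hy
        exact .test
    | prose a b c d e =>
      simp only at hy
      split_ifs at hy <;> simp only [PMF.support_pure, Set.mem_singleton_iff] at hy <;>
        exact hpure _ rfl hy
    | _ => exact key nofun nofun nofun nofun

theorem Step.frame {W W' : World Φ} (h : Step W W') :
    W'.d = W.d ∧ W'.g ≍ W.g ∧ W'.msk = W.msk ∧ W'.kp = W.kp ∧ W'.b = W.b := by
  cases h with
  | same h => unfold SameUsers at h; rw [h]; simp
  | _ => simp

theorem anonOracle_bit {v : BFVersion} {att : Attacker} {goal : Goal} (q : List Str)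
    (W : World Φ) (y) (hy : y ∈ (anonOracle Φ v att goal q W).support) : y.2.b = W.b := by
  rcases step_anonOracle hy with ⟨-, h⟩ | ⟨-, h⟩
  · rw [h]
  · exact h.frame.2.2.2.2

end World

/-! ### Group anonymity -/

/-- Erases the secrets of the ProSe function. -/
def Remap.wipe : Remap where
  ue := id
  kp _ := []
  gids _ := []
  bit := id
  aid_ue _ := rfl
  key_ue _ := rfl
  ak_ue _ := rfl

/-- Clears the hidden bit and shifts the secrets of the ProSe function. -/
def Remap.shift (Δ : Str) : Remap where
  ue := id
  kp k := xorStr k Δ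
  gids l := l.map fun g => xorStr g Δ
  bit _ := false
  aid_ue _ := rfl
  key_ue _ := rfl
  ak_ue _ := rfl

namespace World

variable {Φ : Family}

/-- After the test, erases the secrets of the ProSe function. -/
def wipe (W : World Φ) : World Φ := if W.tested then W.remap .wipe else W

/-- The initial state. -/
def start₀ (Φ : Family) (d : Str) (g : Φ.G d) (msk : ℕ) (kp : Str) (b : Bool) : World Φ :=
  { d := d, g := g, msk := msk, kp := kp, gids := [], ues := [], insts := [], hss := [],
    b := b, tested := false }

theorem anonOracle_tested {v : BFVersion} {att : Attacker} {goal : Goal} {W : World Φ} (h : W.tested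
    = true) (q : List Str) : anonOracle Φ v att goal q W = PMF.pure ([], W) := by
  unfold anonOracle; rw [if_pos h]

/-- What is always true before the test. -/
structure Sound (W : World Φ) : Prop where
  kp : W.kp.length = Φ.n W.d
  gids : ∀ g ∈ W.gids, g.length = Φ.n W.d
  group : ∀ u ∈ W.ues, u.group < W.gids.length

theorem Sound.length_gid {W : World Φ} (h : W.Sound) {u : UE} (hu : u.group < W.gids.length) :
    (W.gid u).length = Φ.n W.d := by
  unfold gid
  rw [List.getD_eq_getElem _ _ hu]
  exact h.gids _ (List.getElem_mem hu)

theorem Sound.step {W W' : World Φ} (h : W.Sound) (hs : Step W W') : W'.Sound := by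
  cases hs with
  | same hs => unfold SameUsers at hs; rw [hs]; exact ⟨h.kp, h.gids, h.group⟩
  | newGroup gid hg =>
    refine ⟨h.kp, ?_, ?_⟩
    · intro g hg'
      rcases List.mem_append.mp hg' with hg' | hg'
      · exact h.gids g hg'
      · rw [List.mem_singleton.mp hg']; exact hg
    · intro u hu
      have := h.group u hu
      simp only [List.length_append]; omega
  | register grp gid ident aid key hg =>
    refine ⟨h.kp, h.gids, ?_⟩
    intro u hu
    rcases List.mem_append.mp hu with hu | hu
    · exact h.group u hu
    grind
  | test => exact ⟨h.kp, h.gids, h.group⟩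

theorem _root_.GD2C.Remap.session_of_id {ρ : Remap} (h : ρ.ue = id) (l : List HSession) :
    l.map ρ.session = l := by
  have : ρ.session = id := by funext s; simp [Remap.session, h]
  rw [this, List.map_id]

theorem remap_wipe_eq (W : World Φ) : W.remap .wipe = { W with kp := [], gids := [] } := by
  have h := Remap.session_of_id (ρ := .wipe) rfl W.hss
  unfold remap
  rw [h]
  simp [Remap.wipe]

theorem remap_shift_eq (W : World Φ) (Δ : Str) : W.remap (.shift Δ) =
    { W with kp := xorStr W.kp Δ, gids := W.gids.map fun g => xorStr g Δ, b := false } := by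
  have h := Remap.session_of_id (ρ := .shift Δ) rfl W.hss
  unfold remap
  rw [h]
  simp [Remap.shift]

theorem remap_shift_ues (W : World Φ) (Δ : Str) : (W.remap (.shift Δ)).ues = W.ues :=
  List.map_id _

theorem gid_shift {W : World Φ} (Δ : Str) {u : UE} (hu : u.group < W.gids.length) :
    (W.remap (.shift Δ)).gid u = xorStr (W.gid u) Δ := by
  simp [gid, remap, Remap.shift, List.getD_eq_getElem?_getD, hu]

/-- The ProSe function compares group identities, and exclusive or with Δ is injective on strings of
length `n`; the acknowledgements depend on AID ⊕ GID ⊕ K_P, in which Δ cancels. -/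
theorem Sound.keepsProse {W : World Φ} (h : W.Sound) {Δ : Str} (hΔ : Δ.length = Φ.n W.d) :
    W.KeepsProse (.shift Δ) := by
  intro sid a b
  unfold prose
  rw [remap_shift_ues]
  cases hu : W.ues.find? (fun u => u.aid == a) with
  | none => rfl
  | some u =>
    cases hv : W.ues.find? (fun u => u.aid == b) with
    | none => rfl
    | some v =>
      have gu := h.group u (List.mem_of_find?_eq_some hu)
      have gv := h.group v (List.mem_of_find?_eq_some hv)
      simp only [gid_shift Δ gu, gid_shift Δ gv]
      have hk : (W.remap (.shift Δ)).kp = xorStr W.kp Δ := rfl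
      have hle : Δ.length ≤ W.kp.length := by rw [h.kp, hΔ]
      rw [hk, xorStr_cancel_pair hle, xorStr_cancel_pair hle]
      have hinj : xorStr (W.gid u) Δ = xorStr (W.gid v) Δ ↔ W.gid u = W.gid v := by
        constructor
        · intro he
          simpa only [xorStr_xorStr_self (show Δ.length ≤ (W.gid u).length by rw [h.length_gid gu, hΔ]),
            xorStr_xorStr_self (show Δ.length ≤ (W.gid v).length by rw [h.length_gid gv, hΔ])]
            using congrArg (xorStr · Δ) he
        · intro he; rw [he]
      simp only [hinj]
      rfl

theorem openT_shift (v : BFVersion) (W : World Φ) (Δ : Str) (t : Str × Ctxt) :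
    (W.remap (.shift Δ)).openT v t = W.openT v t := by
  unfold openT
  rw [remap_shift_ues]; rfl

theorem identOf_shift (W : World Φ) (Δ : Str) (i : ℕ) :
    (W.remap (.shift Δ)).identOf i = W.identOf i := by
  unfold identOf
  rw [remap_shift_ues]; rfl

theorem answerWith_shift (v : BFVersion) {W : World Φ} (h : W.Sound) {Δ : Str} (hΔ : Δ.length = Φ.n
    W.d) {Q : Query} (hQ : Q ≠ .newGroup) (τ : Tape) : (W.remap (.shift Δ)).answerWith v Q τ =
    ((W.answerWith v Q τ).1, (W.answerWith v Q τ).2.remap (.shift Δ)) := by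
  unfold answerWith
  simp only [ctI_remap, ctJ_remap, request_remap, identOf_shift, openT_shift]
  have := core_remap (.shift Δ) (h.keepsProse hΔ) hQ τ (W.ctI v Q τ (W.identOf Q.initiator))
    (W.ctJ v Q τ (W.identOf Q.responder))
  simp only [Remap.shift, Option.map_id, id] at this ⊢
  exact this _ _

theorem testOwner_shift (W : World Φ) (Δ : Str) (k : ℕ) :
    (W.remap (.shift Δ)).testOwner k = W.testOwner k := by
  unfold testOwner
  rw [remap_shift_ues]; rfl

theorem wipe_of_not {W : World Φ} (h : W.tested = false) : W.wipe = W := by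
  unfold wipe; rw [h]; rfl

theorem sameUsers_tested {W W' : World Φ} (h : W.SameUsers W') : W'.tested = W.tested := by
  unfold SameUsers at h; rw [h]

theorem testOwner_lt {W : World Φ} {k i : ℕ} (h : W.testOwner k = some i) : i < W.ues.length := by
  unfold testOwner at h
  grind

end World

/-- The game of group anonymity, in which the secrets of the ProSe function are erased after the
test. -/
def wipedGame (Φ : Family) (v : BFVersion) (att : Attacker) : Game where
  State := World Φ
  init := (anonGame Φ v att .group).init
  greet := (anonGame Φ v att .group).greet
  oracle q W := (anonOracle Φ v att .group q W).map fun y => (y.1, y.2.wipe)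
  bit W := W.b

namespace World

variable {Φ : Family}

theorem wipe_tested (W : World Φ) : W.wipe.tested = W.tested := by
  unfold wipe; split_ifs <;> rfl

theorem wipe_wipe (W : World Φ) : W.wipe.wipe = W.wipe := by
  by_cases ht : W.tested = true
  · have h1 : W.wipe.tested = true := by rw [wipe_tested]; exact ht
    rw [wipe, if_pos h1, wipe, if_pos ht]
    simp only [remap_wipe_eq]
  · rw [wipe_of_not (W := W) (by simpa using ht), wipe_of_not (by simpa using ht)]

/-- Erasure is invisible because every query after the test is refused without inspection of the
state. It is needed because the group identity revealed for bit 0, compared with the stored secrets,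
would still determine Δ. -/
theorem wipe_step (v : BFVersion) (att : Attacker) (W : World Φ) (q : List Str) : (PMF.pure
    W.wipe).bind (fun W => (anonOracle Φ v att .group q W).map fun y => (y.1, y.2.wipe)) =
    (anonOracle Φ v att .group q W).bind fun y => (PMF.pure y.2.wipe).map fun s => (y.1, s) := by
  rw [PMF.pure_bind]
  by_cases ht : W.tested = true
  · rw [anonOracle_tested (by rw [wipe_tested]; exact ht), anonOracle_tested ht]
    simp only [map_eq_bind, PMF.pure_bind, wipe_wipe]
  · rw [wipe_of_not (W := W) (by simpa using ht)]
    simp only [map_eq_bind, PMF.pure_bind]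

end World

theorem Adversary.guess_wiped (A : Adversary) (Φ : Family) (v : BFVersion) (att : Attacker) (κ : ℕ)
    (W : World Φ) (hW : W.tested = false) :
    A.guess (wipedGame Φ v att) κ W = A.guess (anonGame Φ v att .group) κ W := by
  have h := A.run_eq (Γ₁ := wipedGame Φ v att) (Γ₂ := anonGame Φ v att .group) κ
    (fun W => PMF.pure (World.wipe W)) (fun _ => True) (fun _ _ _ _ _ => trivial)
    (fun W q _ => World.wipe_step v att W q)
    (A.bound.eval κ) W [] ((encodeList ((anonGame Φ v att .group).greet W)).take (A.bound.eval κ))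
    trivial
  refine Eq.trans (Eq.symm ?_) h
  refine (PMF.pure_bind _ _).trans ?_
  rw [World.wipe_of_not hW]
  rfl

namespace World

variable {Φ : Family}

/-- A random system whose hidden bit is `0` and that behaves like `W`, where the hidden bit is
`1`. -/
def unbit (W : World Φ) : PMF (World Φ) :=
  if W.tested then PMF.pure { W with b := false }
  else (uniformStr (Φ.n W.d)).map fun Δ => W.remap (.shift Δ)

/-- The core of group anonymity, one query at a time. Before the test, the system with bit 1
corresponds to the system with bit 0 whose ProSe secrets are shifted by a uniform Δ not yet seen by
the attacker. The query that reveals something is the test: its real answer in the shifted system is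
GID ⊕ Δ, and this use of Δ turns it into the fake answer of the other system. -/
theorem wiped_step (v : BFVersion) (att : Attacker) (W : World Φ) (q : List Str)
    (hb : W.b = true) (hw : W.wipe = W)
    (hW : W.tested = false → W.Sound) :
    W.unbit.bind (fun W => (anonOracle Φ v att .group q W).map fun y => (y.1, y.2.wipe)) =
      ((anonOracle Φ v att .group q W).map fun y => (y.1, y.2.wipe)).bind fun y =>
        y.2.unbit.map fun s => (y.1, s) := by
  by_cases ht : W.tested = true
  · have h1 : ({ W with b := false } : World Φ).wipe = { W with b := false } := by
      conv_rhs => rw [← hw]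
      rw [wipe, if_pos (by exact ht), wipe, if_pos ht]
      rfl
    rw [anonOracle_tested ht]
    simp only [map_eq_bind, PMF.pure_bind, hw]
    simp only [unbit, ht, if_true, PMF.pure_bind]
    rw [ht] at h1
    rw [anonOracle_tested rfl, PMF.pure_bind]
    simp only [h1]
  have ht' : W.tested = false := by simpa using ht
  have hs := hW ht'
  have hunbit : ∀ W' : World Φ, W'.tested = false →
      W'.unbit = (uniformStr (Φ.n W'.d)).map fun Δ => W'.remap (.shift Δ) := by
    intro W' h
    unfold unbit; rw [h]; rfl
  have hΔ : ∀ W' : World Φ, ∀ Δ ∈ (uniformStr (Φ.n W'.d)).support, Δ.length = Φ.n W'.d :=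
    fun W' Δ h => length_of_mem_uniformStr h
  have hsh : ∀ Δ, (W.remap (.shift Δ)).tested = false := fun Δ => ht'
  rw [hunbit W ht', PMF.bind_map]
  simp only [Function.comp_def]
  -- answers that are computed from a tape
  have hcore : ∀ Q, Query.parse q = some Q → (∀ k, Q ≠ .register k) → (∀ k, Q ≠ .test k) →
      (∀ a b c d e, Q ≠ .prose a b c d e) → Q ≠ .newGroup →
      ((uniformStr (Φ.n W.d)).bind fun Δ =>
        (anonOracle Φ v att .group q (W.remap (.shift Δ))).map fun y => (y.1, y.2.wipe)) =
      ((anonOracle Φ v att .group q W).map fun y => (y.1, y.2.wipe)).bind fun y =>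
        y.2.unbit.map fun s => (y.1, s) := by
    intro Q hQ h1 h2 h3 h4
    have e1 : ∀ Δ, anonOracle Φ v att .group q (W.remap (.shift Δ)) = _ := fun Δ =>
      anonOracle_eq (hsh Δ) hQ h1 h2 h3
    rw [anonOracle_eq ht' hQ h1 h2 h3]
    simp only [e1, PMF.map_comp, PMF.bind_map, Function.comp_def]
    have hd : ∀ Δ, (W.remap (.shift Δ)).d = W.d := fun _ => rfl
    simp only [hd]
    simp only [map_eq_bind]
    rw [PMF.bind_comm]
    refine bind_congr fun τ _ => ?_
    have hsame := sameUsers_core W h4 τ (W.ctI v Q τ (W.identOf Q.initiator))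
      (W.ctJ v Q τ (W.identOf Q.responder))
      (W.openT v (reqI (W.request Q τ (W.ctI v Q τ (W.identOf Q.initiator))
      (W.ctJ v Q τ (W.identOf Q.responder)))))
      (W.openT v (reqJ (W.request Q τ (W.ctI v Q τ (W.identOf Q.initiator))
      (W.ctJ v Q τ (W.identOf Q.responder)))))
    change W.SameUsers (W.answerWith v Q τ).2 at hsame
    have htt : (W.answerWith v Q τ).2.tested = false := by
      rw [sameUsers_tested hsame]; exact ht'
    rw [wipe_of_not htt, hunbit _ htt]
    have hdd : (W.answerWith v Q τ).2.d = W.d := by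
      unfold SameUsers at hsame; rw [hsame]
    simp only [map_eq_bind, PMF.bind_bind, PMF.pure_bind]
    rw [hdd]
    refine bind_congr fun Δ hΔ' => ?_
    rw [answerWith_shift v hs (hΔ W Δ hΔ') h4, wipe_of_not]
    exact htt
  have hself : ∀ l : List Str,
      ((uniformStr (Φ.n W.d)).bind fun Δ => (PMF.pure (l, W.remap (.shift Δ))).map fun y =>
        (y.1, y.2.wipe)) =
      ((PMF.pure (l, W)).map fun y : List Str × World Φ => (y.1, y.2.wipe)).bind fun y =>
        y.2.unbit.map fun s => (y.1, s) := by
    intro l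
    simp only [map_eq_bind, PMF.pure_bind, wipe_of_not ht', hunbit W ht', PMF.bind_bind,
      wipe_of_not (hsh _)]
  cases hQ : Query.parse q with
  | none =>
    have e : ∀ W' : World Φ, W'.tested = false →
        anonOracle Φ v att .group q W' = PMF.pure ([], W') := by
      intro W' h
      unfold anonOracle; rw [h, hQ]; rfl
    simp only [e _ (hsh _), e W ht']
    exact hself []
  | some Q =>
    cases Q with
    | newGroup =>
      have e : ∀ W' : World Φ, W'.tested = false →
          anonOracle Φ v att .group q W' = W'.newGroup := by
        intro W' h; unfold anonOracle; rw [h, hQ]; rfl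
      simp only [e _ (hsh _), e W ht', newGroup, PMF.map_comp, PMF.bind_map, Function.comp_def]
      simp only [map_eq_bind, wipe, ht', hsh, Bool.false_eq_true, if_false, unbit,
        PMF.bind_bind, PMF.pure_bind]
      conv_rhs => rw [PMF.bind_comm]
      refine bind_congr fun Δ hΔ' => ?_
      change ((uniformStr (Φ.n W.d)).bind fun x => _) = _
      -- A fresh group identity in the shifted system is again uniform after a shift by Δ, so it may
      -- be drawn first in the original system and shifted afterwards.
      conv_lhs => rw [← uniformStr_map_xorStr (hΔ W Δ hΔ')]
      simp only [PMF.bind_map, Function.comp_def]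
      refine bind_congr fun gid _ => ?_
      simp [remap_shift_eq]
      rfl
    | register grp =>
      have e : ∀ W' : World Φ, W'.tested = false →
          anonOracle Φ v att .group q W' = W'.register (att = .hss) grp := by
        intro W' h; unfold anonOracle; rw [h, hQ]; rfl
      simp only [e _ (hsh _), e W ht']
      cases hg : W.gids[grp]? with
      | none =>
        have e1 : W.register (att = .hss) grp = PMF.pure ([], W) := by
          unfold register; rw [hg]
        have e2 : ∀ Δ, (W.remap (.shift Δ)).register (att = .hss) grp =
            PMF.pure ([], W.remap (.shift Δ)) := by
          intro Δ
          unfold register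
          rw [show (W.remap (.shift Δ)).gids[grp]? = none by
            simp only [remap, Remap.shift, List.getElem?_map, hg, Option.map_none]]
        simp only [e1, e2]
        exact hself []
      | some gid =>
        have e2 : ∀ Δ, (W.remap (.shift Δ)).gids[grp]? = some (xorStr gid Δ) := by
          intro Δ
          simp only [remap, Remap.shift, List.getElem?_map, hg, Option.map_some]
        simp only [register, e2, hg]
        have hd : ∀ Δ, (W.remap (.shift Δ)).d = W.d := fun _ => rfl
        simp only [hd]
        simp only [map_eq_bind, PMF.bind_bind, PMF.pure_bind, wipe, ht', hsh,
          Bool.false_eq_true, if_false, unbit]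
        rw [PMF.bind_comm]
        refine bind_congr fun ident _ => ?_
        rw [PMF.bind_comm]
        refine bind_congr fun aid _ => ?_
        rw [PMF.bind_comm]
        refine bind_congr fun key _ => ?_
        refine bind_congr fun Δ hΔ' => ?_
        have hk : (W.remap (.shift Δ)).kp = xorStr W.kp Δ := rfl
        have hle : Δ.length ≤ W.kp.length := by rw [hs.kp, hΔ W Δ hΔ']
        -- The authorization key issued to the new device is the same in both systems.
        rw [hk, xorStr_cancel_pair hle]
        simp only [remap_shift_eq]
        rfl
    | prose a b c d e =>
      have e' : ∀ W' : World Φ, W'.tested = false → anonOracle Φ v att .group q W' =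
          PMF.pure (if att = .hss then ((W'.prose a d e).map fun x => [x.1, x.2]).getD [] else [],
            W') := by
        intro W' h
        unfold anonOracle; grind
      simp only [e' _ (hsh _), e' W ht']
      rw [← hself]
      refine bind_congr fun Δ hΔ' => ?_
      rw [hs.keepsProse (hΔ W Δ hΔ')]
    | test k =>
      have e : ∀ W' : World Φ, W'.tested = false →
          anonOracle Φ v att .group q W' = W'.test .group k := by
        intro W' h; unfold anonOracle; rw [h, hQ]; rfl
      simp only [e _ (hsh _), e W ht', test_eq, testOwner_shift]
      cases hi : W.testOwner k with
      | none => exact hself []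
      | some i =>
        have hlt := testOwner_lt hi
        have hu := List.getElem?_eq_getElem hlt
        set u := W.ues[i] with hu_def
        have hgrp : u.group < W.gids.length := hs.group u (List.getElem_mem hlt)
        have ha : ∀ Δ f, (W.remap (.shift Δ)).testAnswer .group i f = xorStr Δ (W.gid u) := by
          intro Δ f
          unfold testAnswer gidOf
          rw [remap_shift_ues, hu]
          simp only [Option.map_some, Option.getD_some]
          rw [gid_shift Δ hgrp, xorStr_comm]
          rfl
        have ha' : ∀ f, W.testAnswer .group i f = f := by
          intro f; unfold testAnswer; rw [hb]; rfl
        simp only [Option.elim_some, ha, ha', map_eq_bind, PMF.bind_const, PMF.bind_bind,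
          PMF.pure_bind, wipe, if_true, unbit]
        -- The fake answer is written as Δ ⊕ GID with uniform Δ, which is the real answer in the
        -- shifted system; both states are erased and no longer remember Δ.
        conv_rhs => rw [← uniformStr_map_xorStr (hs.length_gid hgrp)]
        simp only [PMF.bind_map, Function.comp_def]
        refine bind_congr fun Δ _ => ?_
        simp only [remap_shift_eq, remap_wipe_eq, if_true, PMF.pure_bind]
        rfl
    | _ => exact hcore _ hQ nofun nofun nofun nofun

theorem Sound.start₀ (Φ : Family) (d : Str) (g : Φ.G d) (msk : ℕ) {kp : Str} (b : Bool)
    (h : kp.length = Φ.n d) : (start₀ Φ d g msk kp b).Sound :=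
  ⟨h, nofun, nofun⟩

theorem wiped_inv (v : BFVersion) (att : Attacker) (W : World Φ) (q : List Str)
    (hW : W.b = true ∧ W.wipe = W ∧ (W.tested = false → W.Sound)) (y)
    (hy : y ∈ ((anonOracle Φ v att .group q W).map fun y => (y.1, y.2.wipe)).support) :
    y.2.b = true ∧ y.2.wipe = y.2 ∧ (y.2.tested = false → y.2.Sound) := by
  rw [PMF.mem_support_map_iff] at hy
  obtain ⟨z, hz, rfl⟩ := hy
  refine ⟨?_, wipe_wipe _, ?_⟩
  · have : z.2.wipe.b = z.2.b := by unfold wipe; split_ifs <;> rfl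
    rw [this, anonOracle_bit q W z hz, hW.1]
  · intro ht
    have ht' : z.2.tested = false := by rwa [wipe_tested] at ht
    rw [wipe_of_not ht']
    rcases step_anonOracle hz with ⟨h1, h2⟩ | ⟨h1, h2⟩
    · rw [h2, h1] at ht'; exact absurd ht' (by simp)
    · exact (hW.2.2 h1).step h2

end World

/-- The initial state of the anonymity games, as a function of the hidden bit. -/
def anonInit (Φ : Family) (κ : ℕ) : PMF (Bool → World Φ) :=
  (Φ.gen κ).bind fun d => (Φ.randGen d).bind fun g => (Φ.randExp d).bind fun s =>
    (uniformStr (Φ.n d)).map fun kp => World.start₀ Φ d g s kp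

theorem anonGame_advantage_eq (A : Adversary) (Φ : Family) (v : BFVersion) (att : Attacker)
    (goal : Goal) (κ : ℕ) :
    A.advantage (anonGame Φ v att goal) κ =
      |(((anonInit Φ κ).bind fun m => A.guess (anonGame Φ v att goal) κ (m true)) true).toReal -
      (((anonInit Φ κ).bind fun m => A.guess (anonGame Φ v att goal) κ (m false)) true).toReal| /
        2 := by
  refine A.advantage_eq (anonGame Φ v att goal) κ World.anonOracle_bit (anonInit Φ κ) ?_ ?_
  · change _ = (anonInit Φ κ).bind fun m =>
      ((PMF.uniformOfFintype Bool).map m : PMF (World Φ))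
    simp only [anonInit, map_eq_bind, PMF.bind_bind, PMF.pure_bind]
    rfl
  · intro m hm b
    obtain ⟨d, -, hm⟩ := (PMF.mem_support_bind_iff _ _ _).mp hm
    obtain ⟨g, -, hm⟩ := (PMF.mem_support_bind_iff _ _ _).mp hm
    obtain ⟨s, -, hm⟩ := (PMF.mem_support_bind_iff _ _ _).mp hm
    obtain ⟨kp, -, rfl⟩ := (PMF.mem_support_map_iff _ _ _).mp hm
    rfl

/-- At the start there are no groups, so the shift affects K_P only. As K_P is uniform, the shifted
initial state has the distribution of an unshifted one, and the simulation of `wiped_step` connects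
the two games themselves. -/
theorem guess_group_eq (A : Adversary) (Φ : Family) (v : BFVersion) (att : Attacker) (κ : ℕ)
    (d : Str) (g : Φ.G d) (s : ℕ) :
    ((uniformStr (Φ.n d)).bind fun kp =>
      A.guess (anonGame Φ v att .group) κ (World.start₀ Φ d g s kp false)) =
    (uniformStr (Φ.n d)).bind fun kp =>
      A.guess (anonGame Φ v att .group) κ (World.start₀ Φ d g s kp true) := by
  simp only [← A.guess_wiped Φ v att κ (World.start₀ Φ d g s _ _) rfl]
  have h : ∀ kp ∈ (uniformStr (Φ.n d)).support,
      ((uniformStr (Φ.n d)).bind fun Δ => A.guess (wipedGame Φ v att) κ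
        (World.start₀ Φ d g s (xorStr kp Δ) false)) =
      A.guess (wipedGame Φ v att) κ (World.start₀ Φ d g s kp true) := by
    intro kp hkp
    have hl := length_of_mem_uniformStr hkp
    have h := A.run_eq (Γ₁ := wipedGame Φ v att) (Γ₂ := wipedGame Φ v att) κ
      World.unbit (fun W => World.b W = true ∧ World.wipe W = W ∧
        (World.tested W = false → World.Sound W))
      (fun W q hW y hy => World.wiped_inv v att W q hW y hy)
      (fun W q hW => World.wiped_step v att W q hW.1 hW.2.1 hW.2.2)
      (A.bound.eval κ) (World.start₀ Φ d g s kp true) []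
      ((encodeList ((anonGame Φ v att .group).greet (World.start₀ Φ d g s kp true))).take
        (A.bound.eval κ))
      ⟨rfl, rfl, fun _ => World.Sound.start₀ Φ d g s true hl⟩
    refine Eq.trans (Eq.symm ?_) h
    refine (PMF.bind_map _ _ _).trans ?_
    rfl
  have h2 := bind_congr (p := uniformStr (Φ.n d)) h
  rw [← h2, PMF.bind_comm]
  have h3 : ∀ Δ ∈ (uniformStr (Φ.n d)).support,
      ((uniformStr (Φ.n d)).bind fun kp => A.guess (wipedGame Φ v att) κ
        (World.start₀ Φ d g s (xorStr kp Δ) false)) =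
      ((uniformStr (Φ.n d)).bind fun kp => A.guess (wipedGame Φ v att) κ
        (World.start₀ Φ d g s kp false)) := by
    intro Δ hΔ
    conv_rhs => rw [← uniformStr_map_xorStr (length_of_mem_uniformStr hΔ)]
    exact (PMF.bind_map (uniformStr (Φ.n d)) (fun u => xorStr u Δ) fun kp =>
      A.guess (wipedGame Φ v att) κ (World.start₀ Φ d g s kp false)).symm
  rw [bind_congr h3, PMF.bind_const]

/-- No adversary whatsoever has an advantage against group anonymity. -/
theorem advantage_group (A : Adversary) (Φ : Family) (v : BFVersion) (att : Attacker) (κ : ℕ) :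
    A.advantage (anonGame Φ v att .group) κ = 0 := by
  rw [anonGame_advantage_eq]
  have h : ∀ b, ((anonInit Φ κ).bind fun m => A.guess (anonGame Φ v att .group) κ (m b)) =
      (Φ.gen κ).bind fun d => (Φ.randGen d).bind fun g => (Φ.randExp d).bind fun s =>
        (uniformStr (Φ.n d)).bind fun kp =>
          A.guess (anonGame Φ v att .group) κ (World.start₀ Φ d g s kp b) := by
    intro b
    simp only [anonInit, map_eq_bind, PMF.bind_bind, PMF.pure_bind]
  rw [h, h]
  simp only [guess_group_eq]
  simp

theorem group_secure (Φ : Family) (v : BFVersion) (att : Attacker) :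
    (anonGame Φ v att .group).Secure := by
  intro A
  have h : A.advantage (anonGame Φ v att .group) = fun _ => 0 := by
    funext κ; exact advantage_group A Φ v att κ
  rw [h]
  exact Asymptotics.superpolynomialDecay_zero _ _

/-! ### Lists of uniform strings -/

/-- A list of `k` independent uniform strings. -/
def sampleList (n : ℕ) : ℕ → PMF (List Str)
  | 0 => PMF.pure []
  | k + 1 => (sampleList n k).bind fun l => (uniformStr n).map fun x => l ++ [x]

theorem length_of_mem_sampleList {n k : ℕ} {l : List Str} (h : l ∈ (sampleList n k).support) :
    l.length = k := by
  induction k generalizing l with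
  | zero =>
    simp only [sampleList, PMF.support_pure, Set.mem_singleton_iff] at h
    rw [h]; rfl
  | succ k ih =>
    simp only [sampleList, PMF.mem_support_bind_iff, PMF.mem_support_map_iff] at h
    obtain ⟨l', hl', x, -, rfl⟩ := h
    simp [ih hl']

theorem sampleList_map_getElem? {n k i : ℕ} (hi : i < k) :
    ((sampleList n k).map fun l => (l[i]?).getD []) = uniformStr n := by
  induction k with
  | zero => omega
  | succ k ih =>
    simp only [sampleList, PMF.map_bind, PMF.map_comp, Function.comp_def]
    by_cases h : i < k
    · rw [← ih h, map_eq_bind]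
      refine bind_congr fun l hl => ?_
      have hl' : i < l.length := by rw [length_of_mem_sampleList hl]; exact h
      simp only [List.getElem?_append_left hl', map_eq_bind, PMF.bind_const]
    · have hik : i = k := by omega
      have : ∀ l ∈ (sampleList n k).support,
          ((uniformStr n).map fun x => ((l ++ [x])[i]?).getD []) = uniformStr n := by
        intro l hl
        have hl' := length_of_mem_sampleList hl
        have : ∀ x : Str, ((l ++ [x])[i]?).getD [] = x := by
          intro x
          rw [hik, ← hl', List.getElem?_append_right le_rfl]
          simp
        simp only [this]
        exact PMF.map_id _
      rw [bind_congr this, PMF.bind_const]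

theorem uniformStr_apply_le (n : ℕ) (x : Str) : uniformStr n x ≤ (2⁻¹ : ℝ≥0∞) ^ n := by
  classical
  have hc : (PMF.uniformOfFintype (Fin n → Bool)).map List.ofFn x ≤ (2⁻¹ : ℝ≥0∞) ^ n := by
    rw [PMF.map_apply]
    by_cases h : ∃ f : Fin n → Bool, x = List.ofFn f
    · obtain ⟨f, rfl⟩ := h
      rw [tsum_eq_single f]
      · simp [PMF.uniformOfFintype_apply, ENNReal.inv_pow]
      · intro g hg
        rw [if_neg]
        intro he
        exact hg (List.ofFn_injective he).symm
    · rw [ENNReal.tsum_eq_zero.mpr]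
      · exact zero_le
      · intro g
        rw [if_neg]
        intro he
        exact h ⟨g, he⟩
  exact hc

open Classical in
theorem tsum_uniformStr_mem (n : ℕ) (l : List Str) :
    ∑' x, uniformStr n x * (if x ∈ l then 1 else 0) ≤ l.length * (2⁻¹ : ℝ≥0∞) ^ n := by
  rw [tsum_eq_sum (s := l.toFinset)]
  · calc ∑ x ∈ l.toFinset, uniformStr n x * (if x ∈ l then 1 else 0)
        ≤ ∑ x ∈ l.toFinset, (2⁻¹ : ℝ≥0∞) ^ n := by
          refine Finset.sum_le_sum fun x hx => ?_
          rw [if_pos (List.mem_toFinset.mp hx), mul_one]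
          exact uniformStr_apply_le n x
      _ = l.toFinset.card * (2⁻¹ : ℝ≥0∞) ^ n := by rw [Finset.sum_const, nsmul_eq_mul]
      _ ≤ _ := by
          gcongr
          exact List.toFinset_card_le l
  · intro x hx
    rw [if_neg (by simpa using hx), mul_zero]

-- Union bound: each of the `k` independent samples meets the list `l` with probability at most
-- l.length · 2^(-n). The list must be fixed before the samples are drawn.
open Classical in
theorem tsum_sampleList_mem (n k : ℕ) (l : List Str) :
    ∑' h, sampleList n k h * (if ∃ m ∈ l, m ∈ h then 1 else 0) ≤
      k * (l.length * (2⁻¹ : ℝ≥0∞) ^ n) := by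
  induction k with
  | zero =>
    rw [ENNReal.tsum_eq_zero.mpr]
    · exact zero_le
    · intro h
      by_cases hh : h = []
      · simp [hh]
      · simp [sampleList, hh]
  | succ k ih =>
    simp only [sampleList]
    rw [tsum_bind_mul]
    have hstep : ∀ h : List Str,
        ∑' y, ((uniformStr n).map fun x => h ++ [x]) y *
          (if ∃ m ∈ l, m ∈ y then (1 : ℝ≥0∞) else 0) ≤
        (if ∃ m ∈ l, m ∈ h then 1 else 0) + l.length * (2⁻¹ : ℝ≥0∞) ^ n := by
      intro h
      rw [map_eq_bind, tsum_bind_mul]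
      calc ∑' x, uniformStr n x * ∑' y, (PMF.pure (h ++ [x])) y *
            (if ∃ m ∈ l, m ∈ y then (1 : ℝ≥0∞) else 0)
          ≤ ∑' x, (uniformStr n x * (if ∃ m ∈ l, m ∈ h then (1 : ℝ≥0∞) else 0) +
              uniformStr n x * (if x ∈ l then 1 else 0)) := by
            refine ENNReal.tsum_le_tsum fun x => ?_
            rw [← mul_add]
            gcongr
            rw [tsum_eq_single (h ++ [x])]
            · simp only [PMF.pure_apply, if_true, one_mul]
              by_cases h1 : ∃ m ∈ l, m ∈ h
              · rw [if_pos h1]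
                exact le_trans (by split_ifs <;> simp) le_self_add
              · by_cases h2 : x ∈ l
                · rw [if_pos h2]
                  exact le_trans (by split_ifs <;> simp) le_add_self
                · rw [if_neg, if_neg h1, if_neg h2, add_zero]
                  rintro ⟨m, hm, hm'⟩
                  rcases List.mem_append.mp hm' with hm' | hm'
                  · exact h1 ⟨m, hm, hm'⟩
                  · exact h2 (List.mem_singleton.mp hm' ▸ hm)
            · intro y hy
              simp [PMF.pure_apply, hy]
        _ = (if ∃ m ∈ l, m ∈ h then 1 else 0) + ∑' x, uniformStr n x *
              (if x ∈ l then 1 else 0) := by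
            rw [ENNReal.tsum_add, ENNReal.tsum_mul_right, PMF.tsum_coe, one_mul]
        _ ≤ _ := by gcongr; exact tsum_uniformStr_mem n l
    calc ∑' h, sampleList n k h * ∑' y, ((uniformStr n).map fun x => h ++ [x]) y *
          (if ∃ m ∈ l, m ∈ y then (1 : ℝ≥0∞) else 0)
        ≤ ∑' h, (sampleList n k h * (if ∃ m ∈ l, m ∈ h then 1 else 0) +
            sampleList n k h * (l.length * (2⁻¹ : ℝ≥0∞) ^ n)) := by
          refine ENNReal.tsum_le_tsum fun h => ?_
          rw [← mul_add]
          gcongr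
          exact hstep h
      _ ≤ k * (l.length * (2⁻¹ : ℝ≥0∞) ^ n) + l.length * (2⁻¹ : ℝ≥0∞) ^ n := by
          rw [ENNReal.tsum_add, ENNReal.tsum_mul_right, PMF.tsum_coe, one_mul]
          gcongr
      _ = _ := by push_cast; ring

/-! ### The game with two identities of every device -/

/-- Two candidates for the identity of a device, and the device without its identity. -/
abbrev Slot := (Str × Str) × UE

/-- The state: the system without the identities, the devices with two candidates for their
identities, and a choice of the first or the second candidate for every coming encryption. -/
structure HState (Φ : Family) where
  W : World Φ
  ids : List Slot
  sel : ℕ → Bool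

/-- The chosen candidate. -/
def pick (β : Bool) (p : Str × Str) : Str := bif β then p.2 else p.1

/-- The device that has the identity `m` as one of its candidates. -/
def lookup (ids : List Slot) (m : Str) : Option UE :=
  (ids.find? fun p => p.1.1 == m || p.1.2 == m).map Prod.snd

/-- The chosen candidate for the identity of a device given by its number. -/
def plain (n : ℕ) (β : Bool) (ids : List Slot) (i : ℕ) : Str :=
  ((ids[i]?).map fun p => pick β p.1).getD (List.replicate n false)

namespace HState

variable {Φ : Family}

/-- Registration of a device. Collisions of identities are refused. -/
def registerDevice (grp : ℕ) (τ : Tape) (W : World Φ) (ids : List Slot) :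
    Option (List Str × World Φ × List Slot) :=
  (W.gids[grp]?).bind fun gid =>
    -- Refusing collisions makes every candidate belong to exactly one device. The reduction needs
    -- this to know how HSS/AuC treats its challenge ciphertext.
    if lookup ids τ.si = none ∧ lookup ids τ.sj = none then
      let u : UE := { ident := [], aid := τ.s₃, key := τ.s₄,
                      ak := xorStr (xorStr τ.s₃ gid) W.kp, group := grp }
      some ([W.ues.length.bits], { W with ues := W.ues ++ [u] }, ids ++ [((τ.si, τ.sj), u)])
    else none

/-- The answer to a registration. -/
def register (grp : ℕ) (τ : Tape) (S : HState Φ) : List Str × HState Φ :=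
  ((registerDevice grp τ S.W S.ids).map fun r =>
    (r.1, { S with W := r.2.1, ids := r.2.2 })).getD ([], S)

/-- The test query reveals the first candidate. -/
def test (k : ℕ) (S : HState Φ) : List Str × HState Φ :=
  ((S.W.testOwner k).map fun i => ([plain (Φ.n S.W.d) false S.ids i],
    -- The candidates are erased, so that the revealed string is no longer tied to anything in the
    -- state; later queries are refused anyway.
    { S with W := { S.W with tested := true }, ids := [] })).getD ([], S)

/-- The answer to a query, for given random choices, ciphertexts and devices identified by
HSS/AuC. -/
def final (Q : Query) (τ : Tape) (ci cj : Ctxt) (oi oj : Option UE) (S : HState Φ) :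
    List Str × HState Φ :=
  match Q with
  | .register grp => S.register grp τ
  | .test k => S.test k
  -- Two choices are consumed whether or not the query encrypts anything; the slots can thus be
  -- counted by rounds.
  | Q => ((S.W.core Q τ ci cj oi oj).1,
      { S with W := (S.W.core Q τ ci cj oi oj).2, sel := fun i => S.sel (i + 2) })

/-- Decryption by HSS/AuC. -/
def _root_.GD2C.World.decryptT (v : BFVersion) (W : World Φ) (t : Str × Ctxt) : Option Str :=
  Φ.decrypt v W.d W.g (Φ.extract W.d W.msk t.1) t.2

/-- Decryption by HSS/AuC and search for the device. -/
def openT (v : BFVersion) (S : HState Φ) (t : Str × Ctxt) : Option UE :=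
  (S.W.decryptT v t).bind (lookup S.ids)

/-- The answer to a query for given random choices and plaintexts. -/
def answerWith (v : BFVersion) (Q : Query) (S : HState Φ) (τ : Tape) : List Str × HState Φ :=
  let ci := S.W.ctI v Q τ (plain (Φ.n S.W.d) (S.sel 0) S.ids Q.initiator)
  let cj := S.W.ctJ v Q τ (plain (Φ.n S.W.d) (S.sel 1) S.ids Q.responder)
  let m := S.W.request Q τ ci cj
  S.final Q τ ci cj (S.openT v (World.reqI m)) (S.openT v (World.reqJ m))

/-- Answers to the queries. -/
def oracle (v : BFVersion) (q : List Str) (S : HState Φ) : PMF (List Str × HState Φ) :=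
  if S.W.tested then PMF.pure ([], S) else
  match Query.parse q with
  | none => PMF.pure ([], S)
  | some Q => (Φ.tape S.W.d).map (S.answerWith v Q)

end HState

/-- The game with two identities of every device. -/
def hybridGame (Φ : Family) (v : BFVersion) : Game where
  State := HState Φ
  init κ := (anonInit Φ κ).map fun m => ⟨m false, [], fun _ => false⟩
  greet S := [S.W.d, Φ.encG S.W.d S.W.g, Φ.encG S.W.d (S.W.g ^ S.W.msk)]
  oracle := HState.oracle v
  bit _ := false

/-! ### The game of identity anonymity and the game with two identities -/

/-- The device without its identity. -/
def UE.erase (u : UE) : UE := { u with ident := [] }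

/-- Erases the identities and the hidden bit. -/
def Remap.erase : Remap where
  ue := UE.erase
  kp := id
  gids := id
  bit _ := false
  aid_ue _ := rfl
  key_ue _ := rfl
  ak_ue _ := rfl

/-- The candidates, if `h` holds the second ones (`β = 0`) or the first ones (`β = 1`), and the
others are the identities of the devices. -/
def candidates (β : Bool) (ues : List UE) (h : List Str) : List Slot :=
  List.zipWith (fun u x => ((bif β then (x, u.ident) else (u.ident, x)), u.erase)) ues h

/-- The true identity sits in position β, so encryption always uses it when all choices are β. The
test reveals position 0, which is the true identity for β = 0 and the hidden string for β = 1. -/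
theorem plain_candidates {β : Bool} {ues : List UE} {h : List Str} (hl : h.length = ues.length) (n i
    : ℕ) : plain n β (candidates β ues h) i = ((ues[i]?).map UE.ident).getD (List.replicate n false)
    := by
  unfold plain candidates
  rw [List.getElem?_zipWith]
  by_cases hi : i < ues.length
  · have hi' : i < h.length := by omega
    rw [List.getElem?_eq_getElem hi, List.getElem?_eq_getElem hi']
    cases β <;> rfl
  · rw [List.getElem?_eq_none (by omega : ues.length ≤ i)]
    rfl

theorem plain_candidates_other {ues : List UE} {h : List Str} (hl : h.length = ues.length) {n i : ℕ}
    (hi : i < ues.length) : plain n false (candidates true ues h) i = (h[i]?).getD [] := by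
  unfold plain candidates
  have hi' : i < h.length := by omega
  rw [List.getElem?_zipWith, List.getElem?_eq_getElem hi, List.getElem?_eq_getElem hi']
  rfl

/-- The additional candidates can influence the search of HSS/AuC only if one of them is the
plaintext itself. -/
theorem lookup_candidates {β : Bool} {m : Str} : ∀ {ues : List UE} {h : List Str},
    h.length = ues.length → m ∉ h →
    lookup (candidates β ues h) m = (ues.find? fun u => u.ident == m).map UE.erase
  | [], [], _, _ => rfl
  | u :: ues, x :: h, hl, hm => by
    have ih := lookup_candidates (β := β) (m := m) (ues := ues) (h := h) (by simpa using hl)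
      (fun h' => hm (List.mem_cons_of_mem _ h'))
    have hx : (x == m) = false := by
      rw [beq_eq_false_iff_ne]
      rintro rfl
      exact hm List.mem_cons_self
    unfold lookup candidates at ih ⊢
    have e : ∀ p : Slot, p = ((bif β then (x, u.ident) else (u.ident, x)), u.erase) →
        (p.1.1 == m || p.1.2 == m) = (u.ident == m) := by
      rintro p rfl
      cases β <;> simp [hx]
    rw [List.zipWith_cons_cons, List.find?_cons, List.find?_cons, e _ rfl]
    cases u.ident == m
    · exact ih
    · rfl

theorem lookup_eq_none {ids : List Slot} {m : Str}
    (h : m ∉ ids.map (fun p => p.1.1) ++ ids.map fun p => p.1.2) : lookup ids m = none := by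
  unfold lookup
  rw [Option.map_eq_none_iff, List.find?_eq_none]
  intro p hp
  simp only [List.mem_append, List.mem_map, not_or, not_exists, not_and] at h
  have h1 := h.1 p hp
  have h2 := h.2 p hp
  simp [h1, h2]

theorem candidates_append {β : Bool} {ues : List UE} {h : List Str} (hl : h.length = ues.length) (u
    : UE) (x : Str) : candidates β (ues ++ [u]) (h ++ [x]) = candidates β ues h ++ [((bif β then (x,
    u.ident) else (u.ident, x)), u.erase)] := by
  unfold candidates
  rw [List.zipWith_append hl.symm]
  rfl

namespace World

variable {Φ : Family}

theorem keepsProse_erase (W : World Φ) : W.KeepsProse .erase := by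
  intro sid a b
  have h : ∀ a, (W.remap .erase).ues.find? (fun u => u.aid == a) =
      (W.ues.find? fun u => u.aid == a).map UE.erase := by
    intro a
    simp only [remap, List.find?_map]
    rfl
  unfold prose
  rw [h, h]
  cases W.ues.find? fun u => u.aid == a with
  | none => rfl
  | some u =>
    cases W.ues.find? fun u => u.aid == b with
    | none => rfl
    | some v => rfl

/-- The state of the game with two identities, with hidden candidates `h`. -/
def hide (β : Bool) (W : World Φ) (h : List Str) : HState Φ :=
  ⟨W.remap .erase, candidates β W.ues h, fun _ => β⟩

/-- A random state of the game with two identities that behaves almost like `W`. -/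
def hideRandom (β : Bool) (W : World Φ) : PMF (HState Φ) :=
  if W.tested then PMF.pure ⟨W.remap .erase, [], fun _ => β⟩
  else (sampleList (Φ.n W.d) W.ues.length).map (W.hide β)

theorem testOwner_erase (W : World Φ) (k : ℕ) : (W.remap .erase).testOwner k = W.testOwner k := by
  unfold testOwner
  have : (W.remap .erase).ues.length = W.ues.length := List.length_map ..
  rw [this]; rfl

/-- The plaintexts that HSS/AuC recovers during the answer to a query. -/
def recovered (v : BFVersion) (Q : Query) (W : World Φ) (τ : Tape) : List Str :=
  let m := W.request Q τ (W.ctI v Q τ (W.identOf Q.initiator))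
    (W.ctJ v Q τ (W.identOf Q.responder))
  (W.decryptT v (reqI m)).toList ++ (W.decryptT v (reqJ m)).toList

theorem length_recovered (v : BFVersion) (Q : Query) (W : World Φ) (τ : Tape) :
    (W.recovered v Q τ).length ≤ 2 := by
  unfold recovered
  rw [List.length_append]
  have h : ∀ o : Option Str, o.toList.length ≤ 1 := by intro o; cases o <;> simp
  have h1 := h (W.decryptT v (reqI (W.request Q τ (W.ctI v Q τ (W.identOf Q.initiator))
    (W.ctJ v Q τ (W.identOf Q.responder)))))
  have h2 := h (W.decryptT v (reqJ (W.request Q τ (W.ctI v Q τ (W.identOf Q.initiator))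
    (W.ctJ v Q τ (W.identOf Q.responder)))))
  omega

theorem openT_hide {v : BFVersion} {β : Bool} {W : World Φ} {h : List Str} (hl : h.length =
    W.ues.length) {t : Str × Ctxt} (ht : ∀ m, W.decryptT v t = some m → m ∉ h) : (W.hide β h).openT
    v t = (W.openT v t).map Remap.erase.ue := by
  change (W.decryptT v t).bind (lookup (candidates β W.ues h)) =
    ((W.decryptT v t).bind fun m => W.ues.find? fun u => u.ident == m).map _
  cases hm : W.decryptT v t with
  | none => rfl
  | some m =>
    simp only [Option.bind_some]
    exact lookup_candidates hl (ht m hm)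

/-- The hidden candidates enter an answer only through the two searches of HSS/AuC, so for a fixed
tape the answers agree unless a recovered plaintext is one of them. -/
theorem answerWith_hide {v : BFVersion} {β : Bool} {W : World Φ} {Q : Query}
    (h₁ : ∀ k, Q ≠ .register k) (h₂ : ∀ k, Q ≠ .test k) {h : List Str}
    (hl : h.length = W.ues.length) (τ : Tape) (hh : ∀ m ∈ W.recovered v Q τ, m ∉ h) :
    (W.hide β h).answerWith v Q τ =
      ((W.answerWith v Q τ).1, (W.answerWith v Q τ).2.hide β h) := by
  have hp : ∀ i, plain (Φ.n W.d) β (candidates β W.ues h) i = W.identOf i :=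
    fun i => plain_candidates hl _ i
  have hci : (W.hide β h).W.ctI v Q τ (plain (Φ.n (W.hide β h).W.d) ((W.hide β h).sel 0)
      (W.hide β h).ids Q.initiator) = W.ctI v Q τ (W.identOf Q.initiator) := by
    rw [← hp]; exact ctI_remap .erase v W Q τ _
  have hcj : (W.hide β h).W.ctJ v Q τ (plain (Φ.n (W.hide β h).W.d) ((W.hide β h).sel 1)
      (W.hide β h).ids Q.responder) = W.ctJ v Q τ (W.identOf Q.responder) := by
    rw [← hp]; exact ctJ_remap .erase v W Q τ _
  have hrec : ∀ t, t = reqI (W.request Q τ (W.ctI v Q τ (W.identOf Q.initiator))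
      (W.ctJ v Q τ (W.identOf Q.responder))) ∨
      t = reqJ (W.request Q τ (W.ctI v Q τ (W.identOf Q.initiator))
      (W.ctJ v Q τ (W.identOf Q.responder))) → ∀ m, W.decryptT v t = some m → m ∉ h := by
    intro t ht m hm
    refine hh m ?_
    unfold recovered
    rcases ht with rfl | rfl
    · exact List.mem_append_left _ (by rw [hm]; simp)
    · exact List.mem_append_right _ (by rw [hm]; simp)
  unfold HState.answerWith World.answerWith
  simp only [hci, hcj]
  have hr : ∀ ci cj, (W.hide β h).W.request Q τ ci cj = W.request Q τ ci cj :=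
    fun ci cj => request_remap .erase W Q τ ci cj
  simp only [hr]
  rw [openT_hide hl (hrec _ (Or.inl rfl)), openT_hide hl (hrec _ (Or.inr rfl))]
  generalize W.ctI v Q τ (W.identOf Q.initiator) = ci
  generalize W.ctJ v Q τ (W.identOf Q.responder) = cj
  generalize W.openT v (reqI (W.request Q τ ci cj)) = oi
  generalize W.openT v (reqJ (W.request Q τ ci cj)) = oj
  have hcore : (W.remap .erase).core Q τ ci cj (oi.map Remap.erase.ue) (oj.map Remap.erase.ue) =
      ((W.core Q τ ci cj oi oj).1, (W.core Q τ ci cj oi oj).2.remap .erase) := by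
    by_cases hQ : Q = .newGroup
    · rw [hQ]; rfl
    · exact core_remap .erase (keepsProse_erase W) hQ τ ci cj oi oj
  have hues : (W.core Q τ ci cj oi oj).2.ues = W.ues := by
    by_cases hQ : Q = .newGroup
    · rw [hQ]; rfl
    · have := sameUsers_core W hQ τ ci cj oi oj
      unfold SameUsers at this
      rw [this]
  have hfin : (W.hide β h).final Q τ ci cj (oi.map Remap.erase.ue) (oj.map Remap.erase.ue) =
      (((W.remap .erase).core Q τ ci cj (oi.map Remap.erase.ue) (oj.map Remap.erase.ue)).1,
        ⟨((W.remap .erase).core Q τ ci cj (oi.map Remap.erase.ue) (oj.map Remap.erase.ue)).2,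
          candidates β W.ues h, fun _ => β⟩) := by
    unfold HState.final
    cases Q with
    | register k => exact absurd rfl (h₁ k)
    | test k => exact absurd rfl (h₂ k)
    | _ => rfl
  rw [hfin, hcore]
  unfold hide
  rw [hues]

theorem tape_bind_strings {X : Type} (Ψ : BFFamily) (d : Str) (f : Str → Str → Str → Str → PMF X) :
    ((Ψ.tape d).bind fun τ => f τ.si τ.sj τ.s₃ τ.s₄) = (uniformStr (Ψ.n d)).bind fun a =>
    (uniformStr (Ψ.n d)).bind fun b => (uniformStr (Ψ.n d)).bind fun c => (uniformStr (Ψ.n d)).bind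
    fun e => f a b c e := by
  simp only [BFFamily.tape, map_eq_bind, PMF.bind_bind, PMF.pure_bind, PMF.bind_const]

/-- The tape is drawn before the hidden candidates. It determines at most two recovered plaintexts,
and these are fixed strings when the candidates are sampled, so the union bound of
`tsum_sampleList_mem` applies. -/
theorem near_core {v : BFVersion} {β : Bool} {W : World Φ} {q : List Str} {Q : Query}
    (ht : W.tested = false) (hQ : Query.parse q = some Q)
    (h₁ : ∀ k, Q ≠ .register k) (h₂ : ∀ k, Q ≠ .test k) (h₃ : ∀ a b c d e, Q ≠ .prose a b c d e) :
    Near (W.ues.length * (2 * (2⁻¹ : ℝ≥0∞) ^ Φ.n W.d))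
      ((W.hideRandom β).bind (HState.oracle v q))
      ((anonOracle Φ v .outsider .identity q W).bind fun y =>
        (y.2.hideRandom β).map fun s => (y.1, s)) := by
  classical
  have htt : ∀ τ, (W.answerWith v Q τ).2.tested = false ∧ (W.answerWith v Q τ).2.ues = W.ues ∧
      (W.answerWith v Q τ).2.d = W.d := by
    intro τ
    by_cases hN : Q = .newGroup
    · rw [hN]; exact ⟨ht, rfl, rfl⟩
    · have := sameUsers_core W hN τ (W.ctI v Q τ (W.identOf Q.initiator))
        (W.ctJ v Q τ (W.identOf Q.responder))
        (W.openT v (reqI (W.request Q τ (W.ctI v Q τ (W.identOf Q.initiator))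
          (W.ctJ v Q τ (W.identOf Q.responder)))))
        (W.openT v (reqJ (W.request Q τ (W.ctI v Q τ (W.identOf Q.initiator))
          (W.ctJ v Q τ (W.identOf Q.responder)))))
      change W.SameUsers (W.answerWith v Q τ).2 at this
      unfold SameUsers at this
      rw [this]
      exact ⟨ht, rfl, rfl⟩
  have hL : (W.hideRandom β).bind (HState.oracle v q) = (Φ.tape W.d).bind fun τ =>
      (sampleList (Φ.n W.d) W.ues.length).bind fun h =>
        PMF.pure ((W.hide β h).answerWith v Q τ) := by
    rw [PMF.bind_comm]
    unfold hideRandom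
    rw [ht]
    simp only [Bool.false_eq_true, if_false, map_eq_bind, PMF.bind_bind, PMF.pure_bind]
    refine bind_congr fun h _ => ?_
    unfold HState.oracle
    have : (W.hide β h).W.tested = false := ht
    rw [this, hQ]
    rfl
  have hR : ((anonOracle Φ v .outsider .identity q W).bind fun y =>
        (y.2.hideRandom β).map fun s => (y.1, s)) = (Φ.tape W.d).bind fun τ =>
      (sampleList (Φ.n W.d) W.ues.length).bind fun h =>
        PMF.pure ((W.answerWith v Q τ).1, (W.answerWith v Q τ).2.hide β h) := by
    rw [anonOracle_eq ht hQ h₁ h₂ h₃, PMF.bind_map]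
    refine bind_congr fun τ _ => ?_
    obtain ⟨e1, e2, e3⟩ := htt τ
    simp only [Function.comp_def, hideRandom, e1, e2, e3, Bool.false_eq_true, if_false,
      map_eq_bind, PMF.bind_bind, PMF.pure_bind]
  rw [hL, hR]
  refine Near.bind fun τ _ => ?_
  refine (Near.bind_of_bad (ε := 0) {h | ∃ m ∈ W.recovered v Q τ, m ∈ h}
    (δ := W.ues.length * (2 * (2⁻¹ : ℝ≥0∞) ^ Φ.n W.d)) ?_ ?_).mono (by rw [zero_add])
  · intro h hh hbad
    refine Near.of_eq ?_
    rw [answerWith_hide h₁ h₂ (length_of_mem_sampleList hh)]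
    intro m hm hm'
    exact hbad ⟨m, hm, hm'⟩
  · refine (tsum_sampleList_mem (Φ.n W.d) W.ues.length (W.recovered v Q τ)).trans ?_
    gcongr
    exact_mod_cast length_recovered v Q W τ

end World

namespace World

variable {Φ : Family}

theorem hideRandom_eq {β : Bool} {W : World Φ} (ht : W.tested = false) :
    W.hideRandom β = (sampleList (Φ.n W.d) W.ues.length).map (W.hide β) := by
  unfold hideRandom; rw [ht]; rfl

theorem register_hide {β : Bool} {W : World Φ} {h : List Str} (hl : h.length = W.ues.length)
    {grp : ℕ} {gid : Str} (hg : W.gids[grp]? = some gid) (τ : Tape)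
    (h₁ : lookup (candidates β W.ues h) τ.si = none)
    (h₂ : lookup (candidates β W.ues h) τ.sj = none) :
    (W.hide β h).register grp τ = ([W.ues.length.bits],
      hide β { W with ues := W.ues ++ [UE.mk (bif β then τ.sj else τ.si) τ.s₃ τ.s₄
            (xorStr (xorStr τ.s₃ gid) W.kp) grp] }
        (h ++ [bif β then τ.si else τ.sj])) := by
  have e : (W.hide β h).W.gids[grp]? = some gid := hg
  unfold HState.register HState.registerDevice
  rw [e]
  have h₁' : lookup (W.hide β h).ids τ.si = none := h₁
  have h₂' : lookup (W.hide β h).ids τ.sj = none := h₂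
  simp only [Option.bind_some, h₁', h₂', and_self, if_true, Option.map_some, Option.getD_some]
  unfold hide
  rw [candidates_append hl]
  cases β <;> simp [remap, Remap.erase, UE.erase]

theorem near_register {v : BFVersion} {β : Bool} {W : World Φ} {q : List Str} {grp : ℕ}
    (ht : W.tested = false) (hQ : Query.parse q = some (.register grp)) :
    Near (W.ues.length * (4 * (2⁻¹ : ℝ≥0∞) ^ Φ.n W.d))
      ((W.hideRandom β).bind (HState.oracle v q))
      ((anonOracle Φ v .outsider .identity q W).bind fun y =>
        (y.2.hideRandom β).map fun s => (y.1, s)) := by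
  classical
  have hO : ∀ h, HState.oracle v q (W.hide β h) =
      (Φ.tape W.d).map fun τ => (W.hide β h).register grp τ := by
    intro h
    unfold HState.oracle
    have : (W.hide β h).W.tested = false := ht
    rw [this, hQ]
    rfl
  have hA : anonOracle Φ v .outsider .identity q W = W.register false grp := by
    unfold anonOracle
    rw [ht, hQ]
    rfl
  rw [hideRandom_eq ht, hA, PMF.bind_map]
  simp only [Function.comp_def, hO]
  cases hg : W.gids[grp]? with
  | none =>
    refine Near.of_eq ?_
    have e1 : ∀ h τ, (W.hide β h).register grp τ = ([], W.hide β h) := by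
      intro h τ
      unfold HState.register HState.registerDevice
      have : (W.hide β h).W.gids[grp]? = none := hg
      rw [this]; rfl
    have e2 : W.register false grp = PMF.pure ([], W) := by unfold register; rw [hg]
    simp only [e1, e2, map_eq_bind, PMF.bind_const, PMF.pure_bind, hideRandom_eq ht, PMF.bind_bind]
  | some gid =>
    have hL : ∀ h, ((Φ.tape W.d).map fun τ => (W.hide β h).register grp τ) =
        (uniformStr (Φ.n W.d)).bind fun a => (uniformStr (Φ.n W.d)).bind fun b =>
        (uniformStr (Φ.n W.d)).bind fun c => (uniformStr (Φ.n W.d)).bind fun e =>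
          PMF.pure ((W.hide β h).register grp ⟨0, 0, 0, a, 0, 0, b, c, e, []⟩) := by
      intro h
      exact tape_bind_strings Φ.toBFFamily W.d fun a b c e =>
        PMF.pure ((W.hide β h).register grp ⟨0, 0, 0, a, 0, 0, b, c, e, []⟩)
    have hR : ((W.register false grp).bind fun y => (y.2.hideRandom β).map fun s => (y.1, s)) =
        (sampleList (Φ.n W.d) W.ues.length).bind fun h =>
        (uniformStr (Φ.n W.d)).bind fun a => (uniformStr (Φ.n W.d)).bind fun b =>
        (uniformStr (Φ.n W.d)).bind fun c => (uniformStr (Φ.n W.d)).bind fun e =>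
          PMF.pure ([W.ues.length.bits],
            hide β { W with ues := W.ues ++ [UE.mk (bif β then b else a) c e
            (xorStr (xorStr c gid) W.kp) grp] }
              (h ++ [bif β then a else b])) := by
      have e1 : W.register false grp = (uniformStr (Φ.n W.d)).bind fun i =>
          (uniformStr (Φ.n W.d)).bind fun c => (uniformStr (Φ.n W.d)).bind fun e =>
          PMF.pure ([W.ues.length.bits], { W with ues := W.ues ++ [UE.mk i c e
            (xorStr (xorStr c gid) W.kp) grp] }) := by
        unfold register; rw [hg]; rfl
      have e2 : ∀ i c e, hideRandom β { W with ues := W.ues ++ [UE.mk i c e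
            (xorStr (xorStr c gid) W.kp) grp] } =
          (sampleList (Φ.n W.d) W.ues.length).bind fun h => (uniformStr (Φ.n W.d)).bind fun x =>
          PMF.pure (hide β { W with ues := W.ues ++ [UE.mk i c e
            (xorStr (xorStr c gid) W.kp) grp] } (h ++ [x])) := by
        intro i c e
        rw [hideRandom_eq (by exact ht)]
        simp only [List.length_append, List.length_singleton, sampleList, map_eq_bind,
          PMF.bind_bind, PMF.pure_bind]
      rw [e1]
      simp only [PMF.bind_bind, PMF.pure_bind, e2, map_eq_bind]
      -- order of the independent samples
      have e3 : ∀ F : Str → Str → Str → List Str → Str → PMF (List Str × HState Φ),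
          ((uniformStr (Φ.n W.d)).bind fun i => (uniformStr (Φ.n W.d)).bind fun c =>
            (uniformStr (Φ.n W.d)).bind fun e =>
            (sampleList (Φ.n W.d) W.ues.length).bind fun h =>
            (uniformStr (Φ.n W.d)).bind fun x => F i c e h x) =
          (sampleList (Φ.n W.d) W.ues.length).bind fun h =>
            (uniformStr (Φ.n W.d)).bind fun i => (uniformStr (Φ.n W.d)).bind fun x =>
            (uniformStr (Φ.n W.d)).bind fun c => (uniformStr (Φ.n W.d)).bind fun e =>
              F i c e h x := by
        intro F
        have s1 : ∀ i c, ((uniformStr (Φ.n W.d)).bind fun e =>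
            (sampleList (Φ.n W.d) W.ues.length).bind fun h =>
            (uniformStr (Φ.n W.d)).bind fun x => F i c e h x) =
            (sampleList (Φ.n W.d) W.ues.length).bind fun h => (uniformStr (Φ.n W.d)).bind fun x =>
            (uniformStr (Φ.n W.d)).bind fun e => F i c e h x := by
          intro i c
          rw [PMF.bind_comm]
          refine bind_congr fun h _ => ?_
          rw [PMF.bind_comm]
        simp only [s1]
        have s2 : ∀ i, ((uniformStr (Φ.n W.d)).bind fun c =>
            (sampleList (Φ.n W.d) W.ues.length).bind fun h => (uniformStr (Φ.n W.d)).bind fun x =>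
            (uniformStr (Φ.n W.d)).bind fun e => F i c e h x) =
            (sampleList (Φ.n W.d) W.ues.length).bind fun h => (uniformStr (Φ.n W.d)).bind fun x =>
            (uniformStr (Φ.n W.d)).bind fun c => (uniformStr (Φ.n W.d)).bind fun e =>
              F i c e h x := by
          intro i
          rw [PMF.bind_comm]
          refine bind_congr fun h _ => ?_
          rw [PMF.bind_comm]
        simp only [s2]
        rw [PMF.bind_comm]
      rw [e3]
      refine bind_congr fun h _ => ?_
      -- For β = 1 the true identity is the second candidate, so the two draws have to be exchanged.
      cases β
      · rfl
      · rw [PMF.bind_comm]; rfl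
    rw [hR]
    simp only [hL]
    refine Near.bind fun h hh => ?_
    have hl := length_of_mem_sampleList hh
    set L := (candidates β W.ues h).map (fun p => p.1.1) ++ (candidates β W.ues h).map fun p => p.1.2
      with hLdef
    have hLlen : (L.length : ℝ≥0∞) = 2 * W.ues.length := by
      have : L.length = 2 * W.ues.length := by
        simp only [hLdef, List.length_append, List.length_map, candidates, List.length_zipWith, hl]
        omega
      rw [this]; push_cast; rfl
    have hP : ∑' x, uniformStr (Φ.n W.d) x * (if x ∈ {x : Str | x ∈ L} then 1 else 0) ≤
        W.ues.length * (2 * (2⁻¹ : ℝ≥0∞) ^ Φ.n W.d) := by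
      refine (tsum_uniformStr_mem (Φ.n W.d) L).trans (le_of_eq ?_)
      rw [hLlen]; ring
    -- Each of the two new candidates has to avoid the two candidates of every earlier device. This
    -- happens twice at the price 2·(number of devices)·2^(-n), which explains the constant 4.
    refine (Near.bind_of_bad (ε := W.ues.length * (2 * (2⁻¹ : ℝ≥0∞) ^ Φ.n W.d)) {x : Str | x ∈ L}
      (fun a _ ha => ?_) hP).mono (le_of_eq (by ring))
    refine (Near.bind_of_bad (ε := 0) {x : Str | x ∈ L} (fun b _ hb => ?_) hP).mono (by rw [zero_add])
    refine Near.of_eq ?_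
    refine bind_congr fun c _ => bind_congr fun e _ => ?_
    have la : lookup (candidates β W.ues h) a = none := lookup_eq_none ha
    have lb : lookup (candidates β W.ues h) b = none := lookup_eq_none hb
    rw [register_hide hl hg ⟨0, 0, 0, a, 0, 0, b, c, e, []⟩ la lb]

/-- For β = 0 the first candidate is the true identity. For β = 1 it is a hidden candidate, whose
marginal distribution is uniform, and since the candidates are erased by the test the state carries
no trace of it. So the correspondence is exact. -/
theorem near_test {v : BFVersion} {β : Bool} {W : World Φ} {q : List Str} {k : ℕ}
    (hb : W.b = β) (ht : W.tested = false) (hQ : Query.parse q = some (.test k)) :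
    ((W.hideRandom β).bind (HState.oracle v q)) =
      ((anonOracle Φ v .outsider .identity q W).bind fun y =>
        (y.2.hideRandom β).map fun s => (y.1, s)) := by
  have hO : ∀ h, HState.oracle v q (W.hide β h) = PMF.pure ((W.hide β h).test k) := by
    intro h
    unfold HState.oracle
    have : (W.hide β h).W.tested = false := ht
    rw [this, hQ]
    simp only [Bool.false_eq_true, if_false]
    exact PMF.bind_const (Φ.tape W.d) (PMF.pure ((W.hide β h).test k))
  have hA : anonOracle Φ v .outsider .identity q W = W.test .identity k := by
    unfold anonOracle
    rw [ht, hQ]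
    rfl
  have hto : ∀ h, (W.hide β h).W.testOwner k = W.testOwner k := fun h => testOwner_erase W k
  rw [hideRandom_eq ht, hA, PMF.bind_map, test_eq]
  simp only [Function.comp_def, hO, HState.test, hto]
  cases hi : W.testOwner k with
  | none =>
    simp only [Option.map_none, Option.getD_none, Option.elim_none, PMF.pure_bind,
      hideRandom_eq ht, PMF.map_comp]
    rfl
  | some i =>
    have hlt := testOwner_lt hi
    simp only [Option.map_some, Option.getD_some, Option.elim_some, PMF.bind_map,
      Function.comp_def]
    have e : hideRandom β { W with tested := true } =
        PMF.pure ⟨{ W with tested := true }.remap .erase, [], fun _ => β⟩ := by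
      unfold hideRandom; rfl
    simp only [e, map_eq_bind, PMF.pure_bind]
    have hn : ∀ h, (W.hide β h).W.d = W.d := fun _ => rfl
    cases β with
    | false =>
      have h1 : ∀ h ∈ (sampleList (Φ.n W.d) W.ues.length).support,
          plain (Φ.n (W.hide false h).W.d) false (W.hide false h).ids i = W.identOf i :=
        fun h hh => plain_candidates (length_of_mem_sampleList hh) _ i
      have h2 : ∀ f, W.testAnswer .identity i f = W.identOf i := by
        intro f; unfold testAnswer; rw [hb]; rfl
      simp only [h2, PMF.bind_const]
      refine Eq.trans (bind_congr (G := fun _ => _) fun h hh => ?_)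
        (PMF.bind_const (sampleList (Φ.n W.d) W.ues.length) _)
      rw [h1 h hh]
      rfl
    | true =>
      have h1 : ∀ h ∈ (sampleList (Φ.n W.d) W.ues.length).support,
          plain (Φ.n (W.hide true h).W.d) false (W.hide true h).ids i = (h[i]?).getD [] :=
        fun h hh => plain_candidates_other (length_of_mem_sampleList hh) hlt
      have h2 : ∀ f, W.testAnswer .identity i f = f := by
        intro f; unfold testAnswer; rw [hb]; rfl
      simp only [h2]
      conv_rhs => rw [← sampleList_map_getElem? hlt, PMF.bind_map]
      refine bind_congr fun h hh => ?_
      rw [h1 h hh]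
      rfl

/-- One query to the real system and to the game with two identities. -/
theorem near_step (v : BFVersion) {β : Bool} {W : World Φ} (q : List Str) (hb : W.b = β) :
    Near (W.ues.length * (4 * (2⁻¹ : ℝ≥0∞) ^ Φ.n W.d))
      ((W.hideRandom β).bind (HState.oracle v q))
      ((anonOracle Φ v .outsider .identity q W).bind fun y =>
        (y.2.hideRandom β).map fun s => (y.1, s)) := by
  by_cases ht : W.tested = true
  · refine Near.of_eq ?_
    rw [anonOracle_tested ht]
    simp only [hideRandom, ht, if_true, PMF.pure_bind, map_eq_bind]
    unfold HState.oracle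
    exact if_pos ht
  have ht' : W.tested = false := by simpa using ht
  have hself : ((W.hideRandom β).bind fun S => PMF.pure (([] : List Str), S)) =
      (PMF.pure (([] : List Str), W)).bind fun y => (y.2.hideRandom β).map fun s => (y.1, s) := by
    rw [PMF.pure_bind]; rfl
  have hle : (W.ues.length : ℝ≥0∞) * (2 * (2⁻¹ : ℝ≥0∞) ^ Φ.n W.d) ≤
      W.ues.length * (4 * (2⁻¹ : ℝ≥0∞) ^ Φ.n W.d) := by
    gcongr
    norm_num
  have hto : ∀ S ∈ (W.hideRandom β).support, S.W.tested = false := by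
    intro S hS
    rw [hideRandom_eq ht', PMF.mem_support_map_iff] at hS
    obtain ⟨h, -, rfl⟩ := hS
    exact ht'
  cases hQ : Query.parse q with
  | none =>
    refine Near.of_eq ?_
    have e1 : anonOracle Φ v .outsider .identity q W = PMF.pure ([], W) := by
      unfold anonOracle; rw [ht', hQ]; rfl
    rw [e1, ← hself]
    refine bind_congr fun S hS => ?_
    unfold HState.oracle
    rw [hto S hS, hQ]; rfl
  | some Q =>
    cases Q with
    | register grp => exact near_register ht' hQ
    | test k => exact Near.of_eq (near_test hb ht' hQ)
    | prose a b c d e =>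
      refine Near.of_eq ?_
      have e1 : anonOracle Φ v .outsider .identity q W = PMF.pure ([], W) := by
        unfold anonOracle; rw [ht', hQ]; rfl
      rw [e1, ← hself]
      refine bind_congr fun S hS => ?_
      have hsel : S.sel = fun _ => β := by
        rw [hideRandom_eq ht', PMF.mem_support_map_iff] at hS
        obtain ⟨h, -, rfl⟩ := hS
        rfl
      have hans : ∀ τ, S.answerWith v (.prose a b c d e) τ = ([], S) := by
        intro τ
        have : S.answerWith v (.prose a b c d e) τ =
            ([], { S with sel := fun i => S.sel (i + 2) }) := rfl
        rw [this, hsel, ← hsel]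
      unfold HState.oracle
      rw [hto S hS, hQ]
      simp only [Bool.false_eq_true, if_false, hans, map_eq_bind, PMF.bind_const]
    | _ => exact (near_core ht' hQ nofun nofun nofun).mono hle

end World

/-! ### The hybrid argument -/

namespace HState

variable {Φ : Family}

/-- The choices of the second candidates are not used up to here. -/
def allSecond (S : HState Φ) : HState Φ := { S with sel := fun _ => true }

theorem final_sel (Q : Query) (τ : Tape) (ci cj : Ctxt) (oi oj : Option UE) (S : HState Φ) :
    (S.final Q τ ci cj oi oj).2.sel = S.sel ∨ (S.final Q τ ci cj oi oj).2.sel = fun i => S.sel (i +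
    2) := by
  unfold final
  cases Q with
  | register grp =>
    left
    simp only [register]
    cases registerDevice grp τ S.W S.ids <;> rfl
  | test k =>
    left
    simp only [test]
    cases S.W.testOwner k <;> rfl
  | _ => right; rfl

theorem final_allSecond (Q : Query) (τ : Tape) (ci cj : Ctxt) (oi oj : Option UE) (S : HState Φ) :
    S.allSecond.final Q τ ci cj oi oj = ((S.final Q τ ci cj oi oj).1, (S.final Q τ ci cj oi
    oj).2.allSecond) := by
  unfold final
  cases Q with
  | register grp =>
    simp only [register, allSecond]
    cases registerDevice grp τ S.W S.ids <;> rfl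
  | test k =>
    simp only [test, allSecond]
    cases S.W.testOwner k <;> rfl
  | _ => simp only [allSecond]

theorem answerWith_allSecond (v : BFVersion) (Q : Query) (S : HState Φ) (τ : Tape)
    (h₀ : S.sel 0 = true) (h₁ : S.sel 1 = true) :
    S.allSecond.answerWith v Q τ = ((S.answerWith v Q τ).1, (S.answerWith v Q τ).2.allSecond) := by
  unfold answerWith
  rw [h₀, h₁]
  exact final_allSecond ..

theorem oracle_sel (v : BFVersion) (q : List Str) (S : HState Φ) (y) (hy : y ∈ (HState.oracle v q
    S).support) : y.2.sel = S.sel ∨ y.2.sel = fun i => S.sel (i + 2) := by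
  unfold HState.oracle at hy
  split_ifs at hy
  · rw [PMF.support_pure, Set.mem_singleton_iff] at hy
    rw [hy]; exact Or.inl rfl
  · cases hQ : Query.parse q with
    | none =>
      simp only [hQ, PMF.support_pure, Set.mem_singleton_iff] at hy
      rw [hy]; exact Or.inl rfl
    | some Q =>
      simp only [hQ, PMF.mem_support_map_iff] at hy
      obtain ⟨τ, -, rfl⟩ := hy
      exact final_sel ..

theorem oracle_allSecond (v : BFVersion) (q : List Str) (S : HState Φ) (h₀ : S.sel 0 = true) (h₁ :
    S.sel 1 = true) : (PMF.pure S.allSecond).bind (HState.oracle v q) = (HState.oracle v q S).bind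
    fun y => (PMF.pure y.2.allSecond).map fun s => (y.1, s) := by
  rw [PMF.pure_bind]
  unfold HState.oracle
  have e : S.allSecond.W = S.W := rfl
  rw [e]
  split_ifs
  · simp only [map_eq_bind, PMF.pure_bind]
  · cases Query.parse q with
    | none => simp only [map_eq_bind, PMF.pure_bind]
    | some Q =>
      simp only [map_eq_bind, PMF.pure_bind, PMF.bind_bind, answerWith_allSecond v Q S _ h₀ h₁]

end HState

/-- The guess of the adversary in the game with two identities. -/
def Adversary.hybridGuess (A : Adversary) (Φ : Family) (v : BFVersion) (κ : ℕ) (W : World Φ)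
    (sel : ℕ → Bool) : PMF Bool :=
  A.guess (hybridGame Φ v) κ (⟨W, [], sel⟩ : HState Φ)

/-- A round shifts the sequence of choices by at most two, so T rounds read only its first 2T
entries; the others may be replaced. -/
theorem hybridGuess_congr (A : Adversary) (Φ : Family) (v : BFVersion) (κ : ℕ) (W : World Φ)
    (sel : ℕ → Bool) (h : ∀ i < 2 * A.bound.eval κ, sel i = true) :
    A.hybridGuess Φ v κ W (fun _ => true) = A.hybridGuess Φ v κ W sel := by
  have hr := A.run_near (Γ₁ := hybridGame Φ v) (Γ₂ := hybridGame Φ v) κ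
    (fun S => PMF.pure (HState.allSecond S)) (fun k S => ∀ i < 2 * k, HState.sel S i = true) 0
    (fun k S hS i hi => hS i (by omega))
    (by
      intro k S q hS y hy
      have key := HState.oracle_sel v q S y hy
      intro i hi
      rcases key with h | h
      · rw [h]; exact hS i (by omega)
      · rw [h]; exact hS (i + 2) (by omega))
    (fun k S q hS => Near.of_eq
      (HState.oracle_allSecond v q S (hS 0 (by omega)) (hS 1 (by omega))))
    (A.bound.eval κ) (⟨W, [], sel⟩ : HState Φ) []
    ((encodeList ((hybridGame Φ v).greet (⟨W, [], sel⟩ : HState Φ))).take (A.bound.eval κ)) h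
  rw [mul_zero] at hr
  refine Eq.trans (Eq.symm ?_) hr.eq
  exact PMF.pure_bind _ _

theorem World.Step.length_ues {Φ : Family} {W W' : World Φ} (h : World.Step W W') :
    W'.ues.length ≤ W.ues.length + 1 := by
  cases h with
  | same h => unfold World.SameUsers at h; rw [h]; simp
  | register => simp
  | _ => simp

/-- A round registers at most one device. The invariant that the number of devices plus the number
of remaining rounds is at most T bounds the error of every round by 4T·2^(-n). -/
theorem guess_near_hybrid (A : Adversary) (Φ : Family) (v : BFVersion) (κ : ℕ) (d : Str)
    (g : Φ.G d) (s : ℕ) (kp : Str) (β : Bool) :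
    Near (A.bound.eval κ * (A.bound.eval κ * (4 * (2⁻¹ : ℝ≥0∞) ^ Φ.n d)))
      (A.hybridGuess Φ v κ (World.start₀ Φ d g s kp false) fun _ => β)
      (A.guess (anonGame Φ v .outsider .identity) κ (World.start₀ Φ d g s kp β)) := by
  have hr := A.run_near (Γ₁ := hybridGame Φ v) (Γ₂ := anonGame Φ v .outsider .identity) κ
    (World.hideRandom β) (fun k W => World.b W = β ∧ World.d W = d ∧
      (World.ues W).length + k ≤ A.bound.eval κ) (A.bound.eval κ * (4 * (2⁻¹ : ℝ≥0∞) ^ Φ.n d))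
    (fun k W hW => ⟨hW.1, hW.2.1, by omega⟩)
    (by
      intro k W q hW y hy
      have hy' : y ∈ (anonOracle Φ v .outsider .identity q W).support := hy
      rcases World.step_anonOracle hy' with ⟨-, h⟩ | ⟨-, h⟩
      · rw [h]; exact ⟨hW.1, hW.2.1, by omega⟩
      · refine ⟨h.frame.2.2.2.2.trans hW.1, h.frame.1.trans hW.2.1, ?_⟩
        have : (World.ues y.2).length ≤ (World.ues W).length + 1 := h.length_ues
        have := hW.2.2
        omega)
    (by
      intro k W q hW
      have := World.near_step v q hW.1
      rw [hW.2.1] at this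
      refine this.mono ?_
      gcongr
      have := hW.2.2
      omega)
    (A.bound.eval κ) (World.start₀ Φ d g s kp β) []
    ((encodeList ((anonGame Φ v .outsider .identity).greet (World.start₀ Φ d g s kp β))).take
      (A.bound.eval κ)) ⟨rfl, rfl, by simp [World.start₀]⟩
  have e : World.hideRandom β (World.start₀ Φ d g s kp β) =
      PMF.pure (⟨World.start₀ Φ d g s kp false, [], fun _ => β⟩ : HState Φ) := by
    rw [World.hideRandom_eq rfl]
    have : (World.start₀ Φ d g s kp β).ues.length = 0 := rfl
    rw [this, sampleList, PMF.pure_map]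
    rfl
  rw [e] at hr
  refine Eq.subst (motive := fun p => Near _ p _) ?_ hr
  refine (PMF.pure_bind _ _).trans ?_
  rfl

/-- The choices in the hybrid game number `j`: the second candidate before slot `j`, the first
candidate after it, and the candidate `β` in the slot `j` itself (counted from `1`). -/
def selOf (j : ℕ) (β : Bool) (i : ℕ) : Bool := decide (i + 1 < j) || (decide (i + 1 = j) && β)

/-- Neighbouring hybrids share an end: this identity is what makes the sum over `j` telescope. -/
theorem selOf_true (j : ℕ) : selOf j true = selOf (j + 1) false := by
  funext i
  by_cases h1 : i + 1 < j <;> by_cases h2 : i + 1 = j <;> simp [selOf, h1, h2] <;> omega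

theorem selOf_zero (β : Bool) : selOf 0 β = fun _ => false := by
  funext i; simp [selOf]

/-- After a query the challenge slot is two positions nearer. Subtraction of natural numbers sends a
slot that has just been used to 0, the value that stands for no challenge to come. -/
theorem selOf_shift (j : ℕ) (β : Bool) : (fun i => selOf j β (i + 2)) = selOf (j - 2) β := by
  funext i
  have h1 : i + 2 + 1 < j ↔ i + 1 < j - 2 := by omega
  have h2 : i + 2 + 1 = j ↔ i + 1 = j - 2 := by omega
  simp only [selOf, h1, h2]

/-- The guess in the hybrid game, for a random system. -/
def Adversary.hybrid (A : Adversary) (Φ : Family) (v : BFVersion) (κ : ℕ) (sel : ℕ → Bool) :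
    PMF Bool :=
  (anonInit Φ κ).bind fun m => A.hybridGuess Φ v κ (m false) sel

theorem mem_anonInit {Φ : Family} {κ : ℕ} {m : Bool → World Φ} (h : m ∈ (anonInit Φ κ).support) : ∃
    d ∈ (Φ.gen κ).support, ∃ g s kp, kp ∈ (uniformStr (Φ.n d)).support ∧ m = World.start₀ Φ d g s kp
    := by
  obtain ⟨d, hd, hm⟩ := (PMF.mem_support_bind_iff _ _ _).mp h
  obtain ⟨g, -, hm⟩ := (PMF.mem_support_bind_iff _ _ _).mp hm
  obtain ⟨s, -, hm⟩ := (PMF.mem_support_bind_iff _ _ _).mp hm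
  obtain ⟨kp, hkp, rfl⟩ := (PMF.mem_support_map_iff _ _ _).mp hm
  exact ⟨d, hd, g, s, kp, hkp, rfl⟩

theorem near_hybrid (A : Adversary) (Φ : Family) (v : BFVersion) {ν : ℕ → ℕ}
    (hn : ∀ κ, ∀ d ∈ (Φ.gen κ).support, ν κ ≤ Φ.n d) (κ : ℕ) (β : Bool) :
    Near (ENNReal.ofReal (4 * ((A.bound.eval κ : ℕ) : ℝ) ^ 2 * (2⁻¹ : ℝ) ^ ν κ))
      (A.hybrid Φ v κ fun _ => β)
      ((anonInit Φ κ).bind fun m =>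
        A.guess (anonGame Φ v .outsider .identity) κ (m β)) := by
  refine Near.bind fun m hm => ?_
  obtain ⟨d, hd, g, s, kp, -, rfl⟩ := mem_anonInit hm
  refine (guess_near_hybrid A Φ v κ d g s kp β).mono ?_
  have h1 : (2⁻¹ : ℝ≥0∞) ^ Φ.n d ≤ (2⁻¹ : ℝ≥0∞) ^ ν κ :=
    pow_le_pow_right_of_le_one' (by simp) (hn κ d hd)
  have h2 : ENNReal.ofReal (4 * ((A.bound.eval κ : ℕ) : ℝ) ^ 2 * (2⁻¹ : ℝ) ^ ν κ) =
      A.bound.eval κ * (A.bound.eval κ * (4 * (2⁻¹ : ℝ≥0∞) ^ ν κ)) := by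
    have e2 : ENNReal.ofReal (2⁻¹ : ℝ) = 2⁻¹ := by
      rw [ENNReal.ofReal_inv_of_pos (by norm_num)]; simp
    rw [ENNReal.ofReal_mul (by positivity), ENNReal.ofReal_mul (by norm_num),
      ENNReal.ofReal_pow (by positivity), ENNReal.ofReal_pow (by positivity), e2,
      ENNReal.ofReal_natCast, ENNReal.ofReal_ofNat]
    ring
  rw [h2]
  gcongr

/-- The advantage in the anonymity game is bounded, if an adversary in the chosen-ciphertext game
plays a random hybrid game. -/
theorem advantage_le_of_hybrids (A B : Adversary) (Φ : Family) (v : BFVersion) {ν : ℕ → ℕ}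
    (hn : ∀ κ, ∀ d ∈ (Φ.gen κ).support, ν κ ≤ Φ.n d) (κ : ℕ) (r : Bool → PMF Bool)
    (hB : B.advantage (ccaGame Φ.toBFFamily v) κ = |((r true) true).toReal -
      ((r false) true).toReal| / 2)
    (hr : ∀ β, r β = (uniformUpTo (2 * A.bound.eval κ)).bind fun j =>
      A.hybrid Φ v κ (selOf j β)) :
    A.advantage (anonGame Φ v .outsider .identity) κ ≤
      (2 * ((A.bound.eval κ : ℕ) : ℝ) + 1) * B.advantage (ccaGame Φ.toBFFamily v) κ +
        4 * ((A.bound.eval κ : ℕ) : ℝ) ^ 2 * (2⁻¹ : ℝ) ^ ν κ := by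
  set T := A.bound.eval κ with hT
  set δ := 4 * (T : ℝ) ^ 2 * (2⁻¹ : ℝ) ^ ν κ with hδ
  have hδ0 : 0 ≤ δ := by positivity
  set H : ℕ → ℝ := fun j => ((A.hybrid Φ v κ (selOf j false)) true).toReal with hH
  -- The guess is averaged over the 2T + 1 values of `j`. For bit 1, hybrid `j` is hybrid `j + 1`
  -- for bit 0.
  have hsum : ∀ β, ((r β) true).toReal =
      (2 * (T : ℝ) + 1)⁻¹ * ∑ j ∈ Finset.range (2 * T + 1), H (j + if β then 1 else 0) := by
    intro β
    rw [hr β, uniformUpTo, PMF.bind_map, PMF.bind_apply, tsum_fintype, ENNReal.toReal_sum]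
    · simp only [PMF.uniformOfFintype_apply, Fintype.card_fin, Function.comp_def,
        ENNReal.toReal_mul]
      rw [← Finset.mul_sum, Finset.sum_range fun j => H (j + if β then 1 else 0)]
      congr 1
      · rw [ENNReal.toReal_inv, ENNReal.toReal_natCast]; push_cast; rfl
      · refine Finset.sum_congr rfl fun j _ => ?_
        cases β
        · rfl
        · rw [selOf_true]; rfl
    · intro j _
      exact ENNReal.mul_ne_top (PMF.apply_ne_top _ _) (PMF.apply_ne_top _ _)
  have htel : ((r true) true).toReal - ((r false) true).toReal =
      (2 * (T : ℝ) + 1)⁻¹ * (H (2 * T + 1) - H 0) := by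
    rw [hsum, hsum, ← mul_sub, ← Finset.sum_sub_distrib]
    congr 1
    exact Finset.sum_range_sub H (2 * T + 1)
  have h0 : A.hybrid Φ v κ (selOf 0 false) = A.hybrid Φ v κ fun _ => false := by
    rw [selOf_zero]
  -- All 2T slots that can be read lie before slot 2T + 1, so they hold second candidates.
  have h1 : A.hybrid Φ v κ (selOf (2 * T + 1) false) = A.hybrid Φ v κ fun _ => true := by
    unfold Adversary.hybrid
    refine bind_congr fun m _ => ?_
    rw [hybridGuess_congr A Φ v κ (m false) (selOf (2 * T + 1) false)]
    intro i hi
    have : i + 1 < 2 * T + 1 := by omega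
    simp [selOf, this]
  have n0 := (near_hybrid A Φ v hn κ false).abs_sub_le hδ0 true
  have n1 := (near_hybrid A Φ v hn κ true).abs_sub_le hδ0 true
  rw [anonGame_advantage_eq, hB, htel, abs_mul,
    abs_of_pos (show (0 : ℝ) < (2 * (T : ℝ) + 1)⁻¹ by positivity)]
  have e0 : H 0 = ((A.hybrid Φ v κ fun _ => false) true).toReal := by rw [hH, ← h0]
  have e1 : H (2 * T + 1) = ((A.hybrid Φ v κ fun _ => true) true).toReal := by rw [hH, ← h1]
  rw [← e0] at n0
  rw [← e1] at n1
  have hpos : (0 : ℝ) < 2 * (T : ℝ) + 1 := by positivity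
  have e2 : (2 * (T : ℝ) + 1) * ((2 * (T : ℝ) + 1)⁻¹ * |H (2 * T + 1) - H 0| / 2) =
      |H (2 * T + 1) - H 0| / 2 := by
    field_simp
  rw [e2]
  generalize ((((anonInit Φ κ).bind fun m =>
    A.guess (anonGame Φ v .outsider .identity) κ (m true)) true).toReal) = x at n1 ⊢
  generalize ((((anonInit Φ κ).bind fun m =>
    A.guess (anonGame Φ v .outsider .identity) κ (m false)) true).toReal) = y at n0 ⊢
  have := abs_sub_abs_le_abs_sub (x - y) (H (2 * T + 1) - H 0)
  -- Both ends of the chain of hybrids are replaced by the real games, at a cost δ each; the factor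
  -- 1/2 in the advantage leaves a single δ.
  have h3 : |x - y - (H (2 * T + 1) - H 0)| ≤ 2 * δ := by
    rw [abs_le] at n0 n1 ⊢
    constructor <;> linarith [n0.1, n0.2, n1.1, n1.2]
  linarith

end GD2C

/-! ### Computability of the protocol in polynomial time, without the master key. -/

namespace GD2C

open Code

/-! ### Encodings of the objects of the protocol -/

variable {α β γ : Type} [Code α] [Code β] [Code γ]

theorem Code.pt_of_eq {f : α → β} {g : α → γ} (hg : PT g) (h : ∀ a, enc (f a) = enc (g a)) :
    PT f := by
  obtain ⟨F, hF, eF⟩ := hg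
  exact ⟨F, hF, fun a => by rw [eF, h]⟩

/-- The components of a device. -/
def UE.flat (u : UE) : Str × Str × Str × Str × ℕ := (u.ident, u.aid, u.key, u.ak, u.group)

instance : Code UE := ⟨fun u => enc u.flat⟩

theorem PT.ueFlat {f : α → UE} (hf : PT f) : PT fun a => (f a).flat :=
  Code.pt_of_eq hf fun _ => rfl

@[fun_prop] theorem PT.aid {f : α → UE} (hf : PT f) : PT fun a => (f a).aid := hf.ueFlat.snd.fst
@[fun_prop] theorem PT.ueKey {f : α → UE} (hf : PT f) : PT fun a => (f a).key :=
  hf.ueFlat.snd.snd.fst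
@[fun_prop] theorem PT.ak {f : α → UE} (hf : PT f) : PT fun a => (f a).ak :=
  hf.ueFlat.snd.snd.snd.fst
@[fun_prop] theorem PT.group {f : α → UE} (hf : PT f) : PT fun a => (f a).group :=
  hf.ueFlat.snd.snd.snd.snd

@[fun_prop] theorem PT.ueMk {a b c d : α → Str} {e : α → ℕ} (ha : PT a) (hb : PT b) (hc : PT c)
    (hd : PT d) (he : PT e) : PT fun x => UE.mk (a x) (b x) (c x) (d x) (e x) :=
  Code.pt_of_eq (ha.prodMk (hb.prodMk (hc.prodMk (hd.prodMk he)))) fun _ => rfl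

/-- The components of an instance. -/
def Inst.flat (I : Inst) : (ℕ × ℕ × Bool × ℕ × Str) × ℕ × Str × Str × Str × Option Str :=
  ((I.owner, I.peer, I.initiator, I.stage, I.sid), I.exp, I.own, I.other, I.nonce, I.key)

instance : Code Inst := ⟨fun u => enc u.flat⟩

theorem PT.instFlat {f : α → Inst} (hf : PT f) : PT fun a => (f a).flat :=
  Code.pt_of_eq hf fun _ => rfl

section
variable {f : α → Inst} (hf : PT f)
include hf
@[fun_prop] theorem PT.owner : PT fun a => (f a).owner := hf.instFlat.fst.fst
@[fun_prop] theorem PT.peer : PT fun a => (f a).peer := hf.instFlat.fst.snd.fst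
@[fun_prop] theorem PT.initiator : PT fun a => (f a).initiator := hf.instFlat.fst.snd.snd.fst
@[fun_prop] theorem PT.stage : PT fun a => (f a).stage := hf.instFlat.fst.snd.snd.snd.fst
@[fun_prop] theorem PT.instSid : PT fun a => (f a).sid := hf.instFlat.fst.snd.snd.snd.snd
@[fun_prop] theorem PT.exp : PT fun a => (f a).exp := hf.instFlat.snd.fst
@[fun_prop] theorem PT.own : PT fun a => (f a).own := hf.instFlat.snd.snd.fst
@[fun_prop] theorem PT.other : PT fun a => (f a).other := hf.instFlat.snd.snd.snd.fst
@[fun_prop] theorem PT.instNonce : PT fun a => (f a).nonce := hf.instFlat.snd.snd.snd.snd.fst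
@[fun_prop] theorem PT.instKey : PT fun a => (f a).key := hf.instFlat.snd.snd.snd.snd.snd
end

@[fun_prop] theorem PT.instMk {a b : α → ℕ} {c : α → Bool} {d : α → ℕ} {e : α → Str} {f : α → ℕ}
    {g h i : α → Str} {j : α → Option Str} (ha : PT a) (hb : PT b) (hc : PT c)
    (hd : PT d) (he : PT e) (hf : PT f) (hg : PT g) (hh : PT h) (hi : PT i) (hj : PT j) :
    PT fun x => Inst.mk (a x) (b x) (c x) (d x) (e x) (f x) (g x) (h x) (i x) (j x) :=
  Code.pt_of_eq ((ha.prodMk (hb.prodMk (hc.prodMk (hd.prodMk he)))).prodMk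
    (hf.prodMk (hg.prodMk (hh.prodMk (hi.prodMk hj))))) fun _ => rfl

/-- The components of a session at HSS/AuC. -/
def HSession.flat (s : HSession) : UE × UE × Str × Str × Bool :=
  (s.ui, s.uj, s.sid, s.nonce, s.isOpen)

instance : Code HSession := ⟨fun u => enc u.flat⟩

theorem PT.sessionFlat {f : α → HSession} (hf : PT f) : PT fun a => (f a).flat :=
  Code.pt_of_eq hf fun _ => rfl

section
variable {f : α → HSession} (hf : PT f)
include hf
@[fun_prop] theorem PT.ui : PT fun a => (f a).ui := hf.sessionFlat.fst
@[fun_prop] theorem PT.uj : PT fun a => (f a).uj := hf.sessionFlat.snd.fst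
@[fun_prop] theorem PT.hssSid : PT fun a => (f a).sid := hf.sessionFlat.snd.snd.fst
@[fun_prop] theorem PT.hssNonce : PT fun a => (f a).nonce := hf.sessionFlat.snd.snd.snd.fst
@[fun_prop] theorem PT.isOpen : PT fun a => (f a).isOpen := hf.sessionFlat.snd.snd.snd.snd
end

@[fun_prop] theorem PT.sessionMk {a b : α → UE} {c d : α → Str} {e : α → Bool} (ha : PT a)
    (hb : PT b) (hc : PT c) (hd : PT d) (he : PT e) :
    PT fun x => HSession.mk (a x) (b x) (c x) (d x) (e x) :=
  Code.pt_of_eq (ha.prodMk (hb.prodMk (hc.prodMk (hd.prodMk he)))) fun _ => rfl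

/-- The components of a tape. -/
def Tape.flat (t : Tape) : (ℕ × ℕ × ℕ × Str × ℕ) × ℕ × Str × Str × Str × Str :=
  ((t.sid, t.x, t.ri, t.si, t.y), t.rj, t.sj, t.s₃, t.s₄, t.R)

instance : Code Tape := ⟨fun u => enc u.flat⟩

theorem PT.tapeFlat {f : α → Tape} (hf : PT f) : PT fun a => (f a).flat :=
  Code.pt_of_eq hf fun _ => rfl

section
variable {f : α → Tape} (hf : PT f)
include hf
@[fun_prop] theorem PT.tapeSid : PT fun a => (f a).sid := hf.tapeFlat.fst.fst
@[fun_prop] theorem PT.tapeX : PT fun a => (f a).x := hf.tapeFlat.fst.snd.fst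
@[fun_prop] theorem PT.tapeRi : PT fun a => (f a).ri := hf.tapeFlat.fst.snd.snd.fst
@[fun_prop] theorem PT.tapeSi : PT fun a => (f a).si := hf.tapeFlat.fst.snd.snd.snd.fst
@[fun_prop] theorem PT.tapeY : PT fun a => (f a).y := hf.tapeFlat.fst.snd.snd.snd.snd
@[fun_prop] theorem PT.tapeRj : PT fun a => (f a).rj := hf.tapeFlat.snd.fst
@[fun_prop] theorem PT.tapeSj : PT fun a => (f a).sj := hf.tapeFlat.snd.snd.fst
@[fun_prop] theorem PT.tapeS₃ : PT fun a => (f a).s₃ := hf.tapeFlat.snd.snd.snd.fst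
@[fun_prop] theorem PT.tapeS₄ : PT fun a => (f a).s₄ := hf.tapeFlat.snd.snd.snd.snd.fst
@[fun_prop] theorem PT.tapeR : PT fun a => (f a).R := hf.tapeFlat.snd.snd.snd.snd.snd
end

@[fun_prop] theorem PT.tapeMk {a b c : α → ℕ} {d : α → Str} {e f : α → ℕ}
    {g h i j : α → Str} (ha : PT a) (hb : PT b) (hc : PT c)
    (hd : PT d) (he : PT e) (hf : PT f) (hg : PT g) (hh : PT h) (hi : PT i) (hj : PT j) :
    PT fun x => Tape.mk (a x) (b x) (c x) (d x) (e x) (f x) (g x) (h x) (i x) (j x) :=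
  Code.pt_of_eq ((ha.prodMk (hb.prodMk (hc.prodMk (hd.prodMk he)))).prodMk
    (hf.prodMk (hg.prodMk (hh.prodMk (hi.prodMk hj))))) fun _ => rfl

/-! ### Queries -/

namespace Query

/-- The kind of a query. -/
def tag : Query → ℕ
  | newGroup => 1
  | register _ => 2
  | execute _ _ => 3
  | start _ _ => 4
  | respond _ _ _ => 5
  | send _ _ => 6
  | hssRequest _ => 7
  | hssConfirm _ _ => 8
  | prose _ _ _ _ _ => 9
  | test _ => 10

/-- The first numerical argument of a query. -/
def arg₁ : Query → ℕ
  | register g => g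
  | execute i _ => i
  | start i _ => i
  | respond j _ _ => j
  | send k _ => k
  | hssConfirm k _ => k
  | test k => k
  | _ => 0

/-- The second numerical argument of a query. -/
def arg₂ : Query → ℕ
  | execute _ j => j
  | start _ j => j
  | respond _ i _ => i
  | _ => 0

/-- The message in a query. -/
def msg : Query → List Str
  | respond _ _ m => m
  | send _ m => m
  | hssRequest m => m
  | hssConfirm _ m => m
  | prose a b c d e => [a, b, c, d, e]
  | _ => []

/-- The components of a query. -/
def flat (Q : Query) : ℕ × ℕ × ℕ × List Str := (Q.tag, Q.arg₁, Q.arg₂, Q.msg)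

instance : Code Query := ⟨fun Q => enc Q.flat⟩

end Query

theorem PT.queryFlat {f : α → Query} (hf : PT f) : PT fun a => (f a).flat :=
  Code.pt_of_eq hf fun _ => rfl

section
variable {f : α → Query} (hf : PT f)
include hf
@[fun_prop] theorem PT.queryTag : PT fun a => (f a).tag := hf.queryFlat.fst
@[fun_prop] theorem PT.arg₁ : PT fun a => (f a).arg₁ := hf.queryFlat.snd.fst
@[fun_prop] theorem PT.arg₂ : PT fun a => (f a).arg₂ := hf.queryFlat.snd.snd.fst
@[fun_prop] theorem PT.msg : PT fun a => (f a).msg := hf.queryFlat.snd.snd.snd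
end

/-- A query with given components. -/
def Query.ofFlat (t a b : ℕ) (m : List Str) : Query :=
  if t = 1 then .newGroup else if t = 2 then .register a else if t = 3 then .execute a b
  else if t = 4 then .start a b else if t = 5 then .respond a b m else if t = 6 then .send a m
  else if t = 7 then .hssRequest m else if t = 8 then .hssConfirm a m
  else if t = 9 then .prose (m.getD 0 []) (m.getD 1 []) (m.getD 2 []) (m.getD 3 []) (m.getD 4 [])
  else .test a

@[fun_prop] theorem PT.queryOfFlat {t a b : α → ℕ} {m : α → List Str} (ht : PT t) (ha : PT a)
    (hb : PT b) (hm : PT m) : PT fun x => Query.ofFlat (t x) (a x) (b x) (m x) := by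
  refine Code.pt_of_eq (γ := ℕ × ℕ × ℕ × List Str) (g := fun x =>
    if t x = 1 then (1, 0, 0, []) else if t x = 2 then (2, a x, 0, []) else
    if t x = 3 then (3, a x, b x, []) else
    if t x = 4 then (4, a x, b x, []) else if t x = 5 then (5, a x, b x, m x) else
    if t x = 6 then (6, a x, 0, m x) else if t x = 7 then (7, 0, 0, m x) else
    if t x = 8 then (8, a x, 0, m x) else
    if t x = 9 then (9, 0, 0, [(m x).getD 0 [], (m x).getD 1 [], (m x).getD 2 [],
      (m x).getD 3 [], (m x).getD 4 []]) else (10, a x, 0, [])) (by fun_prop) fun x => ?_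
  unfold Query.ofFlat
  split_ifs <;> rfl

/-- The match on the shape of the list becomes a test of the kind and of lengths, to which the
closure properties of `PT` apply. -/
theorem Query.parse_eq (q : List Str) : Query.parse q =
    if q.length = 0 then none else
    let t := toNat (q.headD [])
    let m := q.tail
    if (t = 1 ∧ m.length = 0) ∨ (t = 2 ∧ m.length = 1) ∨ (t = 3 ∧ m.length = 2) ∨
      (t = 4 ∧ m.length = 2) ∨ (t = 5 ∧ m.length ≠ 0 ∧ m.tail.length ≠ 0) ∨
      (t = 6 ∧ m.length ≠ 0) ∨ t = 7 ∨ (t = 8 ∧ m.length ≠ 0) ∨ (t = 9 ∧ m.length = 5) ∨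
      (t = 10 ∧ m.length = 1) then
      some (Query.ofFlat t (toNat (m.headD [])) (toNat (m.tail.headD []))
        (if t = 5 then m.tail.tail else if t = 7 ∨ t = 9 then m else m.tail))
    else none := by
  rcases q with - | ⟨t, m⟩
  · rfl
  · simp only [List.length_cons, Nat.succ_ne_zero, if_false, List.headD_cons, List.tail_cons]
    obtain ⟨k, hk⟩ : ∃ k, toNat t = k := ⟨_, rfl⟩
    rcases k with - | - | - | - | - | - | - | - | - | - | - | k
    all_goals rcases m with - | ⟨a, - | ⟨b, - | ⟨c, - | ⟨d, - | ⟨e, - | ⟨f, l⟩⟩⟩⟩⟩⟩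
    all_goals simp [Query.parse, Query.ofFlat, hk]

@[fun_prop] theorem PT.queryParse {f : α → List Str} (hf : PT f) :
    PT fun a => Query.parse (f a) := by
  simp only [Query.parse_eq]
  fun_prop

@[fun_prop] theorem PT.queryInitiator {f : α → Query} (hf : PT f) :
    PT fun a => (f a).initiator := by
  have : ∀ Q : Query, Q.initiator = if Q.tag = 3 ∨ Q.tag = 4 then Q.arg₁ else 0 := by
    intro Q; cases Q <;> rfl
  simp only [this]
  fun_prop

@[fun_prop] theorem PT.queryResponder {f : α → Query} (hf : PT f) :
    PT fun a => (f a).responder := by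
  have : ∀ Q : Query, Q.responder =
      if Q.tag = 3 then Q.arg₂ else if Q.tag = 5 then Q.arg₁ else 0 := by
    intro Q; cases Q <;> rfl
  simp only [this]
  fun_prop

@[fun_prop] theorem PT.respSid {f : α → Query} {s : α → Str} (hf : PT f) (hs : PT s) :
    PT fun a => (f a).respSid (s a) := by
  have : ∀ (Q : Query) s, Q.respSid s = if Q.tag = 5 then Q.msg.getD 0 [] else s := by
    intro Q s; cases Q <;> rfl
  simp only [this]
  fun_prop

end GD2C

namespace GD2C

open Code

variable {α β γ : Type} [Code α] [Code β] [Code γ]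

/-! ### The primitives -/

/-- The contents of the stacks for three arguments. -/
theorem PT.of_polyTime₃ {f : (Fin 3 → Str) → Str} (h : PolyTime f) {x y z : α → Str} (hx : PT x)
    (hy : PT y) (hz : PT z) : PT fun a => f ![x a, y a, z a] := by
  obtain ⟨P, q, hP⟩ := h
  have := FP.of_three (f := fun x y z => f ![x, y, z]) (P := P) (q := q) fun x y z => by
    obtain ⟨s, t, hs, h0, ht⟩ := hP ![x, y, z]
    refine ⟨s, t, ?_, h0, by simpa [Fin.sum_univ_three] using ht⟩
    convert hs using 1
    funext r
    rcases r with - | - | - | r <;> simp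
  convert this.pt.comp (PT.enc (hx.prodMk (hy.prodMk hz))) using 2 with a
  simp [enc_pair, enc_str]

/-- A primitive with fewer arguments expects the other stacks to be empty, so the superfluous
argument is erased before its program starts. All primitives are thereby reduced to the case of
three arguments. -/
theorem PolyTime.clear_two {f : (Fin 2 → Str) → Str} (h : PolyTime f) :
    PolyTime (k := 3) fun v => f ![v 0, v 1] := by
  obtain ⟨P, q, hP⟩ := h
  refine ⟨.seq (.clear 2) P, q + 5 * Polynomial.X + 2, fun v => ?_⟩
  obtain ⟨s, t, hs, h0, ht⟩ := hP ![v 0, v 1]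
  obtain ⟨t', ht', e⟩ := runs_clear 2 fun r => if h : r < 3 then v ⟨r, h⟩ else []
  refine ⟨s, t' + t + 1, .seq e ?_, h0, ?_⟩
  · convert hs using 1
    funext r
    rcases r with - | - | - | r <;> simp [Function.update]
  · have := eval_le_eval q (show ∑ i, (![v 0, v 1] i).length ≤ ∑ i, (v i).length by
      simp [Fin.sum_univ_three, Fin.sum_univ_two])
    simp [Fin.sum_univ_three, Fin.sum_univ_two] at this ht ht' ⊢
    omega

theorem PolyTime.clear_one {f : (Fin 1 → Str) → Str} (h : PolyTime f) :
    PolyTime (k := 2) fun v => f ![v 0] := by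
  obtain ⟨P, q, hP⟩ := h
  refine ⟨.seq (.clear 1) P, q + 5 * Polynomial.X + 2, fun v => ?_⟩
  obtain ⟨s, t, hs, h0, ht⟩ := hP ![v 0]
  obtain ⟨t', ht', e⟩ := runs_clear 1 fun r => if h : r < 2 then v ⟨r, h⟩ else []
  refine ⟨s, t' + t + 1, .seq e ?_, h0, ?_⟩
  · convert hs using 1
    funext r
    rcases r with - | - | r <;> simp [Function.update]
  · have := eval_le_eval q (show ∑ i, (![v 0] i).length ≤ ∑ i, (v i).length by
      simp [Fin.sum_univ_two])
    simp [Fin.sum_univ_two] at this ht ht' ⊢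
    omega

theorem PT.of_polyTime₂ {f : (Fin 2 → Str) → Str} (h : PolyTime f) {x y : α → Str} (hx : PT x)
    (hy : PT y) : PT fun a => f ![x a, y a] := by
  simpa using PT.of_polyTime₃ h.clear_two hx hy (PT.const [])

theorem PT.of_polyTime₁ {f : (Fin 1 → Str) → Str} (h : PolyTime f) {x : α → Str} (hx : PT x) :
    PT fun a => f ![x a] := by
  simpa using PT.of_polyTime₂ h.clear_one hx (PT.const [])

section primitives

variable {Φ : Family} [hΦ : Fact Φ.Efficient] {d : α → Str}

@[fun_prop] theorem PT.prime (hd : PT d) : PT fun a => Φ.p (d a) := by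
  obtain ⟨f, hf, e⟩ := hΦ.out.ibe.prime
  exact Code.pt_of_eq (PT.of_polyTime₁ hf hd) fun a => (e _).symm

@[fun_prop] theorem PT.memG {w : α → Str} (hd : PT d) (hw : PT w) :
    PT fun a => (Φ.decG (d a) (w a)).isSome := by
  obtain ⟨f, hf, e⟩ := hΦ.out.ibe.memG
  exact Code.pt_of_eq (PT.of_polyTime₂ hf hd hw) fun a => (e _ _).symm

@[fun_prop] theorem PT.powG {n : α → ℕ} {x : ∀ a, Φ.G (d a)} (hd : PT d) (hx : PT fun a => Φ.encG (d
    a) (x a)) (hn : PT n) : PT fun a => Φ.encG (d a) (x a ^ n a) := by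
  obtain ⟨f, hf, e⟩ := hΦ.out.ibe.powG
  exact Code.pt_of_eq (PT.of_polyTime₃ hf hd hx (PT.bits hn)) fun a => (e _ _ _).symm

@[fun_prop] theorem PT.powGT {n : α → ℕ} {x : ∀ a, Φ.GT (d a)} (hd : PT d) (hx : PT fun a => Φ.encGT
    (d a) (x a)) (hn : PT n) : PT fun a => Φ.encGT (d a) (x a ^ n a) := by
  obtain ⟨f, hf, e⟩ := hΦ.out.ibe.powGT
  exact Code.pt_of_eq (PT.of_polyTime₃ hf hd hx (PT.bits hn)) fun a => (e _ _ _).symm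

@[fun_prop] theorem PT.pairing {x y : ∀ a, Φ.G (d a)} (hd : PT d)
    (hx : PT fun a => Φ.encG (d a) (x a)) (hy : PT fun a => Φ.encG (d a) (y a)) :
    PT fun a => Φ.encGT (d a) (Φ.e (d a) (x a) (y a)) := by
  obtain ⟨f, hf, e⟩ := hΦ.out.ibe.pairing
  exact Code.pt_of_eq (PT.of_polyTime₃ hf hd hx hy) fun a => (e _ _ _).symm

@[fun_prop] theorem PT.hash1 {w : α → Str} (hd : PT d) (hw : PT w) :
    PT fun a => Φ.encG (d a) (Φ.H1 (d a) (w a)) := by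
  obtain ⟨f, hf, e⟩ := hΦ.out.ibe.hash1
  exact Code.pt_of_eq (PT.of_polyTime₂ hf hd hw) fun a => (e _ _).symm

@[fun_prop] theorem PT.hash2 {z : ∀ a, Φ.GT (d a)} (hd : PT d)
    (hz : PT fun a => Φ.encGT (d a) (z a)) : PT fun a => Φ.H2 (d a) (z a) := by
  obtain ⟨f, hf, e⟩ := hΦ.out.ibe.hash2
  exact Code.pt_of_eq (PT.of_polyTime₂ hf hd hz) fun a => (e _ _).symm

@[fun_prop] theorem PT.hash3 {σ m : α → Str} (hd : PT d) (hσ : PT σ) (hm : PT m) :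
    PT fun a => Φ.H3 (d a) (σ a) (m a) := by
  obtain ⟨f, hf, e⟩ := hΦ.out.ibe.hash3
  exact Code.pt_of_eq (PT.of_polyTime₃ hf hd hσ hm) fun a => (e _ _ _).symm

@[fun_prop] theorem PT.hash4 {σ : α → Str} (hd : PT d) (hσ : PT σ) :
    PT fun a => Φ.H4 (d a) (σ a) := by
  obtain ⟨f, hf, e⟩ := hΦ.out.ibe.hash4
  exact Code.pt_of_eq (PT.of_polyTime₂ hf hd hσ) fun a => (e _ _).symm

@[fun_prop] theorem PT.hash {w : α → Str} (hd : PT d) (hw : PT w) :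
    PT fun a => Φ.H (d a) (w a) := by
  obtain ⟨f, hf, e⟩ := hΦ.out.hash
  exact Code.pt_of_eq (PT.of_polyTime₂ hf hd hw) fun a => (e _ _).symm

@[fun_prop] theorem PT.encS {k m : α → Str} (hk : PT k) (hm : PT m) :
    PT fun a => Φ.ES (k a) (m a) := by
  simpa using PT.of_polyTime₂ hΦ.out.encS hk hm

@[fun_prop] theorem PT.decS {k m : α → Str} (hk : PT k) (hm : PT m) :
    PT fun a => Φ.DS (k a) (m a) := by
  simpa using PT.of_polyTime₂ hΦ.out.decS hk hm

end primitives

/-! ### Strings of zeros and strings of fixed length -/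

/-- A string of zeros of given length is obtained from exclusive or, which is already known to be
computable. -/
theorem replicate_length_false (w : Str) : List.replicate w.length false = xorStr w w := by
  induction w with
  | nil => rfl
  | cons b w ih => simp [xorStr, List.replicate_succ, ih]

theorem PT.zeros {w : α → Str} (hw : PT w) : PT fun a => List.replicate (w a).length false := by
  simp only [replicate_length_false]
  fun_prop

theorem fixedBits_eq (L x : ℕ) :
    fixedBits L x = (x.bits ++ List.replicate L false).take L := by
  refine List.ext_getElem? fun i => ?_
  by_cases h : i < L
  · rw [List.getElem?_take_of_lt h]
    have : (fixedBits L x)[i]? = some (x.testBit i) := by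
      rw [fixedBits, List.getElem?_ofFn]; simp [h]
    rw [this, Nat.testBit_eq_inth, List.getI_eq_getElem?_getD]
    by_cases h' : i < x.bits.length
    · rw [List.getElem?_append_left h', List.getElem?_eq_getElem h']; rfl
    · push Not at h'
      rw [List.getElem?_append_right h', List.getElem?_eq_none h', List.getElem?_replicate,
        if_pos (by omega)]
      rfl
  · push Not at h
    rw [List.getElem?_eq_none, List.getElem?_eq_none]
    · simp; omega
    · simp [fixedBits, h]

theorem PT.fixedBits {w : α → Str} {x : α → ℕ} (hw : PT w) (hx : PT x) :
    PT fun a => fixedBits (w a).length (x a) := by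
  simp only [fixedBits_eq]
  have := PT.zeros hw
  fun_prop

end GD2C

namespace GD2C

open Code

variable {α β γ : Type} [Code α] [Code β] [Code γ] {Φ : Family}

/-! ### The system -/

namespace World

/-- The components of the system that are known without the master key. -/
def flat (W : World Φ) :
    (Str × Str × Str × Str) × List Str × List UE × List Inst × List HSession × Bool :=
  ((W.d, Φ.encG W.d W.g, Φ.encG W.d (W.g ^ W.msk), W.kp), W.gids, W.ues, W.insts, W.hss, W.tested)

/-- The encoding is deliberately not injective: of the master key only g^s is kept, and the hidden
bit is omitted. A function of the system that is in `PT` can therefore be evaluated by the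
reduction, which does not know the master key. -/
instance : Code (World Φ) := ⟨fun W => enc W.flat⟩

end World

theorem PT.worldFlat {f : α → World Φ} (hf : PT f) : PT fun a => (f a).flat :=
  Code.pt_of_eq hf fun _ => rfl

section
variable {W : α → World Φ} (hW : PT W)
include hW
@[fun_prop] theorem PT.worldD : PT fun a => (W a).d := hW.worldFlat.fst.fst
@[fun_prop] theorem PT.worldG : PT fun a => Φ.encG (W a).d (W a).g := hW.worldFlat.fst.snd.fst
@[fun_prop] theorem PT.worldPub : PT fun a => Φ.encG (W a).d ((W a).g ^ (W a).msk) :=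
  hW.worldFlat.fst.snd.snd.fst
@[fun_prop] theorem PT.worldKp : PT fun a => (W a).kp := hW.worldFlat.fst.snd.snd.snd
@[fun_prop] theorem PT.worldGids : PT fun a => (W a).gids := hW.worldFlat.snd.fst
@[fun_prop] theorem PT.worldUes : PT fun a => (W a).ues := hW.worldFlat.snd.snd.fst
@[fun_prop] theorem PT.worldInsts : PT fun a => (W a).insts := hW.worldFlat.snd.snd.snd.fst
@[fun_prop] theorem PT.worldHss : PT fun a => (W a).hss := hW.worldFlat.snd.snd.snd.snd.fst
@[fun_prop] theorem PT.worldTested : PT fun a => (W a).tested := hW.worldFlat.snd.snd.snd.snd.snd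

@[fun_prop] theorem PT.worldUpdate {kp : α → Str} {gids : α → List Str} {ues : α → List UE}
    {insts : α → List Inst} {hss : α → List HSession} {b tested : α → Bool} (hk : PT kp)
    (hg : PT gids)
    (hu : PT ues) (hi : PT insts) (hh : PT hss) (ht : PT tested) :
    PT fun a => World.mk (𝓕 := Φ) (W a).d (W a).g (W a).msk (kp a) (gids a) (ues a) (insts a)
      (hss a) (b a) (tested a) :=
  Code.pt_of_eq ((hW.worldD.prodMk (hW.worldG.prodMk (hW.worldPub.prodMk hk))).prodMk
    (hg.prodMk (hu.prodMk (hi.prodMk (hh.prodMk ht))))) fun _ => rfl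
end

section
variable [hΦ : Fact Φ.Efficient] {W : α → World Φ} (hW : PT W)
include hW

@[fun_prop] theorem PT.dh {x : α → ℕ} (hx : PT x) : PT fun a => (W a).dh (x a) :=
  PT.powG hW.worldD hW.worldG hx

@[fun_prop] theorem PT.newSid {x : α → ℕ} (hx : PT x) : PT fun a => (W a).newSid (x a) := by
  have : ∀ a, (W a).newSid (x a) = GD2C.fixedBits (Φ.p (W a).d).bits.length (x a) := fun a => by
    rw [Nat.size_eq_bits_len]; rfl
  simp only [this]
  exact PT.fixedBits (PT.bits (PT.prime hW.worldD)) hx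

@[fun_prop] theorem PT.delta {k s : α → Str} (hk : PT k) (hs : PT s) :
    PT fun a => (W a).delta (k a) (s a) := PT.hash hW.worldD (hk.xorStr hs)

@[fun_prop] theorem PT.ack {k s : α → Str} (hk : PT k) (hs : PT s) :
    PT fun a => (W a).ack (k a) (s a) := PT.hash hW.worldD ((hk.xorStr hs).xorStr (PT.const _))

@[fun_prop] theorem PT.xres {k s : α → Str} (hk : PT k) (hs : PT s) :
    PT fun a => (W a).xres (k a) (s a) := PT.hash hW.worldD (hk.appendStr hs)

omit hΦ in
@[fun_prop] theorem PT.gid {u : α → UE} (hu : PT u) : PT fun a => (W a).gid (u a) :=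
  hW.worldGids.listGetD hu.group (PT.const _)

omit hΦ in
@[fun_prop] theorem PT.akOf {i : α → ℕ} (hi : PT i) : PT fun a => (W a).akOf (i a) :=
  (PT.optionMap (g := fun _ u => UE.ak u) (hW.worldUes.getElem? hi) (by fun_prop)).getD (PT.const _)

@[fun_prop] theorem PT.tid {i : α → ℕ} {X s : α → Str} (hi : PT i) (hX : PT X) (hs : PT s) :
    PT fun a => (W a).tid (i a) (X a) (s a) := by
  unfold World.tid; fun_prop

@[fun_prop] theorem PT.prose {s x y : α → Str} (hs : PT s) (hx : PT x) (hy : PT y) :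
    PT fun a => (W a).prose (s a) (x a) (y a) := by
  have e : ∀ a, (W a).prose (s a) (x a) (y a) =
      ((W a).ues.find? fun u => u.aid == x a).bind fun ui =>
      ((W a).ues.find? fun u => u.aid == y a).bind fun uj =>
        if (W a).gid ui = (W a).gid uj then
          some ((W a).ack (GD2C.xorStr (GD2C.xorStr ui.aid ((W a).gid ui)) (W a).kp) (s a),
            (W a).ack (GD2C.xorStr (GD2C.xorStr uj.aid ((W a).gid uj)) (W a).kp) (s a)) else none := by
    intro a
    unfold World.prose
    cases (W a).ues.find? (fun u => u.aid == x a) <;>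
      cases (W a).ues.find? (fun u => u.aid == y a) <;> rfl
  simp only [e]
  refine PT.optionBind (PT.find? hW.worldUes (p := fun a u => u.aid == x a) (by fun_prop)) ?_
  refine PT.optionBind (α := α × UE) (g := fun p uj => if (W p.1).gid p.2 = (W p.1).gid uj then
          some ((W p.1).ack (GD2C.xorStr (GD2C.xorStr p.2.aid ((W p.1).gid p.2)) (W p.1).kp) (s p.1),
            (W p.1).ack (GD2C.xorStr (GD2C.xorStr uj.aid ((W p.1).gid uj)) (W p.1).kp) (s p.1)) else none)
    (PT.find? (α := α × UE) (β := UE) (l := fun p => (W p.1).ues) (by fun_prop)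
      (p := fun p u => u.aid == y p.1) (by fun_prop)) ?_
  fun_prop

@[fun_prop] theorem PT.checkToken {u : α → UE} {s t : α → Str} (hu : PT u) (hs : PT s)
    (ht : PT t) : PT fun a => (W a).checkToken (u a) (s a) (t a) := by
  unfold World.checkToken
  -- The number `l d` is available in unary as the length of any hash value, so no separate program
  -- for it is required.
  simp only [← Φ.length_H _ []]
  fun_prop

-- Nothing has to be decoded: if the stored string represents a group element, it is already the
-- input that the program for powers expects. Only the membership test is needed.
@[fun_prop] theorem PT.sessionKey {I : α → Inst} (hI : PT I) :
    PT fun a => (W a).sessionKey (I a) := by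
  have e : ∀ a, ∃ z, (Φ.decG (W a).d (I a).other).isSome →
      Φ.decG (W a).d (I a).other = some z ∧ Φ.encG (W a).d z = (I a).other := by
    intro a
    cases h : Φ.decG (W a).d (I a).other with
    | none => exact ⟨1, by simp⟩
    | some z =>
      refine ⟨z, fun _ => ⟨rfl, ?_⟩⟩
      unfold BFFamily.decG at h
      split_ifs at h with h'
      cases h
      exact h'.choose_spec
  obtain ⟨f, hf, ef⟩ := hΦ.out.ibe.powG
  have hp := PT.of_polyTime₃ hf hW.worldD hI.other (PT.bits hI.exp)
  have hm := PT.memG (Φ := Φ) hW.worldD hI.other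
  refine Code.pt_of_eq (g := fun a => if (Φ.decG (W a).d (I a).other).isSome = true then
    some (f ![(W a).d, (I a).other, (I a).exp.bits]) else none)
    (hm.decide_eq_true.iteProp hp.optionSome (PT.const none)) fun a => ?_
  obtain ⟨z, hz⟩ := e a
  unfold World.sessionKey
  split_ifs with h
  · obtain ⟨h1, h2⟩ := hz h
    rw [h1, ← h2, ef]
    rfl
  · rw [Option.not_isSome_iff_eq_none] at h
    rw [h]
    rfl

@[fun_prop] theorem PT.react {u : α → UE} {I : α → Inst} {m : α → List Str} (hu : PT u)
    (hI : PT I) (hm : PT m) : PT fun a => (W a).react (u a) (I a) (m a) := by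
  simp only [World.react_eq, World.reactWith]
  have h1 : PT fun a => ((W a).checkToken (u a) (I a).sid ((m a).getD 1 [])).elim
      ([], { I a with stage := 0 }) fun R =>
        ([Φ.ES (u a).key R], { I a with stage := 2, other := (m a).getD 0 [], nonce := R }) :=
    PT.optionCases (g := fun a R => (([Φ.ES (u a).key R],
      { I a with stage := 2, other := (m a).getD 0 [], nonce := R }) : List Str × Inst))
      (by fun_prop) (by fun_prop) (by fun_prop)
  have h2 : PT fun a => ((W a).checkToken (u a) (I a).sid ((m a).getD 1 [])).elim
      ([], { I a with stage := 0 }) fun R =>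
        ([(I a).own, (m a).getD 0 []], { I a with stage := 2, nonce := R }) :=
    PT.optionCases (g := fun a R => (([(I a).own, (m a).getD 0 []],
      { I a with stage := 2, nonce := R }) : List Str × Inst))
      (by fun_prop) (by fun_prop) (by fun_prop)
  fun_prop

end

section
variable [hΦ : Fact Φ.Efficient] {W : α → World Φ} (hW : PT W)
include hW

@[fun_prop] theorem PT.send {k : α → ℕ} {m : α → List Str} (hk : PT k) (hm : PT m) :
    PT fun a => (W a).send (k a) (m a) := by
  have e : ∀ a, (W a).send (k a) (m a) = ((W a).insts[k a]?).elim ([], W a) fun I =>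
      ((W a).ues[I.owner]?).elim ([], W a) fun u => (((W a).react u I (m a)).1,
        { W a with insts := (W a).insts.set (k a) ((W a).react u I (m a)).2 }) := by
    intro a
    unfold World.send
    cases (W a).insts[k a]? with
    | none => rfl
    | some I => cases h : (W a).ues[I.owner]? <;> simp [h]
  simp only [e]
  have h : PT fun p : α × Inst => ((W p.1).ues[p.2.owner]?).elim ([], W p.1) fun u =>
      (((W p.1).react u p.2 (m p.1)).1,
        { W p.1 with insts := (W p.1).insts.set (k p.1) ((W p.1).react u p.2 (m p.1)).2 }) :=
    PT.optionCases (g := fun (p : α × Inst) (u : UE) => (((W p.1).react u p.2 (m p.1)).1,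
      ({ W p.1 with insts := (W p.1).insts.set (k p.1) ((W p.1).react u p.2 (m p.1)).2 } :
        World Φ))) (by fun_prop) (by fun_prop) (by fun_prop)
  exact PT.optionCases (hW.worldInsts.getElem? hk) (by fun_prop) h

@[fun_prop] theorem PT.hssConfirm {k : α → ℕ} {m : α → List Str} (hk : PT k) (hm : PT m) :
    PT fun a => (W a).hssConfirm (k a) (m a) := by
  have e : ∀ a, (W a).hssConfirm (k a) (m a) = ((W a).hss[k a]?).elim ([], W a) fun s =>
      if (m a).length = 1 then
        (if s.isOpen = true ∧
            Φ.DS s.ui.key (GD2C.xorStr (Φ.DS s.uj.key ((m a).getD 0 [])) s.nonce) = s.nonce then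
          [(W a).xres s.ui.key s.sid, (W a).xres s.uj.key s.sid] else [],
        { W a with hss := (W a).hss.set (k a) { s with isOpen := false } })
      else ([], W a) := by
    intro a
    unfold World.hssConfirm
    cases (W a).hss[k a]? with
    | none => rfl
    | some s =>
      rcases m a with - | ⟨x, - | ⟨y, l⟩⟩
      · rfl
      · simp only [Option.elim_some, List.length_cons, List.length_nil, if_true,
          List.getD_cons_zero]
        split_ifs <;> rfl
      · simp
  simp only [e]
  refine PT.optionCases (by fun_prop) (by fun_prop) ?_
  fun_prop

@[fun_prop] theorem PT.relay {i j h : α → ℕ} {m : α → List Str} (hi : PT i) (hj : PT j)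
    (hh : PT h) (hm : PT m) : PT fun a => (W a).relay (i a) (j a) (h a) (m a) := by
  have h1 := PT.send hW hj hm
  have h2 := PT.send h1.snd hi h1.fst
  have h3 := PT.send h2.snd hj h2.fst
  have h4 := PT.hssConfirm h3.snd hh h3.fst
  have h5 := PT.send h4.snd hj h4.fst
  have h6 := PT.send h5.snd hi h5.fst
  exact (h1.fst.encodeList.cons (h2.fst.encodeList.cons (h3.fst.encodeList.cons
    (h4.fst.encodeList.cons (h5.fst.encodeList.cons (PT.const _)))))).prodMk h6.snd

omit hΦ in
@[fun_prop] theorem PT.startOk {i j : α → ℕ} (hi : PT i) (hj : PT j) :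
    PT fun a => decide ((W a).StartOk (i a) (j a)) := by
  have e : ∀ a, decide ((W a).StartOk (i a) (j a)) =
      (((W a).ues[i a]?).isSome && (((W a).ues[j a]?).isSome && decide (¬ i a = j a))) := by
    intro a
    rw [Bool.eq_iff_iff, decide_eq_true_iff]
    simp [World.StartOk]
  simp only [e]
  fun_prop

@[fun_prop] theorem PT.startMsg {i j k x : α → ℕ} {c : α → Ctxt} (hi : PT i) (hj : PT j) (hk : PT k)
    (hx : PT x) (hc : PT c) : PT fun a => (W a).startMsg (i a) (j a) (k a) (x a) (c a) := by
  unfold World.startMsg; fun_prop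

@[fun_prop] theorem PT.startInst {i j k x : α → ℕ} (hi : PT i) (hj : PT j) (hk : PT k) (hx : PT x) :
    PT fun a => (W a).startInst (i a) (j a) (k a) (x a) := by
  unfold World.startInst; fun_prop

@[fun_prop] theorem PT.respondOk {j i : α → ℕ} {m : α → List Str} (hj : PT j) (hi : PT i)
    (hm : PT m) : PT fun a => decide ((W a).RespondOk (j a) (i a) (m a)) := by
  have := PT.memG (Φ := Φ) hW.worldD (hm.listGetD (PT.const 5) (PT.const []))
  have e : ∀ a, decide ((W a).RespondOk (j a) (i a) (m a)) =
      (decide ((W a).StartOk (i a) (j a)) && (decide ((m a).length = 6) &&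
        (Φ.decG (W a).d ((m a).getD 5 [])).isSome)) := by
    intro a
    rw [Bool.eq_iff_iff, decide_eq_true_iff]
    simp [World.RespondOk]
  simp only [e]
  fun_prop

@[fun_prop] theorem PT.respondMsg {j i y : α → ℕ} {m : α → List Str} {c : α → Ctxt} (hj : PT j)
    (hi : PT i) (hm : PT m) (hy : PT y) (hc : PT c) :
    PT fun a => (W a).respondMsg (j a) (i a) (m a) (y a) (c a) := by
  unfold World.respondMsg; fun_prop

@[fun_prop] theorem PT.respondInst {j i y : α → ℕ} {m : α → List Str} (hj : PT j) (hi : PT i) (hm :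
    PT m) (hy : PT y) : PT fun a => (W a).respondInst (j a) (i a) (m a) (y a) := by
  unfold World.respondInst; fun_prop

omit hΦ in
@[fun_prop] theorem PT.addInsts {l : α → List Inst} (hl : PT l) :
    PT fun a => (W a).addInsts (l a) := by
  unfold World.addInsts; fun_prop

@[fun_prop] theorem PT.hssWith {m : α → List Str} {oi oj : α → Option UE} {R : α → Str}
    (hm : PT m) (hi : PT oi) (hj : PT oj) (hR : PT R) :
    PT fun a => World.hssWith (m a) (oi a) (oj a) (R a) (W a) := by
  unfold World.hssWith
  have : PT fun a => (oi a).bind fun ui => (oj a).bind fun uj =>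
      ((W a).prose ((m a).getD 0 []) ui.aid uj.aid).map fun b =>
      ([Φ.ES ui.key (b.1 ++ GD2C.xorStr ((m a).getD 0 []) (R a)),
        Φ.ES uj.key (b.2 ++ GD2C.xorStr ((m a).getD 0 []) (R a))],
        ({ W a with hss := (W a).hss ++
          [{ ui := ui, uj := uj, sid := (m a).getD 0 [], nonce := R a, isOpen := true }] } :
          World Φ)) := by
    have h1 : PT fun p : (α × UE) × UE =>
        ((W p.1.1).prose ((m p.1.1).getD 0 []) p.1.2.aid p.2.aid).map fun b =>
        ([Φ.ES p.1.2.key (b.1 ++ GD2C.xorStr ((m p.1.1).getD 0 []) (R p.1.1)),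
          Φ.ES p.2.key (b.2 ++ GD2C.xorStr ((m p.1.1).getD 0 []) (R p.1.1))],
          ({ W p.1.1 with hss := (W p.1.1).hss ++
            [{ ui := p.1.2, uj := p.2, sid := (m p.1.1).getD 0 [], nonce := R p.1.1,
               isOpen := true }] } : World Φ)) :=
      PT.optionMap (g := fun (p : (α × UE) × UE) (b : Str × Str) =>
        (([Φ.ES p.1.2.key (b.1 ++ GD2C.xorStr ((m p.1.1).getD 0 []) (R p.1.1)),
          Φ.ES p.2.key (b.2 ++ GD2C.xorStr ((m p.1.1).getD 0 []) (R p.1.1))],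
          ({ W p.1.1 with hss := (W p.1.1).hss ++
            [{ ui := p.1.2, uj := p.2, sid := (m p.1.1).getD 0 [], nonce := R p.1.1,
               isOpen := true }] } : World Φ)) : List Str × World Φ)) (by fun_prop) (by fun_prop)
    have h2 : PT fun p : α × UE => oj p.1 := by fun_prop
    exact PT.optionBind hi (PT.optionBind h2 h1)
  exact PT.iteProp (by fun_prop) (this.getD (by fun_prop)) (by fun_prop)

/-! ### The answers to queries -/

@[fun_prop] theorem PT.request {Q : α → Query} {τ : α → Tape} {ci cj : α → Ctxt} (hQ : PT Q)
    (hτ : PT τ) (hi : PT ci) (hj : PT cj) :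
    PT fun a => World.request (Q a) (τ a) (ci a) (cj a) (W a) := by
  have e : ∀ (Q : Query) (τ : Tape) (ci cj : Ctxt) (W : World Φ), World.request Q τ ci cj W =
      if Q.tag = 7 then Q.msg else if Q.tag = 3 then W.respondMsg Q.arg₂ Q.arg₁
        (W.startMsg Q.arg₁ Q.arg₂ τ.sid τ.x ci) τ.y cj else [] := by
    intro Q; cases Q <;> intros <;> rfl
  simp only [e]
  fun_prop

@[fun_prop] theorem PT.core {Q : α → Query} {τ : α → Tape} {ci cj : α → Ctxt}
    {oi oj : α → Option UE} (hQ : PT Q)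
    (hτ : PT τ) (hi : PT ci) (hj : PT cj) (hoi : PT oi) (hoj : PT oj) :
    PT fun a => World.core (Q a) (τ a) (ci a) (cj a) (oi a) (oj a) (W a) := by
  have e : ∀ (Q : Query) (τ : Tape) (ci cj : Ctxt) (oi oj : Option UE) (W : World Φ),
      World.core Q τ ci cj oi oj W =
      if Q.tag = 1 then ([W.gids.length.bits], { W with gids := W.gids ++ [τ.si] }) else
      if Q.tag = 3 then W.core (.execute Q.arg₁ Q.arg₂) τ ci cj oi oj else
      if Q.tag = 4 then (W.startMsg Q.arg₁ Q.arg₂ τ.sid τ.x ci,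
        W.addInsts (W.startInst Q.arg₁ Q.arg₂ τ.sid τ.x)) else
      if Q.tag = 5 then (W.respondMsg Q.arg₁ Q.arg₂ Q.msg τ.y cj,
        W.addInsts (W.respondInst Q.arg₁ Q.arg₂ Q.msg τ.y)) else
      if Q.tag = 6 then W.send Q.arg₁ Q.msg else
      if Q.tag = 7 then W.hssWith Q.msg oi oj τ.R else
      if Q.tag = 8 then W.hssConfirm Q.arg₁ Q.msg else ([], W) := by
    intro Q; cases Q <;> intros <;> rfl
  have hx : PT fun a => (W a).core (.execute (Q a).arg₁ (Q a).arg₂) (τ a) (ci a) (cj a) (oi a)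
      (oj a) := by
    simp only [World.core]
    fun_prop
  rw [show (fun a => World.core (Q a) (τ a) (ci a) (cj a) (oi a) (oj a) (W a)) = _ from
    funext fun a => e _ _ _ _ _ _ _]
  fun_prop

omit hΦ in
@[fun_prop] theorem PT.testOwner {k : α → ℕ} (hk : PT k) : PT fun a => (W a).testOwner (k a) := by
  unfold World.testOwner World.completed
  refine PT.optionBind (g := fun (a : α) (I : Inst) => if (I.key.isSome && (W a).insts.any fun J =>
    J.key.isSome && (J.owner == I.peer && (J.peer == I.owner && (J.initiator == !I.initiator &&
      J.sid == I.sid)))) = true ∧ I.owner < (W a).ues.length then some I.owner else none)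
    (by fun_prop) ?_
  have h1 : PT fun p : α × Inst => (W p.1).insts.any fun J =>
      J.key.isSome && (J.owner == p.2.peer && (J.peer == p.2.owner &&
        (J.initiator == !p.2.initiator && J.sid == p.2.sid))) := by
    refine PT.any (by fun_prop) ?_
    have e : ∀ a b : Bool, (a == !b) = ((a && !b) || (!a && b)) := by decide
    simp only [beq_eq_decide (α := ℕ), e]
    fun_prop
  have h2 : PT fun p : α × Inst => decide (p.2.owner < (W p.1).ues.length) := by
    have e : ∀ p : α × Inst, decide (p.2.owner < (W p.1).ues.length) =
        ((W p.1).ues[p.2.owner]?).isSome := by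
      intro p
      rw [Bool.eq_iff_iff]; simp
    simp only [e]
    fun_prop
  fun_prop

end

@[fun_prop] theorem PT.lookup {ids : α → List Slot} {m : α → Str} (hi : PT ids) (hm : PT m) :
    PT fun a => lookup (ids a) (m a) :=
  PT.optionMap (g := fun _ (p : Slot) => p.2) (PT.find? hi
    (p := fun a p => p.1.1 == m a || p.1.2 == m a) (by fun_prop)) (by fun_prop)

theorem PT.plain {w : α → Str} {b : α → Bool} {ids : α → List Slot} {i : α → ℕ} (hw : PT w) (hb : PT
    b) (hids : PT ids) (hi : PT i) : PT fun a => plain (w a).length (b a) (ids a) (i a) := by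
  unfold GD2C.plain pick
  have := PT.zeros hw
  have h2 : PT fun a => ((ids a)[i a]?).map fun p => bif b a then p.1.2 else p.1.1 :=
    PT.optionMap (g := fun a (p : Slot) => bif b a then p.1.2 else p.1.1) (by fun_prop)
      (by fun_prop)
  fun_prop

section
variable [hΦ : Fact Φ.Efficient] {W : α → World Φ} (hW : PT W)
include hW

@[fun_prop] theorem PT.plainN {b : α → Bool} {ids : α → List Slot} {i : α → ℕ} (hb : PT b) (hids :
    PT ids) (hi : PT i) : PT fun a => GD2C.plain (Φ.n (W a).d) (b a) (ids a) (i a) := by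
  -- The length `n` is read off from a value of `H4`, as the lengths of its values are all `n`.
  simp only [← Φ.length_H4 _ []]
  exact PT.plain (PT.hash4 hW.worldD (PT.const [])) hb hids hi

@[fun_prop] theorem PT.ctI (v : BFVersion) {Q : α → Query} {τ : α → Tape} {m : α → Str}
    (hQ : PT Q) (hτ : PT τ) (hm : PT m) : PT fun a => World.ctI v (Q a) (τ a) (m a) (W a) := by
  unfold World.ctI World.tidI BFFamily.encryptWith BFFamily.mask
  have h1 : PT fun a => (W a).tid (Q a).initiator ((W a).dh (τ a).x) ((W a).newSid (τ a).sid) := by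
    fun_prop
  have hp := PT.pairing (Φ := Φ) hW.worldD (PT.hash1 (Φ := Φ) hW.worldD h1) hW.worldPub
  cases v with
  | basic =>
    exact (PT.powG hW.worldD hW.worldG hτ.tapeRi).prodMk ((hm.xorStr
      (PT.hash2 hW.worldD (PT.powGT hW.worldD hp hτ.tapeRi))).prodMk (PT.const _))
  | full =>
    have h3 := PT.hash3 (Φ := Φ) hW.worldD hτ.tapeSi hm
    exact (PT.powG hW.worldD hW.worldG h3).prodMk ((hτ.tapeSi.xorStr
      (PT.hash2 hW.worldD (PT.powGT hW.worldD hp h3))).prodMk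
        (hm.xorStr (PT.hash4 hW.worldD hτ.tapeSi)))

@[fun_prop] theorem PT.tidI {Q : α → Query} {τ : α → Tape} (hQ : PT Q) (hτ : PT τ) :
    PT fun a => World.tidI (Q a) (τ a) (W a) := by
  unfold World.tidI; fun_prop

@[fun_prop] theorem PT.tidJ {Q : α → Query} {τ : α → Tape} (hQ : PT Q) (hτ : PT τ) :
    PT fun a => World.tidJ (Q a) (τ a) (W a) := by
  unfold World.tidJ; fun_prop

@[fun_prop] theorem PT.ctJ (v : BFVersion) {Q : α → Query} {τ : α → Tape} {m : α → Str}
    (hQ : PT Q) (hτ : PT τ) (hm : PT m) : PT fun a => World.ctJ v (Q a) (τ a) (m a) (W a) := by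
  unfold World.ctJ BFFamily.encryptWith BFFamily.mask
  have h1 := PT.tidJ hW hQ hτ
  have hp := PT.pairing (Φ := Φ) hW.worldD (PT.hash1 (Φ := Φ) hW.worldD h1) hW.worldPub
  cases v with
  | basic =>
    exact (PT.powG hW.worldD hW.worldG hτ.tapeRj).prodMk ((hm.xorStr
      (PT.hash2 hW.worldD (PT.powGT hW.worldD hp hτ.tapeRj))).prodMk (PT.const _))
  | full =>
    have h3 := PT.hash3 (Φ := Φ) hW.worldD hτ.tapeSj hm
    exact (PT.powG hW.worldD hW.worldG h3).prodMk ((hτ.tapeSj.xorStr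
      (PT.hash2 hW.worldD (PT.powGT hW.worldD hp h3))).prodMk
        (hm.xorStr (PT.hash4 hW.worldD hτ.tapeSj)))

omit hΦ in
@[fun_prop] theorem PT.registerDevice {g : α → ℕ} {τ : α → Tape} {ids : α → List Slot}
    (hg : PT g) (hτ : PT τ) (hi : PT ids) :
    PT fun a => HState.registerDevice (g a) (τ a) (W a) (ids a) := by
  unfold HState.registerDevice
  refine PT.optionBind (g := fun (a : α) (gid : Str) =>
    if GD2C.lookup (ids a) (τ a).si = none ∧ GD2C.lookup (ids a) (τ a).sj = none then
      some ([(W a).ues.length.bits], { W a with ues := (W a).ues ++ [UE.mk [] (τ a).s₃ (τ a).s₄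
          (GD2C.xorStr (GD2C.xorStr (τ a).s₃ gid) (W a).kp) (g a)] },
        ids a ++ [(((τ a).si, (τ a).sj), UE.mk [] (τ a).s₃ (τ a).s₄
          (GD2C.xorStr (GD2C.xorStr (τ a).s₃ gid) (W a).kp) (g a))])
    else none) (hW.worldGids.getElem? hg) ?_
  have e : ∀ o : Option UE, decide (o = none) = !o.isSome := by
    intro o; cases o <;> simp
  have h1 : PT fun a : α × Str => decide (GD2C.lookup (ids a.1) (τ a.1).si = none) := by
    simp only [e]; fun_prop
  have h2 : PT fun a : α × Str => decide (GD2C.lookup (ids a.1) (τ a.1).sj = none) := by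
    simp only [e]; fun_prop
  fun_prop

end

/-- The answer to a query in the game with two identities: the reply, the system and the devices. -/
def HState.parts (Q : Query) (τ : Tape) (ci cj : Ctxt) (oi oj : Option UE) (W : World Φ)
    (ids : List Slot) : List Str × World Φ × List Slot :=
  if Q.tag = 2 then (registerDevice Q.arg₁ τ W ids).getD ([], W, ids)
  else if Q.tag = 10 then
    ((W.testOwner Q.arg₁).map fun i => ([plain (Φ.n W.d) false ids i],
      { W with tested := true }, [])).getD ([], W, ids)
  else ((W.core Q τ ci cj oi oj).1, (W.core Q τ ci cj oi oj).2, ids)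

/-- Whether the answer to a query uses choices of candidates. -/
def Query.encrypts (Q : Query) : Bool := !decide (Q.tag = 2) && !decide (Q.tag = 10)

/-- The infinite sequence of choices is not an encoded object. It is split off here; the reduction
keeps the number `j` in its place and computes only `parts`. -/
theorem HState.final_eq (Q : Query) (τ : Tape) (ci cj : Ctxt) (oi oj : Option UE) (S : HState Φ) :
    S.final Q τ ci cj oi oj = ((parts Q τ ci cj oi oj S.W S.ids).1, ⟨(parts Q τ ci cj oi oj S.W
    S.ids).2.1, (parts Q τ ci cj oi oj S.W S.ids).2.2, bif Q.encrypts then fun i => S.sel (i + 2)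
    else S.sel⟩) := by
  cases Q
  case register g =>
    simp only [HState.final, HState.register, parts, Query.encrypts, Query.tag, Query.arg₁, if_true]
    cases h : registerDevice g τ S.W S.ids <;> simp
  case test k =>
    simp only [HState.final, HState.test, parts, Query.encrypts, Query.tag, Query.arg₁]
    cases h : S.W.testOwner k <;> simp
  all_goals simp [HState.final, parts, Query.encrypts, Query.tag]

@[fun_prop] theorem PT.encrypts {Q : α → Query} (hQ : PT Q) : PT fun a => (Q a).encrypts := by
  unfold Query.encrypts; fun_prop

@[fun_prop] theorem PT.parts [hΦ : Fact Φ.Efficient] {W : α → World Φ} (hW : PT W) {Q : α → Query}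
    {τ : α → Tape} {ci cj : α → Ctxt} {oi oj : α → Option UE} {ids : α → List Slot} (hQ : PT Q) (hτ
    : PT τ) (hi : PT ci) (hj : PT cj) (hoi : PT oi) (hoj : PT oj) (hids : PT ids) : PT fun a =>
    HState.parts (Q a) (τ a) (ci a) (cj a) (oi a) (oj a) (W a) (ids a) := by
  unfold HState.parts
  have h1 : PT fun a => ((W a).testOwner (Q a).arg₁).map fun i =>
      (([GD2C.plain (Φ.n (W a).d) false (ids a) i],
          { W a with tested := true }, []) : List Str × World Φ × List Slot) :=
    PT.optionMap (g := fun (a : α) (i : ℕ) => (([GD2C.plain (Φ.n (W a).d) false (ids a) i],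
          { W a with tested := true }, []) : List Str × World Φ × List Slot))
      (PT.testOwner hW (by fun_prop)) (by fun_prop)
  have h2 := PT.core hW hQ hτ hi hj hoi hoj
  have h3 := PT.registerDevice hW (PT.arg₁ hQ) hτ hids
  have h4 : PT fun a => (([], W a, ids a) : List Str × World Φ × List Slot) :=
    (PT.const _).prodMk (hW.prodMk hids)
  have h5 : ∀ k : ℕ, PT fun a => decide ((Q a).tag = k) := fun k => by fun_prop
  exact (h5 2).iteProp (h3.getD h4) ((h5 10).iteProp (h1.getD h4)
    (h2.fst.prodMk (h2.snd.prodMk hids)))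

end GD2C

namespace GD2C

open Code

/-! ### Adversaries from transition functions -/

section
variable {Y : Type} (Γ : Game)

/-- One query of a procedure with state `y`, and the next state. -/
def procStep (qry : Y → List Str) (adv : Y → Str → Y) (x : Y × Γ.State) : PMF (Y × Γ.State) :=
  (Γ.answer (qry x.1) x.2).map fun r => (adv x.1 (encodeList r.1), r.2)

/-- Several queries of a procedure. -/
def procRun (qry : Y → List Str) (adv : Y → Str → Y) : ℕ → Y × Γ.State → PMF (Y × Γ.State)
  | 0, x => PMF.pure x
  | k + 1, x => (procStep Γ qry adv x).bind (procRun qry adv k)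

theorem procRun_add (qry : Y → List Str) (adv : Y → Str → Y) (k l : ℕ) (x : Y × Γ.State) :
    procRun Γ qry adv (k + l) x = (procRun Γ qry adv k x).bind (procRun Γ qry adv l) := by
  induction k generalizing x with
  | zero => rw [Nat.zero_add, procRun, PMF.pure_bind]
  | succ k ih =>
    rw [Nat.add_right_comm, procRun, procRun, PMF.bind_bind]
    exact bind_congr fun y _ => ih y

end

/-- The state of an adversary: the guess in front of the state of a procedure. -/
def procCode {Y : Type} [Code Y] (out : Y → Bool) (y : Y) : Str := out y :: enc y

/-- A procedure whose parts are computed in polynomial time is an adversary. -/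
theorem exists_adversary {Y : Type} [Code Y] (Γ : Game) {qry : Y → List Str} {adv : Y → Str → Y}
    {out : Y → Bool} (hq : PT qry) (ha : PT fun p : Y × Str => adv p.1 p.2) (ho : PT out)
    {F₀ : Str → Str} (h₀ : FP F₀) (bound : Polynomial ℕ) :
    ∃ B : Adversary, B.bound = bound ∧ ∀ (κ k : ℕ) (y₀ : Y) (c : Γ.State)
      (Inv : Y → Γ.State → Prop), bound.eval κ = k + 1 →
      F₀ (strPair (List.replicate κ true) (encodeList (Γ.greet c))) = enc y₀ →
      (encodeList (Γ.greet c)).length ≤ bound.eval κ → Inv y₀ c →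
      (∀ y c, Inv y c → (procCode out y).length ≤ bound.eval κ) →
      (∀ y c, Inv y c → ∀ r ∈ (Γ.answer (qry y) c).support,
        (encodeList r.1).length ≤ bound.eval κ ∧ Inv (adv y (encodeList r.1)) r.2) →
      B.guess Γ κ c = (procRun Γ qry adv k (y₀, c)).map fun x => out x.1 := by
  obtain ⟨Fq, hFq, eq⟩ := hq
  obtain ⟨Fa, hFa, ea⟩ := ha
  obtain ⟨Fo, hFo, eo⟩ := ho
  -- The state of an adversary is empty only before its first round, since `procCode` always has the
  -- guess bit in front. An empty state therefore triggers the initialization from the published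
  -- data; otherwise the guess bit is removed and the last reply is processed.
  set N : Str → Str := fun w => strCases (GD2C.strFst (GD2C.strSnd w))
    (F₀ (strPair (GD2C.strFst w) (GD2C.strSnd (GD2C.strSnd w))))
    (Fa (strPair (GD2C.strFst (GD2C.strSnd w)).tail (GD2C.strSnd (GD2C.strSnd w))))
    (Fa (strPair (GD2C.strFst (GD2C.strSnd w)).tail (GD2C.strSnd (GD2C.strSnd w)))) with hN
  have hst : FP fun w => GD2C.strFst (GD2C.strSnd w) := FP.strFst.comp FP.strSnd
  have hre : FP fun w => GD2C.strSnd (GD2C.strSnd w) := FP.strSnd.comp FP.strSnd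
  have hNF : FP N := hst.cases (h₀.comp (FP.strFst.pair hre))
    (hFa.comp ((FP.tail.comp hst).pair hre)) (hFa.comp ((FP.tail.comp hst).pair hre))
  set E : Str → Str := fun w => strPair (strCases (Fo (N w)) (false :: N w) (false :: N w)
    (true :: N w)) (Fq (N w)) with hE
  have hEF : FP E := ((hFo.comp hNF).cases ((FP.cons false).comp hNF) ((FP.cons false).comp hNF)
    ((FP.cons true).comp hNF)).pair (hFq.comp hNF)
  have key : ∀ w y, N w = enc y → decodeList (E w) = procCode out y :: qry y := by
    intro w y h
    have h1 : E w = encodeList (procCode out y :: qry y) := by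
      rw [encodeList_cons, hE]
      dsimp only
      rw [h, eo, eq, enc_strs]
      congr 1
      cases ho : out y <;> simp [ho, procCode, enc_false, enc_true, strCases]
    rw [h1, decodeList_encodeList]
  refine ⟨⟨_, bound, hEF.polyTime⟩, rfl, fun κ k y₀ c Inv hk hF₀ hg hI hsize hstep => ?_⟩
  set B : Adversary := ⟨_, bound, hEF.polyTime⟩ with hB
  have hB' : B.bound = bound := rfl
  have round : ∀ (st rep : Str) (y : Y) (c : Γ.State), Inv y c →
      N (strPair (List.replicate κ true) (strPair st rep)) = enc y →
      B.round Γ κ (st, rep, c) = (Γ.answer (qry y) c).map fun r =>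
        (procCode out y, encodeList r.1, r.2) := by
    intro st rep y c hy hN'
    have hd : decodeList (B.step ![List.replicate κ true, st, rep]) = procCode out y :: qry y := by
      simp only [hB]
      exact key _ y hN'
    rw [Adversary.round_cons hd, map_eq_bind, map_eq_bind]
    refine bind_congr fun r hr => ?_
    simp only [Adversary.next, hB']
    rw [List.take_of_length_le (hsize y c hy), List.take_of_length_le (hstep y c hy r hr).1]
  have main : ∀ (k : ℕ) (st rep : Str) (y : Y) (c : Γ.State), Inv y c →
      N (strPair (List.replicate κ true) (strPair st rep)) = enc y →
      B.run Γ κ (k + 1) (st, rep, c) = (procRun Γ qry adv k (y, c)).map fun x => out x.1 := by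
    intro k
    induction k with
    | zero =>
      intro st rep y c hy hN'
      -- The guess bit is emitted together with a query, before its reply is seen. So the last query
      -- is without effect, and `k + 1` rounds carry out `k` queries of the procedure.
      rw [Adversary.run_succ, round st rep y c hy hN', PMF.bind_map]
      simp only [Function.comp_def, Adversary.run_zero, procRun, PMF.pure_map, procCode,
        List.headD_cons, PMF.bind_const]
    | succ k ih =>
      intro st rep y c hy hN'
      rw [Adversary.run_succ, round st rep y c hy hN', PMF.bind_map, procRun, procStep,
        PMF.bind_map, PMF.map_bind]
      refine bind_congr fun r hr => ?_
      refine ih _ _ _ _ (hstep y c hy r hr).2 ?_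
      have := ea (y, encodeList r.1)
      rw [enc_pair, enc_str] at this
      simp only [hN, strFst_strPair, strSnd_strPair, procCode]
      cases out y <;> simp [strCases, this]
  unfold Adversary.guess
  rw [hB', hk]
  refine main k _ _ y₀ c hI ?_
  rw [← hk, List.take_of_length_le hg]
  simp [hN, strFst_strPair, strSnd_strPair, strCases, hF₀]

end GD2C

/-! ### The reduction: its transition function, its correctness, and its computability. -/

namespace GD2C

open Code

variable {α β γ : Type} [Code α] [Code β] [Code γ] {Φ : Family}

/-! ### Sampling -/

/-- Subtraction of one from a positive binary number. -/
def predStr : Str → Str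
  | [] => []
  | true :: w => false :: w
  | false :: w => true :: predStr w

theorem toNat_predStr (w : Str) (h : 0 < toNat w) : toNat (predStr w) = toNat w - 1 := by
  induction w with
  | nil => simp [toNat] at h
  | cons b w ih =>
    cases b
    · rw [toNat_cons] at h
      simp only [Nat.bit, cond_false] at h
      rw [predStr, toNat_cons, toNat_cons, ih (by omega)]
      simp only [Nat.bit, cond_false, cond_true]
      omega
    · rw [predStr, toNat_cons, toNat_cons]
      simp [Nat.bit]

-- Subtraction with borrow: zeros are flipped up to the first one, and the rest is copied. The
-- number 0 is treated apart, because then there is no one at which the borrow ends.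
@[fun_prop] theorem PT.pred {f : α → ℕ} (hf : PT f) : PT fun a => f a - 1 := by
  have key : ∀ (w acc : Str), (w.foldl (fun (s : Bool × Str) b => bif s.1 then (true, b :: s.2)
      else (b, (!b) :: s.2)) (false, acc)).2.reverse = acc.reverse ++ predStr w := by
    have k1 : ∀ (w acc : Str), (w.foldl (fun (s : Bool × Str) b => bif s.1 then (true, b :: s.2)
      else (b, (!b) :: s.2)) (true, acc)).2.reverse = acc.reverse ++ w := by
      intro w
      induction w with
      | nil => simp
      | cons b w ih => intro acc; rw [List.foldl_cons, cond_true, ih]; simp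
    intro w
    induction w with
    | nil => simp [predStr]
    | cons b w ih =>
      intro acc
      cases b
      · rw [List.foldl_cons, cond_false, ih]; simp [predStr]
      · rw [List.foldl_cons, cond_false, k1]; simp [predStr]
  have h := PT.foldlBits (PT.bits hf) (PT.const (false, ([] : Str)))
    (F := fun _ (s : Bool × Str) b => bif s.1 then (true, b :: s.2) else (b, (!b) :: s.2))
    (by fun_prop) 3 (by
      intro a s b
      rcases s with ⟨- | -, y⟩ <;> cases b <;> simp [enc_pair, enc_str, enc_true, enc_false] <;>
        omega)
  have e : ∀ a, f a - 1 = GD2C.toNat (((f a).bits.foldl (fun (s : Bool × Str) b =>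
      bif s.1 then (true, b :: s.2) else (b, (!b) :: s.2)) (false, [])).2.reverse) := by
    intro a
    rw [key]
    by_cases h : 0 < f a
    · have := toNat_predStr (f a).bits (by rwa [toNat_bits])
      rw [toNat_bits] at this
      simp [this]
    · have : f a = 0 := by omega
      simp [this, predStr, GD2C.toNat]
  simp only [e]
  exact h.snd.reverseStr.toNat

theorem toNat_replicate_true (n : ℕ) : toNat (List.replicate n true) = 2 ^ n - 1 := by
  induction n with
  | zero => rfl
  | succ n ih =>
    rw [List.replicate_succ, toNat_cons, ih]
    have : 0 < 2 ^ n := by positivity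
    simp only [Nat.bit, cond_true, pow_succ]
    omega

/-- A uniform string is a uniform number, written in binary. -/
theorem uniformStr_eq (n : ℕ) : uniformStr n = (uniformUpTo (2 ^ n - 1)).map (fixedBits n) := by
  have hn : 2 ^ n - 1 + 1 = 2 ^ n := Nat.sub_add_cancel Nat.one_le_two_pow
  unfold uniformStr uniformUpTo
  rw [PMF.map_comp]
  have hinj : Function.Injective fun x : Fin (2 ^ n - 1 + 1) => fun i : Fin n =>
      (x : ℕ).testBit i := by
    intro x y h
    apply Fin.ext
    refine Nat.eq_of_testBit_eq fun i => ?_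
    by_cases hi : i < n
    · exact congrFun h ⟨i, hi⟩
    · push Not at hi
      have hx : (x : ℕ) < 2 ^ i := by
        have := x.2; have := Nat.pow_le_pow_right (n := 2) (by norm_num) hi; omega
      have hy : (y : ℕ) < 2 ^ i := by
        have := y.2; have := Nat.pow_le_pow_right (n := 2) (by norm_num) hi; omega
      rw [Nat.testBit_eq_false_of_lt hx, Nat.testBit_eq_false_of_lt hy]
  have hb := (Fintype.bijective_iff_injective_and_card _).mpr ⟨hinj, by simp [hn]⟩
  rw [← uniformOfFintype_map_equiv (Equiv.ofBijective _ hb), PMF.map_comp]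
  rfl

/-- All random choices become uniform numbers in some range {0, …, N}, the only randomness an
adversary can ask for. -/
theorem tape_eq (Ψ : BFFamily) (d : Str) : Ψ.tape d = (uniformUpTo (Ψ.p d - 1)).bind fun sid =>
    (uniformUpTo (Ψ.p d - 1)).bind fun x => (uniformUpTo (Ψ.p d - 1)).bind fun ri => (uniformUpTo (2
    ^ Ψ.n d - 1)).bind fun si => (uniformUpTo (Ψ.p d - 1)).bind fun y => (uniformUpTo (Ψ.p d -
    1)).bind fun rj => (uniformUpTo (2 ^ Ψ.n d - 1)).bind fun sj => (uniformUpTo (2 ^ Ψ.n d -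
    1)).bind fun s₃ => (uniformUpTo (2 ^ Ψ.n d - 1)).bind fun s₄ => (uniformUpTo (2 ^ (Ψ.p d).size -
    1)).map fun R => ⟨sid, x, ri, fixedBits (Ψ.n d) si, y, rj, fixedBits (Ψ.n d) sj, fixedBits (Ψ.n
    d) s₃, fixedBits (Ψ.n d) s₄, fixedBits (Ψ.p d).size R⟩ := by
  simp only [BFFamily.tape, BFFamily.randExp, uniformStr_eq, PMF.bind_map, PMF.map_comp,
    Function.comp_def]

/-! ### The state of the reduction -/

/-- The state of an adversary in the chosen-ciphertext game that plays a hybrid game with another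
adversary: whether it has to be initialized, the remaining number of rounds, the state of the
other adversary and its last reply, the system, the devices, the number of encryptions before the
challenge, the challenge (identity, ciphertext, first message), the security parameter, and the
replies in the present round. -/
structure RState (Φ : Family) where
  boot : Bool
  fuel : Str
  st : Str
  rep : Str
  W : World Φ
  ids : List Slot
  j : ℕ
  chal : Option ((Str × Ctxt) × Str)
  one : Str
  ans : List Str

/-- The components of the state. -/
def RState.flat (y : RState Φ) : (Bool × Str × Str × Str × World Φ) × List Slot × ℕ ×
    Option ((Str × Ctxt) × Str) × Str × List Str :=
  ((y.boot, y.fuel, y.st, y.rep, y.W), y.ids, y.j, y.chal, y.one, y.ans)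

instance : Code (RState Φ) := ⟨fun y => enc y.flat⟩

theorem PT.rFlat {f : α → RState Φ} (hf : PT f) : PT fun a => (f a).flat :=
  Code.pt_of_eq hf fun _ => rfl

section
variable {f : α → RState Φ} (hf : PT f)
include hf
@[fun_prop] theorem PT.rBoot : PT fun a => (f a).boot := hf.rFlat.fst.fst
@[fun_prop] theorem PT.rFuel : PT fun a => (f a).fuel := hf.rFlat.fst.snd.fst
@[fun_prop] theorem PT.rSt : PT fun a => (f a).st := hf.rFlat.fst.snd.snd.fst
@[fun_prop] theorem PT.rRep : PT fun a => (f a).rep := hf.rFlat.fst.snd.snd.snd.fst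
@[fun_prop] theorem PT.rW : PT fun a => (f a).W := hf.rFlat.fst.snd.snd.snd.snd
@[fun_prop] theorem PT.rIds : PT fun a => (f a).ids := hf.rFlat.snd.fst
@[fun_prop] theorem PT.rJ : PT fun a => (f a).j := hf.rFlat.snd.snd.fst
@[fun_prop] theorem PT.rChal : PT fun a => (f a).chal := hf.rFlat.snd.snd.snd.fst
@[fun_prop] theorem PT.rOne : PT fun a => (f a).one := hf.rFlat.snd.snd.snd.snd.fst
@[fun_prop] theorem PT.rAns : PT fun a => (f a).ans := hf.rFlat.snd.snd.snd.snd.snd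
end

@[fun_prop] theorem PT.rMk {a : α → Bool} {b c d : α → Str} {e : α → World Φ}
    {f : α → List Slot} {g : α → ℕ} {h : α → Option ((Str × Ctxt) × Str)} {i : α → Str}
    {j : α → List Str} (ha : PT a) (hb : PT b) (hc : PT c)
    (hd : PT d) (he : PT e) (hf : PT f) (hg : PT g) (hh : PT h) (hi : PT i) (hj : PT j) :
    PT fun x => RState.mk (a x) (b x) (c x) (d x) (e x) (f x) (g x) (h x) (i x) (j x) :=
  Code.pt_of_eq ((ha.prodMk (hb.prodMk (hc.prodMk (hd.prodMk he)))).prodMk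
    (hf.prodMk (hg.prodMk (hh.prodMk (hi.prodMk hj))))) fun _ => rfl

/-- The number in a reply. -/
def num (a : Str) : ℕ := toNat ((decodeList a).headD [])

@[fun_prop] theorem PT.num {f : α → Str} (hf : PT f) : PT fun a => num (f a) := by
  unfold GD2C.num; fun_prop

theorem num_encodeList (k : ℕ) : num (encodeList [k.bits]) = k := by
  simp [num, decodeList_encodeList]

namespace RState

variable (A : Adversary) (v : BFVersion) (y : RState Φ)

/-- The bound of the other adversary. -/
def limit : ℕ := A.bound.eval y.one.length

/-- What the other adversary does in the present round. -/
def action : List Str := decodeList (A.step ![y.one, y.st, y.rep])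

/-- Whether the other adversary asks for a random number. -/
def isCoin : Bool := decide ((y.action A).tail.length = 2) && ((y.action A).tail.headD []).isEmpty

/-- The query of the other adversary to the system. -/
def asked : Option Query :=
  bif (y.action A).isEmpty || y.isCoin A || y.W.tested then none
  else Query.parse (y.action A).tail

/-- The random choices for the present round. -/
def tape : Tape :=
  ⟨num (y.ans.getD 1 []), num (y.ans.getD 2 []), num (y.ans.getD 3 []),
    fixedBits (Φ.n y.W.d) (num (y.ans.getD 4 [])), num (y.ans.getD 5 []),
    num (y.ans.getD 6 []), fixedBits (Φ.n y.W.d) (num (y.ans.getD 7 [])),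
    fixedBits (Φ.n y.W.d) (num (y.ans.getD 8 [])),
    fixedBits (Φ.n y.W.d) (num (y.ans.getD 9 [])),
    fixedBits (Φ.p y.W.d).size (num (y.ans.getD 10 []))⟩

/-- A candidate for the identity of the initiating device. -/
def plainI (Q : Query) (β : Bool) : Str := plain (Φ.n y.W.d) β y.ids Q.initiator

/-- A candidate for the identity of the responding device. -/
def plainJ (Q : Query) (β : Bool) : Str := plain (Φ.n y.W.d) β y.ids Q.responder

/-- The challenge query. -/
def chalQuery (Q : Query) (τ : Tape) : List Str :=
  bif Q.encrypts then
    -- With the least significant bit first, `[true, true]` is 3, the kind of a challenge. The slot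
    -- `j` is 1 or 2 when it lies in the present query.
    if y.j = 1 then [[true, true], y.W.tidI Q τ, y.plainI Q false, y.plainI Q true]
    else if y.j = 2 then [[true, true], y.W.tidJ Q τ, y.plainJ Q false, y.plainJ Q true]
    else []
  else []

/-- The ciphertext in a reply. -/
def ctxt (l : List Str) : Ctxt := (l.getD 0 [], l.getD 1 [], l.getD 2 [])

/-- The first ciphertext in the present round. -/
def ctI (Q : Query) (τ : Tape) (c : Ctxt) : Ctxt :=
  -- For `j = 0` no challenge is to come and the first candidate is encrypted; for `j ≥ 2` this slot
  -- lies before the challenge and receives the second candidate.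
  if y.j = 1 then c else y.W.ctI v Q τ (y.plainI Q !decide (y.j = 0))

/-- The second ciphertext in the present round. -/
def ctJ (Q : Query) (τ : Tape) (c : Ctxt) : Ctxt :=
  -- For `j = 1` the challenge is the preceding slot of the same query, so this slot already lies
  -- after it, as for `j = 0`.
  if y.j = 2 then c else y.W.ctJ v Q τ (y.plainJ Q !decide (y.j = 0 ∨ y.j = 1))

/-- The challenge after the present round. -/
def chalNext (Q : Query) (τ : Tape) (c : Ctxt) : Option ((Str × Ctxt) × Str) :=
  bif Q.encrypts then
    if y.j = 1 then some ((y.W.tidI Q τ, c), y.plainI Q false)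
    else if y.j = 2 then some ((y.W.tidJ Q τ, c), y.plainJ Q false)
    else y.chal
  else y.chal

/-- The request to HSS/AuC in the present round. -/
def request (Q : Query) (τ : Tape) (c : Ctxt) : List Str :=
  y.W.request Q τ (y.ctI v Q τ c) (y.ctJ v Q τ c)

/-- The first message of the challenge, if a given ciphertext is the challenge. -/
def chalMatch (ch : Option ((Str × Ctxt) × Str)) (t : Str × Ctxt) : Option Str :=
  ch.bind fun x => if x.1.1 = t.1 ∧ x.1.2.1 = t.2.1 ∧ x.1.2.2.1 = t.2.2.1 ∧
    x.1.2.2.2 = t.2.2.2 then some x.2 else none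

/-- The decryption query. -/
def decQuery (ch : Option ((Str × Ctxt) × Str)) (t : Str × Ctxt) : List Str :=
  bif (chalMatch ch t).isSome then [] else [[false, true], t.1, t.2.1, t.2.2.1, t.2.2.2]

/-- The device identified by HSS/AuC, given the reply to the decryption query. -/
def opened (ch : Option ((Str × Ctxt) × Str)) (t : Str × Ctxt) (a : List Str) : Option UE :=
  ((chalMatch ch t).elim a.head? some).bind (lookup y.ids)

/-- The answer to the query in the present round. -/
def parts (Q : Query) (τ : Tape) (c : Ctxt) (ai aj : List Str) : List Str × World Φ × List Slot :=
  HState.parts Q τ (y.ctI v Q τ c) (y.ctJ v Q τ c)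
    (y.opened (y.chalNext Q τ c) (World.reqI (y.request v Q τ c)) ai)
    (y.opened (y.chalNext Q τ c) (World.reqJ (y.request v Q τ c)) aj) y.W y.ids

/-- The state after an answer of the system. -/
def answered (st : Str) (Q : Query) (τ : Tape) (c : Ctxt) (ai aj : List Str) : RState Φ :=
  { y with
    fuel := y.fuel.tail
    st := st.take (y.limit A)
    rep := (encodeList (y.parts v Q τ c ai aj).1).take (y.limit A)
    W := (y.parts v Q τ c ai aj).2.1
    ids := (y.parts v Q τ c ai aj).2.2
    j := bif Q.encrypts then y.j - 1 - 1 else y.j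
    chal := y.chalNext Q τ c
    ans := [] }

/-- The state after a round. -/
def finish (a : Str) (τ : Tape) (c : Ctxt) (ai aj : List Str) : RState Φ :=
  bif y.fuel.isEmpty then { y with ans := [] }
  else bif (y.action A).isEmpty then { y with fuel := y.fuel.tail, rep := [], ans := [] }
  else bif y.isCoin A then { y with
    fuel := y.fuel.tail
    st := ((y.action A).headD []).take (y.limit A)
    rep := a.take (y.limit A)
    ans := [] }
  else (y.asked A).elim { y with
    fuel := y.fuel.tail
    st := ((y.action A).headD []).take (y.limit A)
    rep := []
    ans := [] } fun Q => y.answered A v ((y.action A).headD []) Q τ c ai aj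

/-- The state after the initial round. -/
def booted : RState Φ :=
  { y with
    boot := false
    j := num (y.ans.getD 0 [])
    W := { y.W with kp := fixedBits (Φ.n y.W.d) (num (y.ans.getD 1 [])) }
    ans := [] }

/-- Queries for random numbers and of the initial round. -/
def query : List Str :=
  let k := y.ans.length
  bif y.boot then
    -- The challenge slot is uniform in {0, …, 2T}; the second draw of this round is the secret of
    -- the ProSe function.
    if k = 0 then [[], (2 * y.limit A).bits]
    else if k = 1 then [[], List.replicate (Φ.n y.W.d) true] else []
  else if k = 0 then
    bif !y.fuel.isEmpty && (!(y.action A).isEmpty && y.isCoin A) then (y.action A).tail else []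
  else if k = 1 ∨ k = 2 ∨ k = 3 ∨ k = 5 ∨ k = 6 then [[], (Φ.p y.W.d - 1).bits]
  else if k = 4 ∨ k = 7 ∨ k = 8 ∨ k = 9 then [[], List.replicate (Φ.n y.W.d) true]
  else if k = 10 then [[], List.replicate (Φ.p y.W.d).size true]
  else bif y.fuel.isEmpty then []
  else (y.asked A).elim [] fun Q =>
    let c := ctxt (decodeList (y.ans.getD 11 []))
    if k = 11 then y.chalQuery Q y.tape
    else if k = 12 then
      decQuery (y.chalNext Q y.tape c) (World.reqI (y.request v Q y.tape c))
    else decQuery (y.chalNext Q y.tape c) (World.reqJ (y.request v Q y.tape c))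

/-- The next state, given the reply to a query. -/
def advance (a : Str) : RState Φ :=
  let y' : RState Φ := { y with ans := y.ans ++ [a] }
  if y.ans.length = 13 then
    bif y.boot then y'.booted
    else y'.finish A v (y'.ans.getD 0 []) y'.tape (ctxt (decodeList (y'.ans.getD 11 [])))
      (decodeList (y'.ans.getD 12 [])) (decodeList (y'.ans.getD 13 []))
  else y'

end RState

/-! ### The reduction is computed in polynomial time -/

omit [Code β] in
theorem isEmpty_eq_decide {l : List β} : l.isEmpty = decide (l.length = 0) := by
  cases l <;> rfl

theorem PT.isEmptyList {f : α → List β} (hf : PT f) : PT fun a => (f a).isEmpty := by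
  simp only [isEmpty_eq_decide]
  fun_prop

theorem PT.head? {f : α → List β} (hf : PT f) : PT fun a => (f a).head? := by
  simp only [List.head?_eq_getElem?]
  fun_prop

section
variable {y : α → RState Φ} (A : Adversary) (v : BFVersion) (hy : PT y)
include hy

theorem PT.limitOnes : PT fun a => List.replicate ((y a).limit A) true :=
  PT.polynomial A.bound hy.rOne

@[fun_prop] theorem PT.limit : PT fun a => (y a).limit A := by
  simpa using (PT.limitOnes A hy).lengthStr

theorem PT.takeLimit {w : α → Str} (hw : PT w) : PT fun a => (w a).take ((y a).limit A) := by
  simpa using PT.takeStr (PT.limitOnes A hy) hw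

@[fun_prop] theorem PT.action : PT fun a => (y a).action A :=
  (PT.of_polyTime₃ A.polyTime hy.rOne hy.rSt hy.rRep).decodeList

@[fun_prop] theorem PT.isCoin : PT fun a => (y a).isCoin A := by
  unfold RState.isCoin; fun_prop

@[fun_prop] theorem PT.asked : PT fun a => (y a).asked A := by
  unfold RState.asked
  have := PT.isEmptyList (PT.action A hy)
  fun_prop

variable [hΦ : Fact Φ.Efficient]

theorem PT.fixedBitsN {k : α → ℕ} (hk : PT k) :
    PT fun a => GD2C.fixedBits (Φ.n (y a).W.d) (k a) := by
  simp only [← Φ.length_H4 _ []]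
  exact PT.fixedBits (PT.hash4 hy.rW.worldD (PT.const [])) hk

theorem PT.fixedBitsP {k : α → ℕ} (hk : PT k) :
    PT fun a => GD2C.fixedBits (Φ.p (y a).W.d).size (k a) := by
  simp only [← Nat.size_eq_bits_len]
  exact PT.fixedBits (PT.bits (PT.prime hy.rW.worldD)) hk

theorem PT.onesN : PT fun a => List.replicate (Φ.n (y a).W.d) true := by
  simp only [← Φ.length_H4 _ []]
  exact PT.ones (PT.hash4 hy.rW.worldD (PT.const []))

theorem PT.onesP : PT fun a => List.replicate (Φ.p (y a).W.d).size true := by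
  simp only [← Nat.size_eq_bits_len]
  exact PT.ones (PT.bits (PT.prime hy.rW.worldD))

@[fun_prop] theorem PT.tape : PT fun a => (y a).tape := by
  unfold RState.tape
  have h : ∀ i, PT fun a => GD2C.num ((y a).ans.getD i []) := fun i => by fun_prop
  exact PT.tapeMk (h 1) (h 2) (h 3) (PT.fixedBitsN hy (h 4)) (h 5) (h 6) (PT.fixedBitsN hy (h 7))
    (PT.fixedBitsN hy (h 8)) (PT.fixedBitsN hy (h 9)) (PT.fixedBitsP hy (h 10))

section
variable {Q : α → Query} {τ : α → Tape} {c : α → Ctxt} {ai aj : α → List Str} (hQ : PT Q)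
  (hτ : PT τ) (hc : PT c)
include hQ

@[fun_prop] theorem PT.plainI {b : α → Bool} (hb : PT b) :
    PT fun a => (y a).plainI (Q a) (b a) := by
  unfold RState.plainI; fun_prop

@[fun_prop] theorem PT.plainJ {b : α → Bool} (hb : PT b) :
    PT fun a => (y a).plainJ (Q a) (b a) := by
  unfold RState.plainJ; fun_prop

include hτ

@[fun_prop] theorem PT.chalQuery : PT fun a => (y a).chalQuery (Q a) (τ a) := by
  unfold RState.chalQuery; fun_prop

include hc

@[fun_prop] theorem PT.rCtI : PT fun a => (y a).ctI v (Q a) (τ a) (c a) := by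
  unfold RState.ctI; fun_prop

@[fun_prop] theorem PT.rCtJ : PT fun a => (y a).ctJ v (Q a) (τ a) (c a) := by
  unfold RState.ctJ; fun_prop

@[fun_prop] theorem PT.chalNext : PT fun a => (y a).chalNext (Q a) (τ a) (c a) := by
  unfold RState.chalNext; fun_prop

@[fun_prop] theorem PT.rRequest : PT fun a => (y a).request v (Q a) (τ a) (c a) := by
  unfold RState.request; fun_prop

end

omit hy hΦ in
@[fun_prop] theorem PT.ctxt {l : α → List Str} (hl : PT l) : PT fun a => RState.ctxt (l a) := by
  unfold RState.ctxt; fun_prop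

section
variable {ch : α → Option ((Str × Ctxt) × Str)} {t : α → Str × Ctxt} (hch : PT ch) (ht : PT t)

omit hy hΦ in
@[fun_prop] theorem PT.reqI {m : α → List Str} (hm : PT m) : PT fun a => World.reqI (m a) := by
  unfold World.reqI; fun_prop

omit hy hΦ in
@[fun_prop] theorem PT.reqJ {m : α → List Str} (hm : PT m) : PT fun a => World.reqJ (m a) := by
  unfold World.reqJ; fun_prop

include hch ht

omit hy hΦ in
@[fun_prop] theorem PT.chalMatch : PT fun a => RState.chalMatch (ch a) (t a) := by
  unfold RState.chalMatch
  exact PT.optionBind (g := fun (a : α) (x : (Str × Ctxt) × Str) => if x.1.1 = (t a).1 ∧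
    x.1.2.1 = (t a).2.1 ∧ x.1.2.2.1 = (t a).2.2.1 ∧ x.1.2.2.2 = (t a).2.2.2 then some x.2 else none)
    hch (by fun_prop)

omit hy hΦ in
@[fun_prop] theorem PT.decQuery : PT fun a => RState.decQuery (ch a) (t a) := by
  unfold RState.decQuery; fun_prop

omit hΦ in
@[fun_prop] theorem PT.opened {l : α → List Str} (hl : PT l) :
    PT fun a => (y a).opened (ch a) (t a) (l a) := by
  unfold RState.opened
  have h1 := PT.head? hl
  have h2 : PT fun a => (RState.chalMatch (ch a) (t a)).elim (l a).head? some :=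
    PT.optionCases (g := fun _ w => some w) (by fun_prop) h1 (by fun_prop)
  exact PT.optionBind (g := fun a w => GD2C.lookup (y a).ids w) h2 (by fun_prop)

end

section
variable {Q : α → Query} {τ : α → Tape} {c : α → Ctxt} {ai aj : α → List Str} (hQ : PT Q)
  (hτ : PT τ) (hc : PT c) (hi : PT ai) (hj : PT aj)
include hQ hτ hc hi hj

theorem PT.rParts : PT fun a => (y a).parts v (Q a) (τ a) (c a) (ai a) (aj a) := by
  unfold RState.parts
  have h1 := PT.chalNext hy hQ hτ hc
  have h2 := PT.rRequest v hy hQ hτ hc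
  exact PT.parts hy.rW hQ hτ (PT.rCtI v hy hQ hτ hc) (PT.rCtJ v hy hQ hτ hc)
    (PT.opened hy h1 (PT.reqI h2) hi) (PT.opened hy h1 (PT.reqJ h2) hj) hy.rIds

theorem PT.answered {st : α → Str} (hst : PT st) :
    PT fun a => (y a).answered A v (st a) (Q a) (τ a) (c a) (ai a) (aj a) := by
  unfold RState.answered
  have h1 := PT.rParts v hy hQ hτ hc hi hj
  have h2 := PT.takeLimit A hy hst
  have h3 := PT.takeLimit A hy h1.fst.encodeList
  have h4 := PT.chalNext hy hQ hτ hc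
  exact PT.rMk hy.rBoot hy.rFuel.tail h2 h3 h1.snd.fst h1.snd.snd (by fun_prop) h4 hy.rOne
    (PT.const _)

end

theorem PT.finish {τ : α → Tape} {c : α → Ctxt} {ai aj : α → List Str} {w : α → Str} (hw : PT w)
    (hτ : PT τ) (hc : PT c) (hi : PT ai) (hj : PT aj) :
    PT fun a => (y a).finish A v (w a) (τ a) (c a) (ai a) (aj a) := by
  unfold RState.finish
  have e1 := PT.isEmptyList (PT.action A hy)
  have e2 := PT.takeLimit A hy ((PT.action A hy).headD (PT.const []))
  have e3 := PT.takeLimit A hy hw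
  have h : PT fun a => ((y a).asked A).elim ({ y a with
      fuel := (y a).fuel.tail
      st := (((y a).action A).headD []).take ((y a).limit A)
      rep := []
      ans := [] }) fun Q => (y a).answered A v (((y a).action A).headD []) Q (τ a) (c a) (ai a)
        (aj a) := by
    refine PT.optionCases (PT.asked A hy) (PT.rMk hy.rBoot hy.rFuel.tail e2 (PT.const _) hy.rW
      hy.rIds hy.rJ hy.rChal hy.rOne (PT.const _)) ?_
    have h0 : PT fun p : α × Query => p.1 := by fun_prop
    exact PT.answered A v (hy.comp h0) PT.id.snd (hτ.comp h0) (hc.comp h0) (hi.comp h0)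
      (hj.comp h0) (((PT.action A hy).headD (PT.const [])).comp h0)
  have h1 : PT fun a => ({ y a with ans := [] } : RState Φ) := by fun_prop
  have h2 : PT fun a => ({ y a with fuel := (y a).fuel.tail, rep := [], ans := [] } : RState Φ) :=
    by fun_prop
  have h3 : PT fun a => ({ y a with
      fuel := (y a).fuel.tail
      st := (((y a).action A).headD []).take ((y a).limit A)
      rep := (w a).take ((y a).limit A)
      ans := [] } : RState Φ) := PT.rMk hy.rBoot hy.rFuel.tail e2 e3 hy.rW
      hy.rIds hy.rJ hy.rChal hy.rOne (PT.const _)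
  exact hy.rFuel.isEmptyStr.boolCond h1 (e1.boolCond h2 ((PT.isCoin A hy).boolCond h3 h))

theorem PT.query : PT fun a => (y a).query A v := by
  unfold RState.query
  have e1 := PT.isEmptyList (PT.action A hy)
  have e2 := PT.onesN hy
  have e3 := PT.onesP hy
  have h : PT fun a => ((y a).asked A).elim [] fun Q =>
      let c := RState.ctxt (GD2C.decodeList ((y a).ans.getD 11 []))
      if (y a).ans.length = 11 then (y a).chalQuery Q (y a).tape
      else if (y a).ans.length = 12 then
        RState.decQuery ((y a).chalNext Q (y a).tape c) (World.reqI ((y a).request v Q (y a).tape c))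
      else RState.decQuery ((y a).chalNext Q (y a).tape c)
        (World.reqJ ((y a).request v Q (y a).tape c)) := by
    refine PT.optionCases (PT.asked A hy) (PT.const _) ?_
    have h0 : PT fun p : α × Query => p.1 := by fun_prop
    have hy' : PT fun p : α × Query => y p.1 := hy.comp h0
    have hQ : PT fun p : α × Query => p.2 := by fun_prop
    have hτ := PT.tape hy'
    have hc : PT fun p : α × Query => RState.ctxt (GD2C.decodeList ((y p.1).ans.getD 11 [])) := by
      fun_prop
    have h1 := PT.chalNext hy' hQ hτ hc
    have h2 := PT.rRequest v hy' hQ hτ hc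
    exact PT.iteProp (by fun_prop) (PT.chalQuery hy' hQ hτ) (PT.iteProp (by fun_prop)
      (PT.decQuery h1 (PT.reqI h2)) (PT.decQuery h1 (PT.reqJ h2)))
  have hp : PT fun a => [[], (Φ.p (y a).W.d - 1).bits] := by fun_prop
  have hn : PT fun a => [[], List.replicate (Φ.n (y a).W.d) true] := by fun_prop
  have hw : PT fun a => [[], List.replicate (Φ.p (y a).W.d).size true] := by fun_prop
  have hl : PT fun a => [[], (2 * (y a).limit A).bits] := by fun_prop
  have hk : ∀ k : ℕ, PT fun a => decide ((y a).ans.length = k) := fun k => by fun_prop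
  refine hy.rBoot.boolCond ((hk 0).iteProp hl ((hk 1).iteProp hn (PT.const _)))
    ((hk 0).iteProp (by fun_prop) (PT.iteProp (by fun_prop) hp (PT.iteProp (by fun_prop) hn
      ((hk 10).iteProp hw (hy.rFuel.isEmptyStr.boolCond (PT.const _) h)))))

theorem PT.advance {w : α → Str} (hw : PT w) : PT fun a => (y a).advance A v (w a) := by
  unfold RState.advance RState.booted
  have hy' : PT fun a => ({ y a with ans := (y a).ans ++ [w a] } : RState Φ) := by fun_prop
  have h1 := PT.tape hy'
  have h2 := PT.finish (y := fun a => ({ y a with ans := (y a).ans ++ [w a] } : RState Φ)) A v hy'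
    (hy'.rAns.listGetD (PT.const 0) (PT.const [])) h1
    (PT.ctxt (hy'.rAns.listGetD (PT.const 11) (PT.const [])).decodeList)
    (hy'.rAns.listGetD (PT.const 12) (PT.const [])).decodeList
    (hy'.rAns.listGetD (PT.const 13) (PT.const [])).decodeList
  have h3 := PT.fixedBitsN hy' (PT.num (hy'.rAns.listGetD (PT.const 1) (PT.const [])))
  have h4 := PT.num (hy'.rAns.listGetD (PT.const 0) (PT.const []))
  refine PT.iteProp (by fun_prop) (hy.rBoot.boolCond ?_ h2) hy'
  exact PT.rMk (PT.const _) hy.rFuel hy.rSt hy.rRep (PT.worldUpdate hy.rW h3 hy.rW.worldGids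
    hy.rW.worldUes hy.rW.worldInsts hy.rW.worldHss hy.rW.worldTested) hy.rIds h4 hy.rChal hy.rOne
    (PT.const _)

end

end GD2C

namespace GD2C

variable {Φ : Family}

/-! ### The rounds of the reduction -/

namespace RState

variable (A : Adversary) (v : BFVersion) (y : RState Φ)

/-- The state with other replies in the present round. -/
def setAns (l : List Str) : RState Φ := { y with ans := l }

/-- The query for the random number that the other adversary wants. -/
def coinQuery : List Str :=
  bif !y.fuel.isEmpty && (!(y.action A).isEmpty && y.isCoin A) then (y.action A).tail else []

/-- The challenge query in a round. -/
def queryC (τ : Tape) : List Str :=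
  bif y.fuel.isEmpty then [] else (y.asked A).elim [] fun Q => y.chalQuery Q τ

/-- The first decryption query in a round. -/
def queryI (τ : Tape) (c : Ctxt) : List Str :=
  bif y.fuel.isEmpty then [] else (y.asked A).elim [] fun Q =>
    decQuery (y.chalNext Q τ c) (World.reqI (y.request v Q τ c))

/-- The second decryption query in a round. -/
def queryJ (τ : Tape) (c : Ctxt) : List Str :=
  bif y.fuel.isEmpty then [] else (y.asked A).elim [] fun Q =>
    decQuery (y.chalNext Q τ c) (World.reqJ (y.request v Q τ c))

/-- The game of the reduction. -/
abbrev game (Φ : Family) (v : BFVersion) : Game := ccaGame Φ.toBFFamily v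

/-- Rounds of the reduction. -/
abbrev proc (k : ℕ) (x : RState Φ × (game Φ v).State) : PMF (RState Φ × (game Φ v).State) :=
  procRun (game Φ v) (query A v) (advance A v) k x

variable (C : (game Φ v).State)

theorem proc_succ {l : List Str} (hl : l.length ≠ 13) (k : ℕ) :
    proc A v (k + 1) (y.setAns l, C) =
      ((game Φ v).answer ((y.setAns l).query A v) C).bind fun r =>
        proc A v k (y.setAns (l ++ [encodeList r.1]), r.2) := by
  change (procStep (game Φ v) (query A v) (advance A v) (y.setAns l, C)).bind _ = _
  rw [procStep, PMF.bind_map]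
  refine bind_congr fun r _ => ?_
  have : (y.setAns l).advance A v (encodeList r.1) = y.setAns (l ++ [encodeList r.1]) := by
    have h : ¬ (y.setAns l).ans.length = 13 := hl
    rw [advance, if_neg h]
    rfl
  simp only [Function.comp_def, this]

theorem proc_coin {l : List Str} (hl : l.length ≠ 13) (k : ℕ) {N : Str} (hq : (y.setAns l).query A v
    = [[], N]) : proc A v (k + 1) (y.setAns l, C) = (uniformUpTo (toNat N)).bind fun x => proc A v k
    (y.setAns (l ++ [encodeList [x.bits]]), C) := by
  rw [proc_succ A v y C hl, hq, Game.answer_coin, PMF.bind_map]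
  rfl

theorem finish_setAns (l : List Str) (a : Str) (τ : Tape) (c : Ctxt) (ai aj : List Str) :
    (y.setAns l).finish A v a τ c ai aj = y.finish A v a τ c ai aj := rfl

theorem proc_last {l : List Str} (hl : l.length = 13) (hb : y.boot = false) :
    proc A v 1 (y.setAns l, C) =
      ((game Φ v).answer ((y.setAns l).query A v) C).map fun r =>
        (y.finish A v (l.getD 0 []) (y.setAns l).tape (ctxt (decodeList (l.getD 11 [])))
          (decodeList (l.getD 12 [])) r.1, r.2) := by
  change (procStep (game Φ v) (query A v) (advance A v) (y.setAns l, C)).bind PMF.pure = _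
  rw [PMF.bind_pure, procStep, map_eq_bind, map_eq_bind]
  refine bind_congr fun r _ => ?_
  have h : (y.setAns l).ans.length = 13 := hl
  have : (y.setAns l).advance A v (encodeList r.1) =
      y.finish A v (l.getD 0 []) (y.setAns l).tape (ctxt (decodeList (l.getD 11 [])))
          (decodeList (l.getD 12 [])) r.1 := by
    rw [advance, if_pos h]
    change (bif y.boot then _ else (y.setAns (l ++ [encodeList r.1])).finish A v
      ((l ++ [encodeList r.1]).getD 0 []) (y.setAns (l ++ [encodeList r.1])).tape
      (ctxt (decodeList ((l ++ [encodeList r.1]).getD 11 [])))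
      (decodeList ((l ++ [encodeList r.1]).getD 12 []))
      (decodeList ((l ++ [encodeList r.1]).getD 13 []))) = _
    rw [hb, cond_false, finish_setAns]
    match l, hl with
    | [a0, a1, a2, a3, a4, a5, a6, a7, a8, a9, a10, a11, a12], _ =>
      simp only [List.cons_append, List.nil_append, List.getD_cons_zero, List.getD_cons_succ,
        decodeList_encodeList]
      rfl
  rw [this]

/-- The course of a round. -/
theorem proc_block (hb : y.boot = false) (hy : y.ans = []) :
    proc A v 14 (y, C) = ((game Φ v).answer (y.coinQuery A) C).bind fun r₀ =>
      (Φ.tape y.W.d).bind fun τ => ((game Φ v).answer (y.queryC A τ) r₀.2).bind fun rc =>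
      ((game Φ v).answer (y.queryI A v τ (ctxt rc.1)) rc.2).bind fun ri =>
      ((game Φ v).answer (y.queryJ A v τ (ctxt rc.1)) ri.2).map fun rj =>
        (y.finish A v (encodeList r₀.1) τ (ctxt rc.1) ri.1 rj.1, rj.2) := by
  have e : y = y.setAns [] := by rw [setAns, ← hy]
  have q0 : (y.setAns []).query A v = y.coinQuery A := by
    have hb' : (y.setAns []).boot = false := hb
    rw [query, hb']; rfl
  have qp : ∀ l : List Str, (l.length = 1 ∨ l.length = 2 ∨ l.length = 3 ∨ l.length = 5 ∨
      l.length = 6) → (y.setAns l).query A v = [[], (Φ.p y.W.d - 1).bits] := by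
    intro l hl
    have hb' : (y.setAns l).boot = false := hb
    have h0 : ¬ (y.setAns l).ans.length = 0 := by
      intro h; have : l.length = 0 := h; omega
    have h1 : (y.setAns l).ans.length = 1 ∨ (y.setAns l).ans.length = 2 ∨
      (y.setAns l).ans.length = 3 ∨ (y.setAns l).ans.length = 5 ∨
      (y.setAns l).ans.length = 6 := hl
    rw [query, hb']
    simp only [cond_false]
    rw [if_neg h0, if_pos h1]
    rfl
  have qn : ∀ l : List Str, (l.length = 4 ∨ l.length = 7 ∨ l.length = 8 ∨ l.length = 9) →
      (y.setAns l).query A v = [[], List.replicate (Φ.n y.W.d) true] := by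
    intro l hl
    have hb' : (y.setAns l).boot = false := hb
    have hl' : (y.setAns l).ans.length = l.length := rfl
    rw [query, hb']
    simp only [cond_false, hl']
    rw [if_neg (by omega), if_neg (by omega), if_pos hl]
    rfl
  have qw : ∀ l : List Str, l.length = 10 →
      (y.setAns l).query A v = [[], List.replicate (Φ.p y.W.d).size true] := by
    intro l hl
    have hb' : (y.setAns l).boot = false := hb
    have hl' : (y.setAns l).ans.length = l.length := rfl
    rw [query, hb']
    simp only [cond_false, hl']
    rw [if_neg (by omega), if_neg (by omega), if_neg (by omega), if_pos hl]
    rfl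
  have qx : ∀ l : List Str, 11 ≤ l.length → (y.setAns l).query A v =
      if l.length = 11 then y.queryC A (y.setAns l).tape else
      if l.length = 12 then y.queryI A v (y.setAns l).tape (ctxt (decodeList (l.getD 11 [])))
      else y.queryJ A v (y.setAns l).tape (ctxt (decodeList (l.getD 11 []))) := by
    intro l hl
    have hb' : (y.setAns l).boot = false := hb
    have hl' : (y.setAns l).ans.length = l.length := rfl
    have hf' : (y.setAns l).fuel = y.fuel := rfl
    have ha' : (y.setAns l).asked A = y.asked A := rfl
    rw [query, hb']
    simp only [cond_false, hl', hf', ha']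
    rw [if_neg (by omega), if_neg (by omega), if_neg (by omega), if_neg (by omega)]
    unfold queryC queryI queryJ
    cases y.fuel.isEmpty
    · cases y.asked A
      · simp
      · simp only [cond_false, Option.elim_some]
        split_ifs <;> rfl
    · simp
  have hp : toNat (Φ.p y.W.d - 1).bits = Φ.p y.W.d - 1 := toNat_bits _
  conv_lhs => rw [e, proc_succ A v y C (by simp), q0]
  rw [tape_eq]
  simp only [PMF.bind_bind, PMF.bind_map, Function.comp_def]
  refine bind_congr fun r₀ _ => ?_
  rw [proc_coin A v y r₀.2 (by simp) 12 (qp _ (by simp)), hp]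
  refine bind_congr fun k₁ _ => ?_
  rw [proc_coin A v y r₀.2 (by simp) 11 (qp _ (by simp)), hp]
  refine bind_congr fun k₂ _ => ?_
  rw [proc_coin A v y r₀.2 (by simp) 10 (qp _ (by simp)), hp]
  refine bind_congr fun k₃ _ => ?_
  rw [proc_coin A v y r₀.2 (by simp) 9 (qn _ (by simp)), toNat_replicate_true]
  refine bind_congr fun k₄ _ => ?_
  rw [proc_coin A v y r₀.2 (by simp) 8 (qp _ (by simp)), hp]
  refine bind_congr fun k₅ _ => ?_
  rw [proc_coin A v y r₀.2 (by simp) 7 (qp _ (by simp)), hp]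
  refine bind_congr fun k₆ _ => ?_
  rw [proc_coin A v y r₀.2 (by simp) 6 (qn _ (by simp)), toNat_replicate_true]
  refine bind_congr fun k₇ _ => ?_
  rw [proc_coin A v y r₀.2 (by simp) 5 (qn _ (by simp)), toNat_replicate_true]
  refine bind_congr fun k₈ _ => ?_
  rw [proc_coin A v y r₀.2 (by simp) 4 (qn _ (by simp)), toNat_replicate_true]
  refine bind_congr fun k₉ _ => ?_
  rw [proc_coin A v y r₀.2 (by simp) 3 (qw _ (by simp)), toNat_replicate_true]
  refine bind_congr fun k₁₀ _ => ?_
  simp only [List.nil_append, List.cons_append]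
  set τ : Tape := ⟨k₁, k₂, k₃, fixedBits (Φ.n y.W.d) k₄, k₅, k₆, fixedBits (Φ.n y.W.d) k₇,
    fixedBits (Φ.n y.W.d) k₈, fixedBits (Φ.n y.W.d) k₉, fixedBits (Φ.p y.W.d).size k₁₀⟩ with hτ
  have ht : ∀ l' : List Str, (y.setAns (encodeList r₀.1 :: encodeList [k₁.bits] ::
      encodeList [k₂.bits] :: encodeList [k₃.bits] :: encodeList [k₄.bits] ::
      encodeList [k₅.bits] :: encodeList [k₆.bits] :: encodeList [k₇.bits] ::
      encodeList [k₈.bits] :: encodeList [k₉.bits] :: encodeList [k₁₀.bits] :: l')).tape = τ := by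
    intro l'
    simp only [tape, setAns, List.getD_cons_zero, List.getD_cons_succ, num_encodeList, hτ]
  rw [proc_succ A v y r₀.2 (by simp), qx _ (by simp), if_pos (by simp), ht]
  refine bind_congr fun rc _ => ?_
  simp only [List.nil_append, List.cons_append]
  rw [proc_succ A v y rc.2 (by simp), qx _ (by simp), if_neg (by simp), if_pos (by simp), ht]
  simp only [List.getD_cons_zero, List.getD_cons_succ, decodeList_encodeList]
  refine bind_congr fun ri _ => ?_
  simp only [List.nil_append, List.cons_append]
  rw [proc_last A v y ri.2 (by simp) hb, qx _ (by simp), if_neg (by simp), if_neg (by simp), ht]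
  simp only [List.getD_cons_zero, List.getD_cons_succ, decodeList_encodeList]

/-- The course of the initial round. -/
theorem proc_boot (hb : y.boot = true) (hy : y.ans = []) :
    proc A v 14 (y, C) = (uniformUpTo (2 * y.limit A)).bind fun j =>
      (uniformStr (Φ.n y.W.d)).map fun kp =>
        ({ y with boot := false, j := j, W := { y.W with kp := kp } }, C) := by
  have e : y = y.setAns [] := by rw [setAns, ← hy]
  have q : ∀ l : List Str, (y.setAns l).query A v =
      if l.length = 0 then [[], (2 * y.limit A).bits] else
      if l.length = 1 then [[], List.replicate (Φ.n y.W.d) true] else [] := by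
    intro l
    have hb' : (y.setAns l).boot = true := hb
    rw [query, hb']
    rfl
  -- The initial round needs two random numbers only. Its other twelve queries are empty, so that it
  -- has the same length 14 as every other block.
  have idle : ∀ (k : ℕ) (l : List Str), 2 ≤ l.length → l.length + k = 13 →
      proc A v (k + 1) (y.setAns l, C) = PMF.pure ({ y with
        boot := false
        j := num (l.getD 0 [])
        W := { y.W with kp := fixedBits (Φ.n y.W.d) (num (l.getD 1 [])) } }, C) := by
    intro k
    induction k with
    | zero =>
      intro l hl hk
      change (procStep (game Φ v) (query A v) (advance A v) (y.setAns l, C)).bind PMF.pure = _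
      rw [PMF.bind_pure, procStep]
      simp only
      rw [q, if_neg (by omega), if_neg (by omega)]
      rw [show (game Φ v).answer [] C = PMF.pure ([], C) from rfl, PMF.pure_map]
      congr 2
      have h : (y.setAns l).ans.length = 13 := by rw [← hk]; rfl
      rw [advance, if_pos h]
      have hb' : (y.setAns l).boot = true := hb
      rw [hb', cond_true]
      match l, hl with
      | a :: b :: l, _ =>
        simp only [booted, setAns, List.cons_append, List.getD_cons_zero, List.getD_cons_succ, hy]
    | succ k ih =>
      intro l hl hk
      rw [proc_succ A v y C (by omega), q, if_neg (by omega), if_neg (by omega)]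
      rw [show (game Φ v).answer [] C = PMF.pure ([], C) from rfl, PMF.pure_bind]
      rw [ih _ (by simp; omega) (by simp; omega)]
      match l, hl with
      | a :: b :: l, _ =>
        simp only [List.cons_append, List.getD_cons_zero, List.getD_cons_succ]
  conv_lhs => rw [e]
  rw [proc_coin A v y C (by simp) 13 (q []), toNat_bits, uniformStr_eq]
  refine bind_congr fun j _ => ?_
  rw [proc_coin A v y C (by simp) 12 (q _), toNat_replicate_true, PMF.map_comp, map_eq_bind]
  refine bind_congr fun k _ => ?_
  rw [idle 11 _ (by simp) (by simp)]
  simp only [List.nil_append, List.cons_append, List.getD_cons_zero, List.getD_cons_succ,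
    num_encodeList, Function.comp_def]

end RState

/-! ### Correctness of BF-IBE -/

theorem xorStr_cancel {u w : Str} (h : u.length = w.length) : xorStr (xorStr u w) w = u := by
  induction u generalizing w with
  | nil =>
    have : w = [] := List.length_eq_zero_iff.mp h.symm
    rw [this]; rfl
  | cons a u ih =>
    rcases w with - | ⟨b, w⟩
    · simp at h
    · simp only [xorStr]
      rw [ih (by simpa using h)]
      simp

theorem BFFamily.decG_encG (Ψ : BFFamily) (d : Str) (x : Ψ.G d) :
    Ψ.decG d (Ψ.encG d x) = some x := by
  unfold decG
  have h : ∃ z, Ψ.encG d z = Ψ.encG d x := ⟨x, rfl⟩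
  rw [dif_pos h, Ψ.encG_injective d h.choose_spec]

theorem BFFamily.pairing_comm (Ψ : BFFamily) (d : Str) (g : Ψ.G d) (msk : ℕ) (ident : Str) (r : ℕ) :
    Ψ.e d (Ψ.extract d msk ident) (g ^ r) = Ψ.e d (Ψ.H1 d ident) (g ^ msk) ^ r := by
  have h1 := Ψ.e_pow d (Ψ.H1 d ident) g msk r
  have h2 := Ψ.e_pow d (Ψ.H1 d ident) g 1 msk
  rw [pow_one, one_mul] at h2
  rw [extract, h1, h2, pow_mul]

/-- By bilinearity both sides compute the same mask. Masks and plaintexts have length `n`, so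
exclusive or cancels without padding; in the full version the recovered σ and message reproduce the
exponent, and the check succeeds. -/
theorem BFFamily.decrypt_encryptWith (Ψ : BFFamily) (v : BFVersion) (d : Str) (g : Ψ.G d) (msk : ℕ)
    (ident m : Str) (r : ℕ) (σ : Str) (hm : m.length = Ψ.n d) (hσ : σ.length = Ψ.n d) : Ψ.decrypt v
    d g (Ψ.extract d msk ident) (Ψ.encryptWith v d g (g ^ msk) ident m r σ) = some m := by
  cases v with
  | basic =>
    unfold decrypt encryptWith
    simp only [decG_encG, pairing_comm, mask]
    rw [if_pos, xorStr_cancel]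
    · rw [hm, Ψ.length_H2]
    · refine ⟨?_, trivial⟩
      rw [length_xorStr, hm, Ψ.length_H2, max_self]
  | full =>
    unfold decrypt encryptWith
    simp only [decG_encG, pairing_comm, mask]
    have h1 : ∀ z, xorStr (xorStr σ (Ψ.H2 d z)) (Ψ.H2 d z) = σ := fun z =>
      xorStr_cancel (by rw [hσ, Ψ.length_H2])
    have h2 : xorStr (xorStr m (Ψ.H4 d σ)) (Ψ.H4 d σ) = m :=
      xorStr_cancel (by rw [hm, Ψ.length_H4])
    rw [h1, h2, if_pos]
    refine ⟨?_, ?_, rfl⟩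
    · rw [length_xorStr, hσ, Ψ.length_H2, max_self]
    · rw [length_xorStr, hm, Ψ.length_H4, max_self]

theorem BFFamily.decrypt_of_mem_encrypt (Ψ : BFFamily) {v : BFVersion} {d : Str} {g : Ψ.G d} {msk :
    ℕ} {ident m : Str} {c : Ctxt} (hm : m.length = Ψ.n d) (hc : c ∈ (Ψ.encrypt v d g (g ^ msk) ident
    m).support) : Ψ.decrypt v d g (Ψ.extract d msk ident) c = some m := by
  rw [Ψ.encrypt_eq] at hc
  obtain ⟨r, -, hc⟩ := (PMF.mem_support_bind_iff _ _ _).mp hc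
  obtain ⟨σ, hσ, rfl⟩ := (PMF.mem_support_map_iff _ _ _).mp hc
  exact Ψ.decrypt_encryptWith v d g msk ident m r σ hm (length_of_mem_uniformStr hσ)

/-! ### Independent parts of the random choices -/

/-- Redrawing one coordinate of independent choices does not change the joint distribution. It is
used to exchange the encryption randomness of the tape for that of the challenger, which the
reduction cannot choose. -/
theorem bind_resample {A B T X Z : Type} (P : PMF A) (q : PMF B) (t : PMF T) (mk : A → B → T → Z)
    (upd : Z → B → Z) (h : ∀ a b b' x, upd (mk a b x) b' = mk a b' x) (F : Z → PMF X) : ((P.bind fun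
    a => q.bind fun b => t.map (mk a b)).bind fun z => q.bind fun b' => F (upd z b')) = (P.bind fun
    a => q.bind fun b => t.map (mk a b)).bind F := by
  simp only [PMF.bind_bind, PMF.bind_map, Function.comp_def, h, PMF.bind_const]
  refine bind_congr fun a _ => ?_
  exact PMF.bind_comm _ _ _

theorem BFFamily.tape_resampleI {X : Type} (Ψ : BFFamily) (d : Str) (F : Tape → PMF X) :
    ((Ψ.tape d).bind fun τ => (Ψ.randExp d).bind fun r => (uniformStr (Ψ.n d)).bind fun σ =>
      F { τ with ri := r, si := σ }) = (Ψ.tape d).bind F := by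
  have e : Ψ.tape d = ((Ψ.randExp d).bind fun sid => (Ψ.randExp d).map fun x => (sid, x)).bind
      fun a => ((Ψ.randExp d).bind fun r => (uniformStr (Ψ.n d)).map fun σ => (r, σ)).bind
      fun b => ((Ψ.randExp d).bind fun y => (Ψ.randExp d).bind fun rj =>
        (uniformStr (Ψ.n d)).bind fun sj => (uniformStr (Ψ.n d)).bind fun s₃ =>
        (uniformStr (Ψ.n d)).bind fun s₄ => (uniformStr (Ψ.p d).size).map fun R =>
          (y, rj, sj, s₃, s₄, R)).map fun t =>
        (⟨a.1, a.2, b.1, b.2, t.1, t.2.1, t.2.2.1, t.2.2.2.1, t.2.2.2.2.1, t.2.2.2.2.2⟩ : Tape) := by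
    simp only [tape, map_eq_bind, PMF.bind_bind, PMF.pure_bind]
  have h := bind_resample (fun (τ : Tape) (b : ℕ × Str) =>
    { τ with ri := b.1, si := b.2 }) (fun a b b' t => rfl) F
    (P := (Ψ.randExp d).bind fun sid => (Ψ.randExp d).map fun x => (sid, x))
    (q := (Ψ.randExp d).bind fun r => (uniformStr (Ψ.n d)).map fun σ => (r, σ))
    (t := (Ψ.randExp d).bind fun y => (Ψ.randExp d).bind fun rj =>
        (uniformStr (Ψ.n d)).bind fun sj => (uniformStr (Ψ.n d)).bind fun s₃ =>
        (uniformStr (Ψ.n d)).bind fun s₄ => (uniformStr (Ψ.p d).size).map fun R =>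
          (y, rj, sj, s₃, s₄, R))
    (mk := fun a b t => (⟨a.1, a.2, b.1, b.2, t.1, t.2.1, t.2.2.1, t.2.2.2.1, t.2.2.2.2.1,
      t.2.2.2.2.2⟩ : Tape))
  rw [← e] at h
  simpa only [map_eq_bind, PMF.bind_bind, PMF.pure_bind] using h

theorem BFFamily.tape_resampleJ {X : Type} (Ψ : BFFamily) (d : Str) (F : Tape → PMF X) :
    ((Ψ.tape d).bind fun τ => (Ψ.randExp d).bind fun r => (uniformStr (Ψ.n d)).bind fun σ =>
      F { τ with rj := r, sj := σ }) = (Ψ.tape d).bind F := by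
  have e : Ψ.tape d = ((Ψ.randExp d).bind fun sid => (Ψ.randExp d).bind fun x =>
      (Ψ.randExp d).bind fun r => (uniformStr (Ψ.n d)).bind fun σ => (Ψ.randExp d).map fun y =>
        (sid, x, r, σ, y)).bind
      fun a => ((Ψ.randExp d).bind fun r => (uniformStr (Ψ.n d)).map fun σ => (r, σ)).bind
      fun b => ((uniformStr (Ψ.n d)).bind fun s₃ =>
        (uniformStr (Ψ.n d)).bind fun s₄ => (uniformStr (Ψ.p d).size).map fun R =>
          (s₃, s₄, R)).map fun t =>
        (⟨a.1, a.2.1, a.2.2.1, a.2.2.2.1, a.2.2.2.2, b.1, b.2, t.1, t.2.1, t.2.2⟩ : Tape) := by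
    simp only [tape, map_eq_bind, PMF.bind_bind, PMF.pure_bind]
  have h := bind_resample (fun (τ : Tape) (b : ℕ × Str) =>
    { τ with rj := b.1, sj := b.2 }) (fun a b b' t => rfl) F
    (P := (Ψ.randExp d).bind fun sid => (Ψ.randExp d).bind fun x =>
      (Ψ.randExp d).bind fun r => (uniformStr (Ψ.n d)).bind fun σ => (Ψ.randExp d).map fun y =>
        (sid, x, r, σ, y))
    (q := (Ψ.randExp d).bind fun r => (uniformStr (Ψ.n d)).map fun σ => (r, σ))
    (t := (uniformStr (Ψ.n d)).bind fun s₃ =>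
        (uniformStr (Ψ.n d)).bind fun s₄ => (uniformStr (Ψ.p d).size).map fun R => (s₃, s₄, R))
    (mk := fun a b t =>
        (⟨a.1, a.2.1, a.2.2.1, a.2.2.2.1, a.2.2.2.2, b.1, b.2, t.1, t.2.1, t.2.2⟩ : Tape))
  rw [← e] at h
  simpa only [map_eq_bind, PMF.bind_bind, PMF.pure_bind] using h

theorem BFFamily.length_of_mem_tape {Ψ : BFFamily} {d : Str} {τ : Tape}
    (h : τ ∈ (Ψ.tape d).support) : τ.si.length = Ψ.n d ∧ τ.sj.length = Ψ.n d := by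
  unfold tape at h
  simp only [PMF.mem_support_bind_iff, PMF.mem_support_map_iff] at h
  obtain ⟨_, -, _, -, _, -, si, hi, _, -, _, -, sj, hj, _, -, _, -, _, -, rfl⟩ := h
  exact ⟨length_of_mem_uniformStr hi, length_of_mem_uniformStr hj⟩

/-! ### Effects of a query on the state -/

/-- No two devices have a common candidate, and the candidates have length `n`. -/
def NoClash (n : ℕ) (ids : List Slot) : Prop :=
  ∀ p ∈ ids, lookup ids p.1.1 = some p.2 ∧ lookup ids p.1.2 = some p.2 ∧
    p.1.1.length = n ∧ p.1.2.length = n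

theorem lookup_append_of_some {ids l : List Slot} {m : Str} {u : UE} (h : lookup ids m = some u) :
    lookup (ids ++ l) m = some u := by
  unfold lookup at h ⊢
  rw [List.find?_append]
  cases h' : ids.find? fun p => p.1.1 == m || p.1.2 == m with
  | none => rw [h'] at h; simp at h
  | some p => rw [h'] at h; simpa using h

theorem lookup_append_of_none {ids l : List Slot} {m : Str} (h : lookup ids m = none) :
    lookup (ids ++ l) m = lookup l m := by
  unfold lookup at h ⊢
  rw [List.find?_append]
  cases h' : ids.find? fun p => p.1.1 == m || p.1.2 == m with
  | none => simp
  | some p => rw [h'] at h; simp at h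

theorem NoClash.append {n : ℕ} {ids : List Slot} (h : NoClash n ids) {a b : Str} (u : UE)
    (ha : lookup ids a = none) (hb : lookup ids b = none) (la : a.length = n) (lb : b.length = n) :
    NoClash n (ids ++ [((a, b), u)]) := by
  intro p hp
  rcases List.mem_append.mp hp with hp | hp
  · obtain ⟨h1, h2, h3⟩ := h p hp
    exact ⟨lookup_append_of_some h1, lookup_append_of_some h2, h3⟩
  · rw [List.mem_singleton] at hp
    subst hp
    refine ⟨?_, ?_, la, lb⟩
    · rw [lookup_append_of_none ha]; simp [lookup]
    · rw [lookup_append_of_none hb]; simp [lookup]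

theorem NoClash.length_plain {n : ℕ} {ids : List Slot} (h : NoClash n ids) (β : Bool) (i : ℕ) :
    (plain n β ids i).length = n := by
  unfold plain
  cases hi : ids[i]? with
  | none => simp
  | some p =>
    obtain ⟨-, -, h1, h2⟩ := h p (List.mem_of_getElem? hi)
    cases β
    · exact h1
    · exact h2

/-- Two messages that HSS/AuC maps to the same device. -/
def SameOwner (ids : List Slot) (m m' : Str) : Prop :=
  m = m' ∨ ∃ u, lookup ids m = some u ∧ lookup ids m' = some u

theorem SameOwner.append {ids : List Slot} {m m' : Str} (h : SameOwner ids m m') (l : List Slot) :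
    SameOwner (ids ++ l) m m' := by
  rcases h with h | ⟨u, h, h'⟩
  · exact Or.inl h
  · exact Or.inr ⟨u, lookup_append_of_some h, lookup_append_of_some h'⟩

theorem SameOwner.lookup_eq {ids : List Slot} {m m' : Str} (h : SameOwner ids m m') :
    lookup ids m = lookup ids m' := by
  rcases h with rfl | ⟨u, h, h'⟩
  · rfl
  · rw [h, h']

/-- Both candidates of a device are found at that device. For a number without a device both values
are the default string, which is the reason for the alternative `m = m'` in `SameOwner`. -/
theorem NoClash.sameOwner {n : ℕ} {ids : List Slot} (h : NoClash n ids) (β β' : Bool) (i : ℕ) :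
    SameOwner ids (plain n β ids i) (plain n β' ids i) := by
  unfold plain
  cases hi : ids[i]? with
  | none => exact Or.inl rfl
  | some p =>
    obtain ⟨h1, h2, -⟩ := h p (List.mem_of_getElem? hi)
    refine Or.inr ⟨p.2, ?_, ?_⟩
    · cases β
      · exact h1
      · exact h2
    · cases β'
      · exact h1
      · exact h2

/-- The parts of the system that are never changed are the same. -/
def World.SameKeys (W W' : World Φ) : Prop :=
  W' = { W with gids := W'.gids, ues := W'.ues, insts := W'.insts, hss := W'.hss,
                tested := W'.tested }

theorem World.sameKeys_core (W : World Φ) (Q : Query) (τ : Tape) (ci cj : Ctxt) (oi oj : Option UE)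
    : W.SameKeys (W.core Q τ ci cj oi oj).2 ∧ (W.core Q τ ci cj oi oj).2.tested = W.tested := by
  by_cases hQ : Q = .newGroup
  · subst hQ; exact ⟨rfl, rfl⟩
  · have := W.sameUsers_core hQ τ ci cj oi oj
    unfold SameUsers at this
    constructor
    · unfold SameKeys; rw [this]
    · rw [this]

/-- The only changes of the candidates that matter for the invariants: a registration appends a pair
free of collisions, and the test erases everything, after which no invariant about candidates is
required. -/
theorem HState.parts_effect (Q : Query) (τ : Tape) (ci cj : Ctxt) (oi oj : Option UE) (W : World Φ)
    (ids : List Slot) : W.SameKeys (parts Q τ ci cj oi oj W ids).2.1 ∧ ((parts Q τ ci cj oi oj W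
    ids).2.1.tested = false → (parts Q τ ci cj oi oj W ids).2.2 = ids ∨ lookup ids τ.si = none ∧
    lookup ids τ.sj = none ∧ ∃ u, (parts Q τ ci cj oi oj W ids).2.2 = ids ++ [((τ.si, τ.sj), u)]) :=
    by
  unfold parts
  split_ifs with h h'
  · unfold registerDevice
    cases W.gids[Q.arg₁]? with
    | none => exact ⟨rfl, fun _ => Or.inl rfl⟩
    | some gid =>
      simp only [Option.bind_some]
      split_ifs with hl
      · exact ⟨rfl, fun _ => Or.inr ⟨hl.1, hl.2, _, rfl⟩⟩
      · exact ⟨rfl, fun _ => Or.inl rfl⟩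
  · cases W.testOwner Q.arg₁ with
    | none => exact ⟨rfl, fun _ => Or.inl rfl⟩
    | some i => exact ⟨rfl, fun h => by simp at h⟩
  · exact ⟨(W.sameKeys_core Q τ ci cj oi oj).1, fun _ => Or.inl rfl⟩

/-- Which arguments are relevant for the answer. -/
theorem HState.parts_congr {Q : Query} (hQ : Q.encrypts = false) (τ : Tape) (ci cj ci' cj' : Ctxt)
    (oi oj oi' oj' : Option UE) (W : World Φ) (ids : List Slot) :
    parts Q τ ci cj oi oj W ids = parts Q τ ci' cj' oi' oj' W ids := by
  unfold parts
  unfold Query.encrypts at hQ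
  split_ifs with h h'
  · rfl
  · rfl
  · simp [h, h'] at hQ

namespace RState

variable (A : Adversary) (v : BFVersion) (y : RState Φ) (b : Bool)

/-- A state of the challenger. -/
def withTarget (t : Option (Str × Ctxt)) : (game Φ v).State :=
  (⟨y.W.d, y.W.g, y.W.msk, b, t, []⟩ : CCAState Φ.toBFFamily)

/-- The state of the challenger during the reduction. -/
def challenger : (game Φ v).State := y.withTarget v b (y.chal.map Prod.fst)

/-- The state of the hybrid game that the reduction simulates. -/
def sim : HState Φ := ⟨y.W, y.ids, selOf y.j b⟩

/-- The state of the other adversary and of its game. -/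
def view : Str × Str × (hybridGame Φ v).State := (y.st, y.rep, y.sim b)

/-- The challenge is decrypted to an identity of the same device as its first message. -/
def ChalOk (W : World Φ) (ids : List Slot) (ch : Option ((Str × Ctxt) × Str)) : Prop :=
  ∀ x, ch = some x → ∃ m, W.decryptT v x.1 = some m ∧ SameOwner ids m x.2

/-- The states between two rounds. -/
structure Ready : Prop where
  boot : y.boot = false
  ans : y.ans = []
  clash : y.W.tested = false → NoClash (Φ.n y.W.d) y.ids
  j_eq : y.W.tested = false → ∀ x, y.chal = some x → y.j = 0
  chalOk : y.W.tested = false → ChalOk v y.W y.ids y.chal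

/-- The distribution of the challenge ciphertext. -/
def chalDist (Q : Query) (τ : Tape) : PMF Ctxt :=
  bif Q.encrypts then
    if y.j = 1 then
      Φ.encrypt v y.W.d y.W.g (y.W.g ^ y.W.msk) (y.W.tidI Q τ) (y.plainI Q b)
    else if y.j = 2 then
      Φ.encrypt v y.W.d y.W.g (y.W.g ^ y.W.msk) (y.W.tidJ Q τ) (y.plainJ Q b)
    else PMF.pure (ctxt [])
  else PMF.pure (ctxt [])

theorem answer_nil (C : (game Φ v).State) : (game Φ v).answer [] C = PMF.pure ([], C) := rfl

theorem answer_challenge {ident m₀ m₁ : Str} (h₀ : m₀.length = Φ.n y.W.d)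
    (h₁ : m₁.length = Φ.n y.W.d) :
    (game Φ v).answer [[true, true], ident, m₀, m₁] (y.withTarget v b none) =
      (Φ.encrypt v y.W.d y.W.g (y.W.g ^ y.W.msk) ident (bif b then m₁ else m₀)).map fun c =>
        ([c.1, c.2.1, c.2.2], y.withTarget v b (some (ident, c))) := by
  rw [Game.answer_of_ne _ (by simp)]
  have : ∀ S : CCAState Φ.toBFFamily, S.target = none → S.extracted = [] → m₀.length = Φ.n S.d →
      m₁.length = Φ.n S.d → ccaOracle Φ.toBFFamily v [[true, true], ident, m₀, m₁] S =
      (Φ.encrypt v S.d S.g (S.g ^ S.msk) ident (bif S.b then m₁ else m₀)).map fun c =>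
        ([c.1, c.2.1, c.2.2], { S with target := some (ident, c) }) := by
    intro S h1 h2 h3 h4
    unfold ccaOracle
    have : CCAQuery.parse [[true, true], ident, m₀, m₁] = some (.challenge ident m₀ m₁) := rfl
    grind
  exact this ⟨y.W.d, y.W.g, y.W.msk, b, none, []⟩ rfl rfl h₀ h₁

/-- The challenge is granted: if `j` is not 0, none has been made; the reduction never asks for
private keys; and all candidates, including the default for a missing device, have length `n`. -/
theorem answer_chalQuery {y : RState Φ} (hy : y.Ready v) (ht : y.W.tested = false) (Q : Query)
    (τ : Tape) : ((game Φ v).answer (y.chalQuery Q τ) (y.challenger v b)).map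
      (fun r => (ctxt r.1, r.2)) =
      (y.chalDist v b Q τ).map fun c =>
        (c, y.withTarget v b ((y.chalNext Q τ c).map Prod.fst)) := by
  have hn : ∀ h : y.j ≠ 0, y.challenger v b = y.withTarget v b none := fun h => by
    have : y.chal = none := by
      by_contra hc
      obtain ⟨x, hx⟩ := Option.ne_none_iff_exists'.mp hc
      exact h (hy.j_eq ht x hx)
    rw [challenger, this]; rfl
  have hI : ∀ β, (y.plainI Q β).length = Φ.n y.W.d := fun β => (hy.clash ht).length_plain β _
  have hJ : ∀ β, (y.plainJ Q β).length = Φ.n y.W.d := fun β => (hy.clash ht).length_plain β _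
  unfold chalQuery chalDist chalNext
  cases Q.encrypts
  · simp only [cond_false, answer_nil, PMF.pure_map]; rfl
  · simp only [cond_true]
    by_cases h1 : y.j = 1
    · simp only [if_pos h1, Option.map_some]
      rw [hn (by omega), answer_challenge v y b (hI _) (hI _), PMF.map_comp]
      cases b <;> rfl
    · by_cases h2 : y.j = 2
      · simp only [if_neg h1, if_pos h2, Option.map_some]
        rw [hn (by omega), answer_challenge v y b (hJ _) (hJ _), PMF.map_comp]
        cases b <;> rfl
      · simp only [if_neg h1, if_neg h2, answer_nil, PMF.pure_map]; rfl

theorem answer_decrypt {t : Str × Ctxt} {o : Option (Str × Ctxt)} (h : o ≠ some t) :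
    (game Φ v).answer [[false, true], t.1, t.2.1, t.2.2.1, t.2.2.2] (y.withTarget v b o) =
      PMF.pure ((y.W.decryptT v t).toList, y.withTarget v b o) := by
  have hq : ∀ N : Str, [[false, true], t.1, t.2.1, t.2.2.1, t.2.2.2] ≠ [[], N] := by
    simp_all
  rw [Game.answer_of_ne _ hq]
  have : ∀ S : CCAState Φ.toBFFamily, S.target ≠ some t →
      ccaOracle Φ.toBFFamily v [[false, true], t.1, t.2.1, t.2.2.1, t.2.2.2] S =
      PMF.pure ((Φ.decrypt v S.d S.g (Φ.extract S.d S.msk t.1) t.2).toList, S) := by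
    intro S hS
    unfold ccaOracle
    have : CCAQuery.parse [[false, true], t.1, t.2.1, t.2.2.1, t.2.2.2] =
        some (.decrypt t.1 t.2) := rfl
    rw [this]
    simp only
    rw [if_neg hS]
  exact this ⟨y.W.d, y.W.g, y.W.msk, b, o, []⟩ h

/-- The decisive point of the reduction. The challenger refuses to decrypt the challenge, but
HSS/AuC only wants the device, and both challenge messages lead to the same one; the recorded first
message is used in place of the unknown plaintext. Every other ciphertext is passed to the
decryption oracle. Later registrations do not disturb this, by `SameOwner.append`. -/
theorem answer_decQuery {ch : Option ((Str × Ctxt) × Str)} (h : ChalOk v y.W y.ids ch) (t : Str ×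
    Ctxt) : ∃ a : List Str, (game Φ v).answer (decQuery ch t) (y.withTarget v b (ch.map Prod.fst)) =
    PMF.pure (a, y.withTarget v b (ch.map Prod.fst)) ∧ y.opened ch t a = (y.sim b).openT v t := by
  unfold decQuery opened HState.openT sim
  cases hm : chalMatch ch t with
  | some m' =>
    refine ⟨[], answer_nil v _, ?_⟩
    unfold chalMatch at hm
    cases ch with
    | none => simp at hm
    | some x =>
      simp only [Option.bind_some] at hm
      split_ifs at hm with hx
      obtain ⟨h1, h2, h3, h4⟩ := hx
      have ht : x.1 = t := Prod.ext h1 (Prod.ext h2 (Prod.ext h3 h4))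
      obtain ⟨m, hd, hs⟩ := h x rfl
      rw [ht] at hd
      simp only [Option.some.injEq] at hm
      simp only [hd, Option.elim_some, Option.bind_some, hs.lookup_eq, hm]
  | none =>
    refine ⟨(y.W.decryptT v t).toList, answer_decrypt v y b ?_, ?_⟩
    · intro he
      cases ch with
      | none => simp at he
      | some x =>
        simp only [Option.map_some, Option.some.injEq] at he
        simp [chalMatch, he] at hm
    · cases y.W.decryptT v t <;> rfl

/-- The state after an answer of the system. -/
def stepped (st : Str) (Q : Query) (τ : Tape) (c : Ctxt) : RState Φ :=
  let P := HState.parts Q τ (y.ctI v Q τ c) (y.ctJ v Q τ c)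
    ((y.sim b).openT v (World.reqI (y.request v Q τ c)))
    ((y.sim b).openT v (World.reqJ (y.request v Q τ c))) y.W y.ids
  { y with
    fuel := y.fuel.tail
    st := st.take (y.limit A)
    rep := (encodeList P.1).take (y.limit A)
    W := P.2.1
    ids := P.2.2
    j := bif Q.encrypts then y.j - 1 - 1 else y.j
    chal := y.chalNext Q τ c
    ans := [] }

/-- A new challenge decrypts to the encrypted candidate by correctness of BF-IBE. Whichever
candidate this is, it belongs to the same device as the recorded first one. -/
theorem chalOk_next {y : RState Φ} (hy : y.Ready v) (ht : y.W.tested = false) {Q : Query} {τ : Tape}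
    {c : Ctxt} (hc : c ∈ (y.chalDist v b Q τ).support) : ChalOk v y.W y.ids (y.chalNext Q τ c) := by
  unfold chalDist at hc
  unfold chalNext
  have hn := hy.clash ht
  cases hQ : Q.encrypts
  · exact hy.chalOk ht
  · simp only [hQ, cond_true] at hc ⊢
    split_ifs at hc ⊢ with h1 h2
    · intro x hx
      cases hx
      exact ⟨_, Φ.decrypt_of_mem_encrypt (hn.length_plain _ _) hc, hn.sameOwner _ _ _⟩
    · intro x hx
      cases hx
      exact ⟨_, Φ.decrypt_of_mem_encrypt (hn.length_plain _ _) hc, hn.sameOwner _ _ _⟩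
    · exact hy.chalOk ht

theorem challenger_stepped (st : Str) (Q : Query) (τ : Tape) (c : Ctxt) : (y.stepped A v b st Q τ
    c).challenger v b = y.withTarget v b ((y.chalNext Q τ c).map Prod.fst) := by
  unfold stepped challenger withTarget
  simp only
  rw [(HState.parts_effect Q τ (y.ctI v Q τ c) (y.ctJ v Q τ c)
    ((y.sim b).openT v (World.reqI (y.request v Q τ c)))
    ((y.sim b).openT v (World.reqJ (y.request v Q τ c))) y.W y.ids).1]

/-- Registrations keep the candidates free of clashes because collisions are refused. A challenge is
made for `j = 1` or `j = 2` only, and the two slots of the query then bring `j` to 0, so there is no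
second one. -/
theorem ready_stepped {y : RState Φ} (hy : y.Ready v) (ht : y.W.tested = false) (st : Str)
    {Q : Query} {τ : Tape} {c : Ctxt} (hτ : τ ∈ (Φ.tape y.W.d).support)
    (hc : c ∈ (y.chalDist v b Q τ).support) : (y.stepped A v b st Q τ c).Ready v := by
  obtain ⟨hk, he⟩ := HState.parts_effect Q τ (y.ctI v Q τ c) (y.ctJ v Q τ c)
    ((y.sim b).openT v (World.reqI (y.request v Q τ c)))
    ((y.sim b).openT v (World.reqJ (y.request v Q τ c))) y.W y.ids
  obtain ⟨l1, l2⟩ := Φ.length_of_mem_tape hτ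
  have hn := hy.clash ht
  have hch := chalOk_next v b hy ht hc
  refine ⟨hy.boot, rfl, fun ht' => ?_, fun ht' x hx => ?_, fun ht' x hx => ?_⟩
  · unfold stepped
    simp only
    have hd : ∀ W' : World Φ, y.W.SameKeys W' → W'.d = y.W.d := fun W' h => by
      rw [show W' = _ from h]
    rw [hd _ hk]
    rcases he ht' with he | ⟨h1, h2, u, he⟩ <;> rw [he]
    · exact hn
    · exact hn.append u h1 h2 l1 l2
  · have hx' : y.chalNext Q τ c = some x := hx
    change (bif Q.encrypts then y.j - 1 - 1 else y.j) = 0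
    unfold chalNext at hx'
    cases hQ : Q.encrypts
    · rw [hQ] at hx'
      exact hy.j_eq ht x hx'
    · simp only [hQ, cond_true] at hx' ⊢
      split_ifs at hx' with h1 h2
      · omega
      · omega
      · have := hy.j_eq ht x hx'
        omega
  · obtain ⟨m, hd, hs⟩ := hch x hx
    refine ⟨m, ?_, ?_⟩
    · unfold stepped
      simp only
      rw [hk]
      exact hd
    · unfold stepped
      simp only
      rcases he ht' with he | ⟨h1, h2, u, he⟩ <;> rw [he]
      · exact hs
      · exact hs.append _

/-- The answer as a function of the random choices and the two ciphertexts. -/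
def outcome (st : Str) (Q : Query) (τ : Tape) (ci cj : Ctxt) :
    Str × Str × (hybridGame Φ v).State :=
  let S := y.sim b
  let m := y.W.request Q τ ci cj
  (st.take (y.limit A), (encodeList (S.final Q τ ci cj (S.openT v (World.reqI m))
    (S.openT v (World.reqJ m))).1).take (y.limit A),
    (S.final Q τ ci cj (S.openT v (World.reqI m)) (S.openT v (World.reqJ m))).2)

theorem view_stepped (st : Str) (Q : Query) (τ : Tape) (c : Ctxt) : (y.stepped A v b st Q τ c).view
    v b = y.outcome A v b st Q τ (y.ctI v Q τ c) (y.ctJ v Q τ c) := by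
  unfold outcome stepped view sim
  simp only [HState.final_eq]
  refine Prod.ext rfl (Prod.ext rfl ?_)
  simp only
  congr 1
  cases Q.encrypts
  · rfl
  · simp only [cond_true]
    exact (selOf_shift _ _).symm

theorem outcome_congr {Q : Query} (hQ : Q.encrypts = false) (st : Str) (τ : Tape)
    (ci cj ci' cj' : Ctxt) : y.outcome A v b st Q τ ci cj = y.outcome A v b st Q τ ci' cj' := by
  unfold outcome
  simp only [HState.final_eq]
  rw [HState.parts_congr hQ τ ci cj ci' cj']

/-- The encryption randomness enters the answer through the ciphertexts alone. Creation of a group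
is the exception among these queries, since it uses the string `si` as the new group identity. -/
theorem outcome_tape {Q : Query} (hQ : Q.encrypts = true) (hQ' : Q ≠ .newGroup) (st : Str)
    (τ τ' : Tape) (h₁ : τ.sid = τ'.sid) (h₂ : τ.x = τ'.x) (h₃ : τ.y = τ'.y) (h₄ : τ.R = τ'.R)
    (ci cj : Ctxt) : y.outcome A v b st Q τ ci cj = y.outcome A v b st Q τ' ci cj := by
  unfold outcome World.request
  cases Q <;> simp [HState.final, World.core, h₁, h₂, h₃, h₄] at *
  · simp [Query.encrypts, Query.tag] at hQ

theorem outcome_newGroup (st : Str) (τ : Tape) (ci cj ci' cj' : Ctxt) :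
    y.outcome A v b st .newGroup τ ci cj = y.outcome A v b st .newGroup τ ci' cj' := rfl

/-- One ciphertext is made by the challenger with its own randomness, the other with the randomness
of the tape. Resampling the corresponding part of the tape shows that this is distributed as if both
came from the tape, with the candidate in slot `j` selected by the bit of the challenger. -/
theorem map_view_stepped (st : Str) (Q : Query) :
    ((Φ.tape y.W.d).bind fun τ => (y.chalDist v b Q τ).map fun c =>
      (y.stepped A v b st Q τ c).view v b) =
    (Φ.tape y.W.d).map fun τ => y.outcome A v b st Q τ
      (y.W.ctI v Q τ (y.plainI Q (selOf y.j b 0))) (y.W.ctJ v Q τ (y.plainJ Q (selOf y.j b 1))) := by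
  simp only [view_stepped]
  cases hQ : Q.encrypts
  · rw [map_eq_bind]
    refine bind_congr fun τ _ => ?_
    rw [chalDist, hQ, cond_false, PMF.pure_map]
    exact congrArg _ (outcome_congr A v y b hQ st τ _ _ _ _)
  · unfold chalDist ctI ctJ
    simp only [hQ, cond_true]
    by_cases h1 : y.j = 1
    · have e0 : selOf y.j b 0 = b := by simp [selOf, h1]
      have e1 : selOf y.j b 1 = !decide (y.j = 0 ∨ y.j = 1) := by simp [selOf, h1]
      have h2 : ¬ y.j = 2 := by omega
      simp only [if_pos h1, if_neg h2, e0, e1]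
      -- Resampling would change the new group identity here; but no ciphertext is shown, so the
      -- challenge has no influence and can be dropped.
      by_cases hg : Q = .newGroup
      · subst hg
        rw [map_eq_bind]
        refine bind_congr fun τ _ => ?_
        rw [map_eq_bind]
        simp only [outcome_newGroup A v y b st τ _ _ ([], [], []) ([], [], []), PMF.bind_const]
      · rw [map_eq_bind]
        refine Eq.trans ?_ (Φ.tape_resampleI y.W.d _)
        refine bind_congr fun τ _ => ?_
        simp only [Φ.encrypt_eq, PMF.map_bind]
        refine bind_congr fun r _ => ?_
        rw [PMF.map_comp, map_eq_bind]
        refine bind_congr fun σ _ => ?_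
        exact congrArg _ (outcome_tape A v y b hQ hg st τ { τ with ri := r, si := σ }
            rfl rfl rfl rfl _ _)
    · have e0 : selOf y.j b 0 = !decide (y.j = 0) := by
        have : ¬ 0 + 1 = y.j := fun h => h1 h.symm
        by_cases h0 : y.j = 0 <;> simp [selOf, this, h0]; omega
      by_cases h2 : y.j = 2
      · have e1 : selOf y.j b 1 = b := by simp [selOf, h2]
        simp only [if_neg h1, if_pos h2, e0, e1]
        by_cases hg : Q = .newGroup
        · subst hg
          rw [map_eq_bind]
          refine bind_congr fun τ _ => ?_
          rw [map_eq_bind]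
          simp only [outcome_newGroup A v y b st τ _ _ ([], [], []) ([], [], []), PMF.bind_const]
        · rw [map_eq_bind]
          refine Eq.trans ?_ (Φ.tape_resampleJ y.W.d _)
          refine bind_congr fun τ _ => ?_
          simp only [Φ.encrypt_eq, PMF.map_bind]
          refine bind_congr fun r _ => ?_
          rw [PMF.map_comp, map_eq_bind]
          refine bind_congr fun σ _ => ?_
          exact congrArg _ (outcome_tape A v y b hQ hg st τ { τ with rj := r, sj := σ }
            rfl rfl rfl rfl _ _)
      · have e1 : selOf y.j b 1 = !decide (y.j = 0 ∨ y.j = 1) := by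
          have h2' : ¬ 1 + 1 = y.j := fun h => h2 h.symm
          by_cases h0 : y.j = 0 <;> simp [selOf, h2', h0, h1]; omega
        simp only [if_neg h1, if_neg h2, e0, e1, PMF.pure_map]
        rfl

end RState

namespace RState

variable (A : Adversary) (v : BFVersion) (y : RState Φ) (b : Bool)

theorem proc_silent (hb : y.boot = false) (hy : y.ans = [])
    (hs : y.fuel = [] ∨ y.asked A = none) (C : (game Φ v).State) :
    proc A v 14 (y, C) = ((game Φ v).answer (y.coinQuery A) C).map fun r =>
      (y.finish A v (encodeList r.1) ⟨0, 0, 0, [], 0, 0, [], [], [], []⟩ (ctxt []) [] [], r.2) := by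
  have hC : ∀ τ, y.queryC A τ = [] := fun τ => by
    unfold queryC; rcases hs with h | h <;> simp [h]
  have hI : ∀ τ c, y.queryI A v τ c = [] := fun τ c => by
    unfold queryI; rcases hs with h | h <;> simp [h]
  have hJ : ∀ τ c, y.queryJ A v τ c = [] := fun τ c => by
    unfold queryJ; rcases hs with h | h <;> simp [h]
  have hF : ∀ a τ c ai aj τ' c' ai' aj', y.finish A v a τ c ai aj = y.finish A v a τ' c' ai' aj' := by
    intro a τ c ai aj τ' c' ai' aj'
    unfold finish
    rcases hs with h | h <;> simp [h]
  rw [proc_block A v y C hb hy, map_eq_bind]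
  refine bind_congr fun r _ => ?_
  simp only [hC, hI, hJ, answer_nil, PMF.pure_bind, PMF.pure_map]
  simp only [hF _ _ _ _ _ ⟨0, 0, 0, [], 0, 0, [], [], [], []⟩ (ctxt []) [] [], PMF.bind_const]

theorem answered_eq (st : Str) (Q : Query) (τ : Tape) (c : Ctxt) {ai aj : List Str} (hi : y.opened
    (y.chalNext Q τ c) (World.reqI (y.request v Q τ c)) ai = (y.sim b).openT v (World.reqI
    (y.request v Q τ c))) (hj : y.opened (y.chalNext Q τ c) (World.reqJ (y.request v Q τ c)) aj =
    (y.sim b).openT v (World.reqJ (y.request v Q τ c))) : y.answered A v st Q τ c ai aj = y.stepped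
    A v b st Q τ c := by
  unfold answered stepped parts
  rw [hi, hj]

theorem finish_asked (hf : y.fuel.isEmpty = false) (h1 : (y.action A).isEmpty = false) (h2 :
    y.isCoin A = false) {Q : Query} (hQ : y.asked A = some Q) (a : Str) (τ : Tape) (c : Ctxt) (ai aj
    : List Str) : y.finish A v a τ c ai aj = y.answered A v ((y.action A).headD []) Q τ c ai aj :=
    by
  unfold finish
  rw [hf, h1, h2, hQ]
  rfl

/-- The end of a round, after the challenge. -/
def finishDist (τ : Tape) (x : Ctxt × (game Φ v).State) : PMF (RState Φ × (game Φ v).State) :=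
  ((game Φ v).answer (y.queryI A v τ x.1) x.2).bind fun ri =>
    ((game Φ v).answer (y.queryJ A v τ x.1) ri.2).map fun rj =>
      (y.finish A v (encodeList []) τ x.1 ri.1 rj.1, rj.2)

/-- In a block with a query to the simulated system, the challenge is asked first and the two
decryptions afterwards. By then the target of the challenger is already the pair in `chalNext`, so a
challenge made in this very block is also recognized in the request to HSS/AuC. -/
theorem proc_asked {y : RState Φ} (hy : y.Ready v) (hf : y.fuel ≠ []) {Q : Query}
    (hQ : y.asked A = some Q) :
    proc A v 14 (y, y.challenger v b) = ((Φ.tape y.W.d).bind fun τ => (y.chalDist v b Q τ).map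
      fun c => y.stepped A v b ((y.action A).headD []) Q τ c).map fun z => (z, z.challenger v b) := by
  have hf' : y.fuel.isEmpty = false := by simpa using hf
  have hq : ((y.action A).isEmpty || y.isCoin A || y.W.tested) = false := by
    by_contra h
    rw [Bool.not_eq_false] at h
    unfold asked at hQ
    simp [h] at hQ
  simp only [Bool.or_eq_false_iff] at hq
  obtain ⟨⟨h1, h2⟩, ht⟩ := hq
  have h0 : y.coinQuery A = [] := by unfold coinQuery; simp [h2]
  rw [proc_block A v y _ hy.boot hy.ans, h0, answer_nil, PMF.pure_bind, PMF.map_bind]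
  refine bind_congr fun τ _ => ?_
  have e : ∀ F : Ctxt × (game Φ v).State → PMF (RState Φ × (game Φ v).State),
      (((game Φ v).answer (y.queryC A τ) (y.challenger v b)).bind fun rc => F (ctxt rc.1, rc.2)) =
      (y.chalDist v b Q τ).bind fun c =>
        F (c, y.withTarget v b ((y.chalNext Q τ c).map Prod.fst)) := by
    intro F
    have h := congrArg (fun p => PMF.bind p F) (answer_chalQuery v b hy ht Q τ)
    simp only [PMF.bind_map] at h
    have hc : y.queryC A τ = y.chalQuery Q τ := by unfold queryC; rw [hf', hQ]; rfl
    rw [hc]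
    exact h
  change ((game Φ v).answer (y.queryC A τ) (y.challenger v b)).bind
    (fun rc => y.finishDist A v τ (ctxt rc.1, rc.2)) = _
  rw [e (y.finishDist A v τ)]
  simp only [PMF.map_comp]
  rw [map_eq_bind]
  refine bind_congr fun c hc => ?_
  unfold finishDist
  have hI : y.queryI A v τ c = decQuery (y.chalNext Q τ c) (World.reqI (y.request v Q τ c)) := by
    unfold queryI; rw [hf', hQ]; rfl
  have hJ : y.queryJ A v τ c = decQuery (y.chalNext Q τ c) (World.reqJ (y.request v Q τ c)) := by
    unfold queryJ; rw [hf', hQ]; rfl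
  have hch := chalOk_next v b hy ht hc
  obtain ⟨ai, hai, hoi⟩ := y.answer_decQuery v b hch (World.reqI (y.request v Q τ c))
  obtain ⟨aj, haj, hoj⟩ := y.answer_decQuery v b hch (World.reqJ (y.request v Q τ c))
  simp only [hI, hJ, hai, PMF.pure_bind]
  rw [haj, PMF.pure_map]
  refine congrArg PMF.pure (Prod.ext ?_ (challenger_stepped A v y b _ Q τ c).symm)
  exact (finish_asked A v y hf' h1 h2 hQ _ _ _ _ _).trans (answered_eq A v y b _ Q τ c hoi hoj)

/-- A round of the reduction is a round of the hybrid game. -/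
theorem exists_round {κ : ℕ} {y : RState Φ} (hy : y.Ready v) (hf : y.fuel ≠ [])
    (hone : y.one = List.replicate κ true) : ∃ p : PMF (RState Φ),
      proc A v 14 (y, y.challenger v b) = p.map (fun z => (z, z.challenger v b)) ∧
      p.map (view v · b) = A.round (hybridGame Φ v) κ (y.view v b) ∧
      ∀ z ∈ p.support, z.Ready v ∧ z.fuel = y.fuel.tail ∧ z.one = y.one := by
  have hf' : y.fuel.isEmpty = false := by simpa using hf
  have hlim : y.limit A = A.bound.eval κ := by simp [limit, hone]
  have hact : decodeList (A.step ![List.replicate κ true, (y.view v b).1, (y.view v b).2.1]) =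
      y.action A := by simp [action, view, hone]
  cases hQ : y.asked A with
  | some Q =>
    refine ⟨_, proc_asked A v b hy hf hQ, ?_, ?_⟩
    · have hq : ((y.action A).isEmpty || y.isCoin A || y.W.tested) = false := by
        by_contra h
        rw [Bool.not_eq_false] at h
        unfold asked at hQ
        simp [h] at hQ
      have hp : Query.parse (y.action A).tail = some Q := by
        unfold asked at hQ
        rw [hq] at hQ
        exact hQ
      simp only [Bool.or_eq_false_iff] at hq
      obtain ⟨⟨h1, h2⟩, ht⟩ := hq
      obtain ⟨st, q, hs⟩ : ∃ st q, y.action A = st :: q := by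
        cases h : y.action A with
        | nil => simp [h] at h1
        | cons a l => exact ⟨a, l, rfl⟩
      rw [Adversary.round_cons (hact.trans hs)]
      have hnc : ∀ N, q ≠ [[], N] := by
        rintro N rfl
        simp [isCoin, hs] at h2
      rw [Game.answer_of_ne _ hnc]
      have ho : (hybridGame Φ v).oracle q (y.view v b).2.2 =
          PMF.map (β := List Str × (hybridGame Φ v).State) ((y.sim b).answerWith v Q)
            (Φ.tape y.W.d) := by
        change HState.oracle v q (y.sim b) = _
        unfold HState.oracle
        have ht' : (y.sim b).W.tested = false := ht
        rw [hs, List.tail_cons] at hp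
        rw [ht', hp]
        rfl
      rw [ho, hs, List.headD_cons, PMF.map_bind]
      simp only [PMF.map_comp]
      refine ((map_view_stepped A v y b st Q).trans ?_).trans (PMF.map_comp
        (f := fun τ => (((y.sim b).answerWith v Q τ : List Str × HState Φ) :
          List Str × (hybridGame Φ v).State)) _ (A.next κ st)).symm
      refine congrArg (fun f => PMF.map f (Φ.tape y.W.d)) (funext fun τ => ?_)
      rw [outcome, hlim]
      rfl
    · intro z hz
      simp only [PMF.mem_support_bind_iff, PMF.mem_support_map_iff] at hz
      obtain ⟨τ, hτ, c, hc, rfl⟩ := hz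
      have ht : y.W.tested = false := by
        cases ht : y.W.tested
        · rfl
        · simp [asked, ht] at hQ
      exact ⟨ready_stepped A v b hy ht _ hτ hc, rfl, rfl⟩
  | none =>
    have keep : ∀ s r : Str, ({ y with fuel := y.fuel.tail, st := s, rep := r, ans := [] } :
        RState Φ).Ready v := fun s r => ⟨hy.boot, rfl, hy.clash, hy.j_eq, hy.chalOk⟩
    rw [proc_silent A v y hy.boot hy.ans (Or.inr hQ)]
    cases hs : y.action A with
    | nil =>
      have h0 : y.coinQuery A = [] := by unfold coinQuery; simp [hs]
      refine ⟨PMF.pure { y with fuel := y.fuel.tail, rep := [], ans := [] }, ?_, ?_, ?_⟩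
      · rw [h0, answer_nil, PMF.pure_map, PMF.pure_map]
        unfold finish
        rw [hf', hs]
        rfl
      · rw [Adversary.round_nil (hact.trans hs), PMF.pure_map]
        rfl
      · intro z hz
        simp only [PMF.support_pure, Set.mem_singleton_iff] at hz
        subst hz
        exact ⟨keep y.st [], rfl, rfl⟩
    | cons st q =>
      rw [Adversary.round_cons (hact.trans hs)]
      cases h2 : y.isCoin A
      · have h0 : y.coinQuery A = [] := by unfold coinQuery; simp [h2]
        refine ⟨PMF.pure { y with
          fuel := y.fuel.tail, st := st.take (y.limit A), rep := [], ans := [] }, ?_, ?_, ?_⟩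
        · rw [h0, answer_nil, PMF.pure_map, PMF.pure_map]
          unfold finish
          rw [hf', hs, h2, hQ]
          rfl
        · have hnc : ∀ N, q ≠ [[], N] := by
            rintro N rfl
            simp [isCoin, hs] at h2
          rw [Game.answer_of_ne _ hnc]
          have ho : (hybridGame Φ v).oracle q (y.view v b).2.2 =
              PMF.pure (([], (y.sim b : (hybridGame Φ v).State))) := by
            change HState.oracle v q (y.sim b) = _
            unfold HState.oracle
            cases ht : y.W.tested
            · have hp : Query.parse q = none := by simpa [asked, hs, h2, ht] using hQ
              have ht' : (y.sim b).W.tested = false := ht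
              rw [ht', hp]
              rfl
            · have ht' : (y.sim b).W.tested = true := ht
              rw [ht']
              rfl
          rw [ho, PMF.pure_map]
          refine Eq.trans ?_ (PMF.pure_map (A.next κ st)
            (([], y.sim b) : List Str × (hybridGame Φ v).State)).symm
          unfold Adversary.next
          rw [← hlim]
          simp only [view, sim, encodeList, List.flatMap_nil, List.take_nil]
        · intro z hz
          simp only [PMF.support_pure, Set.mem_singleton_iff] at hz
          subst hz
          exact ⟨keep _ [], rfl, rfl⟩
      · obtain ⟨N, rfl⟩ : ∃ N, q = [[], N] := by
          simp only [isCoin, hs, List.tail_cons, Bool.and_eq_true, decide_eq_true_eq] at h2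
          match q, h2 with
          | [[], N], _ => exact ⟨N, rfl⟩
          | [_ :: _, N], h => simp at h
        have h0 : y.coinQuery A = [[], N] := by unfold coinQuery; rw [hf', hs, h2]; rfl
        refine ⟨(uniformUpTo (toNat N)).map fun x => { y with
          fuel := y.fuel.tail
          st := st.take (y.limit A)
          rep := (encodeList [x.bits]).take (y.limit A)
          ans := [] }, ?_, ?_, ?_⟩
        · rw [h0, Game.answer_coin, PMF.map_comp, PMF.map_comp]
          refine congrArg (fun f => PMF.map f _) (funext fun x => ?_)
          simp only [Function.comp_def]
          unfold finish
          rw [hf', hs, h2]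
          rfl
        · rw [Game.answer_coin, PMF.map_comp, PMF.map_comp]
          refine congrArg (fun f => PMF.map f _) (funext fun x => ?_)
          simp only [Function.comp_def, Adversary.next, ← hlim]
          rfl
        · intro z hz
          simp only [PMF.mem_support_map_iff] at hz
          obtain ⟨x, -, rfl⟩ := hz
          exact ⟨keep _ _, rfl, rfl⟩

/-- The bound of an adversary limits both its rounds and the sizes of its data, so the reduction has
more rounds than it needs; the surplus must change nothing. -/
theorem proc_idle (hb : y.boot = false) (hy : y.ans = []) (hf : y.fuel = [])
    (C : (game Φ v).State) (k : ℕ) : proc A v (14 * k) (y, C) = PMF.pure (y, C) := by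
  induction k with
  | zero => rfl
  | succ k ih =>
    have h0 : y.coinQuery A = [] := by unfold coinQuery; simp [hf]
    have h1 : proc A v 14 (y, C) = PMF.pure (y, C) := by
      rw [proc_silent A v y hb hy (Or.inl hf), h0, answer_nil, PMF.pure_map]
      have hf' : y.fuel.isEmpty = true := by rw [hf]; rfl
      have e : ({ y with ans := [] } : RState Φ) = y := by rw [← hy]
      unfold finish
      rw [hf', cond_true, e]
    rw [Nat.mul_succ, Nat.add_comm, proc, procRun_add, show procRun _ _ _ 14 _ = _ from h1,
      PMF.pure_bind]
    exact ih

/-- The guess of the reduction is the guess in the hybrid game. -/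
theorem map_proc {κ : ℕ} (k m : ℕ) : ∀ {y : RState Φ}, y.Ready v → y.fuel.length = k → y.one =
    List.replicate κ true → (proc A v (14 * (k + m)) (y, y.challenger v b)).map (fun x =>
    x.1.st.headD false) = A.run (hybridGame Φ v) κ k (y.view v b) := by
  induction k with
  | zero =>
    intro y hy hf hone
    rw [proc_idle A v y hy.boot hy.ans (List.length_eq_zero_iff.mp hf), Adversary.run_zero,
      PMF.pure_map]
    rfl
  | succ k ih =>
    intro y hy hf hone
    obtain ⟨p, h1, h2, h3⟩ := exists_round A v b hy (by rintro h; simp [h] at hf) hone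
    rw [show 14 * (k + 1 + m) = 14 + 14 * (k + m) by ring, proc, procRun_add,
      show procRun _ _ _ 14 _ = _ from h1, Adversary.run_succ, ← h2, PMF.bind_map, PMF.bind_map,
      PMF.map_bind]
    refine bind_congr fun z hz => ?_
    obtain ⟨r, f, o⟩ := h3 z hz
    exact ih r (by rw [f, List.length_tail, hf]; rfl) (o.trans hone)

end RState

end GD2C

/-! ### Size bounds, by which the truncations built into an adversary never affect the reduction. -/

namespace GD2C

variable {Φ : Family} {S L : ℕ}

/-! ### The size of the system -/

/-- The cipher is injective on the finite set of strings of a given length, hence surjective, so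
every string is the encryption of a string of its own length. -/
theorem Family.length_DS (Φ : Family) (k w : Str) : (Φ.DS k w).length = w.length := by
  let f : List.Vector Bool w.length → List.Vector Bool w.length := fun m =>
    ⟨Φ.ES k m.1, (Φ.length_ES k m.1).trans m.2⟩
  have hf : Function.Injective f := fun a b h => Subtype.ext (by
    rw [← Φ.DS_ES k a.1, ← Φ.DS_ES k b.1]
    exact congrArg (Φ.DS k) (congrArg Subtype.val h))
  obtain ⟨m, hm⟩ := Finite.injective_iff_surjective.mp hf ⟨w, rfl⟩
  have : Φ.ES k m.1 = w := congrArg Subtype.val hm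
  rw [← this, Φ.DS_ES, Φ.length_ES]

theorem length_bits_toNat (w : Str) : (toNat w).bits.length ≤ w.length := by
  rw [Nat.size_eq_bits_len, Nat.size_le]
  induction w with
  | nil => simp [toNat]
  | cons b w ih =>
    rw [toNat_cons, Nat.bit_val, List.length_cons, pow_succ]
    cases b <;> simp <;> omega

theorem length_bits_mono {m n : ℕ} (h : m ≤ n) : m.bits.length ≤ n.bits.length := by
  rw [Nat.size_eq_bits_len, Nat.size_eq_bits_len]
  exact Nat.size_le_size h

theorem length_bits_le (n : ℕ) : n.bits.length ≤ n := by
  rw [Nat.size_eq_bits_len, Nat.size_le]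
  exact Nat.lt_two_pow_self

/-- All strings of the list have at most a given length. -/
def Short (M : ℕ) (l : List Str) : Prop := ∀ w ∈ l, w.length ≤ M

@[simp] theorem short_nil (M : ℕ) : Short M [] := fun _ h => by simp at h

@[simp] theorem short_cons (M : ℕ) (w : Str) (l : List Str) :
    Short M (w :: l) ↔ w.length ≤ M ∧ Short M l := List.forall_mem_cons

theorem Short.getD {M : ℕ} {l : List Str} (h : Short M l) (i : ℕ) : (l.getD i []).length ≤ M := by
  rw [List.getD_eq_getElem?_getD]
  cases hi : l[i]? with
  | none => simp
  | some w => exact h w (List.mem_of_getElem? hi)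

/-- The strings of which a device consists. -/
def UE.strs (u : UE) : List Str := [u.ident, u.aid, u.key, u.ak, u.group.bits]

/-- The strings of which an instance consists. -/
def Inst.strs (I : Inst) : List Str :=
  [I.owner.bits, I.peer.bits, I.stage.bits, I.sid, I.exp.bits, I.own, I.other, I.nonce,
    I.key.getD []]

/-- Bounds for the sizes of the public objects. -/
structure Family.Caps (Φ : Family) (d : Str) (S : ℕ) : Prop where
  G : ∀ x, (Φ.encG d x).length ≤ S
  l : Φ.l d ≤ S
  n : Φ.n d ≤ S
  p : (Φ.p d).size ≤ S
  d : d.length ≤ S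

/-- The size of a system. -/
structure World.Small (W : World Φ) (S L : ℕ) : Prop where
  caps : Φ.Caps W.d S
  kp : W.kp.length ≤ 6 * S + 4
  gids : Short (6 * S + 4) W.gids
  ues : ∀ u ∈ W.ues, Short (6 * S + 4) u.strs
  insts : ∀ I ∈ W.insts, Short (6 * S + 4) I.strs
  hss : ∀ s ∈ W.hss, Short (6 * S + 4) (s.sid :: s.nonce :: (s.ui.strs ++ s.uj.strs))
  len : W.gids.length ≤ L ∧ W.ues.length ≤ L ∧ W.insts.length ≤ L ∧ W.hss.length ≤ L

/-- The sizes of the arguments of a query. -/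
def Query.Small (Q : Query) (S : ℕ) : Prop := Short S (Q.arg₁.bits :: Q.arg₂.bits :: Q.msg)

theorem Query.small_parse {q : List Str} (h : Short S q) {Q : Query} (hQ : parse q = some Q) :
    Q.Small S := by
  have b := fun w => (length_bits_toNat w)
  unfold parse at hQ
  split at hQ
  · cases hQ
  · rw [short_cons] at h
    have h := h.2
    split at hQ <;> cases hQ <;>
      simp only [Small, arg₁, arg₂, msg, short_cons, short_nil, Nat.zero_bits, List.length_nil,
        Nat.zero_le, true_and, and_true] at h ⊢ <;>
      first
      | exact h
      | exact trivial
      | exact ⟨(b _).trans h.1, h.2⟩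
      | exact ⟨(b _).trans h.1, (b _).trans h.2⟩
      | exact ⟨(b _).trans h.1, (b _).trans h.2.1, h.2.2⟩
      | exact (b _).trans h

/-- The sizes of random choices. -/
structure Tape.Small (τ : Tape) (S : ℕ) : Prop where
  x : τ.x.bits.length ≤ 6 * S + 4
  y : τ.y.bits.length ≤ 6 * S + 4
  strs : Short S [τ.si, τ.sj, τ.s₃, τ.s₄, τ.R]

namespace World

/-- Lengths do not accumulate over rounds: the cipher preserves length, exclusive or takes the
maximum, and the other new strings are encoded group elements or small numbers. One and the same
bound is therefore stationary. -/
theorem short_react {W : World Φ} (hc : Φ.Caps W.d S) {u : UE} {I : Inst} {msg : List Str}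
    (hI : Short (6 * S + 4) I.strs) (hm : Short (6 * S + 4) msg) :
    Short (6 * S + 4) (W.react u I msg).1 ∧ Short (6 * S + 4) (W.react u I msg).2.strs := by
  have htok : ∀ w R, W.checkToken u I.sid w = some R → w.length ≤ 6 * S + 4 → R.length ≤ 6 * S + 4 := by
    intro w R h hw
    unfold checkToken at h
    simp only [Inst.strs, short_cons] at hI
    simp only at h
    split_ifs at h
    cases h
    rw [length_xorStr, List.length_drop, Φ.length_DS]
    omega
  have hsk : ((W.sessionKey I).getD []).length ≤ 6 * S + 4 := by
    unfold sessionKey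
    cases Φ.decG W.d I.other with
    | none => simp
    | some z => exact (hc.G _).trans (by omega)
  have g := hm.getD
  have s2 : (2 : ℕ).bits.length ≤ 6 * S + 4 := by have : (2 : ℕ).bits.length = 2 := rfl; omega
  have s3 : (3 : ℕ).bits.length ≤ 6 * S + 4 := by have : (3 : ℕ).bits.length = 2 := rfl; omega
  have s4 : (4 : ℕ).bits.length ≤ 6 * S + 4 := by have : (4 : ℕ).bits.length = 3 := rfl; omega
  have hn := hI
  simp only [Inst.strs, short_cons, short_nil, and_true] at hn
  obtain ⟨h1, h2, h3, h4, h5, h6, h7, h8, h9⟩ := hn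
  rw [react_eq]
  unfold reactWith
  cases I.initiator <;> simp only [cond_true, cond_false] <;> split_ifs
  all_goals first
    | (cases hR : W.checkToken u I.sid (msg.getD 1 []) with
      | none => simp [Inst.strs, *]
      | some R =>
        have := htok _ _ hR (g 1)
        simp only [Option.elim_some, Inst.strs, short_cons, short_nil, Φ.length_ES, and_true]
        simp only [*, and_self])
    | (simp only [Inst.strs, short_cons, short_nil, Φ.length_ES, length_xorStr, max_le_iff,
        and_true, true_and, Nat.zero_bits, List.length_nil, Nat.zero_le]
       simp only [*, and_self])

theorem Small.send {W : World Φ} (h : W.Small S L) (k : ℕ) {msg : List Str} (hm : Short (6 * S + 4)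
    msg) : Short (6 * S + 4) (W.send k msg).1 ∧ (W.send k msg).2.Small S L := by
  unfold World.send
  split
  · exact ⟨short_nil _, h⟩
  · rename_i I hI
    split
    · exact ⟨short_nil _, h⟩
    · rename_i u _
      obtain ⟨h1, h2⟩ := short_react (u := u) h.caps (h.insts I (List.mem_of_getElem? hI)) hm
      refine ⟨h1, { h with insts := fun J hJ => ?_, len := by simpa using h.len }⟩
      rcases List.mem_or_eq_of_mem_set hJ with hJ | rfl
      · exact h.insts J hJ
      · exact h2

theorem Small.hssConfirm {W : World Φ} (h : W.Small S L) (k : ℕ) (msg : List Str) :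
    Short (6 * S + 4) (W.hssConfirm k msg).1 ∧ (W.hssConfirm k msg).2.Small S L := by
  unfold World.hssConfirm
  split
  · rename_i s resj hs
    simp only
    have hl := h.caps.l
    have h' : ({ W with hss := W.hss.set k { s with isOpen := false } } : World Φ).Small S L := by
      refine { h with hss := fun t ht => ?_, len := by simpa using h.len }
      rcases List.mem_or_eq_of_mem_set ht with ht | rfl
      · exact h.hss t ht
      · exact h.hss s (List.mem_of_getElem? hs)
    split_ifs
    · refine ⟨?_, h'⟩
      simp only [short_cons, xres, Φ.length_H, short_nil, and_true]
      omega
    · exact ⟨short_nil _, h'⟩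
  · exact ⟨short_nil _, h⟩

theorem Small.relay {W : World Φ} (h : W.Small S L) (ki kj k : ℕ) {m : List Str}
    (hm : Short (6 * S + 4) m) : (W.relay ki kj k m).2.Small S L := by
  have h1 := h.send kj hm
  have h2 := h1.2.send ki h1.1
  have h3 := h2.2.send kj h2.1
  have h4 := h3.2.hssConfirm k (World.send kj (World.send ki (W.send kj m).1 (W.send kj m).2).1
    (World.send ki (W.send kj m).1 (W.send kj m).2).2).1
  have h5 := h4.2.send kj h4.1
  exact (h5.2.send ki h5.1).2

theorem Small.mono {W : World Φ} (h : W.Small S L) {L' : ℕ} (hL : L ≤ L') : W.Small S L' :=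
  { h with len := by have := h.len; omega }

theorem Small.addInst {W : World Φ} (h : W.Small S L) {P : Prop} [Decidable P] {I : Inst}
    (hI : Short (6 * S + 4) I.strs) : (W.addInsts (if P then [I] else [])).Small S (L + 1) := by
  have hl := h.len
  split_ifs
  · refine { h with insts := fun J hJ => ?_, len := ?_ }
    · rcases List.mem_append.mp hJ with hJ | hJ
      · exact h.insts J hJ
      · rw [List.mem_singleton.mp hJ]; exact hI
    · simp only [addInsts, List.length_append, List.length_singleton]; omega
  · rw [addInsts_nil]; exact h.mono (by omega)

theorem Small.hssWith {W : World Φ} (h : W.Small S L) {msg : List Str}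
    (hm : (msg.getD 0 []).length ≤ S) {oi oj : Option UE}
    (hi : ∀ u, oi = some u → Short (6 * S + 4) u.strs) (hj : ∀ u, oj = some u → Short (6 * S + 4) u.strs)
    {R : Str} (hR : R.length ≤ S) :
    Short (6 * S + 4) (W.hssWith msg oi oj R).1 ∧ (W.hssWith msg oi oj R).2.Small S (L + 1) := by
  have hz : Short (6 * S + 4) [] ∧ W.Small S (L + 1) := ⟨short_nil _, h.mono (by omega)⟩
  have hl := h.caps.l
  unfold World.hssWith
  split_ifs
  · cases oi with
    | none => exact hz
    | some ui =>
      cases oj with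
      | none => exact hz
      | some uj =>
        simp only [Option.bind_some]
        cases hp : W.prose (msg.getD 0 []) ui.aid uj.aid with
        | none => exact hz
        | some a =>
          have ha : a.1.length = Φ.l W.d ∧ a.2.length = Φ.l W.d := by
            unfold prose at hp
            split at hp
            · split_ifs at hp
              cases hp
              exact ⟨Φ.length_H _ _, Φ.length_H _ _⟩
            · cases hp
          refine ⟨?_, { h with hss := fun s hs => ?_, len := ?_ }⟩
          · simp only [Option.map_some, Option.getD_some, short_cons, short_nil, and_true,
              Φ.length_ES, List.length_append, length_xorStr, ha]
            omega
          · rcases List.mem_append.mp hs with hs | hs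
            · exact h.hss s hs
            · rw [List.mem_singleton.mp hs]
              have := hi ui rfl
              have := hj uj rfl
              refine (short_cons _ _ _).mpr ⟨by dsimp only; omega,
                (short_cons _ _ _).mpr ⟨by dsimp only; omega, ?_⟩⟩
              exact fun w hw => (List.mem_append.mp hw).elim (hi ui rfl w) (hj uj rfl w)
          · have := h.len
            simp only [Option.map_some, Option.getD_some, List.length_append,
              List.length_singleton]
            omega
  · exact hz

theorem length_newSid (W : World Φ) (k : ℕ) : (W.newSid k).length = (Φ.p W.d).size := by
  simp [newSid, fixedBits, width]

/-- An undisturbed session creates two instances and one session at HSS/AuC, which is the maximum,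
so `L` grows by at most 3 per query and stays below 3T. -/
theorem Small.core {W : World Φ} (h : W.Small S L) {Q : Query} (hQ : Q.Small S) {τ : Tape}
    (hτ : τ.Small S) (ci cj : Ctxt) {oi oj : Option UE}
    (hi : ∀ u, oi = some u → Short (6 * S + 4) u.strs)
    (hj : ∀ u, oj = some u → Short (6 * S + 4) u.strs) :
    (W.core Q τ ci cj oi oj).2.Small S (L + 3) := by
  have h' := h.mono (show L ≤ L + 3 by omega)
  obtain ⟨ht, -, -, -, hR, -⟩ := by simpa only [short_cons] using hτ.strs
  have s1 : (1 : ℕ).bits.length ≤ 6 * S + 4 := by have : (1 : ℕ).bits.length = 1 := rfl; omega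
  have hx := hτ.x
  have hy := hτ.y
  have hG := h.caps.G
  have hp := h.caps.p
  unfold Query.Small at hQ
  have sI : ∀ i j : ℕ, i.bits.length ≤ S → j.bits.length ≤ S →
      (W.addInsts (W.startInst i j τ.sid τ.x)).Small S (L + 1) := by
    intro i j ai aj
    refine h.addInst ?_
    have := hG (W.g ^ τ.x)
    simp only [Inst.strs, short_cons, short_nil, length_newSid, dh, Option.getD_none,
      List.length_nil, and_true, Nat.zero_le]
    omega
  have rI : ∀ (W' : World Φ) (L' : ℕ), W'.Small S L' → ∀ (j i : ℕ) (msg : List Str),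
      j.bits.length ≤ S → i.bits.length ≤ S → (msg.getD 0 []).length ≤ 6 * S + 4 →
      (msg.getD 5 []).length ≤ 6 * S + 4 →
      (W'.addInsts (W.respondInst j i msg τ.y)).Small S (L' + 1) := by
    intro W' L' h j i msg aj ai m0 m5
    refine h.addInst ?_
    have := hG (W.g ^ τ.y)
    simp only [Inst.strs, short_cons, short_nil, dh, Option.getD_none, List.length_nil,
      and_true, Nat.zero_le]
    omega
  cases Q <;> simp only [Query.arg₁, Query.arg₂, Query.msg, short_cons] at hQ <;>
    simp only [World.core]
  case newGroup =>
    refine { h with gids := fun w hw => ?_, len := ?_ }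
    · rcases List.mem_append.mp hw with hw | hw
      · exact h.gids w hw
      · rw [List.mem_singleton.mp hw]; omega
    · have := h.len
      simp only [List.length_append, List.length_singleton]; omega
  case execute i j =>
    -- The instance of the responder stores only the session identity and the Diffie–Hellman value
    -- of the message, its components 0 and 5; the length of the ciphertext does not matter.
    have hm : ∀ k, ((W.startMsg i j τ.sid τ.x ci).getD k []).length ≤ 6 * S + 4 ∨ k ≠ 0 ∧ k ≠ 5 := by
      intro k
      have := hG (W.g ^ τ.x)
      by_cases h0 : k = 0
      · subst h0; left; unfold startMsg; split_ifs <;> simp [length_newSid]; omega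
      · by_cases h5 : k = 5
        · subst h5; left; unfold startMsg; split_ifs <;> simp [dh]; omega
        · exact Or.inr ⟨h0, h5⟩
    have a := sI i j hQ.1 hQ.2.1
    have b := rI _ _ a j i (W.startMsg i j τ.sid τ.x ci) hQ.2.1 hQ.1
      ((hm 0).resolve_right (by simp)) ((hm 5).resolve_right (by simp))
    have m0 : ((W.respondMsg j i (W.startMsg i j τ.sid τ.x ci) τ.y cj).getD 0 []).length ≤ S := by
      unfold respondMsg startMsg
      split_ifs <;> simp [length_newSid, hp]
    exact ((b.hssWith m0 hi hj hR).2).relay _ _ _ (b.hssWith m0 hi hj hR).1 |>.mono (by omega)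
  case start i j => exact (sI i j hQ.1 hQ.2.1).mono (by omega)
  case respond j i msg =>
    exact (rI W L h j i msg hQ.1 hQ.2.1 ((hQ.2.2.getD 0).trans (by omega))
      ((hQ.2.2.getD 5).trans (by omega))).mono (by omega)
  case send k msg =>
    exact (h'.send k fun w hw => (hQ.2.2 w hw).trans (by omega)).2
  case hssRequest msg => exact (h.hssWith (hQ.2.2.getD 0) hi hj hR).2.mono (by omega)
  case hssConfirm k msg => exact (h'.hssConfirm k msg).2
  all_goals exact h'

end World

/-! ### The size of the state of the reduction -/

/-- The strings of which two candidates and a device consist. -/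
def SmallIds (S L : ℕ) (ids : List Slot) : Prop :=
  (∀ p ∈ ids, Short (6 * S + 4) (p.1.1 :: p.1.2 :: p.2.strs)) ∧ ids.length ≤ L

theorem SmallIds.lookup {ids : List Slot} (h : SmallIds S L ids) {m : Str} {u : UE}
    (hu : lookup ids m = some u) : Short (6 * S + 4) u.strs := by
  unfold GD2C.lookup at hu
  obtain ⟨p, hp, rfl⟩ := Option.map_eq_some_iff.mp hu
  have := h.1 p (List.mem_of_find?_eq_some hp)
  simp only [short_cons] at this
  exact this.2.2

theorem HState.small_parts {W : World Φ} (h : W.Small S L) {ids : List Slot}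
    (hids : SmallIds S L ids) {Q : Query} (hQ : Q.Small S) {τ : Tape} (hτ : τ.Small S)
    (ci cj : Ctxt) {oi oj : Option UE} (hi : ∀ u, oi = some u → Short (6 * S + 4) u.strs)
    (hj : ∀ u, oj = some u → Short (6 * S + 4) u.strs) :
    (parts Q τ ci cj oi oj W ids).2.1.Small S (L + 3) ∧
      SmallIds S (L + 3) (parts Q τ ci cj oi oj W ids).2.2 := by
  have hz : W.Small S (L + 3) ∧ SmallIds S (L + 3) ids :=
    ⟨h.mono (by omega), hids.1, hids.2.trans (by omega)⟩
  unfold parts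
  split_ifs
  · unfold registerDevice
    cases hg : W.gids[Q.arg₁]? with
    | none => exact hz
    | some gid =>
      simp only [Option.bind_some]
      split_ifs
      · have hs := hτ.strs
        have hgid := h.gids gid (List.mem_of_getElem? hg)
        have hkp := h.kp
        unfold Query.Small at hQ
        simp only [short_cons] at hs hQ
        have hu : Short (6 * S + 4) (UE.strs ⟨[], τ.s₃, τ.s₄, xorStr (xorStr τ.s₃ gid) W.kp,
            Q.arg₁⟩) := by
          simp only [UE.strs, short_cons, short_nil, length_xorStr, List.length_nil, and_true,
            Nat.zero_le, true_and]
          omega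
        have hl := h.len
        refine ⟨{ h with ues := fun u hu' => ?_, len := ?_ }, fun p hp => ?_, ?_⟩
        · rcases List.mem_append.mp hu' with hu' | hu'
          · exact h.ues u hu'
          · rw [List.mem_singleton.mp hu']; exact hu
        · simp only [Option.getD_some, List.length_append, List.length_singleton]; omega
        · rcases List.mem_append.mp hp with hp | hp
          · exact hids.1 p hp
          · rw [List.mem_singleton.mp hp]
            simp only [short_cons]
            exact ⟨by omega, by omega, hu⟩
        · have := hids.2
          simp only [Option.getD_some, List.length_append, List.length_singleton]; omega
      · exact hz
  · cases W.testOwner Q.arg₁ with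
    | none => exact hz
    | some i => exact ⟨{ hz.1 with }, fun p hp => by simp at hp, by simp⟩
  · exact ⟨h.core hQ hτ ci cj hi hj, hz.2⟩

theorem length_plain_le {ids : List Slot} (h : SmallIds S L ids) {n : ℕ} (hn : n ≤ S) (β : Bool)
    (i : ℕ) : (plain n β ids i).length ≤ 6 * S + 4 := by
  unfold plain
  cases hi : ids[i]? with
  | none => simp; omega
  | some p =>
    have := h.1 p (List.mem_of_getElem? hi)
    simp only [short_cons] at this
    cases β
    · exact this.1
    · exact this.2.1

theorem length_num (a : Str) : (num a).bits.length ≤ a.length := by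
  have key : ∀ (w acc : Str), ((decodeAux acc w).headD []).length ≤ acc.length + w.length := by
    intro w acc
    induction acc, w using decodeAux.induct with
    | case1 acc => simp [decodeAux]
    | case2 acc w => simp [decodeAux]
    | case3 acc => simp [decodeAux]
    | case4 acc b w ih => simp only [decodeAux, List.length_cons] at ih ⊢; omega
  exact (length_bits_toNat _).trans (by simpa [decodeList] using key a [])

theorem short_decodeList {M : ℕ} {a : Str} (h : a.length ≤ M) : Short M (decodeList a) := by
  have key : ∀ (w acc : Str), Short (acc.length + w.length) (decodeAux acc w) := by
    intro w acc
    induction acc, w using decodeAux.induct with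
    | case1 acc => simp [decodeAux]
    | case2 acc w ih =>
      simp only [decodeAux, short_cons, List.length_reverse, List.length_cons]
      exact ⟨by omega, fun x hx => (ih x hx).trans (by simp; omega)⟩
    | case3 acc => simp [decodeAux]
    | case4 acc b w ih =>
      intro x hx
      simp only [decodeAux] at hx
      have := ih x hx
      simp only [List.length_cons] at this ⊢
      omega
  exact fun w hw => (key a [] w hw).trans (by simpa using h)

/-- The replies of the challenger are short. -/
theorem length_answer {v : BFVersion} {q : List Str} (hq : ∀ N, q = [[], N] → N.length ≤ 2 * S)
    {c : (RState.game Φ v).State} (hc : Φ.Caps (CCAState.d c) S)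
    {r : List Str × (RState.game Φ v).State} (hr : r ∈ ((RState.game Φ v).answer q c).support) :
    (encodeList r.1).length ≤ 6 * S + 4 ∧ CCAState.d r.2 = CCAState.d c := by
  by_cases hN : ∃ N, q = [[], N]
  · obtain ⟨N, rfl⟩ := hN
    rw [Game.answer_coin, PMF.mem_support_map_iff] at hr
    obtain ⟨x, hx, rfl⟩ := hr
    obtain ⟨k, -, rfl⟩ := (PMF.mem_support_map_iff _ _ _).mp hx
    have h1 := length_bits_mono (Nat.lt_succ_iff.mp k.2)
    have h2 := length_bits_toNat N
    have h3 := hq N rfl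
    refine ⟨?_, rfl⟩
    rw [encodeList_cons, length_strPair]
    simp only [encodeList, List.flatMap_nil, List.length_nil]
    omega
  · push Not at hN
    rw [Game.answer_of_ne _ hN] at hr
    have key : ∀ C : CCAState Φ.toBFFamily, Φ.Caps C.d S → ∀ r ∈ (ccaOracle _ v q C).support,
        (encodeList r.1).length ≤ 6 * S + 4 ∧ r.2.d = C.d := by
      intro C hC r hr
      have hG := hC.G
      have hn := hC.n
      have hnil : (encodeList []).length ≤ 6 * S + 4 := by simp [encodeList]
      have h1 : ∀ w : Str, w.length ≤ S → (encodeList [w]).length ≤ 6 * S + 4 := by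
        intro w hw
        rw [encodeList_cons, length_strPair]
        simp only [encodeList, List.flatMap_nil, List.length_nil]
        omega
      unfold ccaOracle at hr
      split at hr
      · cases (PMF.mem_support_pure_iff _ _).mp hr; exact ⟨hnil, rfl⟩
      · split_ifs at hr <;> cases (PMF.mem_support_pure_iff _ _).mp hr
        · exact ⟨hnil, rfl⟩
        · exact ⟨h1 _ (hG _), rfl⟩
      · split_ifs at hr <;> cases (PMF.mem_support_pure_iff _ _).mp hr
        · exact ⟨hnil, rfl⟩
        · refine ⟨?_, rfl⟩
          simp only
          unfold BFFamily.decrypt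
          split
          · exact hnil
          · rename_i c _ _ _
            cases v
            · simp only
              split_ifs with h
              · refine h1 _ ?_
                rw [length_xorStr, h.1, Φ.length_H2]; omega
              · exact hnil
            · simp only
              split_ifs with h
              · refine h1 _ ?_
                rw [length_xorStr, h.2.1, Φ.length_H4]; omega
              · exact hnil
      · rename_i ident m₀ m₁ _
        by_cases h : C.target = none ∧ ident ∉ C.extracted ∧
          m₀.length = Φ.n C.d ∧ m₁.length = Φ.n C.d
        · rw [if_pos h] at hr
          have hm : (if C.b = true then m₁ else m₀).length = Φ.n C.d := by
            split_ifs
            · exact h.2.2.2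
            · exact h.2.2.1
          generalize (if C.b = true then m₁ else m₀) = m at hr hm
          obtain ⟨c, hc, rfl⟩ := (PMF.mem_support_map_iff _ _ _).mp hr
          refine ⟨?_, rfl⟩
          rw [Φ.encrypt_eq] at hc
          obtain ⟨k, -, hc⟩ := (PMF.mem_support_bind_iff _ _ _).mp hc
          obtain ⟨σ, hσ, rfl⟩ := (PMF.mem_support_map_iff _ _ _).mp hc
          have hσ := length_of_mem_uniformStr hσ
          have e0 : (encodeList []).length = 0 := rfl
          have g1 := hG (C.g ^ k)
          -- A ciphertext consists of three strings of length at most S, whose encoding has at most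
          -- 3·(2S + 1) bits. This longest reply accounts for the bound 6S + 4.
          simp only [encodeList_cons, length_strPair, e0]
          cases v
          · simp only [BFFamily.encryptWith, length_xorStr, hm, BFFamily.mask, Φ.length_H2,
              List.length_nil]
            omega
          · have g2 := hG (C.g ^ Φ.H3 C.d σ m)
            simp only [BFFamily.encryptWith, length_xorStr, hm, BFFamily.mask, Φ.length_H2,
              Φ.length_H4, hσ]
            omega
        · rw [if_neg h] at hr
          cases (PMF.mem_support_pure_iff _ _).mp hr
          exact ⟨hnil, rfl⟩
    exact key c hc r hr

end GD2C

namespace GD2C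

open Code

variable {Φ : Family} {S L : ℕ}

theorem length_enc_list {α : Type} [Code α] {e : ℕ} {l : List α}
    (h : ∀ a ∈ l, (enc a).length ≤ e) : (enc l).length ≤ l.length * (2 * e + 1) := by
  induction l with
  | nil => simp [enc, encodeList]
  | cons a l ih =>
    rw [enc_cons, length_strPair, List.length_cons, Nat.add_mul, Nat.one_mul]
    have h1 := h a List.mem_cons_self
    have h2 := ih fun b hb => h b (List.mem_cons_of_mem _ hb)
    omega

theorem length_enc_bool (b : Bool) : (enc b).length ≤ 1 := by cases b <;> simp [enc]

theorem length_enc_ue {M : ℕ} {u : UE} (h : Short M u.strs) : (enc u).length ≤ 9 * M + 4 := by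
  simp only [UE.strs, short_cons] at h
  change (enc u.flat).length ≤ _
  simp only [UE.flat, enc_pair, length_strPair, enc_str, enc_nat]
  omega

theorem length_enc_inst {M : ℕ} {I : Inst} (h : Short M I.strs) :
    (enc I).length ≤ 100 * M + 100 := by
  simp only [Inst.strs, short_cons] at h
  have hb := length_enc_bool I.initiator
  have hk : (enc I.key).length ≤ (I.key.getD []).length + 1 := by
    cases I.key <;> simp [enc]
  change (enc I.flat).length ≤ _
  simp only [Inst.flat, enc_pair, length_strPair, enc_str, enc_nat]
  omega

theorem length_enc_session {M : ℕ} {s : HSession} (h : Short M (s.sid :: s.nonce :: (s.ui.strs ++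
    s.uj.strs))) : (enc s).length ≤ 100 * M + 100 := by
  simp only [short_cons] at h
  have h1 := length_enc_ue (u := s.ui) fun w hw => h.2.2 w (List.mem_append_left _ hw)
  have h2 := length_enc_ue (u := s.uj) fun w hw => h.2.2 w (List.mem_append_right _ hw)
  have hb := length_enc_bool s.isOpen
  change (enc s.flat).length ≤ _
  simp only [HSession.flat, enc_pair, length_strPair, enc_str]
  omega

/-- A bound for the encoding of a list of objects. -/
def listCap (S : ℕ) : ℕ := 3 * S * (2 * (100 * (6 * S + 4) + 100) + 1)

theorem length_enc_list_le {α : Type} [Code α] {l : List α} (hl : l.length ≤ 3 * S)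
    (h : ∀ a ∈ l, (enc a).length ≤ 100 * (6 * S + 4) + 100) : (enc l).length ≤ listCap S :=
  (length_enc_list h).trans (Nat.mul_le_mul_right _ hl)

theorem World.Small.length_enc {W : World Φ} (h : W.Small S (3 * S)) :
    (enc W).length ≤ 200 * (6 * S + 4) + 20 * listCap S + 200 := by
  have h1 := length_enc_list_le h.len.1 fun w hw => by
    have := h.gids w hw; rw [enc_str]; omega
  have h2 := length_enc_list_le h.len.2.1 fun u hu => by
    have := length_enc_ue (h.ues u hu); omega
  have h3 := length_enc_list_le h.len.2.2.1 fun I hI => length_enc_inst (h.insts I hI)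
  have h4 := length_enc_list_le h.len.2.2.2 fun s hs => length_enc_session (h.hss s hs)
  have hb := length_enc_bool W.tested
  have g1 := h.caps.G W.g
  have g2 := h.caps.G (W.g ^ W.msk)
  have hd := h.caps.d
  have hk := h.kp
  change (enc W.flat).length ≤ _
  simp only [World.flat, enc_pair, length_strPair]
  simp only [enc_str W.d, enc_str W.kp, enc_str (Φ.encG _ _)]
  omega

namespace RState

variable (A : Adversary) (v : BFVersion) (κ S : ℕ)

/-- The sizes of the components of the state. -/
structure Bounded (y : RState Φ) (c : (game Φ v).State) : Prop where
  d_eq : CCAState.d c = y.W.d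
  one : y.one = List.replicate κ true
  fuel : y.fuel.length ≤ A.bound.eval κ
  W : y.W.Small S (3 * (A.bound.eval κ - y.fuel.length))
  ids : SmallIds S (3 * (A.bound.eval κ - y.fuel.length)) y.ids
  st : y.st.length ≤ A.bound.eval κ
  rep : y.rep.length ≤ A.bound.eval κ
  j : y.j.bits.length ≤ 6 * S + 4
  chal : ∀ x, y.chal = some x →
    Short (6 * S + 4) [x.1.1, x.1.2.1, x.1.2.2.1, x.1.2.2.2, x.2]
  ans : Short (6 * S + 4) y.ans
  ans_length : y.ans.length ≤ 13

variable {A v κ S} {y : RState Φ} {c : (game Φ v).State}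

theorem Bounded.limit_eq (h : y.Bounded A v κ S c) : y.limit A = A.bound.eval κ := by
  simp [limit, h.one]

theorem Bounded.length_enc (h : y.Bounded A v κ S c) (hT : A.bound.eval κ ≤ S) (hκ : κ ≤ S) :
    (enc y).length ≤ 10000 * (6 * S + 4) + 1000 * listCap S + 10000 := by
  have h1 := (h.W.mono (show _ ≤ 3 * S by omega)).length_enc
  have h2 := length_enc_list_le (h.ids.2.trans (show _ ≤ 3 * S by omega)) fun p hp => by
    have hs := h.ids.1 p hp
    simp only [short_cons] at hs
    have := length_enc_ue hs.2.2
    obtain ⟨⟨a, b⟩, u⟩ := p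
    simp only [enc_pair, length_strPair, enc_str] at hs this ⊢
    omega
  have h3 : (enc y.ans).length ≤ 13 * (2 * (6 * S + 4) + 1) :=
    (length_enc_list h.ans).trans (Nat.mul_le_mul_right _ h.ans_length)
  have h4 : (enc y.chal).length ≤ 30 * (6 * S + 4) + 30 := by
    cases hc : y.chal with
    | none => simp [enc]
    | some x =>
      have := h.chal x hc
      simp only [short_cons] at this
      obtain ⟨⟨t, c₁, c₂, c₃⟩, m⟩ := x
      simp only [enc_some, List.length_cons, enc_pair, length_strPair, enc_str] at this ⊢
      omega
  have h5 : y.one.length = κ := by rw [h.one, List.length_replicate]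
  have ⟨h6, h7, h8, h9⟩ : _ ∧ _ ∧ _ ∧ _ := ⟨h.fuel, h.st, h.rep, h.j⟩
  have hb := length_enc_bool y.boot
  change (enc y.flat).length ≤ _
  simp only [flat, enc_pair, length_strPair, enc_nat]
  simp only [enc_str y.fuel, enc_str y.st, enc_str y.rep, enc_str y.one]
  omega

theorem Bounded.tape (h : Short (6 * S + 4) y.ans) (hc : Φ.Caps y.W.d S) : y.tape.Small S := by
  have hn := hc.n
  have hp := hc.p
  refine ⟨(length_num _).trans (h.getD 2), (length_num _).trans (h.getD 5), ?_⟩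
  simp [RState.tape, fixedBits, hn, hp]

theorem Bounded.opened (h : SmallIds S L y.ids) {ch : Option ((Str × Ctxt) × Str)} {t : Str × Ctxt}
    {a : List Str} (u : UE) (hu : y.opened ch t a = some u) : Short (6 * S + 4) u.strs := by
  obtain ⟨m, -, hm⟩ := Option.bind_eq_some_iff.mp hu
  exact h.lookup hm

/-- One unit of fuel is spent for each simulated round, and this pays for the three entries that a
query may add to a list. Strings stay bounded because the state and the reply of the simulated
adversary are cut at its own bound. -/
theorem Bounded.finish (h : y.Bounded A v κ S c) (hact : Short S (y.action A)) {a : Str}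
    {τ : Tape} (hτ : τ.Small S) {ct : Ctxt} (hct : Short (6 * S + 4) [ct.1, ct.2.1, ct.2.2])
    (ai aj : List Str) : (y.finish A v a τ ct ai aj).Bounded A v κ S c := by
  have hn : Short (6 * S + 4) [] ∧ ([] : List Str).length ≤ 13 := by simp
  unfold RState.finish
  cases hf : y.fuel.isEmpty
  · have hf1 : 0 < y.fuel.length := by
      rw [List.length_pos_iff]; rintro h; simp [h] at hf
    have hf2 : y.fuel.tail.length ≤ A.bound.eval κ := by
      rw [List.length_tail]; have := h.fuel; omega
    have hf3 : 3 * (A.bound.eval κ - y.fuel.length) + 3 ≤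
        3 * (A.bound.eval κ - y.fuel.tail.length) := by
      rw [List.length_tail]; have := h.fuel; omega
    have hf4 := le_trans (Nat.le_add_right _ _) hf3
    have keep : ∀ s r : Str, s.length ≤ A.bound.eval κ → r.length ≤ A.bound.eval κ →
        ({ y with fuel := y.fuel.tail, st := s, rep := r, ans := [] } :
          RState Φ).Bounded A v κ S c := fun s r hs hr =>
      { h with
        fuel := hf2, W := h.W.mono hf4, ids := ⟨h.ids.1, h.ids.2.trans hf4⟩, st := hs, rep := hr
        ans := hn.1, ans_length := hn.2 }
    have ht : ∀ s : Str, (s.take (y.limit A)).length ≤ A.bound.eval κ := fun s => by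
      rw [List.length_take, h.limit_eq]; omega
    cases (y.action A).isEmpty
    · cases y.isCoin A
      · cases hQ : y.asked A with
        | none => exact keep _ _ (ht _) (by simp)
        | some Q =>
          simp only [cond_false, Option.elim_some]
          have hQs : Q.Small S := by
            unfold asked at hQ
            cases hb : ((y.action A).isEmpty || y.isCoin A || y.W.tested) <;> rw [hb] at hQ
            · exact Query.small_parse (fun w hw => hact w (List.mem_of_mem_tail hw)) hQ
            · cases hQ
          obtain ⟨h1, h2⟩ := HState.small_parts h.W h.ids hQs hτ (y.ctI v Q τ ct) (y.ctJ v Q τ ct)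
            (Bounded.opened h.ids (ch := y.chalNext Q τ ct)
              (t := World.reqI (y.request v Q τ ct)) (a := ai))
            (Bounded.opened h.ids (ch := y.chalNext Q τ ct)
              (t := World.reqJ (y.request v Q τ ct)) (a := aj))
          have hd : (y.parts v Q τ ct ai aj).2.1.d = y.W.d := by
            have := (HState.parts_effect Q τ (y.ctI v Q τ ct) (y.ctJ v Q τ ct)
              (y.opened (y.chalNext Q τ ct) (World.reqI (y.request v Q τ ct)) ai)
              (y.opened (y.chalNext Q τ ct) (World.reqJ (y.request v Q τ ct)) aj) y.W y.ids).1
            unfold parts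
            rw [show _ = _ from this]
          have hl := h.W.caps.l
          have hp := h.W.caps.p
          have hG := h.W.caps.G
          simp only [short_cons] at hct
          refine ⟨h.d_eq.trans hd.symm, h.one, hf2, h1.mono hf3, ⟨h2.1, h2.2.trans hf3⟩, ht _, ht _,
            ?_, fun x hx => ?_, hn.1, hn.2⟩
          · refine (length_bits_mono ?_).trans h.j
            cases hq : Q.encrypts <;> simp only [answered, hq, cond_true, cond_false] <;> omega
          · have hx : y.chalNext Q τ ct = some x := hx
            unfold chalNext at hx
            have old := h.chal x
            have gx := hG (y.W.g ^ τ.x)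
            have gy := hG (y.W.g ^ τ.y)
            cases hq : Q.encrypts <;> rw [hq] at hx
            · exact old hx
            · simp only [cond_true] at hx
              split_ifs at hx
              · cases hx
                have := length_plain_le h.ids h.W.caps.n false Q.initiator
                simp only [short_cons, short_nil, and_true, World.tidI, World.tid,
                  List.length_append, World.delta, Φ.length_H, World.dh, World.length_newSid]
                exact ⟨by omega, hct.1, hct.2.1, hct.2.2.1, this⟩
              · cases hx
                have := length_plain_le h.ids h.W.caps.n false Q.responder
                have hs : (Q.respSid (y.W.newSid τ.sid)).length ≤ S := by
                  unfold Query.Small at hQs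
                  cases Q <;> simp only [Query.respSid, World.length_newSid, hp]
                  simp only [Query.msg, short_cons] at hQs
                  exact hQs.2.2.getD 0
                simp only [short_cons, short_nil, and_true, World.tidJ, World.tid,
                  List.length_append, World.delta, Φ.length_H, World.dh]
                exact ⟨by omega, hct.1, hct.2.1, hct.2.2.1, this⟩
              · exact old hx
      · exact keep _ _ (ht _) (ht _)
    · exact keep _ _ h.st (by simp)
  · exact { h with ans := hn.1, ans_length := hn.2 }

theorem Bounded.advance (h : y.Bounded A v κ S c) (hact : Short S (y.action A)) {a : Str}
    (ha : a.length ≤ 6 * S + 4) : (y.advance A v a).Bounded A v κ S c := by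
  have hs : Short (6 * S + 4) (y.ans ++ [a]) := fun w hw => by
    rcases List.mem_append.mp hw with hw | hw
    · exact h.ans w hw
    · rw [List.mem_singleton.mp hw]; exact ha
  have hn : Short (6 * S + 4) [] ∧ ([] : List Str).length ≤ 13 := by simp
  have ht : (y.setAns (y.ans ++ [a])).tape.Small S := Bounded.tape hs h.W.caps
  have hd := (short_decodeList (hs.getD 11)).getD
  have hk : (fixedBits (Φ.n y.W.d) (num ((y.ans ++ [a]).getD 1 []))).length ≤ 6 * S + 4 := by
    have := h.W.caps.n
    rw [fixedBits, List.length_ofFn]; omega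
  unfold RState.advance
  simp only
  split_ifs with hl
  · have hF := h.finish (a := (y.ans ++ [a]).getD 0 []) hact ht
      (ct := ctxt (decodeList ((y.ans ++ [a]).getD 11 [])))
      (by simp only [ctxt, short_cons]; exact ⟨hd 0, hd 1, hd 2, short_nil _⟩)
      (decodeList ((y.ans ++ [a]).getD 12 [])) (decodeList ((y.ans ++ [a]).getD 13 []))
    have hB : ((y.setAns (y.ans ++ [a])).booted).Bounded A v κ S c :=
      { h with
        W := { h.W with kp := hk }
        j := (length_num _).trans (hs.getD 0)
        ans := hn.1
        ans_length := hn.2 }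
    unfold setAns at hB
    have both : ∀ {p q : RState Φ}, p.Bounded A v κ S c → q.Bounded A v κ S c → ∀ b : Bool,
        (bif b then p else q).Bounded A v κ S c := fun hp hq b => by cases b <;> assumption
    exact both hB hF y.boot
  · have hl' : (y.ans ++ [a]).length ≤ 13 := by
      have := h.ans_length
      rw [List.length_append, List.length_singleton]; omega
    exact { h with ans := hs, ans_length := hl' }

/-- A query of the form `[[], N]` comes from the fixed schedule of random choices or from the
simulated adversary. Challenges and decryptions start with a non-empty kind and are never mistaken
for coins. -/
theorem Bounded.query (h : y.Bounded A v κ S c) (hT : A.bound.eval κ ≤ S)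
    (hact : Short S (y.action A)) (N : Str) (hN : y.query A v = [[], N]) : N.length ≤ 2 * S := by
  have hc := h.W.caps
  have hp := hc.p
  have hn := hc.n
  have e : ∀ {M : Str}, [[], M] = [[], N] → M = N := fun h => by simpa using h
  have hdec : ∀ ch t, decQuery ch t ≠ [[], N] := by
    intro ch t
    unfold decQuery
    cases (chalMatch ch t).isSome <;> simp
  have hchal : ∀ Q τ, y.chalQuery Q τ ≠ [[], N] := by
    intro Q τ
    unfold chalQuery
    cases Q.encrypts <;> simp
    split_ifs <;> simp
  unfold RState.query at hN
  simp only at hN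
  cases hb : y.boot <;> rw [hb] at hN <;> simp only [cond_true, cond_false] at hN
  · split_ifs at hN
    · cases hx : (!y.fuel.isEmpty && (!(y.action A).isEmpty && y.isCoin A)) <;> rw [hx] at hN
      · cases hN
      · simp only [cond_true] at hN
        have := hact N (List.mem_of_mem_tail (hN ▸ by simp))
        omega
    · rw [← e hN]
      have := length_bits_mono (Nat.sub_le (Φ.p y.W.d) 1)
      rw [← Nat.size_eq_bits_len] at hp
      omega
    · rw [← e hN, List.length_replicate]; omega
    · rw [← e hN, List.length_replicate]; omega
    all_goals
      cases hf : y.fuel.isEmpty <;> rw [hf] at hN <;> simp only [cond_true, cond_false] at hN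
      · cases hQ : y.asked A <;> rw [hQ] at hN <;>
          simp only [Option.elim_none, Option.elim_some] at hN
        · cases hN
        · first | exact absurd hN (hchal _ _) | exact absurd hN (hdec _ _)
      · cases hN
  · split_ifs at hN
    · rw [← e hN, h.limit_eq]
      exact (length_bits_le _).trans (by omega)
    · rw [← e hN, List.length_replicate]; omega

end RState

end GD2C

/-! ### The reduction as an adversary, and the conclusion. -/

namespace GD2C

open Code

variable {Φ : Family} [hΦ : Fact Φ.Efficient]

/-! ### The reduction as an adversary -/

/-- The initial state of the reduction. -/
def RState.first (Φ : Family) (A : Adversary) (κ : ℕ) (d : Str) (g : Φ.G d) (s : ℕ) : RState Φ :=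
  ⟨true, List.replicate (A.bound.eval κ) true, [],
    (encodeList [d, Φ.encG d g, Φ.encG d (g ^ s)]).take (A.bound.eval κ),
    World.start₀ Φ d g s [] false, [], 0, none, List.replicate κ true, []⟩

-- The initial state contains the exponent `s`, but its code contains only g^s, which is among the
-- published data. So the code can be computed from the greeting.
omit hΦ in
theorem RState.exists_first (A : Adversary) : ∃ F : Str → Str, FP F ∧ ∀ κ d g s, F (strPair
    (List.replicate κ true) (encodeList [d, Φ.encG d g, Φ.encG d (g ^ s)])) = enc (first Φ A κ d g
    s) := by
  have h1 : PT fun p : Str × Str => p.1 := by fun_prop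
  have h2 : PT fun p : Str × Str => p.2 := by fun_prop
  have hT := PT.polynomial A.bound h1
  have ht := PT.takeStr hT h2
  have key : PT fun p : Str × Str => ((true, List.replicate (A.bound.eval p.1.length) true,
      ([] : Str), p.2.take (List.replicate (A.bound.eval p.1.length) true).length,
      (((decodeList p.2).getD 0 [], (decodeList p.2).getD 1 [], (decodeList p.2).getD 2 [],
        ([] : Str)), ([] : List Str), ([] : List UE), ([] : List Inst), ([] : List HSession),
        false)), ([] : List Slot), 0, (none : Option ((Str × Ctxt) × Str)), p.1,
      ([] : List Str)) := by fun_prop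
  obtain ⟨F, hF, e⟩ := key
  refine ⟨F, hF, fun κ d g s => ?_⟩
  have e := e (List.replicate κ true, encodeList [d, Φ.encG d g, Φ.encG d (g ^ s)])
  rw [enc_pair, enc_str, enc_str] at e
  rw [e]
  simp only [List.length_replicate, decodeList_encodeList]
  rfl

/-- A polynomial that bounds the sizes of all objects. -/
theorem exists_size (A : Adversary) : ∃ S : Polynomial ℕ, ∀ κ, A.bound.eval κ ≤ S.eval κ ∧ κ ≤
    S.eval κ ∧ (∀ d ∈ (Φ.gen κ).support, Φ.Caps d (S.eval κ)) ∧ ∀ a b : Str, a.length ≤ A.bound.eval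
    κ → b.length ≤ A.bound.eval κ → Short (S.eval κ) (decodeList (A.step ![List.replicate κ true, a,
    b])) := by
  obtain ⟨q₀, h₀⟩ := hΦ.out.ibe.size_gen
  obtain ⟨q₁, h₁⟩ := hΦ.out.ibe.size_encG
  obtain ⟨q₂, h₂⟩ := (PT.hash (Φ := Φ) PT.id (PT.const ([] : Str))).length_le
  obtain ⟨q₃, h₃⟩ := (PT.hash4 (Φ := Φ) PT.id (PT.const ([] : Str))).length_le
  obtain ⟨q₄, h₄⟩ := (PT.prime (Φ := Φ) PT.id).length_le
  obtain ⟨q₅, h₅⟩ := (PT.of_polyTime₃ (x := fun p : Str × Str × Str => p.1)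
    (y := fun p => p.2.1) (z := fun p => p.2.2) A.polyTime (by fun_prop) (by fun_prop)
    (by fun_prop)).length_le
  -- The summands bound in turn the rounds of the simulated adversary, the security parameter, the
  -- description, the group elements, the hash length `l`, the length `n`, the binary size of `p`,
  -- and what the simulated adversary writes in one round.
  refine ⟨A.bound + .X + q₀ + q₁.comp q₀ + q₂.comp q₀ + q₃.comp q₀ + q₄.comp q₀ +
    q₅.comp (2 * .X + 3 * A.bound + 2), fun κ => ?_⟩
  simp only [Polynomial.eval_add, Polynomial.eval_X, Polynomial.eval_comp, Polynomial.eval_mul,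
    Polynomial.eval_ofNat]
  refine ⟨by omega, by omega, fun d hd => ?_, fun a b ha hb => ?_⟩
  · have hd := h₀ κ d hd
    have g₂ := (h₂ d).trans (eval_le_eval q₂ hd)
    have g₃ := (h₃ d).trans (eval_le_eval q₃ hd)
    have g₄ := (h₄ d).trans (eval_le_eval q₄ hd)
    rw [enc_str, Φ.length_H] at g₂
    rw [enc_str, Φ.length_H4] at g₃
    rw [enc_nat, Nat.size_eq_bits_len] at g₄
    exact ⟨fun x => ((h₁ d x).trans (eval_le_eval q₁ hd)).trans (by omega), by omega, by omega,
      by omega, by omega⟩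
  · have g := h₅ (List.replicate κ true, a, b)
    simp only [enc_pair, length_strPair, enc_str, List.length_replicate] at g
    have := eval_le_eval q₅ (show 2 * κ + 1 + (2 * a.length + 1 + b.length) ≤
      2 * κ + 3 * A.bound.eval κ + 2 by omega)
    exact short_decodeList (by omega)

omit hΦ in
theorem RState.bounded_first {A : Adversary} {v : BFVersion} {κ S : ℕ} {d : Str}
    (hd : Φ.Caps d S) (g : Φ.G d) (s : ℕ) {c : (game Φ v).State} (hc : CCAState.d c = d) :
    (first Φ A κ d g s).Bounded A v κ S c where
  d_eq := hc
  one := rfl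
  fuel := by simp [first]
  W := ⟨hd, by simp [first, World.start₀], by simp [first, World.start₀],
    by simp [first, World.start₀], by simp [first, World.start₀], by simp [first, World.start₀],
    by simp [first, World.start₀]⟩
  ids := by simp [first, SmallIds]
  st := by simp [first]
  rep := by simp [first]
  j := by simp [first]
  chal := by simp [first]
  ans := by simp [first]
  ans_length := by simp [first]

/-- An adversary in the chosen-ciphertext game plays a random hybrid game. -/
theorem exists_reduction (A : Adversary) (v : BFVersion) : ∃ B : Adversary, ∀ κ,
    ∀ d ∈ (Φ.gen κ).support, ∀ g s b,
      B.guess (ccaGame Φ.toBFFamily v) κ (⟨d, g, s, b, none, []⟩ : CCAState Φ.toBFFamily) =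
        (uniformUpTo (2 * A.bound.eval κ)).bind fun j => (uniformStr (Φ.n d)).bind fun kp =>
          A.hybridGuess Φ v κ (World.start₀ Φ d g s kp false) (selOf j b) := by
  obtain ⟨S, hS⟩ := exists_size (Φ := Φ) A
  obtain ⟨F, hF, eF⟩ := RState.exists_first (Φ := Φ) A
  -- The bound of `RState.Bounded.length_enc` for the code of a state, plus one for the guess bit.
  set P : Polynomial ℕ := 10000 * (6 * S + 4) +
    1000 * (3 * S * (2 * (100 * (6 * S + 4) + 100) + 1)) + 10001 with hP
  -- Blocks of 14 queries: one for the initialization, `A.bound` for the rounds of the simulated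
  -- adversary, and `P` idle ones, which only raise the bound above the size of every state. The
  -- additional round is the one that emits the guess.
  obtain ⟨B, -, hB⟩ := exists_adversary (RState.game Φ v)
    (PT.query (y := fun y : RState Φ => y) A v PT.id)
    (PT.advance (y := fun p : RState Φ × Str => p.1) A v PT.id.fst PT.id.snd)
    (out := fun y : RState Φ => y.st.headD false) (by fun_prop) hF (14 * (1 + (A.bound + P)) + 1)
  refine ⟨B, fun κ d hd g s b => ?_⟩
  obtain ⟨hT, hκ, hcap, hact⟩ := hS κ
  have hcap := hcap d hd
  have hPe : P.eval κ = 10000 * (6 * S.eval κ + 4) + 1000 * listCap (S.eval κ) + 10001 := by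
    simp [hP, listCap]
  have hbe : (14 * (1 + (A.bound + P)) + 1 : Polynomial ℕ).eval κ =
      14 * (1 + (A.bound.eval κ + P.eval κ)) + 1 := by simp
  have hact' : ∀ {y : RState Φ} {c : (RState.game Φ v).State}, y.Bounded A v κ (S.eval κ) c →
      Short (S.eval κ) (y.action A) := fun {y c} h => by
    unfold RState.action; rw [h.one]; exact hact _ _ h.st h.rep
  have hB := hB κ _ (RState.first Φ A κ d g s)
    (⟨d, g, s, b, none, []⟩ : CCAState Φ.toBFFamily)
    (fun y c => y.Bounded A v κ (S.eval κ) c) hbe (eF κ d g s)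
    (by
      have h1 := hcap.G g
      have h2 := hcap.G (g ^ s)
      have h3 := hcap.d
      rw [hbe]
      change (encodeList [d, Φ.encG d g, Φ.encG d (g ^ s)]).length ≤ _
      have h0 : (encodeList []).length = 0 := rfl
      simp only [encodeList_cons, length_strPair]
      omega)
    (RState.bounded_first hcap g s rfl)
    (fun y c h => by
      have := h.length_enc hT hκ
      rw [hbe, procCode, List.length_cons]
      omega)
    (fun y c h r hr => by
      obtain ⟨h1, h2⟩ := length_answer (h.query hT (hact' h)) (h.d_eq ▸ h.W.caps) hr
      have h3 := h.advance (hact' h) h1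
      exact ⟨by rw [hbe]; omega, { h3 with d_eq := h2.trans h3.d_eq }⟩)
  refine hB.trans ?_
  rw [Nat.mul_add, Nat.mul_one, procRun_add]
  have hboot := RState.proc_boot A v (y := RState.first Φ A κ d g s)
    (C := (⟨d, g, s, b, none, []⟩ : CCAState Φ.toBFFamily)) rfl rfl
  have hl : (RState.first Φ A κ d g s).limit A = A.bound.eval κ := by
    simp [RState.limit, RState.first]
  rw [hl] at hboot
  change ((RState.proc A v 14 _).bind _).map _ = _
  rw [hboot]
  simp only [PMF.map_bind, PMF.bind_bind, PMF.bind_map, Function.comp_def]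
  refine bind_congr fun j _ => bind_congr fun kp _ => ?_
  have hr : ({ RState.first Φ A κ d g s with
      boot := false, j := j, W := World.start₀ Φ d g s kp false } : RState Φ).Ready v :=
    ⟨rfl, rfl, fun _ _ hp => absurd hp List.not_mem_nil, fun _ _ hx => (nomatch hx),
      fun _ _ hx => (nomatch hx)⟩
  exact RState.map_proc A v b _ _ hr (List.length_replicate ..) rfl

theorem ccaOracle_bit {Ψ : BFFamily} {v : BFVersion} {q : List Str} {c : CCAState Ψ}
    {y : List Str × CCAState Ψ} (hy : y ∈ (ccaOracle Ψ v q c).support) : y.2.b = c.b := by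
  unfold ccaOracle at hy
  split at hy <;> try split_ifs at hy
  all_goals
    first
    | (rw [PMF.mem_support_map_iff] at hy; obtain ⟨_, -, rfl⟩ := hy; rfl)
    | (rw [PMF.support_pure, Set.mem_singleton_iff] at hy; subst hy; rfl)

/-- The distribution of the initial states of the chosen-ciphertext game. -/
def ccaInit (Ψ : BFFamily) (κ : ℕ) : PMF (Bool → CCAState Ψ) :=
  (Ψ.gen κ).bind fun d => (Ψ.randGen d).bind fun g => (Ψ.randExp d).map fun s b =>
    ⟨d, g, s, b, none, []⟩

theorem ccaGame_advantage_eq (B : Adversary) (Ψ : BFFamily) (v : BFVersion) (κ : ℕ) :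
    B.advantage (ccaGame Ψ v) κ =
      |(((ccaInit Ψ κ).bind fun m => B.guess (ccaGame Ψ v) κ (m true)) true).toReal -
      (((ccaInit Ψ κ).bind fun m => B.guess (ccaGame Ψ v) κ (m false)) true).toReal| / 2 := by
  refine Adversary.advantage_eq B (ccaGame Ψ v) κ ?_ (ccaInit Ψ κ) ?_ fun m hm b => ?_
  · exact fun q c y hy => ccaOracle_bit (v := v) (q := q) (c := c) hy
  · change _ = (ccaInit Ψ κ).bind fun m =>
      ((PMF.uniformOfFintype Bool).map m : PMF (CCAState Ψ))
    simp only [ccaInit, PMF.bind_bind, PMF.bind_map, Function.comp_def]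
    rfl
  · obtain ⟨d, -, hm⟩ := (PMF.mem_support_bind_iff _ _ _).mp hm
    obtain ⟨g, -, hm⟩ := (PMF.mem_support_bind_iff _ _ _).mp hm
    obtain ⟨s, -, rfl⟩ := (PMF.mem_support_map_iff _ _ _).mp hm
    rfl

theorem exists_reduction_advantage (v : BFVersion) {ν : ℕ → ℕ} (hn : ∀ κ, ∀ d ∈ (Φ.gen κ).support, ν
    κ ≤ Φ.n d) (A : Adversary) : ∃ (B : Adversary) (q : Polynomial ℕ), ∀ κ, A.advantage (anonGame Φ
    v .outsider .identity) κ ≤ ((q.eval κ : ℕ) : ℝ) * (B.advantage (ccaGame Φ.toBFFamily v) κ + (2 :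
    ℝ)⁻¹ ^ ν κ) := by
  obtain ⟨B, hB⟩ := exists_reduction (Φ := Φ) A v
  -- The factor 2T + 1 comes from the hybrids and 4T² from the statistical distance; their sum
  -- dominates both.
  refine ⟨B, 4 * A.bound ^ 2 + 2 * A.bound + 1, fun κ => ?_⟩
  have h := advantage_le_of_hybrids A B Φ v hn κ
    (fun β => (ccaInit Φ.toBFFamily κ).bind fun m => B.guess (ccaGame Φ.toBFFamily v) κ (m β))
    (ccaGame_advantage_eq B _ v κ) fun β => by
      simp only [ccaInit, PMF.bind_bind, PMF.bind_map, Function.comp_def, Adversary.hybrid,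
        anonInit]
      -- The reduction draws `j` after the parameters are fixed, whereas the average over the
      -- hybrids has it outermost; the draws are independent and are exchanged one by one.
      rw [PMF.bind_comm (uniformUpTo _)]
      refine bind_congr fun d hd => ?_
      rw [PMF.bind_comm (uniformUpTo _)]
      refine bind_congr fun g _ => ?_
      rw [PMF.bind_comm (uniformUpTo _)]
      exact bind_congr fun s _ => hB κ d hd g s β
  have e : ((4 * A.bound ^ 2 + 2 * A.bound + 1).eval κ : ℕ) =
      4 * A.bound.eval κ ^ 2 + 2 * A.bound.eval κ + 1 := by simp
  rw [e]
  push_cast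
  have hT : (0 : ℝ) ≤ (A.bound.eval κ : ℕ) := Nat.cast_nonneg _
  generalize ((A.bound.eval κ : ℕ) : ℝ) = T at *
  have hx : 0 ≤ B.advantage (ccaGame Φ.toBFFamily v) κ := abs_nonneg _
  have hy : 0 ≤ (2 : ℝ)⁻¹ ^ ν κ := by positivity
  have h1 := mul_nonneg (sq_nonneg T) hx
  have h2 := mul_nonneg hT hy
  linarith

theorem Negligible.of_le {f g : ℕ → ℝ} (q : Polynomial ℕ) (hg : Negligible g) (hf : ∀ κ, 0 ≤ f κ)
    (h : ∀ κ, f κ ≤ ((q.eval κ : ℕ) : ℝ) * g κ) : Negligible f := by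
  refine (hg.polynomial_mul (q.map (Nat.castRingHom ℝ))).trans_abs_le fun κ => ?_
  rw [Polynomial.eval_natCast_map, abs_of_nonneg (hf κ)]
  exact (h κ).trans (le_abs_self _)

end GD2C

end

theorem mainTheorem3 (𝓕 : GD2C.Family) (v : GD2C.BFVersion) (h𝓕 : 𝓕.Efficient)
    (ν : ℕ → ℕ) (hν : GD2C.Negligible fun κ => (2 : ℝ)⁻¹ ^ ν κ)
    (hn : ∀ κ, ∀ d ∈ (𝓕.gen κ).support, ν κ ≤ 𝓕.n d) :
    (∀ A : GD2C.Adversary, ∃ (B : GD2C.Adversary) (q : Polynomial ℕ), ∀ κ : ℕ,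
      A.advantage (GD2C.anonGame 𝓕 v .outsider .identity) κ ≤
        ((q.eval κ : ℕ) : ℝ) * (B.advantage (GD2C.ccaGame 𝓕.toBFFamily v) κ + (2 : ℝ)⁻¹ ^ ν κ)) ∧
    ((GD2C.ccaGame 𝓕.toBFFamily v).Secure →
      (GD2C.anonGame 𝓕 v .outsider .identity).Secure) ∧
    (GD2C.anonGame 𝓕 v .outsider .group).Secure ∧
    (GD2C.anonGame 𝓕 v .hss .group).Secure := by
  have := Fact.mk h𝓕
  refine ⟨fun A => ?_, fun hB A => ?_, GD2C.group_secure 𝓕 v .outsider,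
    GD2C.group_secure 𝓕 v .hss⟩
  · obtain ⟨B, q, h⟩ := GD2C.exists_reduction_advantage (Φ := 𝓕) v hn A
    exact ⟨B, q, h⟩
  · obtain ⟨B, q, h⟩ := GD2C.exists_reduction_advantage (Φ := 𝓕) v hn A
    exact GD2C.Negligible.of_le q (by exact (hB B).add hν) (fun κ => abs_nonneg _) h
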